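/- Let $\mathbf k$ be an algebraically closed field of characteristic $p>0$. Let ${\rm Ver}_p$ be the Verlinde category, i.e. the quotient of the monoidal category of finite dimensional $\mathbf k$-representations of $\mathbb Z/p$ by the tensor ideal of negligible morphisms (those $f:X\to Y$ with ${\rm Tr}(fg)=0$ for all $g:Y\to X$), and let $L_1=\mathbf 1,\dots,L_{p-1}$ be its simple objects, $L_i$ being the image of the Jordan block $\mathbf k[D]/D^i$ on which a generator of $\mathbb Z/p$ acts by $1-D$. A symmetric tensor category over $\mathbf k$ is a $\mathbf k$-linear abelian rigid symmetric monoidal category with $\mathbf k$-bilinear tensor product, finite dimensional morphism spaces, objects of finite length and ${\rm End}(\mathbf 1)=\mathbf k$. For such a category $\mathcal C$ let $\mathcal C^{(1)}$ be its Frobenius twist (the same category, with $\lambda\in\mathbf k$ acting on morphisms as $\lambda^p$ does in $\mathcal C$), and let $\mathcal C^{(1)}\boxtimes{\rm Ver}_p$ be the Deligne tensor product with its monoidal structure. For $X\in\mathcal C$ let $c$ be the cyclic permutation of the tensor factors of $X^{\otimes p}$, let $D=1-c$, and put $$F_i(X)=\frac{{\rm Ker}\,D\cap{\rm Im}\,D^{i-1}}{{\rm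 Ker}\,D\cap{\rm Im}\,D^{i}},\quad 1\le i\le p-1,\qquad F(X)=\bigoplus_{i=1}^{p-1}F_i(X)\otimes L_i .$$ (i) The functor $F=F_{\mathcal C}:\mathcal C\to\mathcal C^{(1)}\boxtimes{\rm Ver}_p$ is additive, in fact $\mathbf k$-linear, and has a natural structure of a monoidal functor. (ii) $F$ commutes with symmetric tensor functors: the monoidal structures in (i) can be chosen for all $\mathcal C$ simultaneously in such a way that for every exact $\mathbf k$-linear symmetric monoidal functor $E:\mathcal C\to\mathcal D$ between symmetric tensor categories over $\mathbf k$ there is an isomorphism of monoidal functors $$(E^{(1)}\boxtimes{\rm id})\circ F_{\mathcal C}\;\cong\;F_{\mathcal D}\circ E,$$ given by $\bigoplus_i\theta_i\otimes{\rm id}_{L_i}$, where $\theta_i:E(F_i(X))\to F_i(E(X))$ is the map of subquotients induced by the canonical isomorphism $E(X^{\otimes p})\cong E(X)^{\otimes p}$. -/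

import Mathlib

set_option linter.unusedSectionVars false
open CategoryTheory MonoidalCategory Limits
open scoped TensorProduct

universe w v v₁ v₂ u u₁ u₂

noncomputable section

/-! ### The tensor product of two linear categories -/

/-- Objects of the naive tensor product over `k` of two `k`-linear categories: pairs `(X, V)`,
to be thought of as external products `X ⊠ V`. -/
@[ext]
structure LinProd (k : Type w) (C : Type u₁) (D : Type u₂) where
  left : C
  right : D

namespace LinProd

section Category

variable (k : Type w) [Field k]
variable (C : Type u₁) [Category.{v₁} C] [Preadditive C] [Linear k C]
variable (D : Type u₂) [Category.{v₂} D] [Preadditive D] [Linear k D]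

/-- `Hom(X ⊠ V, Y ⊠ W) = Hom(X, Y) ⊗ Hom(V, W)`, composed factorwise. -/
instance : Category.{max v₁ v₂} (LinProd k C D) where
  Hom X Y := (X.left ⟶ Y.left) ⊗[k] (X.right ⟶ Y.right)
  id X := 𝟙 X.left ⊗ₜ[k] 𝟙 X.right
  comp {X Y Z} f g := TensorProduct.map₂ (Linear.comp (S := k) X.left Y.left Z.left)
    (Linear.comp (S := k) X.right Y.right Z.right) f g
  id_comp {X Y} f := by
    induction f using TensorProduct.induction_on with
    | zero => simp
    | tmul a b => simp
    | add a b ha hb => rw [map_add, ha, hb]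
  comp_id {X Y} f := by
    induction f using TensorProduct.induction_on with
    | zero => simp
    | tmul a b => simp
    | add a b ha hb => rw [map_add, LinearMap.add_apply, ha, hb]
  assoc {W X Y Z} f g h := by
    induction f using TensorProduct.induction_on with
    | zero => simp
    | add a b ha hb => simp only [map_add, LinearMap.add_apply, ha, hb]
    | tmul a a' =>
      induction g using TensorProduct.induction_on with
      | zero => simp
      | add a b ha hb => simp only [map_add, LinearMap.add_apply, ha, hb]
      | tmul b b' =>
        induction h using TensorProduct.induction_on with
        | zero => simp
        | add a b ha hb => simp only [map_add, ha, hb]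
        | tmul c c' => simp

variable {k C D}

/-- The pure tensor `f ⊗ g` as a morphism `X ⊠ V ⟶ Y ⊠ W`. -/
def homMk {X Y : C} {V W : D} (f : X ⟶ Y) (g : V ⟶ W) :
    (⟨X, V⟩ : LinProd k C D) ⟶ ⟨Y, W⟩ :=
  f ⊗ₜ[k] g

instance : Preadditive (LinProd k C D) where
  homGroup X Y := inferInstanceAs (AddCommGroup ((X.left ⟶ Y.left) ⊗[k] (X.right ⟶ Y.right)))
  add_comp _ _ _ f f' g := LinearMap.map_add₂
    (TensorProduct.map₂ (Linear.comp (S := k) _ _ _) (Linear.comp (S := k) _ _ _)) f f' g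
  comp_add _ _ _ f g g' := LinearMap.map_add
    (TensorProduct.map₂ (Linear.comp (S := k) _ _ _) (Linear.comp (S := k) _ _ _) f) g g'

instance : Linear k (LinProd k C D) where
  homModule X Y := inferInstanceAs (Module k ((X.left ⟶ Y.left) ⊗[k] (X.right ⟶ Y.right)))
  smul_comp _ _ _ r f g := LinearMap.map_smul₂
    (TensorProduct.map₂ (Linear.comp (S := k) _ _ _) (Linear.comp (S := k) _ _ _)) r f g
  comp_smul _ _ _ f r g := LinearMap.map_smul
    (TensorProduct.map₂ (Linear.comp (S := k) _ _ _) (Linear.comp (S := k) _ _ _) f) r g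

theorem homMk_id (X : C) (V : D) :
    (homMk (𝟙 X) (𝟙 V) : (⟨X, V⟩ : LinProd k C D) ⟶ ⟨X, V⟩) = 𝟙 _ := rfl

theorem homMk_comp {X Y Z : C} {V W U : D} (f : X ⟶ Y) (g : V ⟶ W) (f' : Y ⟶ Z) (g' : W ⟶ U) :
    (homMk f g : (⟨X, V⟩ : LinProd k C D) ⟶ ⟨Y, W⟩) ≫ homMk f' g' =
      homMk (f ≫ f') (g ≫ g') := rfl

/-- A property of morphisms holds as soon as it holds for pure tensors and is additive. -/
theorem hom_induction {X Y : LinProd k C D} {P : (X ⟶ Y) → Prop} (f : X ⟶ Y) (h0 : P 0)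
    (hm : ∀ (a : X.left ⟶ Y.left) (b : X.right ⟶ Y.right), P (homMk a b))
    (ha : ∀ a b, P a → P b → P (a + b)) : P f :=
  TensorProduct.induction_on (motive := P) f h0 hm ha

/-- External product of isomorphisms. -/
def isoMk {X Y : C} {V W : D} (f : X ≅ Y) (g : V ≅ W) :
    (⟨X, V⟩ : LinProd k C D) ≅ ⟨Y, W⟩ where
  hom := homMk f.hom g.hom
  inv := homMk f.inv g.inv
  hom_inv_id := by rw [homMk_comp, f.hom_inv_id, g.hom_inv_id, homMk_id]
  inv_hom_id := by rw [homMk_comp, f.inv_hom_id, g.inv_hom_id, homMk_id]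

end Category

section Monoidal

/-- The tensor product of morphisms in a `k`-linear monoidal category, as a bilinear map. -/
def tensorHomBilin (k : Type w) [Field k] {C : Type u₁} [Category.{v₁} C] [Preadditive C]
    [Linear k C] [MonoidalCategory C] [MonoidalPreadditive C] [MonoidalLinear k C]
    (X Y X' Y' : C) : (X ⟶ Y) →ₗ[k] (X' ⟶ Y') →ₗ[k] (X ⊗ X' ⟶ Y ⊗ Y') :=
  LinearMap.mk₂ k (fun f g => f ⊗ₘ g)
    (fun f f' g => by simp [MonoidalPreadditive.add_tensor])
    (fun c f g => by simp [MonoidalCategory.tensorHom_def])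
    (fun f g g' => by simp [MonoidalPreadditive.tensor_add])
    (fun c f g => by simp [MonoidalCategory.tensorHom_def])

variable {k : Type w} [Field k]
variable {C : Type u₁} [Category.{v₁} C] [Preadditive C] [Linear k C] [MonoidalCategory C]
  [MonoidalPreadditive C] [MonoidalLinear k C]
variable {D : Type u₂} [Category.{v₂} D] [Preadditive D] [Linear k D] [MonoidalCategory D]
  [MonoidalPreadditive D] [MonoidalLinear k D]

/-- The tensor product of morphisms in the naive tensor product. -/
def tensorHom' {X Y X' Y' : LinProd k C D} (f : X ⟶ Y) (g : X' ⟶ Y') :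
    (⟨X.left ⊗ X'.left, X.right ⊗ X'.right⟩ : LinProd k C D) ⟶
      ⟨Y.left ⊗ Y'.left, Y.right ⊗ Y'.right⟩ :=
  TensorProduct.map₂ (tensorHomBilin k X.left Y.left X'.left Y'.left)
    (tensorHomBilin k X.right Y.right X'.right Y'.right) f g

/-- The tensor product is computed factorwise. -/
instance : MonoidalCategoryStruct (LinProd k C D) where
  tensorObj X Y := ⟨X.left ⊗ Y.left, X.right ⊗ Y.right⟩
  tensorUnit := ⟨𝟙_ C, 𝟙_ D⟩
  tensorHom f g := tensorHom' f g
  whiskerLeft X _ _ f := tensorHom' (𝟙 X) f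
  whiskerRight f X := tensorHom' f (𝟙 X)
  associator X Y Z := isoMk (α_ X.left Y.left Z.left) (α_ X.right Y.right Z.right)
  leftUnitor X := isoMk (λ_ X.left) (λ_ X.right)
  rightUnitor X := isoMk (ρ_ X.left) (ρ_ X.right)

theorem homMk_tensorHom {X Y X' Y' : C} {V W V' W' : D} (f : X ⟶ Y) (g : V ⟶ W)
    (f' : X' ⟶ Y') (g' : V' ⟶ W') :
    (homMk f g : (⟨X, V⟩ : LinProd k C D) ⟶ ⟨Y, W⟩) ⊗ₘ
      (homMk f' g' : (⟨X', V'⟩ : LinProd k C D) ⟶ ⟨Y', W'⟩) =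
      homMk (f ⊗ₘ f') (g ⊗ₘ g') := rfl

theorem add_tensorHom {X Y X' Y' : LinProd k C D} (f f' : X ⟶ Y) (g : X' ⟶ Y') :
    (f + f') ⊗ₘ g = f ⊗ₘ g + f' ⊗ₘ g := by
  change TensorProduct.map₂ _ _ (f + f') g = _
  rw [map_add, LinearMap.add_apply]; rfl

theorem tensorHom_add {X Y X' Y' : LinProd k C D} (f : X ⟶ Y) (g g' : X' ⟶ Y') :
    f ⊗ₘ (g + g') = f ⊗ₘ g + f ⊗ₘ g' := by
  change TensorProduct.map₂ _ _ f (g + g') = _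
  rw [map_add]; rfl

theorem zero_tensorHom {X Y X' Y' : LinProd k C D} (g : X' ⟶ Y') :
    (0 : X ⟶ Y) ⊗ₘ g = 0 := by
  change TensorProduct.map₂ _ _ (0 : _ ⊗[k] _) g = _
  rw [map_zero]; rfl

theorem tensorHom_zero {X Y X' Y' : LinProd k C D} (f : X ⟶ Y) :
    f ⊗ₘ (0 : X' ⟶ Y') = 0 := by
  change TensorProduct.map₂ _ _ f (0 : _ ⊗[k] _) = _
  rw [map_zero]

instance : MonoidalCategory (LinProd k C D) :=
  MonoidalCategory.ofTensorHom
    (id_tensorHom_id := fun X Y => by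
      change homMk (𝟙 _ ⊗ₘ 𝟙 _) (𝟙 _ ⊗ₘ 𝟙 _) = homMk (𝟙 _) (𝟙 _)
      rw [id_tensorHom_id, id_tensorHom_id])
    (id_tensorHom := fun _ _ _ _ => rfl)
    (tensorHom_id := fun _ _ => rfl)
    (tensorHom_comp_tensorHom := fun {X₁ Y₁ Z₁ X₂ Y₂ Z₂} f₁ f₂ g₁ g₂ => by
      induction f₁ using hom_induction with
      | h0 => simp only [zero_tensorHom, zero_comp]
      | ha a b ha hb => simp only [add_tensorHom, Preadditive.add_comp, ha, hb]
      | hm a₁ b₁ =>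
      induction f₂ using hom_induction with
      | h0 => simp only [tensorHom_zero, zero_comp]
      | ha a b ha hb => simp only [tensorHom_add, Preadditive.add_comp, ha, hb]
      | hm a₂ b₂ =>
      induction g₁ using hom_induction with
      | h0 => simp only [zero_tensorHom, comp_zero]
      | ha a b ha hb => simp only [add_tensorHom, Preadditive.comp_add, ha, hb]
      | hm a₃ b₃ =>
      induction g₂ using hom_induction with
      | h0 => simp only [tensorHom_zero, comp_zero]
      | ha a b ha hb => simp only [tensorHom_add, Preadditive.comp_add, ha, hb]
      | hm a₄ b₄ =>
      change homMk ((a₁ ⊗ₘ a₂) ≫ (a₃ ⊗ₘ a₄)) ((b₁ ⊗ₘ b₂) ≫ (b₃ ⊗ₘ b₄)) =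
        homMk ((a₁ ≫ a₃) ⊗ₘ (a₂ ≫ a₄)) ((b₁ ≫ b₃) ⊗ₘ (b₂ ≫ b₄))
      simp)
    (associator_naturality := fun {X₁ X₂ X₃ Y₁ Y₂ Y₃} f₁ f₂ f₃ => by
      induction f₁ using hom_induction with
      | h0 => simp only [zero_tensorHom, zero_comp, comp_zero]
      | ha a b ha hb =>
        simp only [add_tensorHom, Preadditive.add_comp, Preadditive.comp_add, ha, hb]
      | hm a₁ b₁ =>
      induction f₂ using hom_induction with
      | h0 => simp only [zero_tensorHom, tensorHom_zero, zero_comp, comp_zero]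
      | ha a b ha hb =>
        simp only [add_tensorHom, tensorHom_add, Preadditive.add_comp, Preadditive.comp_add, ha, hb]
      | hm a₂ b₂ =>
      induction f₃ using hom_induction with
      | h0 => simp only [tensorHom_zero, zero_comp, comp_zero]
      | ha a b ha hb =>
        simp only [tensorHom_add, Preadditive.add_comp, Preadditive.comp_add, ha, hb]
      | hm a₃ b₃ =>
      change homMk (((a₁ ⊗ₘ a₂) ⊗ₘ a₃) ≫ (α_ _ _ _).hom) (((b₁ ⊗ₘ b₂) ⊗ₘ b₃) ≫ (α_ _ _ _).hom) =
        homMk ((α_ _ _ _).hom ≫ (a₁ ⊗ₘ (a₂ ⊗ₘ a₃))) ((α_ _ _ _).hom ≫ (b₁ ⊗ₘ (b₂ ⊗ₘ b₃)))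
      rw [associator_naturality, associator_naturality])
    (leftUnitor_naturality := fun {X Y} f => by
      induction f using hom_induction with
      | h0 => simp only [tensorHom_zero, zero_comp, comp_zero]
      | ha a b ha hb =>
        simp only [tensorHom_add, Preadditive.add_comp, Preadditive.comp_add, ha, hb]
      | hm a b =>
      change homMk ((𝟙 _ ⊗ₘ a) ≫ (λ_ _).hom) ((𝟙 _ ⊗ₘ b) ≫ (λ_ _).hom) =
        homMk ((λ_ _).hom ≫ a) ((λ_ _).hom ≫ b)
      simp)
    (rightUnitor_naturality := fun {X Y} f => by
      induction f using hom_induction with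
      | h0 => simp only [zero_tensorHom, zero_comp, comp_zero]
      | ha a b ha hb =>
        simp only [add_tensorHom, Preadditive.add_comp, Preadditive.comp_add, ha, hb]
      | hm a b =>
      change homMk ((a ⊗ₘ 𝟙 _) ≫ (ρ_ _).hom) ((b ⊗ₘ 𝟙 _) ≫ (ρ_ _).hom) =
        homMk ((ρ_ _).hom ≫ a) ((ρ_ _).hom ≫ b)
      simp)
    (pentagon := fun W X Y Z => by
      change homMk (((α_ _ _ _).hom ⊗ₘ 𝟙 _) ≫ (α_ _ _ _).hom ≫ (𝟙 _ ⊗ₘ (α_ _ _ _).hom))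
          (((α_ _ _ _).hom ⊗ₘ 𝟙 _) ≫ (α_ _ _ _).hom ≫ (𝟙 _ ⊗ₘ (α_ _ _ _).hom)) =
        homMk ((α_ _ _ _).hom ≫ (α_ _ _ _).hom) ((α_ _ _ _).hom ≫ (α_ _ _ _).hom)
      simp)
    (triangle := fun X Y => by
      change homMk ((α_ _ _ _).hom ≫ (𝟙 _ ⊗ₘ (λ_ _).hom)) ((α_ _ _ _).hom ≫ (𝟙 _ ⊗ₘ (λ_ _).hom)) =
        homMk ((ρ_ _).hom ⊗ₘ 𝟙 _) ((ρ_ _).hom ⊗ₘ 𝟙 _)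
      simp)

instance : MonoidalPreadditive (LinProd k C D) where
  whiskerLeft_zero {X _ _} := tensorHom_zero (𝟙 X)
  zero_whiskerRight {X _ _} := zero_tensorHom (𝟙 X)
  whiskerLeft_add {X _ _} f g := tensorHom_add (𝟙 X) f g
  add_whiskerRight {X _ _} f g := add_tensorHom f g (𝟙 X)

end Monoidal

end LinProd

end

noncomputable section

namespace Mat_Monoidal

variable {C : Type u} [Category.{v} C] [Preadditive C]

/-- The entries of a morphism in the additive envelope. -/
def entry {M N : Mat_ C} (f : M ⟶ N) (i : M.ι) (j : N.ι) : M.X i ⟶ N.X j := f i j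

/-- The morphism of families with given entries. -/
def ofEntries {M N : Mat_ C} (f : ∀ i j, M.X i ⟶ N.X j) : M ⟶ N := f

theorem ofEntries_apply {M N : Mat_ C} (f : ∀ i j, M.X i ⟶ N.X j) (i : M.ι) (j : N.ι) :
    ofEntries f i j = f i j := rfl

/-- The morphism of families with entries `φ i` at the places `(i, e i)` and zero elsewhere. -/
def relabel {M N : Mat_ C} (e : M.ι → N.ι) (φ : ∀ i, M.X i ⟶ N.X (e i)) : M ⟶ N :=
  ofEntries fun i j => φ i ≫ entry (𝟙 N) (e i) j

theorem relabel_comp {M N P : Mat_ C} (e : M.ι → N.ι) (φ : ∀ i, M.X i ⟶ N.X (e i)) (g : N ⟶ P)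
    (i : M.ι) (k : P.ι) : (relabel e φ ≫ g) i k = φ i ≫ g (e i) k := by
  have h : (𝟙 N ≫ g) (e i) k = g (e i) k := by rw [Category.id_comp]
  rw [← h, Mat_.comp_apply, Mat_.comp_apply, Preadditive.comp_sum]
  exact Finset.sum_congr rfl fun j _ => Category.assoc _ _ _

theorem comp_relabel {M N P : Mat_ C} (f : M ⟶ N) (e : N.ι → P.ι) (he : Function.Injective e)
    (φ : ∀ i, N.X i ⟶ P.X (e i)) (i : M.ι) (k : N.ι) :
    (f ≫ relabel e φ) i (e k) = f i k ≫ φ k := by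
  rw [Mat_.comp_apply, Finset.sum_eq_single k]
  · simp [relabel, ofEntries_apply, entry]
  · intro j _ hj
    have : e j ≠ e k := fun h => hj (he h)
    simp [relabel, ofEntries_apply, entry, Mat_.id_apply_of_ne _ _ _ this]
  · simp

theorem relabel_relabel {M N P : Mat_ C} (e : M.ι → N.ι) (φ : ∀ i, M.X i ⟶ N.X (e i))
    (e' : N.ι → P.ι) (φ' : ∀ i, N.X i ⟶ P.X (e' i)) :
    relabel e φ ≫ relabel e' φ' = relabel (fun i => e' (e i)) (fun i => φ i ≫ φ' (e i)) := by
  ext i k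
  rw [relabel_comp]
  exact (Category.assoc _ _ _).symm

theorem relabel_id (M : Mat_ C) : relabel (fun i : M.ι => i) (fun i => 𝟙 (M.X i)) = 𝟙 M := by
  ext i j
  exact Category.id_comp _

/-- A bijective relabelling with invertible entries is an isomorphism. -/
def relabelIso {M N : Mat_ C} (e : M.ι → N.ι) (e' : N.ι → M.ι) (h : ∀ i, e' (e i) = i)
    (h' : ∀ j, e (e' j) = j) (φ : ∀ i, M.X i ≅ N.X (e i)) : M ≅ N where
  hom := relabel e fun i => (φ i).hom
  inv := ofEntries fun i j => entry (𝟙 N) i (e j) ≫ (φ j).inv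
  hom_inv_id := by
    ext i j
    rw [relabel_comp]
    by_cases hij : i = j
    · subst hij; simp [ofEntries_apply, entry]
    · have : e i ≠ e j := fun hh => hij (by rw [← h i, hh, h])
      simp [ofEntries_apply, entry, Mat_.id_apply_of_ne _ _ _ this, Mat_.id_apply_of_ne _ _ _ hij]
  inv_hom_id := by
    have he : Function.Injective e := fun a b hh => by rw [← h a, hh, h]
    ext i k
    obtain ⟨j, rfl⟩ : ∃ j, e j = k := ⟨_, h' k⟩
    rw [comp_relabel _ _ he]
    simp [ofEntries_apply, entry]

/-- An index map, seen as an index map of the image families. -/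
def mapIdx {D : Type u₂} [Category.{v} D] [Preadditive D] (F : C ⥤ D) [F.Additive]
    {M N : Mat_ C} (e : M.ι → N.ι) : (F.mapMat_.obj M).ι → (F.mapMat_.obj N).ι := e

/-- Images of the entries of a relabelling. -/
def mapEntry {D : Type u₂} [Category.{v} D] [Preadditive D] (F : C ⥤ D) [F.Additive]
    {M N : Mat_ C} (e : M.ι → N.ι) (φ : ∀ i, M.X i ⟶ N.X (e i)) (i : (F.mapMat_.obj M).ι) :
    (F.mapMat_.obj M).X i ⟶ (F.mapMat_.obj N).X (mapIdx F e i) := F.map (φ i)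

theorem mapMat_relabel {D : Type u₂} [Category.{v} D] [Preadditive D] (F : C ⥤ D) [F.Additive]
    {M N : Mat_ C} (e : M.ι → N.ι) (φ : ∀ i, M.X i ⟶ N.X (e i)) :
    F.mapMat_.map (relabel e φ) = relabel (mapIdx F e) (mapEntry F e φ) := by
  ext i j
  have h : F.map (entry (𝟙 N) (e i) j) = entry (𝟙 (F.mapMat_.obj N)) (e i) j :=
    congrArg (fun t : F.mapMat_.obj N ⟶ F.mapMat_.obj N => entry t (e i) j)
      (F.mapMat_.map_id N)
  change F.map (φ i ≫ entry (𝟙 N) (e i) j) = F.map (φ i) ≫ _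
  rw [F.map_comp, h]
  rfl

variable [MonoidalCategory C]

/-- The tensor product of families is the family of all tensor products of members, and
matrices are multiplied by the Kronecker product. -/
instance : MonoidalCategoryStruct (Mat_ C) where
  tensorObj M N := ⟨M.ι × N.ι, fun p => M.X p.1 ⊗ N.X p.2⟩
  tensorUnit := ⟨PUnit, fun _ => 𝟙_ C⟩
  tensorHom f g := ofEntries fun p q => entry f p.1 q.1 ⊗ₘ entry g p.2 q.2
  whiskerLeft M _ _ f := ofEntries fun p q => entry (𝟙 M) p.1 q.1 ⊗ₘ entry f p.2 q.2
  whiskerRight f M := ofEntries fun p q => entry f p.1 q.1 ⊗ₘ entry (𝟙 M) p.2 q.2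
  associator M N P := relabelIso (fun p => (p.1.1, (p.1.2, p.2))) (fun p => ((p.1, p.2.1), p.2.2))
    (fun _ => rfl) (fun _ => rfl) (fun p => α_ (M.X p.1.1) (N.X p.1.2) (P.X p.2))
  leftUnitor M := relabelIso (fun p => p.2) (fun i => (PUnit.unit, i))
    (fun _ => rfl) (fun _ => rfl) (fun p => λ_ (M.X p.2))
  rightUnitor M := relabelIso (fun p => p.1) (fun i => (i, PUnit.unit))
    (fun _ => rfl) (fun _ => rfl) (fun p => ρ_ (M.X p.1))

theorem tensorHom_apply {M N M' N' : Mat_ C} (f : M ⟶ N) (g : M' ⟶ N') (p : M.ι × M'.ι)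
    (q : N.ι × N'.ι) : (f ⊗ₘ g) p q = entry f p.1 q.1 ⊗ₘ entry g p.2 q.2 := rfl

theorem associator_hom (M N P : Mat_ C) : (α_ M N P).hom =
    relabel (M := (M ⊗ N) ⊗ P) (N := M ⊗ (N ⊗ P)) (fun p => (p.1.1, (p.1.2, p.2)))
      (fun p => (α_ (M.X p.1.1) (N.X p.1.2) (P.X p.2)).hom) := rfl

theorem leftUnitor_hom (M : Mat_ C) : (λ_ M).hom =
    relabel (M := 𝟙_ (Mat_ C) ⊗ M) (N := M) (fun p => p.2) (fun p => (λ_ (M.X p.2)).hom) := rfl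

theorem rightUnitor_hom (M : Mat_ C) : (ρ_ M).hom =
    relabel (M := M ⊗ 𝟙_ (Mat_ C)) (N := M) (fun p => p.1) (fun p => (ρ_ (M.X p.1)).hom) := rfl

variable [MonoidalPreadditive C]

theorem id_tensor_id (M N : Mat_ C) : 𝟙 M ⊗ₘ 𝟙 N = 𝟙 (M ⊗ N) := by
  classical
  ext ⟨i, j⟩ ⟨i', j'⟩
  rw [tensorHom_apply]
  by_cases h : i = i'
  · subst h
    by_cases h' : j = j'
    · subst h'
      simp only [entry, Mat_.id_apply_self]
      exact id_tensorHom_id _ _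
    · have h2 : ((i, j) : M.ι × N.ι) ≠ (i, j') := fun hh => h' (Prod.ext_iff.1 hh).2
      rw [Mat_.id_apply_of_ne (M ⊗ N) (i, j) (i, j') h2]
      simp only [entry, Mat_.id_apply_of_ne _ _ _ h', MonoidalPreadditive.tensor_zero]
  · have h2 : ((i, j) : M.ι × N.ι) ≠ (i', j') := fun hh => h (Prod.ext_iff.1 hh).1
    rw [Mat_.id_apply_of_ne (M ⊗ N) (i, j) (i', j') h2]
    simp only [entry, Mat_.id_apply_of_ne _ _ _ h, MonoidalPreadditive.zero_tensor]

theorem relabel_tensor {M N M' N' : Mat_ C} (e : M.ι → N.ι) (φ : ∀ i, M.X i ⟶ N.X (e i))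
    (e' : M'.ι → N'.ι) (φ' : ∀ i, M'.X i ⟶ N'.X (e' i)) :
    relabel e φ ⊗ₘ relabel e' φ' =
      relabel (M := M ⊗ M') (N := N ⊗ N') (fun p => (e p.1, e' p.2))
        (fun p => φ p.1 ⊗ₘ φ' p.2) := by
  ext p q
  simp only [relabel, tensorHom_apply, ofEntries_apply, entry, ← id_tensor_id]
  exact (tensorHom_comp_tensorHom _ _ _ _).symm

theorem comp_tensor_comp {M N P M' N' P' : Mat_ C} (f : M ⟶ N) (f' : M' ⟶ N') (g : N ⟶ P)
    (g' : N' ⟶ P') : (f ⊗ₘ f') ≫ (g ⊗ₘ g') = (f ≫ g) ⊗ₘ (f' ≫ g') := by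
  ext p q
  rw [Mat_.comp_apply, tensorHom_apply, entry, entry, Mat_.comp_apply, Mat_.comp_apply,
    sum_tensor]
  simp only [tensor_sum]
  refine (Fintype.sum_prod_type (α₁ := N.ι) (α₂ := N'.ι) _).trans ?_
  exact Finset.sum_congr rfl fun i _ => Finset.sum_congr rfl fun j _ =>
    tensorHom_comp_tensorHom _ _ _ _

theorem relabel_tensor_id {M N : Mat_ C} (e : M.ι → N.ι) (φ : ∀ i, M.X i ⟶ N.X (e i))
    (P : Mat_ C) : relabel e φ ⊗ₘ 𝟙 P =
      relabel (M := M ⊗ P) (N := N ⊗ P) (fun p => (e p.1, p.2)) (fun p => φ p.1 ⊗ₘ 𝟙 _) := by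
  rw [← relabel_id P, relabel_tensor]

theorem id_tensor_relabel {M N : Mat_ C} (e : M.ι → N.ι) (φ : ∀ i, M.X i ⟶ N.X (e i))
    (P : Mat_ C) : 𝟙 P ⊗ₘ relabel e φ =
      relabel (M := P ⊗ M) (N := P ⊗ N) (fun p => (p.1, e p.2)) (fun p => 𝟙 _ ⊗ₘ φ p.2) := by
  rw [← relabel_id P, relabel_tensor]

instance : MonoidalCategory (Mat_ C) :=
  MonoidalCategory.ofTensorHom
    (id_tensorHom_id := id_tensor_id)
    (id_tensorHom := fun _ _ _ _ => rfl)
    (tensorHom_id := fun _ _ => rfl)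
    (tensorHom_comp_tensorHom := comp_tensor_comp)
    (associator_naturality := fun {M₁ M₂ M₃ N₁ N₂ N₃} f₁ f₂ f₃ => by
      ext ⟨⟨i, j⟩, k⟩ ⟨i', ⟨j', k'⟩⟩
      rw [associator_hom, associator_hom, relabel_comp]
      refine (comp_relabel (((f₁ ⊗ₘ f₂) ⊗ₘ f₃)) _ ?_ _ ((i, j), k) ((i', j'), k')).trans ?_
      · rintro ⟨⟨a, b⟩, c⟩ ⟨⟨a', b'⟩, c'⟩ h
        exact congrArg (fun x : N₁.ι × N₂.ι × N₃.ι => ((x.1, x.2.1), x.2.2)) h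
      · exact associator_naturality _ _ _)
    (leftUnitor_naturality := fun {M N} f => by
      ext ⟨⟨⟩, i⟩ j
      rw [leftUnitor_hom, leftUnitor_hom, relabel_comp]
      refine (comp_relabel (𝟙 (𝟙_ (Mat_ C)) ⊗ₘ f) _ ?_ _ (PUnit.unit, i) (PUnit.unit, j)).trans ?_
      · rintro ⟨⟨⟩, c⟩ ⟨⟨⟩, c'⟩ h
        exact congrArg (fun x => (PUnit.unit, x)) h
      · rw [tensorHom_apply]
        simp only [entry, Mat_.id_apply_self]
        rw [id_tensorHom]
        exact leftUnitor_naturality _)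
    (rightUnitor_naturality := fun {M N} f => by
      ext ⟨i, ⟨⟩⟩ j
      rw [rightUnitor_hom, rightUnitor_hom, relabel_comp]
      refine (comp_relabel (f ⊗ₘ 𝟙 (𝟙_ (Mat_ C))) _ ?_ _ (i, PUnit.unit) (j, PUnit.unit)).trans ?_
      · rintro ⟨c, ⟨⟩⟩ ⟨c', ⟨⟩⟩ h
        exact congrArg (fun x => (x, PUnit.unit)) h
      · rw [tensorHom_apply]
        simp only [entry, Mat_.id_apply_self]
        rw [tensorHom_id]
        exact rightUnitor_naturality _)
    (pentagon := fun W X Y Z => by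
      simp only [associator_hom]
      rw [relabel_tensor_id, id_tensor_relabel, relabel_relabel, relabel_relabel, relabel_relabel]
      congr 1
      funext p
      refine Eq.trans ?_ (MonoidalCategory.pentagon (W.X p.1.1.1) (X.X p.1.1.2) (Y.X p.1.2) (Z.X p.2))
      rw [tensorHom_id, id_tensorHom]
      rfl)
    (triangle := fun X Y => by
      simp only [associator_hom, leftUnitor_hom, rightUnitor_hom]
      rw [relabel_tensor_id, id_tensor_relabel, relabel_relabel]
      congr 1
      funext p
      refine Eq.trans ?_ ((MonoidalCategory.triangle (X.X p.1.1) (Y.X p.2)).trans ?_)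
      · rw [id_tensorHom]; rfl
      · rw [tensorHom_id])


/-- Linear structure on the additive envelope, entry by entry. -/
instance (k : Type w) [Semiring k] (C : Type u) [Category.{v} C] [Preadditive C] [Linear k C] :
    Linear k (Mat_ C) where
  homModule M N := inferInstanceAs (Module k (∀ (i : M.ι) (j : N.ι), M.X i ⟶ N.X j))
  smul_comp M N P r f g := by
    ext i j
    change ∑ l, (r • f i l) ≫ g l j = r • ∑ l, f i l ≫ g l j
    simp [Finset.smul_sum]
  comp_smul M N P f r g := by
    ext i j
    change ∑ l, f i l ≫ (r • g l j) = r • ∑ l, f i l ≫ g l j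
    simp [Finset.smul_sum]

section Functor

variable {D : Type u₂} [Category.{v} D] [Preadditive D] [MonoidalCategory D]
  [MonoidalPreadditive D] (F : C ⥤ D) [F.Additive] [F.Monoidal]

open Functor.LaxMonoidal Functor.Monoidal

/-- Index map of the unit comparison. -/
def unitIdx : (𝟙_ (Mat_ D)).ι → (F.mapMat_.obj (𝟙_ (Mat_ C))).ι := fun i => i

/-- Entries of the unit comparison. -/
def unitEntry (i : (𝟙_ (Mat_ D)).ι) :
    (𝟙_ (Mat_ D)).X i ≅ (F.mapMat_.obj (𝟙_ (Mat_ C))).X (unitIdx F i) := εIso F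

/-- The unit comparison of the additive envelope of a monoidal functor. -/
def unitComparison : 𝟙_ (Mat_ D) ≅ F.mapMat_.obj (𝟙_ (Mat_ C)) :=
  relabelIso (unitIdx F) (fun i => i) (fun _ => rfl) (fun _ => rfl) (unitEntry F)

/-- Index map of the tensor comparison. -/
def tensorIdx (M N : Mat_ C) : (F.mapMat_.obj M ⊗ F.mapMat_.obj N).ι →
    (F.mapMat_.obj (M ⊗ N)).ι := fun p => p

/-- Entries of the tensor comparison. -/
def tensorEntry (M N : Mat_ C) (p : (F.mapMat_.obj M ⊗ F.mapMat_.obj N).ι) :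
    (F.mapMat_.obj M ⊗ F.mapMat_.obj N).X p ≅ (F.mapMat_.obj (M ⊗ N)).X (tensorIdx F M N p) :=
  μIso F (M.X p.1) (N.X p.2)

/-- The tensor comparison of the additive envelope of a monoidal functor. -/
def tensorComparison (M N : Mat_ C) :
    F.mapMat_.obj M ⊗ F.mapMat_.obj N ≅ F.mapMat_.obj (M ⊗ N) :=
  relabelIso (tensorIdx F M N) (fun p => p) (fun _ => rfl) (fun _ => rfl) (tensorEntry F M N)

theorem unitComparison_hom : (unitComparison F).hom =
    relabel (unitIdx F) (fun i => (unitEntry F i).hom) := rfl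

theorem tensorComparison_hom (M N : Mat_ C) : (tensorComparison F M N).hom =
    relabel (tensorIdx F M N) (fun i => (tensorEntry F M N i).hom) := rfl

theorem tensorComparison_natural {M N M' N' : Mat_ C} (f : M ⟶ N) (f' : M' ⟶ N') :
    (F.mapMat_.map f ⊗ₘ F.mapMat_.map f') ≫ (tensorComparison F N N').hom =
      (tensorComparison F M M').hom ≫ F.mapMat_.map (f ⊗ₘ f') := by
  ext p q
  rw [tensorComparison_hom, tensorComparison_hom, relabel_comp]
  refine (comp_relabel _ (tensorIdx F N N') (fun _ _ h => h) _ p q).trans ?_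
  exact μ_natural F (entry f p.1 q.1) (entry f' p.2 q.2)

/-- The additive envelope of a monoidal functor is monoidal, entry by entry. -/
instance : F.mapMat_.Monoidal :=
  Functor.CoreMonoidal.toMonoidal
    { εIso := unitComparison F
      μIso := tensorComparison F
      μIso_hom_natural_left := fun f X' => by
        rw [← tensorHom_id, ← tensorHom_id, ← tensorComparison_natural, F.mapMat_.map_id]
      μIso_hom_natural_right := fun X' f => by
        rw [← id_tensorHom, ← id_tensorHom, ← tensorComparison_natural, F.mapMat_.map_id]
      associativity := fun X Y Z => by
        simp only [tensorComparison_hom, ← id_tensorHom, ← tensorHom_id, associator_hom]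
        rw [relabel_tensor_id, id_tensor_relabel, mapMat_relabel, relabel_relabel,
          relabel_relabel, relabel_relabel, relabel_relabel]
        refine congrArg (relabel _) (funext fun p => ?_)
        refine Eq.trans ?_ ((associativity F (X.X p.1.1) (Y.X p.1.2) (Z.X p.2)).trans ?_)
        · rw [tensorHom_id]; rfl
        · rw [id_tensorHom]; rfl
      left_unitality := fun X => by
        simp only [tensorComparison_hom, unitComparison_hom, ← tensorHom_id, leftUnitor_hom]
        rw [relabel_tensor_id, mapMat_relabel, relabel_relabel, relabel_relabel]
        refine congrArg (relabel _) (funext fun p => ?_)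
        refine (left_unitality F (X.X p.2)).trans ?_
        rw [tensorHom_id]; rfl
      right_unitality := fun X => by
        simp only [tensorComparison_hom, unitComparison_hom, ← id_tensorHom, rightUnitor_hom]
        rw [id_tensor_relabel, mapMat_relabel, relabel_relabel, relabel_relabel]
        refine congrArg (relabel _) (funext fun p => ?_)
        refine (right_unitality F (X.X p.1)).trans ?_
        rw [id_tensorHom]; rfl }

end Functor

end Mat_Monoidal

end

noncomputable section

namespace LinProd

variable {k : Type w} [Field k]
variable {C : Type u} [Category.{v} C] [Preadditive C] [Linear k C]
variable {C' : Type u₁} [Category.{v} C'] [Preadditive C'] [Linear k C']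
variable (D : Type u₂) [Category.{v₂} D] [Preadditive D] [Linear k D]
variable (G : C ⥤ C') [G.Additive] [G.Linear k]

/-- The functor `X ⊠ V ↦ G X ⊠ V` induced by a `k`-linear functor `G`. -/
def mapLeft : LinProd k C D ⥤ LinProd k C' D where
  obj X := ⟨G.obj X.left, X.right⟩
  map {X Y} f := TensorProduct.map (G.mapLinearMap k (X := X.left) (Y := Y.left))
    (LinearMap.id (M := X.right ⟶ Y.right)) f
  map_id X := by
    change homMk (G.map (𝟙 _)) (𝟙 _) = homMk (𝟙 _) (𝟙 _)
    rw [G.map_id]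
  map_comp {X Y Z} f g := by
    induction f using hom_induction with
    | h0 => rw [zero_comp]; exact (map_zero _).trans (by erw [map_zero, zero_comp])
    | ha a b ha hb =>
      rw [Preadditive.add_comp]
      refine (map_add _ _ _).trans ?_
      erw [ha, hb, map_add, Preadditive.add_comp]
    | hm a b =>
    induction g using hom_induction with
    | h0 => rw [comp_zero]; exact (map_zero _).trans (by erw [map_zero, comp_zero])
    | ha a b ha hb =>
      rw [Preadditive.comp_add]
      refine (map_add _ _ _).trans ?_
      erw [ha, hb, map_add, Preadditive.comp_add]
    | hm a' b' =>
    change homMk (G.map (a ≫ a')) (b ≫ b') = homMk (G.map a ≫ G.map a') (b ≫ b')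
    rw [G.map_comp]

instance : (mapLeft (k := k) D G).Additive where
  map_add {_ _ f g} := map_add (TensorProduct.map (G.mapLinearMap k) LinearMap.id) f g

theorem mapLeft_map_homMk {X Y : C} {V W : D} (f : X ⟶ Y) (g : V ⟶ W) :
    (mapLeft D G).map (homMk f g : (⟨X, V⟩ : LinProd k C D) ⟶ ⟨Y, W⟩) = homMk (G.map f) g := rfl

variable [MonoidalCategory C] [MonoidalPreadditive C] [MonoidalLinear k C]
variable [MonoidalCategory C'] [MonoidalPreadditive C'] [MonoidalLinear k C']
variable [MonoidalCategory D] [MonoidalPreadditive D] [MonoidalLinear k D]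
variable [G.Monoidal]

open Functor.LaxMonoidal Functor.Monoidal

/-- The tensor comparison of the functor `X ⊠ V ↦ G X ⊠ V`. -/
def tensorComparison (X Y : LinProd k C D) :
    (mapLeft D G).obj X ⊗ (mapLeft D G).obj Y ≅ (mapLeft D G).obj (X ⊗ Y) :=
  isoMk (μIso G X.left Y.left) (Iso.refl (X.right ⊗ Y.right))

theorem tensorComparison_natural {X Y X' Y' : LinProd k C D} (f : X ⟶ Y) (f' : X' ⟶ Y') :
    ((mapLeft D G).map f ⊗ₘ (mapLeft D G).map f') ≫ (tensorComparison D G Y Y').hom =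
      (tensorComparison D G X X').hom ≫ (mapLeft D G).map (f ⊗ₘ f') := by
  induction f using hom_induction with
  | h0 => simp only [Functor.map_zero, zero_tensorHom, zero_comp, comp_zero]
  | ha a b ha hb =>
    simp only [Functor.map_add, add_tensorHom, Preadditive.add_comp, Preadditive.comp_add, ha, hb]
  | hm a b =>
  induction f' using hom_induction with
  | h0 => simp only [Functor.map_zero, tensorHom_zero, zero_comp, comp_zero]
  | ha a b ha hb =>
    simp only [Functor.map_add, tensorHom_add, Preadditive.add_comp, Preadditive.comp_add, ha, hb]
  | hm a' b' =>
  change homMk ((G.map a ⊗ₘ G.map a') ≫ μ G _ _) ((b ⊗ₘ b') ≫ 𝟙 _) =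
    homMk (μ G _ _ ≫ G.map (a ⊗ₘ a')) (𝟙 _ ≫ (b ⊗ₘ b'))
  rw [μ_natural, Category.comp_id, Category.id_comp]

/-- If `G` is monoidal, so is `X ⊠ V ↦ G X ⊠ V`. -/
instance : (mapLeft (k := k) D G).Monoidal :=
  Functor.CoreMonoidal.toMonoidal
    { εIso := isoMk (εIso G) (Iso.refl (𝟙_ D))
      μIso := tensorComparison D G
      μIso_hom_natural_left := fun f X' => by
        rw [← tensorHom_id, ← tensorHom_id, ← tensorComparison_natural,
          CategoryTheory.Functor.map_id]
      μIso_hom_natural_right := fun X' f => by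
        rw [← id_tensorHom, ← id_tensorHom, ← tensorComparison_natural,
          CategoryTheory.Functor.map_id]
      associativity := fun X Y Z => by
        simp only [← id_tensorHom, ← tensorHom_id]
        change homMk ((μ G _ _ ⊗ₘ 𝟙 _) ≫ μ G _ _ ≫ G.map (α_ _ _ _).hom)
            ((𝟙 _ ⊗ₘ 𝟙 _) ≫ 𝟙 _ ≫ (α_ _ _ _).hom) =
          homMk ((α_ _ _ _).hom ≫ (𝟙 _ ⊗ₘ μ G _ _) ≫ μ G _ _)
            ((α_ _ _ _).hom ≫ (𝟙 _ ⊗ₘ 𝟙 _) ≫ 𝟙 _)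
        rw [tensorHom_id, id_tensorHom, associativity]
        simp
      left_unitality := fun X => by
        simp only [← tensorHom_id]
        change homMk (λ_ _).hom (λ_ _).hom =
          homMk ((ε G ⊗ₘ 𝟙 _) ≫ μ G _ _ ≫ G.map (λ_ _).hom) ((𝟙 _ ⊗ₘ 𝟙 _) ≫ 𝟙 _ ≫ (λ_ _).hom)
        rw [tensorHom_id, ← left_unitality]
        simp
      right_unitality := fun X => by
        simp only [← id_tensorHom]
        change homMk (ρ_ _).hom (ρ_ _).hom =
          homMk ((𝟙 _ ⊗ₘ ε G) ≫ μ G _ _ ≫ G.map (ρ_ _).hom) ((𝟙 _ ⊗ₘ 𝟙 _) ≫ 𝟙 _ ≫ (ρ_ _).hom)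
        rw [id_tensorHom, ← right_unitality]
        simp }

end LinProd

/-! ### Frobenius twist -/

/-- The Frobenius twist `C⁽¹⁾` of a `k`-linear category: the same category, in which
`c : k` acts on morphisms as `c ^ p` does in `C`. -/
def FrobeniusTwist (_p : ℕ) (C : Type u) : Type u := C

namespace FrobeniusTwist

variable (p : ℕ) (C : Type u) [Category.{v} C]

instance : Category.{v} (FrobeniusTwist p C) := inferInstanceAs (Category.{v} C)

instance [Preadditive C] : Preadditive (FrobeniusTwist p C) := inferInstanceAs (Preadditive C)

instance [MonoidalCategory C] : MonoidalCategory (FrobeniusTwist p C) :=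
  inferInstanceAs (MonoidalCategory C)

instance [Preadditive C] [MonoidalCategory C] [MonoidalPreadditive C] :
    MonoidalPreadditive (FrobeniusTwist p C) := inferInstanceAs (MonoidalPreadditive C)

variable {C} in
/-- An object of `C`, seen in the twist. -/
def of (X : C) : FrobeniusTwist p C := X

variable {C} in
/-- A morphism of `C`, seen in the twist. -/
def ofHom {X Y : C} (f : X ⟶ Y) : of p X ⟶ of p Y := f

section Linear

variable {k : Type w} [Field k] [ExpChar k p] [Preadditive C] [Linear k C]

instance : Linear k (FrobeniusTwist p C) where
  homModule X Y :=
    letI : Module k (X ⟶ Y) := Linear.homModule (R := k) (C := C) X Y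
    Module.compHom (X ⟶ Y) (frobenius k p)
  smul_comp X Y Z r f g := Linear.smul_comp (C := C) X Y Z (frobenius k p r) f g
  comp_smul X Y Z f r g := Linear.comp_smul (C := C) X Y Z f (frobenius k p r) g

theorem smul_ofHom {X Y : C} (c : k) (f : X ⟶ Y) : c • ofHom p f = ofHom p (c ^ p • f) := rfl

instance [MonoidalCategory C] [MonoidalPreadditive C] [MonoidalLinear k C] :
    MonoidalLinear k (FrobeniusTwist p C) where
  whiskerLeft_smul X _ _ r f := MonoidalLinear.whiskerLeft_smul (C := C) X (frobenius k p r) f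
  smul_whiskerRight r _ _ f X := MonoidalLinear.smul_whiskerRight (C := C) (frobenius k p r) f X

end Linear

section Map

variable {C} {D : Type u₂} [Category.{v₂} D] (G : C ⥤ D)

/-- The twist of a functor: the same functor between the twists. -/
def map : FrobeniusTwist p C ⥤ FrobeniusTwist p D := G

instance [Preadditive C] [Preadditive D] [G.Additive] : (map p G).Additive :=
  inferInstanceAs G.Additive

instance [MonoidalCategory C] [MonoidalCategory D] [G.Monoidal] : (map p G).Monoidal :=
  inferInstanceAs G.Monoidal

instance {k : Type w} [Field k] [ExpChar k p] [Preadditive C] [Linear k C] [Preadditive D]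
    [Linear k D] [G.Linear k] : (map p G).Linear k where
  map_smul f r := Functor.Linear.map_smul (F := G) f (frobenius k p r)

end Map

end FrobeniusTwist

end

noncomputable section

/-! ### The Verlinde category -/

namespace Verlinde

section PartialTrace

variable {k : Type w} [Field k] {U V W : Type w} [AddCommGroup U] [Module k U]
  [FiniteDimensional k U] [AddCommGroup V] [Module k V] [FiniteDimensional k V]
  [AddCommGroup W] [Module k W] [FiniteDimensional k W]

/-- The partial trace of a linear map `U ⊗ W → V ⊗ W` along `W`. -/
def partialTrace : (U ⊗[k] W →ₗ[k] V ⊗[k] W) →ₗ[k] (U →ₗ[k] V) :=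
  (TensorProduct.rid k (U →ₗ[k] V)).toLinearMap ∘ₗ
    (TensorProduct.map LinearMap.id (LinearMap.trace k W)) ∘ₗ
      (homTensorHomEquiv k U W V W).symm.toLinearMap

theorem partialTrace_map (f : U →ₗ[k] V) (g : W →ₗ[k] W) :
    partialTrace (TensorProduct.map f g) = LinearMap.trace k W g • f := by
  have : (homTensorHomEquiv k U W V W).symm (TensorProduct.map f g) = f ⊗ₜ g := by
    rw [LinearEquiv.symm_apply_eq, homTensorHomEquiv_apply]
    rfl
  simp [partialTrace, this]

theorem hom_induction {P : (U ⊗[k] W →ₗ[k] V ⊗[k] W) → Prop} (g : U ⊗[k] W →ₗ[k] V ⊗[k] W)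
    (h0 : P 0) (hm : ∀ a b, P (TensorProduct.map a b)) (ha : ∀ a b, P a → P b → P (a + b)) :
    P g := by
  obtain ⟨t, rfl⟩ := (homTensorHomEquiv k U W V W).surjective g
  induction t using TensorProduct.induction_on with
  | zero => rwa [map_zero]
  | tmul a b => rw [homTensorHomEquiv_apply]; exact hm a b
  | add a b h h' => rw [map_add]; exact ha _ _ h h'

theorem partialTrace_conj (g : U ⊗[k] W →ₗ[k] V ⊗[k] W) (A : V →ₗ[k] V) (A' : U →ₗ[k] U)
    (B B' : W →ₗ[k] W) (h : B' ∘ₗ B = LinearMap.id) :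
    partialTrace (TensorProduct.map A B ∘ₗ g ∘ₗ TensorProduct.map A' B') =
      A ∘ₗ partialTrace g ∘ₗ A' := by
  induction g using hom_induction with
  | h0 => simp
  | ha a b ha hb => simp only [LinearMap.add_comp, LinearMap.comp_add, map_add, ha, hb]
  | hm a b =>
    rw [← TensorProduct.map_comp, ← TensorProduct.map_comp, partialTrace_map, partialTrace_map]
    have : LinearMap.trace k W (B ∘ₗ b ∘ₗ B') = LinearMap.trace k W b := by
      rw [LinearMap.trace_comp_comm', LinearMap.comp_assoc, h, LinearMap.comp_id]
    rw [this]
    simp [LinearMap.smul_comp, LinearMap.comp_smul]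

theorem trace_partialTrace (g : U ⊗[k] W →ₗ[k] V ⊗[k] W) (f : V →ₗ[k] U) :
    LinearMap.trace k V (partialTrace g ∘ₗ f) =
      LinearMap.trace k (V ⊗[k] W) (g ∘ₗ TensorProduct.map f LinearMap.id) := by
  induction g using hom_induction with
  | h0 => simp
  | ha a b ha hb => simp only [LinearMap.add_comp, map_add, ha, hb]
  | hm a b =>
    rw [partialTrace_map, ← TensorProduct.map_comp, LinearMap.comp_id,
      LinearMap.trace_tensorProduct', LinearMap.smul_comp, map_smul, smul_eq_mul, mul_comm]

end PartialTrace

section Negligible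

variable {k : Type w} [Field k] {G : Type v} [Group G]

/-- The linear map underlying a morphism of representations. -/
def toLin {X Y : FDRep k G} (f : X ⟶ Y) : X →ₗ[k] Y := f.hom.hom.hom

/-- A morphism `f : X ⟶ Y` of finite dimensional representations is negligible if
`Tr (f g) = 0` for all `g : Y ⟶ X`. -/
def IsNegligible {X Y : FDRep k G} (f : X ⟶ Y) : Prop :=
  ∀ g : Y ⟶ X, LinearMap.trace k X (toLin (f ≫ g)) = 0

theorem trace_comm {X Y : FDRep k G} (f : X ⟶ Y) (g : Y ⟶ X) :
    LinearMap.trace k X (toLin (f ≫ g)) = LinearMap.trace k Y (toLin (g ≫ f)) :=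
  LinearMap.trace_comp_comm' (toLin f) (toLin g)

theorem IsNegligible.comp {X Y Z : FDRep k G} {f : X ⟶ Y} (hf : IsNegligible f) (h : Y ⟶ Z) :
    IsNegligible (f ≫ h) := fun g => by rw [Category.assoc]; exact hf _

theorem IsNegligible.precomp {X Y Z : FDRep k G} {f : X ⟶ Y} (hf : IsNegligible f) (h : Z ⟶ X) :
    IsNegligible (h ≫ f) := fun g => by
  rw [Category.assoc, trace_comm, Category.assoc]; exact hf _

theorem IsNegligible.add {X Y : FDRep k G} {f f' : X ⟶ Y} (hf : IsNegligible f)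
    (hf' : IsNegligible f') : IsNegligible (f + f') := fun g => by
  rw [Preadditive.add_comp]
  exact (map_add (LinearMap.trace k X) (toLin (f ≫ g)) (toLin (f' ≫ g))).trans
    (by rw [hf g, hf' g, add_zero])

theorem IsNegligible.smul {X Y : FDRep k G} {f : X ⟶ Y} (hf : IsNegligible f) (c : k) :
    IsNegligible (c • f) := fun g => by
  rw [Linear.smul_comp]
  exact (map_smul (LinearMap.trace k X) c (toLin (f ≫ g))).trans (by rw [hf g, smul_zero])

theorem IsNegligible.zero (X Y : FDRep k G) : IsNegligible (0 : X ⟶ Y) := fun g => by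
  rw [zero_comp]; exact map_zero (LinearMap.trace k X)

theorem toLin_comm {X Y : FDRep k G} (f : X ⟶ Y) (a : G) :
    toLin f ∘ₗ X.ρ a = Y.ρ a ∘ₗ toLin f :=
  congrArg (fun t : X.V ⟶ Y.V => t.hom.hom) (f.comm a)

/-- The partial trace of a morphism of representations. -/
def ptr {X Y Z : FDRep k G} (g : Y ⊗ Z ⟶ X ⊗ Z) : Y ⟶ X where
  hom := FGModuleCat.ofHom (partialTrace (U := Y) (V := X) (W := Z) (toLin g))
  comm a := by
    have h1 : (TensorProduct.map (X.ρ a) (Z.ρ a)) ∘ₗ (toLin g : (Y : Type w) ⊗[k] (Z : Type w) →ₗ[k] (X : Type w) ⊗[k] (Z : Type w)) ∘ₗ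
        (TensorProduct.map (Y.ρ a⁻¹) (Z.ρ a⁻¹)) = toLin g := by
      have := toLin_comm g a
      have h2 : TensorProduct.map (Y.ρ a) (Z.ρ a) ∘ₗ TensorProduct.map (Y.ρ a⁻¹) (Z.ρ a⁻¹) =
          LinearMap.id := by
        rw [← TensorProduct.map_comp]
        simp only [← Module.End.mul_eq_comp, ← map_mul]
        simp only [mul_inv_cancel, map_one]
        exact TensorProduct.map_id
      change (TensorProduct.map (X.ρ a) (Z.ρ a) ∘ₗ toLin g) ∘ₗ _ = _
      have h3 : TensorProduct.map (X.ρ a) (Z.ρ a) ∘ₗ (toLin g : (Y : Type w) ⊗[k] (Z : Type w) →ₗ[k] (X : Type w) ⊗[k] (Z : Type w)) =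
        toLin g ∘ₗ TensorProduct.map (Y.ρ a) (Z.ρ a) := this.symm
      rw [h3, LinearMap.comp_assoc, h2]
      rfl
    have hz : Z.ρ a⁻¹ ∘ₗ Z.ρ a = LinearMap.id := by
      rw [← Module.End.mul_eq_comp, ← map_mul, inv_mul_cancel, map_one]; rfl
    have hy : Y.ρ a⁻¹ ∘ₗ Y.ρ a = LinearMap.id := by
      rw [← Module.End.mul_eq_comp, ← map_mul, inv_mul_cancel, map_one]; rfl
    have h4 := partialTrace_conj (U := Y) (V := X) (W := Z) (toLin g) (X.ρ a) (Y.ρ a⁻¹)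
      (Z.ρ a) (Z.ρ a⁻¹) hz
    rw [h1] at h4
    have h5 : partialTrace (U := Y) (V := X) (W := Z) (toLin g) ∘ₗ Y.ρ a =
        X.ρ a ∘ₗ partialTrace (U := Y) (V := X) (W := Z) (toLin g) := by
      conv_lhs => rw [h4]
      rw [LinearMap.comp_assoc, LinearMap.comp_assoc, hy]
      rfl
    ext1
    exact h5

theorem IsNegligible.whiskerRight {X Y : FDRep k G} {f : X ⟶ Y} (hf : IsNegligible f)
    (Z : FDRep k G) : IsNegligible (f ▷ Z) := fun g =>
  (trace_partialTrace (U := Y) (V := X) (W := Z) (toLin g) (toLin f)).symm.trans (hf (ptr g))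

theorem IsNegligible.whiskerLeft {X Y : FDRep k G} {f : X ⟶ Y} (hf : IsNegligible f)
    (Z : FDRep k G) : IsNegligible (Z ◁ f) := by
  have : Z ◁ f = (β_ Z X).hom ≫ f ▷ Z ≫ (β_ Z Y).inv := by
    rw [← Category.assoc, Iso.eq_comp_inv, BraidedCategory.braiding_naturality_right]
  rw [this]
  exact ((hf.whiskerRight Z).comp _).precomp _

variable (k G) in
/-- Morphisms are identified when they differ by a negligible one. -/
def negligibleRel : HomRel (FDRep k G) := fun _ _ f g => IsNegligible (f - g)

instance : Congruence (negligibleRel k G) where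
  equivalence :=
    { refl := fun f => by
        change IsNegligible (f - f); rw [sub_self]; exact IsNegligible.zero _ _
      symm := fun {f g} h => by
        change IsNegligible (g - f)
        have := IsNegligible.smul h (-1)
        rwa [neg_one_smul, neg_sub] at this
      trans := fun {f g h} h1 h2 => by
        change IsNegligible (f - h)
        have := IsNegligible.add h1 h2
        rwa [sub_add_sub_cancel] at this }
  comp_left {_ _ _} f {g g'} h := by
    change IsNegligible (f ≫ g - f ≫ g')
    rw [← Preadditive.comp_sub]
    exact IsNegligible.precomp h f
  comp_right {_ _ _} {f f'} g h := by
    change IsNegligible (f ≫ g - f' ≫ g)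
    rw [← Preadditive.sub_comp]
    exact IsNegligible.comp h g

theorem negligibleRel_whiskerLeft (Z : FDRep k G) {X Y : FDRep k G} {f g : X ⟶ Y}
    (h : negligibleRel k G f g) : negligibleRel k G (Z ◁ f) (Z ◁ g) := by
  have : Z ◁ (f - g) = Z ◁ f - Z ◁ g := (tensorLeft Z).map_sub
  exact (congrArg IsNegligible this).mp (IsNegligible.whiskerLeft h Z)

theorem negligibleRel_whiskerRight (Z : FDRep k G) {X Y : FDRep k G} {f g : X ⟶ Y}
    (h : negligibleRel k G f g) : negligibleRel k G (f ▷ Z) (g ▷ Z) := by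
  have : (f - g) ▷ Z = f ▷ Z - g ▷ Z := (tensorRight Z).map_sub
  exact (congrArg IsNegligible this).mp (IsNegligible.whiskerRight h Z)

variable (k G) in
/-- The quotient of the category of finite dimensional representations of `G` by the tensor
ideal of negligible morphisms. -/
abbrev Semisimplification := CategoryTheory.Quotient (negligibleRel k G)

theorem rel_add ⦃X Y : FDRep k G⦄ (f₁ f₂ g₁ g₂ : X ⟶ Y) (h : negligibleRel k G f₁ f₂)
    (h' : negligibleRel k G g₁ g₂) : negligibleRel k G (f₁ + g₁) (f₂ + g₂) := by
  have := IsNegligible.add h h'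
  change IsNegligible (f₁ + g₁ - (f₂ + g₂))
  rwa [add_sub_add_comm]

instance : Preadditive (Semisimplification k G) := Quotient.preadditive _ rel_add

instance : (Quotient.functor (negligibleRel k G)).Additive := Quotient.functor_additive _ rel_add

instance : Linear k (Semisimplification k G) :=
  Quotient.linear k _ fun a X Y f₁ f₂ h => by
    have := IsNegligible.smul h a
    change IsNegligible (a • f₁ - a • f₂)
    rwa [smul_sub] at this

/-- The projection to the quotient category, on morphisms. -/
def proj {X Y : FDRep k G} (f : X ⟶ Y) :
    (⟨X⟩ : Semisimplification k G) ⟶ ⟨Y⟩ := (Quotient.functor (negligibleRel k G)).map f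

theorem proj_surjective {X Y : Semisimplification k G} (f : X ⟶ Y) :
    ∃ g : X.as ⟶ Y.as, proj g = f := (Quotient.functor (negligibleRel k G)).map_surjective f

theorem proj_comp {X Y Z : FDRep k G} (f : X ⟶ Y) (g : Y ⟶ Z) :
    proj (f ≫ g) = proj f ≫ proj g := rfl

theorem proj_id (X : FDRep k G) : proj (𝟙 X) = 𝟙 _ := rfl

theorem proj_add {X Y : FDRep k G} (f g : X ⟶ Y) : proj (f + g) = proj f + proj g := rfl

theorem proj_smul {X Y : FDRep k G} (c : k) (f : X ⟶ Y) : proj (c • f) = c • proj f := rfl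

/-- Image of an isomorphism in the quotient category. -/
def projIso {X Y : FDRep k G} (f : X ≅ Y) : (⟨X⟩ : Semisimplification k G) ≅ ⟨Y⟩ :=
  (Quotient.functor (negligibleRel k G)).mapIso f

theorem closure_iff {X Y : FDRep k G} (f g : X ⟶ Y) :
    HomRel.CompClosure (negligibleRel k G) f g ↔ negligibleRel k G f g :=
  HomRel.compClosure_iff_self _ _ _

/-- The tensor product of morphisms in the quotient category. -/
def tensorHom' {X Y X' Y' : Semisimplification k G} (f : X ⟶ Y) (g : X' ⟶ Y') :
    (⟨X.as ⊗ X'.as⟩ : Semisimplification k G) ⟶ ⟨Y.as ⊗ Y'.as⟩ :=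
  Quot.map₂ (fun (a : X.as ⟶ Y.as) (b : X'.as ⟶ Y'.as) => a ⊗ₘ b)
    (fun a b b' h => by
      rw [closure_iff] at h ⊢
      rw [MonoidalCategory.tensorHom_def, MonoidalCategory.tensorHom_def]
      exact HomRel.comp_left _ (negligibleRel_whiskerLeft _ h))
    (fun a a' b h => by
      rw [closure_iff] at h ⊢
      rw [MonoidalCategory.tensorHom_def, MonoidalCategory.tensorHom_def]
      exact HomRel.comp_right _ (negligibleRel_whiskerRight _ h)) f g

/-- The tensor product of representatives. -/
instance : MonoidalCategoryStruct (Semisimplification k G) where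
  tensorObj X Y := ⟨X.as ⊗ Y.as⟩
  tensorUnit := ⟨𝟙_ _⟩
  tensorHom f g := tensorHom' f g
  whiskerLeft X _ _ f := tensorHom' (𝟙 X) f
  whiskerRight f X := tensorHom' f (𝟙 X)
  associator X Y Z := projIso (α_ X.as Y.as Z.as)
  leftUnitor X := projIso (λ_ X.as)
  rightUnitor X := projIso (ρ_ X.as)

theorem proj_tensorHom {X Y X' Y' : FDRep k G} (f : X ⟶ Y) (g : X' ⟶ Y') :
    proj f ⊗ₘ proj g = proj (f ⊗ₘ g) := rfl

instance : MonoidalCategory (Semisimplification k G) :=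
  MonoidalCategory.ofTensorHom
    (id_tensorHom_id := fun X Y => congrArg proj (id_tensorHom_id X.as Y.as))
    (id_tensorHom := fun _ _ _ _ => rfl)
    (tensorHom_id := fun _ _ => rfl)
    (tensorHom_comp_tensorHom := fun f₁ f₂ g₁ g₂ => by
      obtain ⟨f₁, rfl⟩ := proj_surjective f₁
      obtain ⟨f₂, rfl⟩ := proj_surjective f₂
      obtain ⟨g₁, rfl⟩ := proj_surjective g₁
      obtain ⟨g₂, rfl⟩ := proj_surjective g₂
      exact congrArg proj (tensorHom_comp_tensorHom f₁ f₂ g₁ g₂))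
    (associator_naturality := fun f₁ f₂ f₃ => by
      obtain ⟨f₁, rfl⟩ := proj_surjective f₁
      obtain ⟨f₂, rfl⟩ := proj_surjective f₂
      obtain ⟨f₃, rfl⟩ := proj_surjective f₃
      exact congrArg proj (associator_naturality f₁ f₂ f₃))
    (leftUnitor_naturality := fun f => by
      obtain ⟨f, rfl⟩ := proj_surjective f
      have h := leftUnitor_naturality f
      rw [← id_tensorHom] at h
      exact congrArg proj h)
    (rightUnitor_naturality := fun f => by
      obtain ⟨f, rfl⟩ := proj_surjective f
      have h := rightUnitor_naturality f
      rw [← tensorHom_id] at h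
      exact congrArg proj h)
    (pentagon := fun W X Y Z => by
      have h := MonoidalCategory.pentagon W.as X.as Y.as Z.as
      rw [← id_tensorHom, ← tensorHom_id] at h
      exact congrArg proj h)
    (triangle := fun X Y => by
      have h := MonoidalCategory.triangle X.as Y.as
      rw [← id_tensorHom, ← tensorHom_id] at h
      exact congrArg proj h)

theorem proj_whiskerLeft (Z : FDRep k G) {X Y : FDRep k G} (f : X ⟶ Y) :
    (⟨Z⟩ : Semisimplification k G) ◁ proj f = proj (Z ◁ f) :=
  congrArg proj (id_tensorHom Z f)

theorem proj_whiskerRight (Z : FDRep k G) {X Y : FDRep k G} (f : X ⟶ Y) :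
    proj f ▷ (⟨Z⟩ : Semisimplification k G) = proj (f ▷ Z) :=
  congrArg proj (tensorHom_id f Z)

instance : MonoidalPreadditive (Semisimplification k G) where
  whiskerLeft_zero {X Y Z} := (proj_whiskerLeft X.as (0 : Y.as ⟶ Z.as)).trans
    (congrArg proj MonoidalPreadditive.whiskerLeft_zero)
  zero_whiskerRight {X Y Z} := (proj_whiskerRight X.as (0 : Y.as ⟶ Z.as)).trans
    (congrArg proj MonoidalPreadditive.zero_whiskerRight)
  whiskerLeft_add {X Y Z} f g := by
    obtain ⟨f, rfl⟩ := proj_surjective f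
    obtain ⟨g, rfl⟩ := proj_surjective g
    rw [proj_whiskerLeft, proj_whiskerLeft]
    exact (proj_whiskerLeft X.as (f + g)).trans
      (congrArg proj (MonoidalPreadditive.whiskerLeft_add f g))
  add_whiskerRight {X Y Z} f g := by
    obtain ⟨f, rfl⟩ := proj_surjective f
    obtain ⟨g, rfl⟩ := proj_surjective g
    rw [proj_whiskerRight, proj_whiskerRight]
    exact (proj_whiskerRight X.as (f + g)).trans
      (congrArg proj (MonoidalPreadditive.add_whiskerRight f g))

instance : MonoidalLinear k (Semisimplification k G) where
  whiskerLeft_smul X {Y Z} c f := by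
    obtain ⟨f, rfl⟩ := proj_surjective f
    rw [proj_whiskerLeft]
    exact (proj_whiskerLeft X.as (c • f)).trans
      (congrArg proj (MonoidalLinear.whiskerLeft_smul X.as c f))
  smul_whiskerRight c {Y Z} f X := by
    obtain ⟨f, rfl⟩ := proj_surjective f
    rw [proj_whiskerRight]
    exact (proj_whiskerRight X.as (c • f)).trans
      (congrArg proj (MonoidalLinear.smul_whiskerRight c f X.as))

end Negligible

section Jordan

variable (k : Type w) [Field k] (p : ℕ) [Fact p.Prime] [CharP k p]

/-- The Verlinde category `Ver_p`: the quotient of the category of finite dimensional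
representations of `ℤ/p` in characteristic `p` by the negligible morphisms. -/
abbrev Ver := Semisimplification k (Multiplicative (ZMod p))

/-- The underlying space `k[D]/D^n` of a Jordan block of size `n`. -/
abbrev Block (n : ℕ) : Type w := AdjoinRoot (Polynomial.X ^ n : Polynomial k)

/-- The unipotent operator `1 - D` on `k[D]/D^n`. -/
def unipotent (n : ℕ) : Block k n →ₗ[k] Block k n :=
  LinearMap.mulLeft k (1 - AdjoinRoot.root (Polynomial.X ^ n : Polynomial k))

theorem unipotent_pow (n : ℕ) (hn : n ≤ p) : unipotent k n ^ p = 1 := by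
  have h0 : AdjoinRoot.root (Polynomial.X ^ n : Polynomial k) ^ n = 0 := by
    have := AdjoinRoot.mk_self (f := (Polynomial.X ^ n : Polynomial k))
    rwa [map_pow, AdjoinRoot.mk_X] at this
  have h1 : (1 - AdjoinRoot.root (Polynomial.X ^ n : Polynomial k)) ^ p = 1 := by
    have h2 : (1 - Polynomial.X : Polynomial k) ^ p = 1 - Polynomial.X ^ p := by
      rw [sub_pow_expChar, one_pow]
    have h3 := congrArg (AdjoinRoot.mk (Polynomial.X ^ n : Polynomial k)) h2
    rw [map_pow, map_sub, map_sub, map_one, map_pow, AdjoinRoot.mk_X] at h3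
    rw [h3, ← Nat.sub_add_cancel hn, pow_add, h0, mul_zero, sub_zero]
  rw [unipotent, LinearMap.pow_mulLeft, h1]
  ext x
  simp

/-- The generator of `ℤ/p` acts on the Jordan block of size `n ≤ p` by `1 - D`. -/
def blockRep (n : ℕ) (hn : n ≤ p) : Representation k (Multiplicative (ZMod p)) (Block k n) where
  toFun a := unipotent k n ^ (Multiplicative.toAdd a).val
  map_one' := by simp
  map_mul' a b := by
    rw [← pow_add, toAdd_mul, ZMod.val_add]
    conv_rhs => rw [← Nat.div_add_mod ((Multiplicative.toAdd a).val + (Multiplicative.toAdd b).val) p,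
      pow_add, pow_mul, unipotent_pow k p n hn, one_pow, one_mul]

instance (n : ℕ) : Module.Finite k (Block k n) :=
  (Polynomial.monic_X_pow n).finite_adjoinRoot

/-- The simple objects `L_1, …, L_{p-1}` of `Ver_p`; `L k p i` is `L_{i+1}`. -/
def L (i : Fin (p - 1)) : Ver k p :=
  ⟨FDRep.of (blockRep k p (i + 1) (by omega))⟩

end Jordan

end Verlinde

end

noncomputable section

/-! ### Tensor categories -/

/-- The conditions for a `k`-linear abelian monoidal category with bilinear tensor product to be
a tensor category: finite dimensional morphism spaces, objects of finite length, left and right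
duals, and `End(𝟙) = k`. -/
class IsTensorCategory (k : Type w) [Field k] (C : Type u) [Category.{v} C] [Abelian C]
    [Linear k C] [MonoidalCategory C] : Prop where
  finite_hom (X Y : C) : Module.Finite k (X ⟶ Y)
  noetherian (X : C) : IsNoetherianObject X
  artinian (X : C) : IsArtinianObject X
  left_dual (X : C) : Nonempty (HasLeftDual X)
  right_dual (X : C) : Nonempty (HasRightDual X)
  end_unit : Function.Bijective fun c : k => c • 𝟙 (𝟙_ C)

/-! ### The Deligne product with a split semisimple category -/

/-- The product `C ⊠ D` of `k`-linear categories: formal finite direct sums of external products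
`X ⊠ V`, with `Hom(X ⊠ V, Y ⊠ W) = Hom(X, Y) ⊗ Hom(V, W)`. If `C` is abelian and every object of
`D` is a finite direct sum of simple objects with endomorphism algebra `k` (as for `D = Ver_p`),
then every object is isomorphic to some `⊕ᵢ Xᵢ ⊠ Lᵢ`, with `Lᵢ` running over the simple objects of
`D`, and this is the Deligne tensor product of `C` and `D`. -/
abbrev DeligneProduct (k : Type w) [Field k] (C : Type u₁) [Category.{v₁} C] [Preadditive C]
    [Linear k C] (D : Type u₂) [Category.{v₂} D] [Preadditive D] [Linear k D] :=
  Mat_ (LinProd k C D)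

namespace FrobeniusFunctor

/-! ### Tensor powers and the cyclic permutation -/

section Power

variable {C : Type u} [Category.{v} C] [MonoidalCategory C]

/-- The tensor power functor `X ↦ X^{⊗ n}`. -/
def power : ℕ → C ⥤ C
  | 0 => (Functor.const C).obj (𝟙_ C)
  | n + 1 =>
    { obj := fun X => (power n).obj X ⊗ X
      map := fun f => (power n).map f ⊗ₘ f
      map_id := fun X => by simp
      map_comp := fun f g => by simp }

/-- The associativity constraint `X ⊗ X^{⊗ n} ≅ X^{⊗ n} ⊗ X`, which does not permute factors. -/
def shift (X : C) : (n : ℕ) → (X ⊗ (power n).obj X ≅ (power n).obj X ⊗ X)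
  | 0 => ρ_ X ≪≫ (λ_ X).symm
  | n + 1 => (α_ X ((power n).obj X) X).symm ≪≫ whiskerRightIso (shift X n) X

/-- The cyclic permutation `c` of the tensor factors of `X^{⊗ n}`: it moves the last factor to
the first place. -/
def cyclic [BraidedCategory C] (X : C) : (n : ℕ) → ((power n).obj X ⟶ (power n).obj X)
  | 0 => 𝟙 _
  | n + 1 => (β_ ((power n).obj X) X).hom ≫ (shift X n).hom

theorem shift_natural {X Y : C} (f : X ⟶ Y) (n : ℕ) :
    (f ⊗ₘ (power n).map f) ≫ (shift Y n).hom = (shift X n).hom ≫ ((power n).map f ⊗ₘ f) := by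
  induction n with
  | zero =>
    change (f ⊗ₘ 𝟙 _) ≫ (ρ_ Y).hom ≫ (λ_ Y).inv = ((ρ_ X).hom ≫ (λ_ X).inv) ≫ (𝟙 _ ⊗ₘ f)
    simp
  | succ n ih =>
    change (f ⊗ₘ ((power n).map f ⊗ₘ f)) ≫ (α_ _ _ _).inv ≫ (shift Y n).hom ▷ Y =
      ((α_ _ _ _).inv ≫ (shift X n).hom ▷ X) ≫ (((power n).map f ⊗ₘ f) ⊗ₘ f)
    rw [associator_inv_naturality_assoc, Category.assoc]
    congr 1
    rw [← tensorHom_id, ← tensorHom_id, tensorHom_comp_tensorHom, tensorHom_comp_tensorHom, ih,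
      Category.comp_id, Category.id_comp]

theorem cyclic_natural [BraidedCategory C] {X Y : C} (f : X ⟶ Y) (n : ℕ) :
    cyclic X n ≫ (power n).map f = (power n).map f ≫ cyclic Y n := by
  cases n with
  | zero => exact (Category.id_comp _).trans (Category.comp_id _).symm
  | succ n =>
    change ((β_ ((power n).obj X) X).hom ≫ (shift X n).hom) ≫ ((power n).map f ⊗ₘ f) =
      ((power n).map f ⊗ₘ f) ≫ (β_ ((power n).obj Y) Y).hom ≫ (shift Y n).hom
    rw [Category.assoc, ← shift_natural, BraidedCategory.braiding_naturality_assoc]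

/-- The comparison `E(X)^{⊗ n} ≅ E(X^{⊗ n})` of a monoidal functor `E`. -/
def powerComparison {D : Type u₂} [Category.{v₂} D] [MonoidalCategory D] (E : C ⥤ D) [E.Monoidal]
    (X : C) : (n : ℕ) → ((power n).obj (E.obj X) ≅ E.obj ((power n).obj X))
  | 0 => Functor.Monoidal.εIso E
  | n + 1 => whiskerRightIso (powerComparison E X n) (E.obj X) ≪≫
      Functor.Monoidal.μIso E ((power n).obj X) X

end Power

/-! ### The functors `B_i` -/

section Layer

variable {C : Type u} [Category.{v} C] [Abelian C]

/-- The power `D^j` of an endomorphism. -/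
def endPow {X : C} (D : X ⟶ X) : ℕ → (X ⟶ X)
  | 0 => 𝟙 X
  | j + 1 => D ≫ endPow D j

/-- `Ker D ∩ Im D^j` for an endomorphism `D` of `X`. -/
def kerIm {X : C} (D : X ⟶ X) (j : ℕ) : Subobject X :=
  kernelSubobject D ⊓ imageSubobject (endPow D j)

theorem kerIm_le {X : C} (D : X ⟶ X) (j : ℕ) : kerIm D (j + 1) ≤ kerIm D j :=
  inf_le_inf_left _ (imageSubobject_comp_le D (endPow D j))

theorem kerIm_le_ker {X : C} (D : X ⟶ X) (j : ℕ) : kerIm D j ≤ kernelSubobject D := inf_le_left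

theorem kerIm_le_im {X : C} (D : X ⟶ X) (j : ℕ) : kerIm D j ≤ imageSubobject (endPow D j) :=
  inf_le_right

/-- The object `(Ker D ∩ Im D^j) / (Ker D ∩ Im D^{j+1})`, which is `B_{j+1}(X)`. -/
def layer {X : C} (D : X ⟶ X) (j : ℕ) : C :=
  cokernel (Subobject.ofLE _ _ (kerIm_le D j))

/-- The projection `Ker D ∩ Im D^j ⟶ B_{j+1}(X)`. -/
def layerπ {X : C} (D : X ⟶ X) (j : ℕ) : (kerIm D j : C) ⟶ layer D j :=
  cokernel.π _

instance {X : C} (D : X ⟶ X) (j : ℕ) : Epi (layerπ D j) :=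
  inferInstanceAs (Epi (cokernel.π _))

theorem pow_natural {X Y : C} {D : X ⟶ X} {D' : Y ⟶ Y} (f : X ⟶ Y) (h : D ≫ f = f ≫ D') (j : ℕ) :
    endPow D j ≫ f = f ≫ endPow D' j := by
  induction j with
  | zero => exact (Category.id_comp _).trans (Category.comp_id _).symm
  | succ j ih => rw [endPow, endPow, Category.assoc, ih, ← Category.assoc, h, Category.assoc]

theorem kerIm_factors {X Y : C} {D : X ⟶ X} {D' : Y ⟶ Y} (f : X ⟶ Y) (h : D ≫ f = f ≫ D')
    (j : ℕ) : (kerIm D' j).Factors ((kerIm D j).arrow ≫ f) := by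
  refine (Subobject.inf_factors _).2 ⟨?_, ?_⟩
  · apply kernelSubobject_factors
    have h1 : (kerIm D j).arrow ≫ D = 0 := by
      rw [← Subobject.ofLE_arrow (kerIm_le_ker D j), Category.assoc,
        kernelSubobject_arrow_comp, comp_zero]
    rw [Category.assoc, ← h, ← Category.assoc, h1, zero_comp]
  · rw [← Subobject.ofLE_arrow (kerIm_le_im D j), Category.assoc]
    have sq := imageSubobjectMap_arrow (Arrow.homMk' f f (pow_natural f h j).symm)
    change _ = _ ≫ f at sq
    rw [← sq, ← Category.assoc]
    exact Subobject.factors_comp_arrow _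

/-- The map induced on `Ker D ∩ Im D^j` by a morphism commuting with `D`. -/
def kerImMap {X Y : C} {D : X ⟶ X} {D' : Y ⟶ Y} (f : X ⟶ Y) (h : D ≫ f = f ≫ D') (j : ℕ) :
    (kerIm D j : C) ⟶ (kerIm D' j : C) :=
  (kerIm D' j).factorThru ((kerIm D j).arrow ≫ f) (kerIm_factors f h j)

theorem kerImMap_arrow {X Y : C} {D : X ⟶ X} {D' : Y ⟶ Y} (f : X ⟶ Y) (h : D ≫ f = f ≫ D')
    (j : ℕ) : kerImMap f h j ≫ (kerIm D' j).arrow = (kerIm D j).arrow ≫ f :=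
  Subobject.factorThru_arrow _ _ _

/-- The map induced on `B_{j+1}` by a morphism commuting with `D`. -/
def layerMap {X Y : C} {D : X ⟶ X} {D' : Y ⟶ Y} (f : X ⟶ Y) (h : D ≫ f = f ≫ D') (j : ℕ) :
    layer D j ⟶ layer D' j :=
  cokernel.map _ _ (kerImMap f h (j + 1)) (kerImMap f h j) (by
    rw [← cancel_mono (kerIm D' j).arrow]
    simp [kerImMap_arrow])

theorem layerπ_map {X Y : C} {D : X ⟶ X} {D' : Y ⟶ Y} (f : X ⟶ Y) (h : D ≫ f = f ≫ D') (j : ℕ) :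
    layerπ D j ≫ layerMap f h j = kerImMap f h j ≫ layerπ D' j :=
  cokernel.π_desc _ _ _

theorem layerMap_id {X : C} (D : X ⟶ X) (h : D ≫ 𝟙 X = 𝟙 X ≫ D) (j : ℕ) :
    layerMap (𝟙 X) h j = 𝟙 _ := by
  rw [← cancel_epi (layerπ D j), layerπ_map, Category.comp_id]
  have : kerImMap (𝟙 X) h j = 𝟙 _ := by
    rw [← cancel_mono (kerIm D j).arrow, kerImMap_arrow, Category.comp_id, Category.id_comp]
  rw [this, Category.id_comp]

theorem layerMap_comp {X Y Z : C} {D : X ⟶ X} {D' : Y ⟶ Y} {D'' : Z ⟶ Z} (f : X ⟶ Y) (g : Y ⟶ Z)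
    (h : D ≫ f = f ≫ D') (h' : D' ≫ g = g ≫ D'') (h'' : D ≫ f ≫ g = (f ≫ g) ≫ D'') (j : ℕ) :
    layerMap (f ≫ g) h'' j = layerMap f h j ≫ layerMap g h' j := by
  rw [← cancel_epi (layerπ D j), layerπ_map, ← Category.assoc, layerπ_map, Category.assoc,
    layerπ_map, ← Category.assoc]
  congr 1
  rw [← cancel_mono (kerIm D'' j).arrow, kerImMap_arrow, Category.assoc, kerImMap_arrow,
    ← Category.assoc, ← Category.assoc, kerImMap_arrow]

end Layer

/-! ### The Frobenius functor -/

section Frobenius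

variable {C : Type u} [Category.{v} C] [Abelian C] [MonoidalCategory C] [SymmetricCategory C]

/-- The operator `D = 1 - c` on `X^{⊗ n}`, with `c` the cyclic permutation. -/
def diff (n : ℕ) (X : C) : (power n).obj X ⟶ (power n).obj X := 𝟙 _ - cyclic X n

theorem diff_natural (n : ℕ) {X Y : C} (f : X ⟶ Y) :
    diff n X ≫ (power n).map f = (power n).map f ≫ diff n Y := by
  rw [diff, diff, Preadditive.sub_comp, Preadditive.comp_sub, cyclic_natural, Category.id_comp,
    Category.comp_id]

variable (C) in
/-- The functor `F_{j+1} : X ↦ B_{j+1}(X^{⊗ p})`. -/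
def component (p j : ℕ) : C ⥤ C where
  obj X := layer (diff p X) j
  map f := layerMap ((power p).map f) (diff_natural p f) j
  map_id X := by
    have : ∀ (g : (power p).obj X ⟶ (power p).obj X) (h : diff p X ≫ g = g ≫ diff p X),
        g = 𝟙 _ → layerMap g h j = 𝟙 _ := by
      rintro g h rfl; exact layerMap_id _ _ _
    exact this _ _ ((power p).map_id X)
  map_comp {X Y Z} f g := by
    have : ∀ (t : (power p).obj X ⟶ (power p).obj Z) (h : diff p X ≫ t = t ≫ diff p Z),
        t = (power p).map f ≫ (power p).map g → layerMap t h j =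
          layerMap _ (diff_natural p f) j ≫ layerMap _ (diff_natural p g) j := by
      rintro t h rfl; exact layerMap_comp _ _ _ _ _ _
    exact this _ _ ((power p).map_comp f g)

variable (k : Type w) [Field k] (p : ℕ) [Fact p.Prime] [CharP k p]

section Target

variable (C : Type u) [Category.{v} C] [Preadditive C] [Linear k C]

/-- The category `C⁽¹⁾ ⊠ Ver_p`. -/
abbrev Target := DeligneProduct k (FrobeniusTwist p C) (Verlinde.Ver k p)

variable {C} in
/-- The object `⊕_{i=1}^{p-1} X_i ⊠ L_i` of `C⁽¹⁾ ⊠ Ver_p` (with indices shifted by one). -/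
def sumObj (X : Fin (p - 1) → C) : Target k p C :=
  ⟨Fin (p - 1), fun i => ⟨FrobeniusTwist.of p (X i), Verlinde.L k p i⟩⟩

variable {C} in
/-- The morphism `⊕_i f_i ⊠ id` from `⊕_i X_i ⊠ L_i` to `⊕_i Y_i ⊠ L_i`. -/
def sumMap {X Y : Fin (p - 1) → C} (f : ∀ i, X i ⟶ Y i) : sumObj k p X ⟶ sumObj k p Y :=
  Mat_Monoidal.relabel (M := sumObj k p X) (N := sumObj k p Y) (fun i => i)
    (fun i => LinProd.homMk (FrobeniusTwist.ofHom p (f i)) (𝟙 (Verlinde.L k p i)))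

theorem sumMap_id (X : Fin (p - 1) → C) : sumMap k p (fun i => 𝟙 (X i)) = 𝟙 _ :=
  Mat_Monoidal.relabel_id (sumObj k p X)

theorem sumMap_comp {X Y Z : Fin (p - 1) → C} (f : ∀ i, X i ⟶ Y i) (g : ∀ i, Y i ⟶ Z i) :
    sumMap k p (fun i => f i ≫ g i) = sumMap k p f ≫ sumMap k p g := by
  refine Eq.trans ?_ (Mat_Monoidal.relabel_relabel (M := sumObj k p X) (N := sumObj k p Y)
    (P := sumObj k p Z) _ _ _ _).symm
  refine congrArg (Mat_Monoidal.relabel (M := sumObj k p X) (N := sumObj k p Z) _)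
    (funext fun i => ?_)
  exact congrArg (LinProd.homMk (FrobeniusTwist.ofHom p (f i ≫ g i))) (Category.comp_id _).symm

variable {C} in
/-- The functor `E⁽¹⁾ ⊠ id : C⁽¹⁾ ⊠ Ver_p ⥤ D⁽¹⁾ ⊠ Ver_p` induced by a linear functor `E`. -/
abbrev targetMap {D : Type u₁} [Category.{v} D] [Preadditive D] [Linear k D] (E : C ⥤ D)
    [E.Additive] [E.Linear k] : Target k p C ⥤ Target k p D :=
  (LinProd.mapLeft (Verlinde.Ver k p) (FrobeniusTwist.map p E)).mapMat_

end Target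

variable (C) in
/-- The Frobenius functor `F : C ⥤ C⁽¹⁾ ⊠ Ver_p`, `F(X) = ⊕_{i=1}^{p-1} F_i(X) ⊠ L_i`. -/
def frob [Linear k C] : C ⥤ Target k p C where
  obj X := sumObj k p fun i => (component C p i).obj X
  map f := sumMap k p fun i => (component C p i).map f
  map_id X := by
    simp only [CategoryTheory.Functor.map_id]
    exact sumMap_id k p C _
  map_comp f g := by
    simp only [Functor.map_comp]
    exact sumMap_comp k p C _ _

/-- `θ : E(F_{j+1}(X)) ⟶ F_{j+1}(E(X))` is the canonical comparison: it is induced by the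
isomorphism `E(X^{⊗ p}) ≅ E(X)^{⊗ p}` on the subquotients of both sides. -/
def IsCanonical {D : Type u₁} [Category.{v₁} D] [Abelian D] [MonoidalCategory D]
    [SymmetricCategory D] (E : C ⥤ D) [E.Monoidal] (j : ℕ) (X : C)
    (θ : E.obj ((component C p j).obj X) ⟶ (component D p j).obj (E.obj X)) : Prop :=
  ∃ κ : E.obj (kerIm (diff p X) j : C) ⟶ (kerIm (diff p (E.obj X)) j : D),
    κ ≫ (kerIm (diff p (E.obj X)) j).arrow =
      E.map (kerIm (diff p X) j).arrow ≫ (powerComparison E X p).inv ∧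
    E.map (layerπ (diff p X) j) ≫ θ = κ ≫ layerπ (diff p (E.obj X)) j

end Frobenius

end FrobeniusFunctor

end

/-! Let `V` carry an automorphism `g` such that `D = 1 - g` satisfies `D^p = 0`, and write
`B_{i+1}(V) = (Ker D ∩ Im D^i)/(Ker D ∩ Im D^{i+1})`. The work is done for the functor `B(V) = ⊕
B_i(V) ⊠ L_i` composed with an arbitrary monoidal functor `P` with a monoidal automorphism `g`. It
is then applied to the `p`-th tensor power and its cyclic permutation `c`. In a symmetric category
`c` is monoidal, and `c^p = 1` gives `D^p = 0` in characteristic `p` (`endPow_diff`).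

Tensor structure. Via `D^i`, the layer `B_{i+1}(V)` is `Ker D^{i+1}` modulo `Ker D^i + D (Ker
D^{i+2})` (`powKer_exact`). A generalized element `S ⟶ Ker D^{i+1}` is an equivariant map from `S ⊗
L_{i+1}` to `V`, and the two kinds of relations become maps that factor through Jordan blocks of
size `i` and `i + 2`, hence through negligible morphisms (`Equivar.exists_can_rel`). So every
equivariant map `f` from `S ⊗ J` to `V`, with `J` a representation of `ℤ/p`, induces a morphism
`ψ(f)` from `S ⊠ J` to `B(V)` (`Equivar.psi`). Tensor products of such maps induce `B(V) ⊗ B(W) ⟶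
B(V ⊗ W)`, characterised by sending `ψ(f) ⊗ ψ(f')` to `ψ(f ⊗ f')` (`sum_psi_tensor_muEntry`). The
canonical elements form an epimorphism, so all coherence conditions are tested on them and reduce to
those of `P`.

The tensor structure is invertible. Let `F` be the resulting lax functor and `X`, `Y` a dual pair.
Layers of dual objects are in perfect duality through `(x, y) ↦ ev (D^i x, y)`
(`exists_layer_pairing`), so the evaluation `F Y ⊗ F X ⟶ 𝟙` has a coevaluation `c`, and `c` yields a
one-sided inverse of `μ`. The defect `n = F(coev) - μ(c)`, a morphism from the unit to `F (X ⊗ Y)`,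
acts on `F (X ⊗ U)` by the complementary idempotent and on `F X` by zero. Locally `n` is given by an
invariant element of `P X ⊗ P Y`, that is, by an equivariant operator on `P X`. This operator
vanishes on the layers `B_1, …, B_{p-1}`, and after subtraction of a norm it also vanishes on `Im
D^{p-1}` (`exists_modification`). It therefore raises the filtration of `Ker D` by the `Im D^i`,
hence is nilpotent on `P X` (`after_eq_zero`) and on `P X ⊗ P U`. An idempotent that is nilpotent is
zero, so `μ` is invertible (`isIso_μ`).

Compatibility with `E`. An exact functor commutes with kernels and images, hence with layers
(`isIso_layerComparison`), and the comparison carries `ψ(f)` to `ψ` of the image of `f`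
(`Equivar.map_psi`). Since the tensor structure is determined by its values on the `ψ(f)`, the
comparison is monoidal.

Linearity. In the expansion of `(f + g)^{⊗ p}` the mixed terms are permuted by `ℤ/p` without fixed
subsets, so their sum is a norm. In characteristic `p` the norm is `(1 - Ad c)^{p-1}`, and a norm
induces zero on all layers below the top one (`cls_comp_sum_conjHom_eq_zero`). A scalar comes out
with exponent `p`, which is linearity into the twist. -/

noncomputable section

/-! ### Jordan blocks as cyclic modules, and representations of `ℤ/p`. -/

namespace Verlinde

section BlockMaps

variable {k : Type w} [Field k] {U : Type u} [AddCommGroup U] [Module k U]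

/-- The linear map out of `k[D]/D^m` determined by a vector killed by the `m`-th power of an
operator. -/
def blockMap (T : U →ₗ[k] U) (m : ℕ) (x : U) (hx : (T ^ m) x = 0) : Block k m →ₗ[k] U :=
  Submodule.liftQ ((Ideal.span {(Polynomial.X ^ m : Polynomial k)}).restrictScalars k)
    ((LinearMap.applyₗ x).comp (Polynomial.aeval T).toLinearMap) (by
      intro q hq
      obtain ⟨r, rfl⟩ := Ideal.mem_span_singleton'.1 ((Submodule.restrictScalars_mem _ _ _).1 hq)
      simp [hx])

theorem blockMap_mk (T : U →ₗ[k] U) (m : ℕ) (x : U) (hx : (T ^ m) x = 0) (q : Polynomial k) :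
    blockMap T m x hx (AdjoinRoot.mk _ q) = Polynomial.aeval T q x := rfl

theorem blockMap_one (T : U →ₗ[k] U) (m : ℕ) (x : U) (hx : (T ^ m) x = 0) :
    blockMap T m x hx 1 = x := by
  rw [← map_one (AdjoinRoot.mk _), blockMap_mk]; simp

theorem blockMap_root_mul (T : U →ₗ[k] U) (m : ℕ) (x : U) (hx : (T ^ m) x = 0) (y : Block k m) :
    blockMap T m x hx (AdjoinRoot.root _ * y) = T (blockMap T m x hx y) := by
  induction y using AdjoinRoot.induction_on with
  | ih q => rw [← AdjoinRoot.mk_X, ← map_mul, blockMap_mk, blockMap_mk]; simp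

/-- The block is a cyclic `k[D]`-module, so an intertwiner is determined by the image of its
generator. -/
theorem blockHom_mk (T : U →ₗ[k] U) {m : ℕ} (f : Block k m →ₗ[k] U)
    (hf : ∀ y, f (AdjoinRoot.root _ * y) = T (f y)) (q : Polynomial k) :
    f (AdjoinRoot.mk _ q) = Polynomial.aeval T q (f 1) := by
  induction q using Polynomial.induction_on' with
  | add a b ha hb => simp [ha, hb]
  | monomial n c =>
    induction n generalizing c with
    | zero =>
      rw [Polynomial.monomial_zero_left, Polynomial.aeval_C]
      have : AdjoinRoot.mk (Polynomial.X ^ m) (Polynomial.C c) = c • (1 : Block k m) := by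
        rw [Algebra.smul_def, mul_one]; rfl
      rw [this, map_smul]; rfl
    | succ n ih =>
      have : (Polynomial.monomial (n + 1) c : Polynomial k) =
          Polynomial.X * Polynomial.monomial n c := by
        rw [Polynomial.X_mul_monomial]
      rw [this, map_mul, AdjoinRoot.mk_X, hf, ih, map_mul, Polynomial.aeval_X]; rfl

theorem blockHom_ext (T : U →ₗ[k] U) {m : ℕ} (f g : Block k m →ₗ[k] U)
    (hf : ∀ y, f (AdjoinRoot.root _ * y) = T (f y))
    (hg : ∀ y, g (AdjoinRoot.root _ * y) = T (g y)) (h : f 1 = g 1) : f = g := by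
  ext y
  induction y using AdjoinRoot.induction_on with
  | ih q => rw [blockHom_mk T f hf, blockHom_mk T g hg, h]

theorem root_pow_eq_zero (m : ℕ) :
    AdjoinRoot.root (Polynomial.X ^ m : Polynomial k) ^ m = 0 := by
  have := AdjoinRoot.mk_self (f := (Polynomial.X ^ m : Polynomial k))
  rwa [map_pow, AdjoinRoot.mk_X] at this

theorem blockHom_pow_one (T : U →ₗ[k] U) {m : ℕ} (f : Block k m →ₗ[k] U)
    (hf : ∀ y, f (AdjoinRoot.root _ * y) = T (f y)) (n : ℕ) :
    f (AdjoinRoot.root _ ^ n) = (T ^ n) (f 1) := by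
  have := blockHom_mk T f hf (Polynomial.X ^ n)
  rwa [(AdjoinRoot.mk _).map_pow, AdjoinRoot.mk_X, map_pow (Polynomial.aeval T),
    Polynomial.aeval_X] at this

theorem finrank_block (m : ℕ) : Module.finrank k (Block k m) = m := by
  rw [(AdjoinRoot.powerBasis' (Polynomial.monic_X_pow m)).finrank]
  simp [AdjoinRoot.powerBasis']

/-- The trace of a multiplication operator on `k[D]/D^m` is `m` times the constant term. -/
theorem trace_mulLeft (m : ℕ) (q : Polynomial k) :
    LinearMap.trace k (Block k m) (LinearMap.mulLeft k (AdjoinRoot.mk _ q : Block k m)) =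
      m * q.coeff 0 := by
  -- The constant term acts as a scalar and accounts for the trace; the rest is a multiple of `D`,
  -- hence nilpotent and traceless.
  have hq : q = Polynomial.C (q.coeff 0) + Polynomial.X * q.divX := by
    rw [add_comm]; exact (Polynomial.X_mul_divX_add q).symm
  have h1 : LinearMap.mulLeft k (AdjoinRoot.mk (Polynomial.X ^ m) q : Block k m) =
      q.coeff 0 • LinearMap.id + LinearMap.mulLeft k
        (AdjoinRoot.mk (Polynomial.X ^ m) (Polynomial.X * q.divX) : Block k m) := by
    conv_lhs => rw [hq]
    ext y
    rw [map_add]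
    simp only [LinearMap.mulLeft_apply, LinearMap.add_apply, LinearMap.smul_apply,
      LinearMap.id_apply, add_mul]
    rw [Algebra.smul_def]; rfl
  have h2 : IsNilpotent (LinearMap.mulLeft k
      (AdjoinRoot.mk (Polynomial.X ^ m) (Polynomial.X * q.divX) : Block k m)) := by
    refine ⟨m, ?_⟩
    rw [LinearMap.pow_mulLeft, ← map_pow, mul_pow, map_mul, AdjoinRoot.mk_self, zero_mul]
    ext; simp
  rw [h1, map_add, map_smul, (LinearMap.isNilpotent_trace_of_isNilpotent h2).eq_zero,
    LinearMap.trace_id, finrank_block]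
  simp [mul_comm]

theorem blockEnd_eq_mulLeft {m : ℕ} (f : Block k m →ₗ[k] Block k m)
    (hf : ∀ y, f (AdjoinRoot.root _ * y) = AdjoinRoot.root _ * f y) :
    f = LinearMap.mulLeft k (f 1) := by
  refine blockHom_ext (LinearMap.mulLeft k (AdjoinRoot.root _ : Block k m)) _ _ hf (fun y => ?_) (by simp)
  simp only [LinearMap.mulLeft_apply]; ring

end BlockMaps

section Rep

variable (k : Type w) [Field k] (p : ℕ) [Fact p.Prime]

/-- The chosen generator of `ℤ/p`. -/
abbrev gen : Multiplicative (ZMod p) := Multiplicative.ofAdd 1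

variable {k p}

/-- The action of the generator of `ℤ/p`. -/
def act (J : FDRep k (Multiplicative (ZMod p))) : (J : Type w) →ₗ[k] J := J.ρ (gen p)

/-- The operator `D = 1 - g` on a representation of `ℤ/p`. -/
def dop (J : FDRep k (Multiplicative (ZMod p))) : (J : Type w) →ₗ[k] J := 1 - act J

theorem act_apply (J : FDRep k (Multiplicative (ZMod p))) (x : J) : act J x = x - dop J x := by
  simp [dop]

theorem ρ_eq_act_pow (J : FDRep k (Multiplicative (ZMod p))) (a : Multiplicative (ZMod p)) :
    J.ρ a = act J ^ (Multiplicative.toAdd a).val := by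
  rw [act, ← map_pow]
  congr 1
  rw [← ofAdd_nsmul, nsmul_one, ZMod.natCast_zmod_val]
  rfl

/-- A linear map commuting with the generator is a morphism of representations. -/
def homOfComm {J J' : FDRep k (Multiplicative (ZMod p))} (f : (J : Type w) →ₗ[k] J')
    (h : ∀ x, f (act J x) = act J' (f x)) : J ⟶ J' where
  hom := FGModuleCat.ofHom f
  comm a := by
    have h1 : f ∘ₗ J.ρ a = J'.ρ a ∘ₗ f := by
      have h2 : ∀ n : ℕ, ∀ x, f ((act J ^ n) x) = (act J' ^ n) (f x) := by
        intro n
        induction n with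
        | zero => intro x; rfl
        | succ n ih => intro x; rw [pow_succ', pow_succ', Module.End.mul_apply, h, ih]; rfl
      rw [ρ_eq_act_pow, ρ_eq_act_pow]
      ext x
      exact h2 _ x
    ext1
    exact h1

theorem toLin_act {J J' : FDRep k (Multiplicative (ZMod p))} (f : J ⟶ J') (x : J) :
    toLin f (act J x) = act J' (toLin f x) :=
  LinearMap.congr_fun (toLin_comm f (gen p)) x

theorem toLin_dop {J J' : FDRep k (Multiplicative (ZMod p))} (f : J ⟶ J') (x : J) :
    toLin f (dop J x) = dop J' (toLin f x) := by
  have := toLin_act f x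
  rw [act_apply, act_apply, map_sub, sub_right_inj] at this
  exact this

theorem toLin_injective {J J' : FDRep k (Multiplicative (ZMod p))} {f g : J ⟶ J'}
    (h : toLin f = toLin g) : f = g := by
  ext1
  ext1
  exact h

theorem toLin_comp {J J' J'' : FDRep k (Multiplicative (ZMod p))} (f : J ⟶ J') (g : J' ⟶ J'') :
    toLin (f ≫ g) = toLin g ∘ₗ toLin f := rfl

theorem proj_eq_iff {J J' : FDRep k (Multiplicative (ZMod p))} (f g : J ⟶ J') :
    proj f = proj g ↔ IsNegligible (f - g) :=
  Quotient.functor_map_eq_iff (negligibleRel k (Multiplicative (ZMod p))) f g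

theorem proj_eq_zero_iff {J J' : FDRep k (Multiplicative (ZMod p))} (f : J ⟶ J') :
    proj f = 0 ↔ IsNegligible f := by
  have := proj_eq_iff f 0
  rwa [sub_zero] at this

variable [CharP k p]

variable (k p) in
/-- The Jordan block of size `n ≤ p` as a representation of `ℤ/p`. -/
abbrev blk (n : ℕ) (hn : n ≤ p) : FDRep k (Multiplicative (ZMod p)) :=
  FDRep.of (blockRep k p n hn)

theorem act_blk (n : ℕ) (hn : n ≤ p) (x : Block k n) :
    act (blk k p n hn) x = (1 - AdjoinRoot.root _) * x := by
  have h : (Multiplicative.toAdd (gen p)).val = 1 :=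
    haveI : Fact (1 < p) := ⟨(Fact.out : p.Prime).one_lt⟩
    ZMod.val_one p
  change (unipotent k n ^ (Multiplicative.toAdd (gen p)).val) x = _
  rw [h, pow_one]; rfl

theorem dop_blk (n : ℕ) (hn : n ≤ p) (x : Block k n) :
    dop (blk k p n hn) x = AdjoinRoot.root _ * x := by
  have := act_apply (blk k p n hn) x
  rw [act_blk] at this
  linear_combination this

theorem dop_blk_pow (n : ℕ) (hn : n ≤ p) (m : ℕ) (x : Block k n) :
    (dop (blk k p n hn) ^ m) x = (AdjoinRoot.root _ ^ m * x : Block k n) := by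
  induction m with
  | zero => simp
  | succ m ih =>
    rw [pow_succ', Module.End.mul_apply, ih]
    exact (dop_blk n hn _).trans (by rw [pow_succ']; ring)

/-- The morphism from a Jordan block of size `m` given by a vector killed by `D^m`. -/
def ofVec {J : FDRep k (Multiplicative (ZMod p))} (m : ℕ) (hm : m ≤ p) (x : J)
    (hx : (dop J ^ m) x = 0) : blk k p m hm ⟶ J :=
  homOfComm (blockMap (dop J) m x hx) fun y => by
    have h := blockMap_root_mul (dop J) m x hx y
    have h2 := act_blk (k := k) m hm y
    refine (congrArg (blockMap (dop J) m x hx) h2).trans ?_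
    rw [sub_mul, one_mul, map_sub, h, act_apply]

theorem ofVec_one {J : FDRep k (Multiplicative (ZMod p))} (m : ℕ) (hm : m ≤ p) (x : J)
    (hx : (dop J ^ m) x = 0) : toLin (ofVec m hm x hx) (1 : Block k m) = x :=
  blockMap_one _ _ _ hx

theorem toLin_root_mul {J : FDRep k (Multiplicative (ZMod p))} {m : ℕ} {hm : m ≤ p}
    (f : blk k p m hm ⟶ J) (y : Block k m) :
    toLin f (AdjoinRoot.root _ * y : Block k m) = dop J (toLin f y) := by
  rw [← toLin_dop]; exact congrArg (toLin f) (dop_blk m hm y).symm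

theorem blkHom_ext {J : FDRep k (Multiplicative (ZMod p))} {m : ℕ} {hm : m ≤ p}
    (f g : blk k p m hm ⟶ J) (h : toLin f (1 : Block k m) = toLin g (1 : Block k m)) : f = g :=
  toLin_injective (blockHom_ext (dop J) _ _ (toLin_root_mul f) (toLin_root_mul g) h)

theorem dop_pow_toLin_one {J : FDRep k (Multiplicative (ZMod p))} {m : ℕ} {hm : m ≤ p}
    (f : blk k p m hm ⟶ J) : (dop J ^ m) (toLin f (1 : Block k m)) = 0 := by
  have := blockHom_pow_one (dop J) (toLin f) (toLin_root_mul f) m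
  rw [root_pow_eq_zero, map_zero] at this
  exact this.symm

end Rep

end Verlinde

end

noncomputable section

/-! ### Negligible maps between Jordan blocks, and semisimplicity of `Ver_p`. -/

namespace Verlinde

section Blocks

variable {k : Type w} [Field k] {p : ℕ} [Fact p.Prime] [CharP k p]

theorem trace_blkEnd {m : ℕ} {hm : m ≤ p} (f : blk k p m hm ⟶ blk k p m hm)
    (q : Polynomial k) (hq : toLin f (1 : Block k m) = (AdjoinRoot.mk _ q : Block k m)) :
    LinearMap.trace k (Block k m) (toLin f) = m * q.coeff 0 := by
  have h : (toLin f : Block k m →ₗ[k] Block k m) = LinearMap.mulLeft k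
      (AdjoinRoot.mk _ q : Block k m) := by
    rw [← hq]
    exact blockEnd_eq_mulLeft _ fun y => (toLin_root_mul f y).trans (dop_blk m hm _)
  rw [← trace_mulLeft m q, ← h]

theorem exists_poly {m : ℕ} (y : Block k m) :
    ∃ q : Polynomial k, (AdjoinRoot.mk _ q : Block k m) = y :=
  AdjoinRoot.mk_surjective y

theorem toLin_mk {m n : ℕ} {hm : m ≤ p} {hn : n ≤ p} (f : blk k p m hm ⟶ blk k p n hn)
    (q : Polynomial k) : toLin f (AdjoinRoot.mk _ q : Block k m) =
      ((AdjoinRoot.mk _ q : Block k n) * toLin f (1 : Block k m) : Block k n) := by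
  have h := blockHom_mk (LinearMap.mulLeft k (AdjoinRoot.root _ : Block k n)) (toLin f)
    (fun y => (toLin_root_mul f y).trans (dop_blk n hn _)) q
  refine h.trans ?_
  have : (LinearMap.mulLeft k (AdjoinRoot.root (Polynomial.X ^ n : Polynomial k) : Block k n)) =
      Algebra.lmul k (Block k n) (AdjoinRoot.root _) := rfl
  rw [this, Polynomial.aeval_algHom_apply]
  have h2 : Polynomial.aeval (AdjoinRoot.root (Polynomial.X ^ n : Polynomial k)) q =
    AdjoinRoot.mk _ q := AdjoinRoot.aeval_eq q
  rw [h2]; rfl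

/-- The image of the generator is killed by `D^a`, which in a longer block forces its constant term
to vanish. Any endomorphism of the source through this map is then multiplication by a multiple of
`D`, with trace zero. -/
theorem isNegligible_of_lt {a b : ℕ} {ha : a ≤ p} {hb : b ≤ p} (hab : a < b)
    (f : blk k p a ha ⟶ blk k p b hb) : IsNegligible f := by
  intro g
  obtain ⟨q, hq⟩ := exists_poly (toLin f (1 : Block k a))
  obtain ⟨r, hr⟩ := exists_poly (toLin g (1 : Block k b))
  have h0 : q.coeff 0 = 0 := by
    have h1 := toLin_mk f (Polynomial.X ^ a)
    rw [AdjoinRoot.mk_self, map_zero, ← hq, ← map_mul] at h1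
    have h2 := AdjoinRoot.mk_eq_zero.1 h1.symm
    have h3 := (Polynomial.X_pow_dvd_iff.1 h2) a hab
    rwa [Polynomial.coeff_X_pow_mul', if_pos le_rfl, Nat.sub_self] at h3
  have h1 : toLin (f ≫ g) (1 : Block k a) = (AdjoinRoot.mk _ (q * r) : Block k a) := by
    rw [toLin_comp]
    refine (congrArg (toLin g) hq.symm).trans ?_
    rw [toLin_mk, ← hr, map_mul]
  refine (trace_blkEnd _ _ h1).trans ?_
  rw [Polynomial.mul_coeff_zero, h0, zero_mul, mul_zero]

theorem IsNegligible.of_comp_trace {J J' : FDRep k (Multiplicative (ZMod p))} {f : J ⟶ J'}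
    (h : ∀ g : J' ⟶ J, LinearMap.trace k J' (toLin (g ≫ f)) = 0) : IsNegligible f := fun g => by
  rw [trace_comm]; exact h g

theorem isNegligible_of_ne {a b : ℕ} {ha : a ≤ p} {hb : b ≤ p} (hab : a ≠ b)
    (f : blk k p a ha ⟶ blk k p b hb) : IsNegligible f := by
  rcases lt_or_gt_of_ne hab with h | h
  · exact isNegligible_of_lt h f
  · exact IsNegligible.of_comp_trace fun g => isNegligible_of_lt h g f

/-- The trace of an endomorphism of a block is a multiple of its size, which here is `p = 0`. -/
theorem isNegligible_blk_top (f : blk k p p le_rfl ⟶ blk k p p le_rfl) : IsNegligible f := by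
  intro g
  obtain ⟨q, hq⟩ := exists_poly (toLin (f ≫ g) (1 : Block k p))
  refine (trace_blkEnd _ _ hq.symm).trans ?_
  rw [CharP.cast_eq_zero, zero_mul]

/-- Multiplication by an element of `k[D]/D^m` as a morphism of representations. -/
def mulHom (m : ℕ) (hm : m ≤ p) (y : Block k m) : blk k p m hm ⟶ blk k p m hm :=
  homOfComm (LinearMap.mulLeft k y) fun x => by
    have h1 := act_blk (k := k) m hm x
    have h2 := act_blk (k := k) m hm (LinearMap.mulLeft k y x)
    refine (congrArg (LinearMap.mulLeft k y) h1).trans (Eq.trans ?_ h2.symm)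
    simp only [LinearMap.mulLeft_apply]; ring

theorem mulHom_one (m : ℕ) (hm : m ≤ p) (y : Block k m) :
    toLin (mulHom m hm y) (1 : Block k m) = y := mul_one y

theorem eq_mulHom {m : ℕ} {hm : m ≤ p} (f : blk k p m hm ⟶ blk k p m hm) :
    f = mulHom m hm (toLin f (1 : Block k m)) :=
  blkHom_ext _ _ (mulHom_one m hm _).symm

theorem mulHom_comp (m : ℕ) (hm : m ≤ p) (y z : Block k m) :
    mulHom m hm y ≫ mulHom m hm z = mulHom m hm (y * z) :=
  blkHom_ext _ _ ((congrArg (toLin (mulHom m hm z)) (mulHom_one m hm y)).trans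
    ((mul_comm z y).trans (mulHom_one m hm _).symm))

theorem mulHom_id (m : ℕ) (hm : m ≤ p) : mulHom (k := k) m hm 1 = 𝟙 _ :=
  blkHom_ext _ _ (mulHom_one m hm _)

theorem isNegligible_mulHom {m : ℕ} {hm : m ≤ p} (q : Polynomial k) (hq : q.coeff 0 = 0) :
    IsNegligible (mulHom m hm (AdjoinRoot.mk _ q)) := by
  intro g
  obtain ⟨r, hr⟩ := exists_poly (toLin g (1 : Block k m))
  rw [eq_mulHom g, ← hr, mulHom_comp, ← map_mul]
  refine (trace_blkEnd _ _ (mulHom_one m hm _)).trans ?_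
  rw [Polynomial.mul_coeff_zero, hq, zero_mul, mul_zero]

/-- An endomorphism is multiplication by a polynomial in `D`; subtracting the constant term leaves a
multiple of `D`, which is negligible. -/
theorem blkEnd_scalar {m : ℕ} {hm : m ≤ p} (f : blk k p m hm ⟶ blk k p m hm) :
    ∃ c : k, proj f = c • 𝟙 _ := by
  obtain ⟨q, hq⟩ := exists_poly (toLin f (1 : Block k m))
  refine ⟨q.coeff 0, ?_⟩
  rw [← proj_id, ← proj_smul, proj_eq_iff]
  have : f - q.coeff 0 • 𝟙 _ = mulHom m hm (AdjoinRoot.mk _ (q - Polynomial.C (q.coeff 0))) := by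
    refine blkHom_ext _ _ ?_
    rw [mulHom_one, map_sub, hq]
    have : AdjoinRoot.mk (Polynomial.X ^ m) (Polynomial.C (q.coeff 0)) =
        q.coeff 0 • (1 : Block k m) := by
      rw [Algebra.smul_def, mul_one]; rfl
    rw [this]; rfl
  rw [this]
  exact isNegligible_mulHom _ (by simp)

theorem not_isNegligible_id {m : ℕ} {hm : m ≤ p} (h0 : 0 < m) (h : m < p) :
    ¬ IsNegligible (𝟙 (blk k p m hm)) := by
  intro hn
  have h1 := hn (𝟙 _)
  rw [Category.id_comp] at h1
  have h2 := trace_blkEnd (𝟙 (blk k p m hm)) 1 (map_one (AdjoinRoot.mk _)).symm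
  rw [Polynomial.coeff_one_zero, mul_one] at h2
  have h3 : (m : k) = 0 := h2.symm.trans h1
  rw [CharP.cast_eq_zero_iff k p] at h3
  exact absurd (Nat.le_of_dvd h0 h3) (not_le.2 h)

theorem isUnit_of_coeff {m : ℕ} (q : Polynomial k) (hq : q.coeff 0 ≠ 0) :
    IsUnit (AdjoinRoot.mk _ q : Block k m) := by
  have h : q = Polynomial.C (q.coeff 0) + Polynomial.X * q.divX := by
    rw [add_comm]; exact (Polynomial.X_mul_divX_add q).symm
  rw [h, map_add]
  refine IsNilpotent.isUnit_add_left_of_commute ?_ ?_ (Commute.all _ _)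
  · refine ⟨m, ?_⟩
    rw [← map_pow, mul_pow, map_mul, AdjoinRoot.mk_self, zero_mul]
  · exact (Polynomial.isUnit_C.2 (isUnit_iff_ne_zero.2 hq)).map _


/-- The projection onto a Jordan block determined by a functional killing the image of `D^{j+1}`. -/
def splitMap {J : FDRep k (Multiplicative (ZMod p))} (j : ℕ) (hj : j + 1 ≤ p)
    (l : (J : Type w) →ₗ[k] k) (hl : ∀ x, l ((dop J ^ (j + 1)) x) = 0) :
    J ⟶ blk k p (j + 1) hj :=
  homOfComm (J' := blk k p (j + 1) hj)
    (∑ s ∈ Finset.range (j + 1), (l ∘ₗ (dop J ^ (j - s))).smulRight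
      (AdjoinRoot.root _ ^ s : Block k (j + 1))) fun x => by
    have h0 : ∀ x : J, (∑ s ∈ Finset.range (j + 1), (l ∘ₗ (dop J ^ (j - s))).smulRight
      (AdjoinRoot.root _ ^ s : Block k (j + 1))) (dop J x) = (AdjoinRoot.root _ *
        (∑ s ∈ Finset.range (j + 1), (l ∘ₗ (dop J ^ (j - s))).smulRight
      (AdjoinRoot.root _ ^ s : Block k (j + 1))) x : Block k (j + 1)) := by
      intro x
      simp only [LinearMap.sum_apply, LinearMap.smulRight_apply, LinearMap.comp_apply,
        Finset.mul_sum, mul_smul_comm]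
      -- Both sums agree after a shift of the index. The two boundary terms vanish, one because `l`
      -- kills `Im D^{j+1}`, the other because `root^(j+1) = 0`.
      rw [Finset.sum_range_succ', Finset.sum_range_succ _ j]
      have h1 : l ((dop J ^ (j - 0)) (dop J x)) = 0 := by
        rw [← Module.End.mul_apply, ← pow_succ]; exact hl x
      have h2 : (AdjoinRoot.root _ * AdjoinRoot.root _ ^ j : Block k (j + 1)) = 0 := by
        rw [← pow_succ']; exact root_pow_eq_zero (j + 1)
      rw [h1, h2, zero_smul, smul_zero]
      congr 1
      refine Finset.sum_congr rfl fun s hs => ?_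
      rw [Finset.mem_range] at hs
      rw [← pow_succ', ← Module.End.mul_apply, ← pow_succ]
      congr 4
      omega
    have h1 := act_blk (k := k) (j + 1) hj ((∑ s ∈ Finset.range (j + 1),
      (l ∘ₗ (dop J ^ (j - s))).smulRight (AdjoinRoot.root _ ^ s : Block k (j + 1))) x)
    refine Eq.trans ?_ h1.symm
    rw [act_apply, map_sub, h0, sub_mul, one_mul]

theorem toLin_splitMap {J : FDRep k (Multiplicative (ZMod p))} (j : ℕ) (hj : j + 1 ≤ p)
    (l : (J : Type w) →ₗ[k] k) (hl : ∀ x, l ((dop J ^ (j + 1)) x) = 0) (x : J) :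
    toLin (splitMap j hj l hl) x =
      (∑ s ∈ Finset.range (j + 1), l ((dop J ^ (j - s)) x) • AdjoinRoot.root _ ^ s :
        Block k (j + 1)) := by
  change (∑ s ∈ Finset.range (j + 1), (l ∘ₗ (dop J ^ (j - s))).smulRight
      (AdjoinRoot.root _ ^ s : Block k (j + 1))) x = _
  simp [LinearMap.sum_apply]

/-- Only the constant term matters later: it decides the trace, and whether a composite endomorphism
of the block is invertible. -/
theorem splitMap_poly {J : FDRep k (Multiplicative (ZMod p))} (j : ℕ) (hj : j + 1 ≤ p)
    (l : (J : Type w) →ₗ[k] k) (hl : ∀ x, l ((dop J ^ (j + 1)) x) = 0) (x : J) :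
    ∃ q : Polynomial k, q.coeff 0 = l ((dop J ^ j) x) ∧
      toLin (splitMap j hj l hl) x = (AdjoinRoot.mk _ q : Block k (j + 1)) := by
  refine ⟨∑ s ∈ Finset.range (j + 1), l ((dop J ^ (j - s)) x) • Polynomial.X ^ s, ?_, ?_⟩
  · rw [Polynomial.finsetSum_coeff, Finset.sum_eq_single 0]
    · simp
    · intro s _ hs; simp [Polynomial.coeff_X_pow, hs.symm]
    · simp
  · rw [toLin_splitMap, map_sum]
    refine Finset.sum_congr rfl fun s _ => ?_
    rw [Polynomial.smul_eq_C_mul, map_mul, map_pow, AdjoinRoot.mk_X, Algebra.smul_def]; rfl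

theorem exists_functional {V : Type u} [AddCommGroup V] [Module k V] (N : Submodule k V) (x : V)
    (hx : x ∉ N) : ∃ l : V →ₗ[k] k, l x = 1 ∧ ∀ y ∈ N, l y = 0 := by
  obtain ⟨l, h1, h2⟩ := Submodule.exists_le_ker_of_notMem hx
  refine ⟨(l x)⁻¹ • l, by simp [h1], fun y hy => ?_⟩
  have : l y = 0 := h2 hy
  simp [this]

/-- The image of the generator under a negligible map from a block of size `j + 1 < p`. -/
theorem IsNegligible.exists_decomp {J : FDRep k (Multiplicative (ZMod p))} {j : ℕ}
    {hj : j + 1 ≤ p} (hj' : j + 1 < p) {f : blk k p (j + 1) hj ⟶ J} (hf : IsNegligible f) :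
    ∃ x y : J, toLin f (1 : Block k (j + 1)) = x + dop J y ∧ (dop J ^ j) x = 0 := by
  by_contra hcon
  set b : J := toLin f (1 : Block k (j + 1)) with hb
  -- The desired decomposition exists exactly when `D^j b` lies in `Im D^{j+1}`. Otherwise a
  -- functional separates the two, and the resulting projection onto the block composes with `f` to
  -- an endomorphism of trace `j + 1`, nonzero in `k`.
  have h1 : (dop J ^ j) b ∉ LinearMap.range (dop J ^ (j + 1)) := by
    rintro ⟨y, hy⟩
    refine hcon ⟨b - dop J y, y, by abel, ?_⟩
    rw [map_sub, ← hy, pow_succ, Module.End.mul_apply, sub_self]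
  obtain ⟨l, h2, h3⟩ := exists_functional _ _ h1
  have h4 : ∀ x, l ((dop J ^ (j + 1)) x) = 0 := fun x => h3 _ ⟨x, rfl⟩
  obtain ⟨q, h5, h6⟩ := splitMap_poly j hj l h4 b
  have h7 := trace_blkEnd (f ≫ splitMap j hj l h4) q h6
  rw [h5, h2, mul_one] at h7
  have h8 : ((j + 1 : ℕ) : k) = 0 := h7.symm.trans (hf _)
  rw [CharP.cast_eq_zero_iff k p] at h8
  exact absurd (Nat.le_of_dvd (Nat.succ_pos j) h8) (not_le.2 hj')

/-- In characteristic `p` one has `(1 - g)^p = 1 - g^p`; the zero representation is treated apart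
because its endomorphism ring is trivial. -/
theorem dop_pow_char (J : FDRep k (Multiplicative (ZMod p))) : dop J ^ p = 0 := by
  have h1 : act J ^ p = 1 := by
    rw [act, ← map_pow]
    have : (gen p) ^ p = 1 := by
      rw [← ofAdd_nsmul]; simp
    rw [this, map_one]
  have : Nontrivial (Module.End k (J : Type w)) ∨ Subsingleton (Module.End k (J : Type w)) :=
    (subsingleton_or_nontrivial _).symm
  rcases this with h | h
  · have : CharP (Module.End k (J : Type w)) p := charP_of_injective_algebraMap
      (algebraMap k (Module.End k (J : Type w))).injective p
    rw [dop, sub_pow_expChar_of_commute p (Commute.one_left _), one_pow, h1, sub_self]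
  · exact Subsingleton.elim _ _

/-- A vector of maximal nilpotency order in the image of `e` generates a Jordan block, and this
block is a direct summand: a functional nonzero on its socle gives a map back, and the composite on
the block has nonzero constant term, so it is a unit. -/
theorem exists_split {J : FDRep k (Multiplicative (ZMod p))} (e : J ⟶ J) (he : e ≫ e = e)
    (h0 : e ≠ 0) : ∃ (n : ℕ) (hn : n + 1 ≤ p) (γ : J ⟶ blk k p (n + 1) hn)
      (β : blk k p (n + 1) hn ⟶ J), (e - γ ≫ β) ≫ (e - γ ≫ β) = e - γ ≫ β ∧
        Module.finrank k (LinearMap.range (toLin (e - γ ≫ β))) <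
          Module.finrank k (LinearMap.range (toLin e)) := by
  classical
  have hee : ∀ x, toLin e (toLin e x) = toLin e x := fun x =>
    congrArg (fun t => toLin t x) he
  have hD : ∀ (n : ℕ) x, toLin e ((dop J ^ n) x) = (dop J ^ n) (toLin e x) := by
    intro n
    induction n with
    | zero => intro x; rfl
    | succ n ih => intro x; rw [pow_succ, Module.End.mul_apply, ih, toLin_dop]; rfl
  have hex : ∃ n, ∀ x, (dop J ^ n) (toLin e x) = 0 := ⟨p, fun x => by rw [dop_pow_char]; rfl⟩
  obtain ⟨n, hn⟩ : ∃ n, Nat.find hex = n + 1 := by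
    refine Nat.exists_eq_succ_of_ne_zero fun h => h0 ?_
    have := Nat.find_spec hex
    rw [h] at this
    exact toLin_injective (LinearMap.ext this)
  have hz := Nat.find_spec hex
  rw [hn] at hz
  have hnp : n + 1 ≤ p := hn ▸ Nat.find_min' hex fun x => by rw [dop_pow_char]; rfl
  have hmin := Nat.find_min hex (m := n) (by omega)
  push Not at hmin
  obtain ⟨a, ha⟩ := hmin
  set b : J := toLin e a with hb
  obtain ⟨l, hl1, -⟩ := exists_functional (⊥ : Submodule k J) _ (by simpa using ha)
  -- The functional is precomposed with `e`, so that it kills `Im D^{n+1}` on all of `J` and the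
  -- projection built from it factors through `e`.
  have hl : ∀ x, (l ∘ₗ toLin e) ((dop J ^ (n + 1)) x) = 0 := fun x => by
    rw [LinearMap.comp_apply, hD, hz, map_zero]
  let γ := splitMap n hnp (l ∘ₗ toLin e) hl
  let β := ofVec (n + 1) hnp b (hz a)
  have hβ1 : toLin β (1 : Block k (n + 1)) = b := ofVec_one _ _ _ _
  obtain ⟨q, hq0, hq⟩ := splitMap_poly n hnp (l ∘ₗ toLin e) hl b
  have heb : toLin e b = b := hee a
  have hq0' : q.coeff 0 ≠ 0 := by
    rw [hq0, LinearMap.comp_apply, hD, heb, hl1]; exact one_ne_zero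
  obtain ⟨u, hu⟩ := isUnit_of_coeff (m := n + 1) q hq0'
  have hβγ : β ≫ γ = mulHom (n + 1) hnp (u : Block k (n + 1)) := by
    refine blkHom_ext _ _ ?_
    rw [toLin_comp, mulHom_one, hu, LinearMap.comp_apply, hβ1]
    exact hq
  have heγ : e ≫ γ = γ := by
    refine toLin_injective (LinearMap.ext fun x => ?_)
    rw [toLin_comp, LinearMap.comp_apply, toLin_splitMap, toLin_splitMap]
    refine Finset.sum_congr rfl fun s _ => ?_
    rw [LinearMap.comp_apply, LinearMap.comp_apply, hD, hD, hee]
  have hβe : β ≫ e = β := by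
    refine blkHom_ext _ _ ?_
    rw [toLin_comp, LinearMap.comp_apply, hβ1, heb]
  -- Multiplication by the inverse unit turns the pair `β`, `γ` into a section and a retraction.
  let θ := mulHom (n + 1) hnp (↑u⁻¹ : Block k (n + 1))
  have hid : (β ≫ γ) ≫ θ = 𝟙 _ := by
    rw [hβγ, mulHom_comp, Units.mul_inv, mulHom_id]
  have h1 : e ≫ ((γ ≫ θ) ≫ β) = (γ ≫ θ) ≫ β := by
    rw [← Category.assoc, ← Category.assoc, heγ]
  have h2 : ((γ ≫ θ) ≫ β) ≫ e = (γ ≫ θ) ≫ β := by rw [Category.assoc, hβe]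
  have h3' : β ≫ (γ ≫ θ) ≫ β = β := by
    rw [← Category.assoc, ← Category.assoc, hid, Category.id_comp]
  have h3 : ((γ ≫ θ) ≫ β) ≫ ((γ ≫ θ) ≫ β) = (γ ≫ θ) ≫ β := by
    rw [Category.assoc, h3']
  have h4 : (e - (γ ≫ θ) ≫ β) ≫ (e - (γ ≫ θ) ≫ β) = e - (γ ≫ θ) ≫ β := by
    rw [Preadditive.sub_comp, Preadditive.comp_sub, Preadditive.comp_sub, he, h1, h2, h3, sub_self,
      sub_zero]
  refine ⟨n, hnp, γ ≫ θ, β, h4, ?_⟩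
  refine Submodule.finrank_lt_finrank_of_lt ?_
  rw [SetLike.lt_iff_le_and_exists]
  refine ⟨?_, b, ⟨a, rfl⟩, ?_⟩
  · rintro _ ⟨x, rfl⟩
    refine ⟨toLin (e - (γ ≫ θ) ≫ β) x, ?_⟩
    have : (e - (γ ≫ θ) ≫ β) ≫ e = e - (γ ≫ θ) ≫ β := by rw [Preadditive.sub_comp, he, h2]
    exact congrArg (fun t => toLin t x) this
  · rintro ⟨x, hx⟩
    have h5 : toLin (e - (γ ≫ θ) ≫ β) b = b := by
      rw [← hx]; exact congrArg (fun t => toLin t x) h4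
    have h6 : toLin ((γ ≫ θ) ≫ β) b = b := by
      have := congrArg (fun t => toLin t (1 : Block k (n + 1))) h3'
      simp only [toLin_comp, LinearMap.comp_apply, hβ1] at this ⊢
      exact this
    have h7 : toLin (e - (γ ≫ θ) ≫ β) b = toLin e b - toLin ((γ ≫ θ) ≫ β) b := rfl
    rw [h7, heb, h6, sub_self] at h5
    rw [← h5, map_zero] at ha
    exact ha rfl

/-- Blocks are split off one at a time, with induction on the rank. Blocks of size `p` are
negligible and disappear in the quotient, so only sizes below `p` are recorded. -/
theorem exists_list_of_idempotent {J : FDRep k (Multiplicative (ZMod p))} (N : ℕ) :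
    ∀ e : J ⟶ J, e ≫ e = e → Module.finrank k (LinearMap.range (toLin e)) ≤ N →
      ∃ l : List (Σ i : Fin (p - 1), (J ⟶ (L k p i).as) × ((L k p i).as ⟶ J)),
        proj e = (l.map fun a => proj a.2.1 ≫ proj a.2.2).sum := by
  induction N with
  | zero =>
    intro e _ hr
    refine ⟨[], ?_⟩
    have : LinearMap.range (toLin e) = ⊥ := Submodule.finrank_eq_zero.1 (Nat.le_zero.1 hr)
    have h2 : e = 0 := toLin_injective (LinearMap.range_eq_bot.1 this)
    rw [h2]; rfl
  | succ N ih =>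
    intro e he hr
    by_cases h0 : e = 0
    · exact ⟨[], by rw [h0]; rfl⟩
    obtain ⟨n, hn, γ, β, h1, h2⟩ := exists_split e he h0
    obtain ⟨l, hl⟩ := ih _ h1 (by omega)
    have h3 : proj e = proj (e - γ ≫ β) + proj γ ≫ proj β := by
      rw [← proj_comp, ← proj_add, sub_add_cancel]
    by_cases hp : n + 1 = p
    · refine ⟨l, ?_⟩
      subst hp
      have h4 : proj (γ ≫ β) = 0 := by
        rw [proj_eq_zero_iff, ← Category.id_comp β, ← Category.assoc]
        exact ((isNegligible_blk_top (𝟙 _)).precomp γ).comp β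
      rw [h3, ← proj_comp, h4, add_zero, hl]
    · refine ⟨⟨⟨n, by omega⟩, γ, β⟩ :: l, ?_⟩
      rw [h3, hl, List.map_cons, List.sum_cons, add_comm]; rfl

/-- In the Verlinde category every object is a direct sum of the simple objects `L_i`. -/
theorem exists_decomposition (J : FDRep k (Multiplicative (ZMod p))) :
    ∃ (N : ℕ) (n : Fin N → Fin (p - 1)) (γ : ∀ a, J ⟶ (L k p (n a)).as)
      (β : ∀ a, (L k p (n a)).as ⟶ J), ∑ a, proj (γ a) ≫ proj (β a) = 𝟙 (⟨J⟩ : Ver k p) := by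
  obtain ⟨l, hl⟩ := exists_list_of_idempotent _ (𝟙 J) (Category.id_comp _) le_rfl
  refine ⟨l.length, fun a => (l.get a).1, fun a => (l.get a).2.1, fun a => (l.get a).2.2, ?_⟩
  rw [← proj_id, hl]
  exact Fin.sum_univ_fun_getElem l fun a => proj a.2.1 ≫ proj a.2.2

/-- Together with `L_end_scalar` and `L_id_ne_zero` this is Schur's lemma; it allows a morphism into
some `Y ⊠ L_m` to be read off on copies of `L_m`. -/
theorem L_hom_eq_zero {i j : Fin (p - 1)} (hij : i ≠ j) (f : L k p i ⟶ L k p j) : f = 0 := by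
  obtain ⟨f, rfl⟩ := proj_surjective f
  rw [proj_eq_zero_iff]
  exact isNegligible_of_ne (by intro h; exact hij (Fin.ext (by omega))) f

theorem L_end_scalar (i : Fin (p - 1)) (f : L k p i ⟶ L k p i) : ∃ c : k, f = c • 𝟙 _ := by
  obtain ⟨f, rfl⟩ := proj_surjective f
  exact blkEnd_scalar f

theorem L_id_ne_zero (i : Fin (p - 1)) : 𝟙 (L k p i) ≠ 0 := by
  intro h
  have h2 : proj (𝟙 (L k p i).as) = 0 := h
  rw [proj_eq_zero_iff] at h2
  exact not_isNegligible_id (by omega) (by omega) h2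

end Blocks

end Verlinde

end

noncomputable section

/-! ### Generalized elements of the layers. -/

namespace FrobeniusFunctor

section LayerElements

variable {C : Type u} [Category.{v} C] [Abelian C] {V : C}

theorem endPow_comm (D : V ⟶ V) (j : ℕ) : endPow D j ≫ D = D ≫ endPow D j :=
  pow_natural D rfl j

theorem endPow_succ' (D : V ⟶ V) (j : ℕ) : endPow D (j + 1) = endPow D j ≫ D :=
  (endPow_comm D j).symm

theorem endPow_add (D : V ⟶ V) (i j : ℕ) : endPow D (i + j) = endPow D i ≫ endPow D j := by
  induction i with
  | zero => rw [Nat.zero_add]; exact (Category.id_comp _).symm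
  | succ i ih => rw [Nat.succ_add, endPow, ih, endPow, Category.assoc]

theorem comp_endPow_eq_zero {D : V ⟶ V} {S : C} {x : S ⟶ V} {i j : ℕ} (hij : i ≤ j)
    (h : x ≫ endPow D i = 0) : x ≫ endPow D j = 0 := by
  obtain ⟨l, rfl⟩ := Nat.exists_eq_add_of_le hij
  rw [endPow_add, ← Category.assoc, h, zero_comp]

theorem factors_kerIm {D : V ⟶ V} {j : ℕ} {S : C} (x : S ⟶ V)
    (h : x ≫ endPow D (j + 1) = 0) : (kerIm D j).Factors (x ≫ endPow D j) := by
  refine (Subobject.inf_factors _).2 ⟨kernelSubobject_factors _ _ ?_, ?_⟩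
  · rw [Category.assoc, endPow_comm]; exact h
  · have h1 : x ≫ endPow D j = (x ≫ factorThruImageSubobject (endPow D j)) ≫
        (imageSubobject (endPow D j)).arrow := by
      rw [Category.assoc, imageSubobject_arrow_comp]
    exact h1 ▸ Subobject.factors_comp_arrow _

/-- The class in `B_{j+1}` of (the image under `D^j` of) a generalized element killed by
`D^{j+1}`. -/
def cls (D : V ⟶ V) (j : ℕ) {S : C} (x : S ⟶ V) (h : x ≫ endPow D (j + 1) = 0) :
    S ⟶ layer D j :=
  (kerIm D j).factorThru (x ≫ endPow D j) (factors_kerIm x h) ≫ layerπ D j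

theorem comp_cls {D : V ⟶ V} {j : ℕ} {S S' : C} (s : S' ⟶ S) (x : S ⟶ V)
    (h : x ≫ endPow D (j + 1) = 0) (h' : (s ≫ x) ≫ endPow D (j + 1) = 0) :
    s ≫ cls D j x h = cls D j (s ≫ x) h' := by
  rw [cls, cls, ← Category.assoc]
  congr 1
  rw [← cancel_mono (kerIm D j).arrow]
  simp

theorem cls_congr {D : V ⟶ V} {j : ℕ} {S : C} {x y : S ⟶ V}
    (h : x ≫ endPow D (j + 1) = 0) (e : x = y) :
    cls D j x h = cls D j y (e ▸ h) := by subst e; rfl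

theorem cls_layerMap {W : C} {D : V ⟶ V} {D' : W ⟶ W} (f : V ⟶ W) (hf : D ≫ f = f ≫ D')
    {j : ℕ} {S : C} (x : S ⟶ V) (h : x ≫ endPow D (j + 1) = 0)
    (h' : (x ≫ f) ≫ endPow D' (j + 1) = 0) :
    cls D j x h ≫ layerMap f hf j = cls D' j (x ≫ f) h' := by
  rw [cls, cls, Category.assoc, layerπ_map, ← Category.assoc]
  congr 1
  rw [← cancel_mono (kerIm D' j).arrow]
  simp only [Category.assoc, kerImMap_arrow, Subobject.factorThru_arrow,
    Subobject.factorThru_arrow_assoc, pow_natural f hf]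

theorem cls_add {D : V ⟶ V} {j : ℕ} {S : C} (x y : S ⟶ V)
    (hx : x ≫ endPow D (j + 1) = 0) (hy : y ≫ endPow D (j + 1) = 0)
    (h : (x + y) ≫ endPow D (j + 1) = 0) :
    cls D j (x + y) h = cls D j x hx + cls D j y hy := by
  rw [cls, cls, cls, ← Preadditive.add_comp]
  congr 1
  rw [← cancel_mono (kerIm D j).arrow]
  simp

theorem cls_smul {k : Type w} [Field k] [Linear k C] {D : V ⟶ V} {j : ℕ} {S : C} (c : k)
    (x : S ⟶ V) (hx : x ≫ endPow D (j + 1) = 0) (h : (c • x) ≫ endPow D (j + 1) = 0) :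
    cls D j (c • x) h = c • cls D j x hx := by
  rw [cls, cls, ← Linear.smul_comp]
  congr 1
  rw [← cancel_mono (kerIm D j).arrow]
  simp

theorem cls_eq_zero_of_pow {D : V ⟶ V} {j : ℕ} {S : C} (x : S ⟶ V)
    (hx : x ≫ endPow D (j + 1) = 0) (h : x ≫ endPow D j = 0) : cls D j x hx = 0 := by
  have : (kerIm D j).factorThru (x ≫ endPow D j) (factors_kerIm x hx) = 0 := by
    rw [← cancel_mono (kerIm D j).arrow]; simp [h]
  rw [cls, this, zero_comp]

/-- A generalized element of an image lifts to the source only after an epimorphism onto the test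
object; this makes arguments with elements available in an abelian category. -/
theorem factors_kerIm_iff {D : V ⟶ V} {j : ℕ} {S : C} (x : S ⟶ V) :
    (kerIm D j).Factors x ↔ x ≫ D = 0 ∧ ∃ (S' : C) (σ : S' ⟶ S) (_ : Epi σ) (y : S' ⟶ V),
      σ ≫ x = y ≫ endPow D j := by
  rw [kerIm, Subobject.inf_factors]
  refine and_congr (kernelSubobject_factors_iff _ _) ⟨fun h => ?_, ?_⟩
  · obtain ⟨S', σ, hσ, y, hy⟩ := surjective_up_to_refinements_of_epi
      (factorThruImageSubobject (endPow D j)) ((imageSubobject (endPow D j)).factorThru x h)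
    refine ⟨S', σ, hσ, y, ?_⟩
    have := congrArg (fun t => t ≫ (imageSubobject (endPow D j)).arrow) hy
    simpa using this
  · rintro ⟨S', σ, hσ, y, hy⟩
    have h1 : σ ≫ x ≫ cokernel.π (endPow D j) = 0 := by
      rw [← Category.assoc, hy, Category.assoc, cokernel.condition, comp_zero]
    have h2 : x ≫ cokernel.π (endPow D j) = 0 := by
      rw [← cancel_epi σ, h1, comp_zero]
    have h3 := (ShortComplex.exact_cokernel (imageSubobject (endPow D j)).arrow)
    have hc : x ≫ cokernel.π (imageSubobject (endPow D j)).arrow = 0 := by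
      obtain ⟨t, ht⟩ : ∃ t, cokernel.π (imageSubobject (endPow D j)).arrow =
          cokernel.π (endPow D j) ≫ t :=
        ⟨cokernel.desc _ (cokernel.π (imageSubobject (endPow D j)).arrow) (by
          have h4 : endPow D j ≫ cokernel.π (imageSubobject (endPow D j)).arrow =
              (factorThruImageSubobject (endPow D j) ≫ (imageSubobject (endPow D j)).arrow) ≫
                cokernel.π (imageSubobject (endPow D j)).arrow := by
            rw [imageSubobject_arrow_comp]
          rw [h4, Category.assoc, cokernel.condition, comp_zero]), by simp⟩
      rw [ht, ← Category.assoc, h2, zero_comp]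
    have : Mono (ShortComplex.mk (imageSubobject (endPow D j)).arrow
      (cokernel.π (imageSubobject (endPow D j)).arrow) (by simp)).f := by dsimp; infer_instance
    have h4 := h3.lift_f x hc
    dsimp at h4
    rw [← h4]
    exact Subobject.factors_comp_arrow _

theorem cls_eq_zero_iff {D : V ⟶ V} {j : ℕ} {S : C} (x : S ⟶ V)
    (hx : x ≫ endPow D (j + 1) = 0) : cls D j x hx = 0 ↔
      ∃ (S' : C) (σ : S' ⟶ S) (_ : Epi σ) (y : S' ⟶ V),
        σ ≫ x ≫ endPow D j = y ≫ endPow D (j + 1) := by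
  rw [cls, layerπ]
  refine (CokernelCofork.IsColimit.comp_π_eq_zero_iff_up_to_refinements
    (cokernelIsCokernel (Subobject.ofLE _ _ (kerIm_le D j))) _).trans ⟨?_, ?_⟩
  · rintro ⟨S', σ, hσ, y, hy⟩
    have h1 := congrArg (fun t => t ≫ (kerIm D j).arrow) hy
    simp only [Category.assoc, Subobject.factorThru_arrow, Subobject.ofLE_arrow] at h1
    obtain ⟨-, S'', τ, hτ, z, hz⟩ := (factors_kerIm_iff (D := D) (j := j + 1)
      (y ≫ (kerIm D (j + 1)).arrow)).1 (Subobject.factors_comp_arrow _)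
    refine ⟨S'', τ ≫ σ, epi_comp _ _, z, ?_⟩
    rw [Category.assoc, h1, hz]
  · rintro ⟨S', σ, hσ, y, hy⟩
    have h1 : (kerIm D (j + 1)).Factors (σ ≫ x ≫ endPow D j) := by
      rw [hy]
      exact factors_kerIm y (by
        rw [endPow_succ', ← Category.assoc, ← hy, Category.assoc, Category.assoc, ← endPow_succ',
          hx, comp_zero])
    refine ⟨S', σ, hσ, (kerIm D (j + 1)).factorThru _ h1, ?_⟩
    rw [← cancel_mono (kerIm D j).arrow]
    simp

theorem cls_comp_eq_zero {D : V ⟶ V} {j : ℕ} {S : C} (x : S ⟶ V)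
    (h : (x ≫ D) ≫ endPow D (j + 1) = 0) : cls D j (x ≫ D) h = 0 :=
  (cls_eq_zero_iff _ _).2 ⟨S, 𝟙 S, inferInstance, x, by simp [endPow]⟩

/-- Two ways for a class to vanish exhaust all of them. -/
theorem exists_of_cls_eq_zero {D : V ⟶ V} {j : ℕ} {S : C} (x : S ⟶ V)
    (hx : x ≫ endPow D (j + 1) = 0) (h : cls D j x hx = 0) :
    ∃ (S' : C) (σ : S' ⟶ S) (_ : Epi σ) (a b : S' ⟶ V),
      σ ≫ x = a + b ≫ D ∧ a ≫ endPow D j = 0 ∧ b ≫ endPow D (j + 2) = 0 := by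
  obtain ⟨S', σ, hσ, y, hy⟩ := (cls_eq_zero_iff x hx).1 h
  -- The lift `y` of `D^j x` through `D^{j+1}` is itself the second element, and the remainder is
  -- killed by `D^j`.
  refine ⟨S', σ, hσ, σ ≫ x - y ≫ D, y, by abel, ?_, ?_⟩
  · rw [Preadditive.sub_comp, Category.assoc, hy, Category.assoc]
    exact sub_self _
  · rw [endPow_succ', ← Category.assoc, ← hy, Category.assoc, Category.assoc, ← endPow_succ', hx,
      comp_zero]

theorem exists_cls_eq {D : V ⟶ V} {j : ℕ} {S : C} (y : S ⟶ layer D j) :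
    ∃ (S' : C) (σ : S' ⟶ S) (_ : Epi σ) (x : S' ⟶ V) (hx : x ≫ endPow D (j + 1) = 0),
      σ ≫ y = cls D j x hx := by
  obtain ⟨S', σ, hσ, z, hz⟩ := surjective_up_to_refinements_of_epi (layerπ D j) y
  obtain ⟨h0, S'', τ, hτ, x, hx⟩ := (factors_kerIm_iff (D := D) (j := j)
      (z ≫ (kerIm D j).arrow)).1 (Subobject.factors_comp_arrow _)
  have hx' : x ≫ endPow D (j + 1) = 0 := by
    rw [endPow_succ', ← Category.assoc, ← hx, Category.assoc, h0, comp_zero]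
  refine ⟨S'', τ ≫ σ, epi_comp _ _, x, hx', ?_⟩
  rw [Category.assoc, hz, ← Category.assoc, cls]
  congr 1
  rw [← cancel_mono (kerIm D j).arrow]
  simp [hx]

/-- The kernel of `D^{j+1}`. -/
abbrev powKer (D : V ⟶ V) (j : ℕ) : C := kernel (endPow D (j + 1))

/-- The projection `Ker D^{j+1} ⟶ B_{j+1}`. -/
def powKerπ (D : V ⟶ V) (j : ℕ) : powKer D j ⟶ layer D j :=
  cls D j (kernel.ι _) (kernel.condition _)

theorem lift_powKerπ {D : V ⟶ V} {j : ℕ} {S : C} (x : S ⟶ V) (hx : x ≫ endPow D (j + 1) = 0) :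
    kernel.lift _ x hx ≫ powKerπ D j = cls D j x hx := by
  rw [powKerπ, comp_cls _ _ _ (by rw [kernel.lift_ι]; exact hx)]
  exact cls_congr _ (by simp)

instance (D : V ⟶ V) (j : ℕ) : Epi (powKerπ D j) := by
  rw [epi_iff_surjective_up_to_refinements]
  intro S y
  obtain ⟨S', σ, hσ, x, hx, h⟩ := exists_cls_eq y
  exact ⟨S', σ, hσ, kernel.lift _ x hx, by rw [h, lift_powKerπ]⟩

/-- The relations defining `B_{j+1}` as a quotient of `Ker D^{j+1}`: the kernel of `D^j` and the
image under `D` of the kernel of `D^{j+2}`. -/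
def powKerRel (D : V ⟶ V) (j : ℕ) :
    kernel (endPow D j) ⊞ kernel (endPow D (j + 2)) ⟶ powKer D j :=
  biprod.desc (kernel.lift _ (kernel.ι _) (comp_endPow_eq_zero (Nat.le_succ j)
    (kernel.condition _)))
    (kernel.lift _ (kernel.ι (endPow D (j + 2)) ≫ D) (by
      rw [Category.assoc]; exact kernel.condition (endPow D (j + 2))))

theorem powKerRel_π (D : V ⟶ V) (j : ℕ) : powKerRel D j ≫ powKerπ D j = 0 := by
  rw [powKerRel]
  ext
  · rw [biprod.inl_desc_assoc, lift_powKerπ, comp_zero]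
    exact cls_eq_zero_of_pow _ _ (kernel.condition _)
  · rw [biprod.inr_desc_assoc, lift_powKerπ, comp_zero]
    exact cls_comp_eq_zero _ _

/-- This presentation replaces the subquotient of `Ker D` by a quotient of `Ker D^{j+1}`, whose
generalized elements are equivariant maps out of a Jordan block of size `j + 1`. Its two relations
correspond to blocks of size `j` and `j + 2`. -/
theorem powKer_exact (D : V ⟶ V) (j : ℕ) :
    (ShortComplex.mk _ _ (powKerRel_π D j)).Exact := by
  rw [ShortComplex.exact_iff_exact_up_to_refinements]
  intro S x hx
  dsimp at x hx
  have h0 : (x ≫ kernel.ι _) ≫ endPow D (j + 1) = 0 := by simp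
  have h1 : cls D j (x ≫ kernel.ι _) h0 = 0 := by
    rw [← comp_cls x (kernel.ι _) (kernel.condition _)]; exact hx
  obtain ⟨S', σ, hσ, a, b, h2, ha, hb⟩ := exists_of_cls_eq_zero _ _ h1
  refine ⟨S', σ, hσ, biprod.lift (kernel.lift _ a ha) (kernel.lift _ b hb), ?_⟩
  dsimp
  rw [powKerRel, biprod.lift_desc, ← cancel_mono (kernel.ι _)]
  simp [h2]

end LayerElements

end FrobeniusFunctor

end

/-! ### Exactness of the tensor product in the presence of duals. -/

noncomputable section

/-- A monoidal category in which every object has a left and a right dual. -/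
class HasDuals (C : Type u) [Category.{v} C] [MonoidalCategory C] : Prop where
  left_dual (X : C) : Nonempty (HasLeftDual X)
  right_dual (X : C) : Nonempty (HasRightDual X)

namespace HasDuals

variable {C : Type u} [Category.{v} C] [MonoidalCategory C] [HasDuals C]

/-- Tensoring with an object is adjoint on both sides to tensoring with its duals. It therefore
preserves epimorphisms, monomorphisms and cokernels, which allows morphisms to descend along tensor
products of quotients. -/
theorem isLeftAdjoint_tensorLeft (X : C) : (tensorLeft X).IsLeftAdjoint := by
  obtain ⟨h⟩ := HasDuals.left_dual X
  exact (tensorLeftAdjunction (ᘁX) X).isLeftAdjoint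

theorem isRightAdjoint_tensorLeft (X : C) : (tensorLeft X).IsRightAdjoint := by
  obtain ⟨h⟩ := HasDuals.right_dual X
  exact (tensorLeftAdjunction X Xᘁ).isRightAdjoint

theorem isLeftAdjoint_tensorRight (X : C) : (tensorRight X).IsLeftAdjoint := by
  obtain ⟨h⟩ := HasDuals.right_dual X
  exact (tensorRightAdjunction X Xᘁ).isLeftAdjoint

theorem isRightAdjoint_tensorRight (X : C) : (tensorRight X).IsRightAdjoint := by
  obtain ⟨h⟩ := HasDuals.left_dual X
  exact (tensorRightAdjunction (ᘁX) X).isRightAdjoint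

instance {X Y : C} (f : X ⟶ Y) [Epi f] (Z : C) : Epi (Z ◁ f) :=
  have := isLeftAdjoint_tensorLeft Z
  inferInstanceAs (Epi ((tensorLeft Z).map f))

instance {X Y : C} (f : X ⟶ Y) [Mono f] (Z : C) : Mono (Z ◁ f) :=
  have := isRightAdjoint_tensorLeft Z
  inferInstanceAs (Mono ((tensorLeft Z).map f))

instance {X Y : C} (f : X ⟶ Y) [Epi f] (Z : C) : Epi (f ▷ Z) :=
  have := isLeftAdjoint_tensorRight Z
  inferInstanceAs (Epi ((tensorRight Z).map f))

instance {X Y : C} (f : X ⟶ Y) [Mono f] (Z : C) : Mono (f ▷ Z) :=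
  have := isRightAdjoint_tensorRight Z
  inferInstanceAs (Mono ((tensorRight Z).map f))

instance {X Y X' Y' : C} (f : X ⟶ Y) (g : X' ⟶ Y') [Epi f] [Epi g] : Epi (f ⊗ₘ g) := by
  rw [MonoidalCategory.tensorHom_def]; infer_instance

theorem exact_whiskerRight {C : Type u} [Category.{v} C] [Abelian C] [MonoidalCategory C]
    [MonoidalPreadditive C] [HasDuals C] {X Y Z : C} {f : X ⟶ Y} {g : Y ⟶ Z} {h : f ≫ g = 0}
    (hS : (ShortComplex.mk f g h).Exact) [Epi g] (W : C) (h' : f ▷ W ≫ g ▷ W = 0) :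
    (ShortComplex.mk (f ▷ W) (g ▷ W) h').Exact := by
  have := isLeftAdjoint_tensorRight W
  exact hS.map_of_epi_of_preservesCokernel (tensorRight W) ‹_› inferInstance

theorem exact_whiskerLeft {C : Type u} [Category.{v} C] [Abelian C] [MonoidalCategory C]
    [MonoidalPreadditive C] [HasDuals C] {X Y Z : C} {f : X ⟶ Y} {g : Y ⟶ Z} {h : f ≫ g = 0}
    (hS : (ShortComplex.mk f g h).Exact) [Epi g] (W : C) (h' : W ◁ f ≫ W ◁ g = 0) :
    (ShortComplex.mk (W ◁ f) (W ◁ g) h').Exact := by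
  have := isLeftAdjoint_tensorLeft W
  exact hS.map_of_epi_of_preservesCokernel (tensorLeft W) ‹_› inferInstance

end HasDuals

/-! ### Exactness properties of external products over a field. -/

namespace LinProd

variable {k : Type w} [Field k]
variable {C : Type u₁} [Category.{v₁} C] [Preadditive C] [Linear k C]
variable {D : Type u₂} [Category.{v₂} D] [Preadditive D] [Linear k D]

theorem homMk_add_left {X Y : C} {V W : D} (f f' : X ⟶ Y) (g : V ⟶ W) :
    (homMk (f + f') g : (⟨X, V⟩ : LinProd k C D) ⟶ ⟨Y, W⟩) = homMk f g + homMk f' g :=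
  TensorProduct.add_tmul _ _ _

theorem homMk_zero_left {X Y : C} {V W : D} (g : V ⟶ W) :
    (homMk 0 g : (⟨X, V⟩ : LinProd k C D) ⟶ ⟨Y, W⟩) = 0 :=
  TensorProduct.zero_tmul _ _

theorem homMk_zero_right {X Y : C} {V W : D} (f : X ⟶ Y) :
    (homMk f 0 : (⟨X, V⟩ : LinProd k C D) ⟶ ⟨Y, W⟩) = 0 :=
  TensorProduct.tmul_zero _ _

theorem homMk_smul {X Y : C} {V W : D} (c : k) (f : X ⟶ Y) (g : V ⟶ W) :
    (homMk f (c • g) : (⟨X, V⟩ : LinProd k C D) ⟶ ⟨Y, W⟩) = homMk (c • f) g :=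
  (TensorProduct.smul_tmul c f g).symm

theorem smul_homMk {X Y : C} {V W : D} (c : k) (f : X ⟶ Y) (g : V ⟶ W) :
    c • (homMk f g : (⟨X, V⟩ : LinProd k C D) ⟶ ⟨Y, W⟩) = homMk (c • f) g :=
  rfl

theorem homMk_sum_right {X Y : C} {V W : D} (f : X ⟶ Y) {ι : Type*} (s : Finset ι)
    (g : ι → (V ⟶ W)) :
    (homMk f (∑ i ∈ s, g i) : (⟨X, V⟩ : LinProd k C D) ⟶ ⟨Y, W⟩) = ∑ i ∈ s, homMk f (g i) :=
  TensorProduct.tmul_sum _ _ _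

theorem homMk_sum_left {X Y : C} {V W : D} {ι : Type*} (s : Finset ι)
    (f : ι → (X ⟶ Y)) (g : V ⟶ W) :
    (homMk (∑ i ∈ s, f i) g : (⟨X, V⟩ : LinProd k C D) ⟶ ⟨Y, W⟩) = ∑ i ∈ s, homMk (f i) g :=
  TensorProduct.sum_tmul _ _ _

theorem homMk_comp_eq_rTensor {X Y Z : C} {V W : D} (e : X ⟶ Y)
    (t : (⟨Y, V⟩ : LinProd k C D) ⟶ ⟨Z, W⟩) :
    (homMk e (𝟙 V) : (⟨X, V⟩ : LinProd k C D) ⟶ ⟨Y, V⟩) ≫ t =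
      (Linear.leftComp k Z e).rTensor (V ⟶ W) t := by
  induction t using hom_induction with
  | h0 => rw [comp_zero]; exact (map_zero _).symm
  | ha a b ha hb => rw [Preadditive.comp_add, ha, hb]; exact (map_add _ _ _).symm
  | hm a b =>
    rw [homMk_comp, Category.id_comp]; rfl

/-- Precomposition with `e` is injective on morphisms, and stays so after tensoring with a space of
morphisms in `D`, which is flat over `k`. -/
instance {X Y : C} {V : D} (e : X ⟶ Y) [Epi e] :
    Epi (homMk e (𝟙 V) : (⟨X, V⟩ : LinProd k C D) ⟶ ⟨Y, V⟩) where
  left_cancellation {T} t t' h := by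
    rw [homMk_comp_eq_rTensor e t, homMk_comp_eq_rTensor e t'] at h
    exact Module.Flat.rTensor_preserves_injective_linearMap (M := V ⟶ T.right)
      (Linear.leftComp k T.left e) (fun a b hab => (cancel_epi e).1 hab) h

/-- By flatness, exactness of `Hom(Y, Z) → Hom(X, Z) → Hom(R, Z)` survives tensoring with `Hom(V,
W)`. External products thus inherit the universal property of a cokernel in the first factor. -/
theorem exists_factor {X Y Z R : C} {V W : D} (r : R ⟶ X) (e : X ⟶ Y)
    (h : ∀ x : X ⟶ Z, r ≫ x = 0 → ∃ y, e ≫ y = x) (he : r ≫ e = 0)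
    (t : (⟨X, V⟩ : LinProd k C D) ⟶ ⟨Z, W⟩)
    (ht : (homMk r (𝟙 V) : (⟨R, V⟩ : LinProd k C D) ⟶ ⟨X, V⟩) ≫ t = 0) :
    ∃ t' : (⟨Y, V⟩ : LinProd k C D) ⟶ ⟨Z, W⟩, homMk e (𝟙 V) ≫ t' = t := by
  have hex : Function.Exact (Linear.leftComp k Z e) (Linear.leftComp k Z r) := by
    intro x
    refine ⟨fun hx => h x hx, ?_⟩
    rintro ⟨y, rfl⟩
    change r ≫ e ≫ y = 0
    rw [← Category.assoc, he, zero_comp]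
  have := Module.Flat.rTensor_exact (V ⟶ W) hex
  rw [homMk_comp_eq_rTensor] at ht
  obtain ⟨y, hy⟩ := (this t).1 ht
  exact ⟨y, (homMk_comp_eq_rTensor e y).trans hy⟩

/-- Morphisms of external products vanish if there are none between the right factors. -/
theorem eq_zero_of_right {X Y : C} {V W : D} (h : ∀ g : V ⟶ W, g = 0)
    (t : (⟨X, V⟩ : LinProd k C D) ⟶ ⟨Y, W⟩) : t = 0 := by
  induction t using hom_induction with
  | h0 => rfl
  | ha a b ha hb => rw [ha, hb, add_zero]
  | hm a b => rw [h b, homMk_zero_right]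

theorem eq_zero_of_left {X Y : C} {V W : D} (h : ∀ g : X ⟶ Y, g = 0)
    (t : (⟨X, V⟩ : LinProd k C D) ⟶ ⟨Y, W⟩) : t = 0 := by
  induction t using hom_induction with
  | h0 => rfl
  | ha a b ha hb => rw [ha, hb, add_zero]
  | hm a b => rw [h a, homMk_zero_left]

/-- Contract the second tensor factor with a functional taking the value `1` at `g`. -/
theorem homMk_left_injective {X Y : C} {V W : D} (g : V ⟶ W) (hg : g ≠ 0) {f f' : X ⟶ Y}
    (h : (homMk f g : (⟨X, V⟩ : LinProd k C D) ⟶ ⟨Y, W⟩) = homMk f' g) : f = f' := by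
  obtain ⟨l, hl, -⟩ := Verlinde.exists_functional (⊥ : Submodule k (V ⟶ W)) g (by simpa using hg)
  have := congrArg ((TensorProduct.rid k (X ⟶ Y)) ∘ (l.lTensor (X ⟶ Y))) h
  simpa [homMk, hl] using this

end LinProd

/-! ### Equivariant maps from a representation into spaces of generalized elements. -/

namespace FrobeniusFunctor

open Verlinde LinProd

section TestElements

variable {k : Type w} [Field k] {p : ℕ} [Fact p.Prime]
variable {C : Type u} [Category.{v} C] [Abelian C] [Linear k C]

/-- Equivariant linear maps from a representation `J` of `ℤ/p` to the space of morphisms from `S`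
to an object with an endomorphism `g`; that is, equivariant morphisms from `S ⊗ J`. -/
@[ext]
structure Equivar (J : FDRep k (Multiplicative (ZMod p))) (S : C) {V : C} (g : V ⟶ V) where
  toFun : (J : Type w) →ₗ[k] (S ⟶ V)
  comm : ∀ x, toFun (act J x) = toFun x ≫ g

namespace Equivar

variable {J J' J'' : FDRep k (Multiplicative (ZMod p))} {S S' S'' V W V' W' : C} {g : V ⟶ V}
  {h : W ⟶ W} {g' : V' ⟶ V'} {h' : W' ⟶ W'}

theorem dop_comm (f : Equivar J S g) (x : J) : f.toFun (dop J x) = f.toFun x ≫ (𝟙 V - g) := by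
  have h1 := f.comm x
  rw [act_apply, map_sub] at h1
  rw [Preadditive.comp_sub, Category.comp_id, ← h1, sub_sub_cancel]

theorem dop_pow_comm (f : Equivar J S g) (n : ℕ) (x : J) :
    f.toFun ((dop J ^ n) x) = f.toFun x ≫ endPow (𝟙 V - g) n := by
  induction n with
  | zero => exact (Category.comp_id _).symm
  | succ n ih => rw [pow_succ', Module.End.mul_apply, dop_comm, ih, endPow_succ', Category.assoc]

/-- Precomposition with a morphism of each of the two factors. -/
def pre (f : Equivar J S g) (s : S' ⟶ S) (j : J' ⟶ J) : Equivar J' S' g where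
  toFun := Linear.leftComp k V s ∘ₗ f.toFun ∘ₗ toLin j
  comm x := by
    simp only [LinearMap.comp_apply, Linear.leftComp_apply, Category.assoc]
    rw [toLin_act, f.comm]

theorem pre_apply (f : Equivar J S g) (s : S' ⟶ S) (j : J' ⟶ J) (x : J') :
    (f.pre s j).toFun x = s ≫ f.toFun (toLin j x) := rfl

/-- Postcomposition with an equivariant morphism. -/
def post (f : Equivar J S g) (φ : V ⟶ W) (hφ : g ≫ φ = φ ≫ h) : Equivar J S h where
  toFun := Linear.rightComp k S φ ∘ₗ f.toFun
  comm x := by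
    simp only [LinearMap.comp_apply, Linear.rightComp_apply, Category.assoc]
    rw [f.comm, Category.assoc, hφ]

instance : Zero (Equivar J S g) := ⟨⟨0, fun x => by simp⟩⟩

instance : Add (Equivar J S g) :=
  ⟨fun f f' => ⟨f.toFun + f'.toFun, fun x => by simp [f.comm, f'.comm]⟩⟩

theorem add_apply (f f' : Equivar J S g) (x : J) : (f + f').toFun x = f.toFun x + f'.toFun x := rfl

theorem zero_apply (x : J) : (0 : Equivar J S g).toFun x = 0 := rfl

instance : AddCommMonoid (Equivar J S g) where
  add_assoc f f' f'' := Equivar.ext (add_assoc _ _ _)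
  zero_add f := Equivar.ext (zero_add _)
  add_zero f := Equivar.ext (add_zero _)
  add_comm f f' := Equivar.ext (add_comm _ _)
  nsmul := nsmulRec

/-- Underlying linear map as an additive homomorphism. -/
def toFunHom : Equivar J S g →+ ((J : Type w) →ₗ[k] (S ⟶ V)) where
  toFun f := f.toFun
  map_zero' := rfl
  map_add' _ _ := rfl

theorem sum_apply {ι : Type*} (s : Finset ι) (f : ι → Equivar J S g) (x : J) :
    (∑ i ∈ s, f i).toFun x = ∑ i ∈ s, (f i).toFun x := by
  have := map_sum (toFunHom (J := J) (S := S) (g := g)) f s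
  exact (congrArg (fun t => t x) this).trans (LinearMap.sum_apply _ _ _)

section Block

variable [CharP k p]

theorem rightComp_pow (D : V ⟶ V) (n : ℕ) (x : S ⟶ V) :
    (Linear.rightComp k S D ^ n) x = x ≫ endPow D n := by
  induction n with
  | zero => exact (Category.comp_id _).symm
  | succ n ih =>
    rw [pow_succ', Module.End.mul_apply, ih, endPow_succ', ← Category.assoc]; rfl

/-- The equivariant map from a Jordan block given by a generalized element killed by `D^m`. -/
def ofElem (m : ℕ) (hm : m ≤ p) (x : S ⟶ V) (hx : x ≫ endPow (𝟙 V - g) m = 0) :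
    Equivar (blk k p m hm) S g where
  toFun := blockMap (Linear.rightComp k S (𝟙 V - g)) m x ((rightComp_pow _ m x).trans hx)
  comm y := by
    have h1 := act_blk (k := k) m hm y
    refine (congrArg (blockMap _ m x _) h1).trans ?_
    rw [sub_mul, one_mul, map_sub, blockMap_root_mul, Linear.rightComp_apply,
      Preadditive.comp_sub, Category.comp_id, sub_sub_cancel]

theorem ofElem_one (m : ℕ) (hm : m ≤ p) (x : S ⟶ V) (hx : x ≫ endPow (𝟙 V - g) m = 0) :
    (ofElem (k := k) m hm x hx).toFun (1 : Block k m) = x :=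
  blockMap_one _ _ _ ((rightComp_pow _ m x).trans hx)

theorem root_mul {m : ℕ} {hm : m ≤ p} (f : Equivar (blk k p m hm) S g) (y : Block k m) :
    f.toFun (AdjoinRoot.root _ * y : Block k m) = f.toFun y ≫ (𝟙 V - g) := by
  rw [← dop_comm]; exact congrArg f.toFun (dop_blk m hm y).symm

theorem blk_ext {m : ℕ} {hm : m ≤ p} {f f' : Equivar (blk k p m hm) S g}
    (hf : f.toFun (1 : Block k m) = f'.toFun (1 : Block k m)) : f = f' :=
  Equivar.ext (blockHom_ext (Linear.rightComp k S (𝟙 V - g)) _ _ f.root_mul f'.root_mul hf)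

theorem one_comp_endPow {m : ℕ} {hm : m ≤ p} (f : Equivar (blk k p m hm) S g) :
    f.toFun (1 : Block k m) ≫ endPow (𝟙 V - g) m = 0 := by
  rw [← dop_pow_comm]
  have h : (dop (blk k p m hm) ^ m) (1 : Block k m) = 0 :=
    (dop_blk_pow m hm m 1).trans (by rw [root_pow_eq_zero, zero_mul])
  exact (congrArg f.toFun h).trans (map_zero _)

end Block

section Tensor

variable [MonoidalCategory C] [MonoidalPreadditive C] [MonoidalLinear k C]

/-- The tensor product of equivariant maps. -/
def tensor (f : Equivar J S g) (f' : Equivar J' S' h) : Equivar (J ⊗ J') (S ⊗ S') (g ⊗ₘ h) where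
  toFun := TensorProduct.lift ((tensorHomBilin k S V S' W).compl₁₂ f.toFun f'.toFun)
  comm x := by
    have h1 : TensorProduct.lift ((tensorHomBilin k S V S' W).compl₁₂ f.toFun f'.toFun) ∘ₗ
          TensorProduct.map (act J) (act J') =
        Linear.rightComp k (S ⊗ S') (g ⊗ₘ h) ∘ₗ
          TensorProduct.lift ((tensorHomBilin k S V S' W).compl₁₂ f.toFun f'.toFun) := by
      ext a b
      change f.toFun (act J a) ⊗ₘ f'.toFun (act J' b) = (f.toFun a ⊗ₘ f'.toFun b) ≫ (g ⊗ₘ h)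
      rw [f.comm, f'.comm, tensorHom_comp_tensorHom]
    exact LinearMap.congr_fun h1 x

theorem tensor_tmul (f : Equivar J S g) (f' : Equivar J' S' h) (a : J) (b : J') :
    (f.tensor f').toFun (a ⊗ₜ[k] b : (J : Type w) ⊗[k] (J' : Type w)) = f.toFun a ⊗ₘ f'.toFun b := rfl

theorem tensor_ext {f f' : Equivar (J ⊗ J') S g}
    (hf : ∀ (a : J) (b : J'), f.toFun (a ⊗ₜ[k] b : (J : Type w) ⊗[k] (J' : Type w)) =
      f'.toFun (a ⊗ₜ[k] b : (J : Type w) ⊗[k] (J' : Type w))) : f = f' :=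
  Equivar.ext (TensorProduct.ext' (R := k) (M := J) (N := J') hf)

end Tensor

end Equivar

end TestElements

end FrobeniusFunctor

end

/-! ### From equivariant maps to morphisms into the layers, and the product of layers. -/

noncomputable section

namespace Verlinde

section Pr

variable {k : Type w} [Field k] {p : ℕ} [Fact p.Prime] [CharP k p]

/-- The morphism of the Verlinde category represented by a morphism of representations. -/
def pr {X Y : Ver k p} (f : X.as ⟶ Y.as) : X ⟶ Y := (Quotient.functor _).map f

variable {X Y Z X' Y' : Ver k p}

theorem pr_comp (f : X.as ⟶ Y.as) (g : Y.as ⟶ Z.as) : (pr (f ≫ g) : X ⟶ Z) = pr f ≫ pr g := rfl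

theorem pr_id : pr (𝟙 X.as) = 𝟙 X := rfl

theorem pr_add (f g : X.as ⟶ Y.as) : (pr (f + g) : X ⟶ Y) = pr f + pr g := rfl

theorem pr_smul (c : k) (f : X.as ⟶ Y.as) : (pr (c • f) : X ⟶ Y) = c • pr f := rfl

theorem pr_sum {ι : Type*} (s : Finset ι) (f : ι → (X.as ⟶ Y.as)) :
    (pr (∑ i ∈ s, f i) : X ⟶ Y) = ∑ i ∈ s, pr (f i) :=
  map_sum (AddMonoidHom.mk' (pr (X := X) (Y := Y)) pr_add) f s

theorem pr_eq_iff (f g : X.as ⟶ Y.as) : (pr f : X ⟶ Y) = pr g ↔ IsNegligible (f - g) :=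
  proj_eq_iff f g

theorem pr_eq_zero_iff (f : X.as ⟶ Y.as) : (pr f : X ⟶ Y) = 0 ↔ IsNegligible f :=
  proj_eq_zero_iff f

theorem pr_tensorHom (f : X.as ⟶ Y.as) (g : X'.as ⟶ Y'.as) :
    (pr f : X ⟶ Y) ⊗ₘ (pr g : X' ⟶ Y') = pr (f ⊗ₘ g) := rfl

theorem exists_id_eq_sum (J : Ver k p) :
    ∃ (N : ℕ) (n : Fin N → Fin (p - 1)) (γ : ∀ a, J.as ⟶ (L k p (n a)).as)
      (β : ∀ a, (L k p (n a)).as ⟶ J.as),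
      ∑ a, (pr (γ a) : J ⟶ L k p (n a)) ≫ (pr (β a) : L k p (n a) ⟶ J) = 𝟙 J :=
  exists_decomposition J.as

end Pr

end Verlinde


namespace FrobeniusFunctor

open Verlinde LinProd Mat_Monoidal

section Psi

variable {k : Type w} [Field k] {p : ℕ} [Fact p.Prime] [CharP k p]
variable {C : Type u} [Category.{v} C] [Abelian C] [Linear k C]

/-- The generator of the Jordan block `L_{m+1}`. -/
def genL (m : Fin (p - 1)) : (L k p m).as := (1 : Block k (m + 1))

/-- The image of the generator of a Jordan block. -/
def genImage (m : Fin (p - 1)) {J : FDRep k (Multiplicative (ZMod p))}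
    (β : (L k p m).as ⟶ J) : J := toLin β (genL m)

theorem genImage_add (m : Fin (p - 1)) {J : FDRep k (Multiplicative (ZMod p))}
    (β β' : (L k p m).as ⟶ J) : genImage m (β + β') = genImage m β + genImage m β' := rfl

theorem genImage_smul (m : Fin (p - 1)) {J : FDRep k (Multiplicative (ZMod p))} (c : k)
    (β : (L k p m).as ⟶ J) : genImage m (c • β) = c • genImage m β := rfl

variable {J J' J'' : FDRep k (Multiplicative (ZMod p))} {S S' S'' V W V' W' : C} {g : V ⟶ V}
  {h : W ⟶ W} {g' : V' ⟶ V'} {h' : W' ⟶ W'}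

theorem Equivar.L_ext {i : Fin (p - 1)} {f f' : Equivar (L k p i).as S g}
    (hf : f.toFun (genL i) = f'.toFun (genL i)) : f = f' :=
  Equivar.blk_ext (m := i + 1) (hm := by omega) hf

theorem Equivar.genL_comp_endPow {i : Fin (p - 1)} (f : Equivar (L k p i).as S g) :
    f.toFun (genL i) ≫ endPow (𝟙 V - g) (i + 1) = 0 :=
  Equivar.one_comp_endPow (m := i + 1) (hm := by omega) f

theorem Equivar.genImage_comp_endPow (f : Equivar J S g) (m : Fin (p - 1))
    (β : (L k p m).as ⟶ J) : f.toFun (genImage m β) ≫ endPow (𝟙 V - g) (m + 1) = 0 := by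
  rw [← Equivar.dop_pow_comm]
  have h1 : (dop J ^ (m.val + 1)) (genImage m β) = 0 :=
    dop_pow_toLin_one (m := m + 1) (hm := by omega) β
  rw [h1, map_zero]

/-- The class in `B_{m+1}` attached to a morphism from a Jordan block. -/
def Equivar.eval (f : Equivar J S g) (m : Fin (p - 1)) (β : (L k p m).as ⟶ J) :
    S ⟶ layer (𝟙 V - g) m :=
  cls (𝟙 V - g) m (f.toFun (genImage m β)) (f.genImage_comp_endPow m β)

theorem Equivar.eval_add (f : Equivar J S g) (m : Fin (p - 1)) (β β' : (L k p m).as ⟶ J) :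
    f.eval m (β + β') = f.eval m β + f.eval m β' := by
  rw [eval, eval, eval, ← cls_add _ _ _ _ (by
    rw [Preadditive.add_comp, f.genImage_comp_endPow, f.genImage_comp_endPow, add_zero])]
  exact cls_congr _ (by rw [genImage_add, map_add])

theorem Equivar.eval_smul (f : Equivar J S g) (m : Fin (p - 1)) (c : k) (β : (L k p m).as ⟶ J) :
    f.eval m (c • β) = c • f.eval m β := by
  rw [eval, eval, ← cls_smul _ _ _ (by
    rw [Linear.smul_comp, f.genImage_comp_endPow, smul_zero])]
  exact cls_congr _ (by rw [genImage_smul, map_smul])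

theorem Equivar.add_eval (f f' : Equivar J S g) (m : Fin (p - 1)) (β : (L k p m).as ⟶ J) :
    (f + f').eval m β = f.eval m β + f'.eval m β := by
  rw [eval, eval, eval, ← cls_add _ _ _ _ (by
    rw [Preadditive.add_comp, f.genImage_comp_endPow, f'.genImage_comp_endPow, add_zero])]
  exact cls_congr _ (by rw [add_apply])

theorem Equivar.zero_eval (m : Fin (p - 1)) (β : (L k p m).as ⟶ J) :
    (0 : Equivar J S g).eval m β = 0 :=
  cls_eq_zero_of_pow _ _ (by rw [zero_apply, zero_comp])

/-- A negligible map sends the generator to `x + D y` with `D^m x = 0`. Under `f` these two summands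
become the two kinds of relations defining the layer. The hypothesis that the block is smaller than
`p` is built into the index. -/
theorem Equivar.eval_of_negligible (f : Equivar J S g) (m : Fin (p - 1))
    (β : (L k p m).as ⟶ J) (hβ : IsNegligible β) : f.eval m β = 0 := by
  obtain ⟨x, y, hxy, hx⟩ := IsNegligible.exists_decomp (j := m) (hj := by omega) (by omega) hβ
  have hb : genImage m β = x + dop J y := hxy
  have h0 := f.genImage_comp_endPow m β
  have h1 : f.toFun x ≫ endPow (𝟙 V - g) m = 0 := by rw [← f.dop_pow_comm, hx, map_zero]
  have h2 : f.toFun x ≫ endPow (𝟙 V - g) (m + 1) = 0 := comp_endPow_eq_zero (Nat.le_succ _) h1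
  have h3 : f.toFun (genImage m β) = f.toFun x + f.toFun y ≫ (𝟙 V - g) := by
    rw [hb, map_add, f.dop_comm]
  have h4 : (f.toFun y ≫ (𝟙 V - g)) ≫ endPow (𝟙 V - g) (m + 1) = 0 := by
    rw [h3, Preadditive.add_comp, h2, zero_add] at h0; exact h0
  rw [eval, cls_congr _ h3, cls_add _ _ h2 h4, cls_eq_zero_of_pow _ _ h1, cls_comp_eq_zero,
    add_zero]

theorem Equivar.eval_congr (f : Equivar J S g) (m : Fin (p - 1))
    {β β' : (L k p m).as ⟶ J} (hβ : pr β = pr β') : f.eval m β = f.eval m β' := by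
  have h1 := f.eval_of_negligible m (β - β') ((pr_eq_iff _ _).1 hβ)
  have h2 := f.eval_add m (β - β') β'
  rw [sub_add_cancel, h1, zero_add] at h2
  exact h2

theorem Equivar.eval_sum (f : Equivar J S g) (m : Fin (p - 1)) {ι : Type*} (s : Finset ι)
    (β : ι → ((L k p m).as ⟶ J)) : f.eval m (∑ i ∈ s, β i) = ∑ i ∈ s, f.eval m (β i) :=
  map_sum (AddMonoidHom.mk' (f.eval m) (f.eval_add m)) β s

theorem Equivar.eval_pre (f : Equivar J S g) (s : S' ⟶ S) (j : J' ⟶ J) (m : Fin (p - 1))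
    (β : (L k p m).as ⟶ J') : (f.pre s j).eval m β = s ≫ f.eval m (β ≫ j) :=
  (comp_cls s _ (f.genImage_comp_endPow m (β ≫ j)) ((f.pre s j).genImage_comp_endPow m β)).symm

theorem Equivar.eval_post (f : Equivar J S g) (φ : V ⟶ W) (hφ : g ≫ φ = φ ≫ h)
    (hφ' : (𝟙 V - g) ≫ φ = φ ≫ (𝟙 W - h)) (m : Fin (p - 1))
    (β : (L k p m).as ⟶ J) : (f.post φ hφ).eval m β = f.eval m β ≫ layerMap φ hφ' m :=
  (cls_layerMap φ hφ' _ (f.genImage_comp_endPow m β) ((f.post φ hφ).genImage_comp_endPow m β)).symm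

theorem id_eq_sum (S : C) {N : ℕ} {n : Fin N → Fin (p - 1)}
    {γ : ∀ a, J ⟶ (L k p (n a)).as} {β : ∀ a, (L k p (n a)).as ⟶ J}
    (hs : ∑ a, (pr (γ a) : ⟨J⟩ ⟶ L k p (n a)) ≫ (pr (β a) : L k p (n a) ⟶ ⟨J⟩) = 𝟙 (⟨J⟩ : Ver k p)) :
    𝟙 (⟨S, ⟨J⟩⟩ : LinProd k C (Ver k p)) =
      ∑ a, (homMk (𝟙 S) (pr (γ a)) : (⟨S, ⟨J⟩⟩ : LinProd k C (Ver k p)) ⟶ ⟨S, L k p (n a)⟩) ≫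
        homMk (𝟙 S) (pr (β a)) := by
  rw [← homMk_id, ← hs, homMk_sum_right]
  refine Finset.sum_congr rfl fun a _ => ?_
  rw [homMk_comp, Category.comp_id]

theorem hom_ext_of_blocks {X : LinProd k C (Ver k p)}
    (t t' : (⟨S, ⟨J⟩⟩ : LinProd k C (Ver k p)) ⟶ X)
    (H : ∀ (i : Fin (p - 1)) (β : (L k p i).as ⟶ J),
      (homMk (𝟙 S) (pr β) : (⟨S, L k p i⟩ : LinProd k C (Ver k p)) ⟶ ⟨S, ⟨J⟩⟩) ≫ t =
        homMk (𝟙 S) (pr β) ≫ t') : t = t' := by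
  obtain ⟨N, n, γ, β, hs⟩ := exists_id_eq_sum (⟨J⟩ : Ver k p)
  rw [← Category.id_comp t, ← Category.id_comp t', id_eq_sum S hs, Preadditive.sum_comp,
    Preadditive.sum_comp]
  refine Finset.sum_congr rfl fun a _ => ?_
  rw [Category.assoc, Category.assoc, H]

/-- In `Ver_p` the object `J` is a sum of simple objects, and by Schur's lemma only the summands
`L_m` map nontrivially to the target. -/
theorem hom_ext_of_block {Y : C} {m : Fin (p - 1)}
    (t t' : (⟨S, ⟨J⟩⟩ : LinProd k C (Ver k p)) ⟶ ⟨Y, L k p m⟩)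
    (H : ∀ (β : (L k p m).as ⟶ J),
      (homMk (𝟙 S) (pr β) : (⟨S, L k p m⟩ : LinProd k C (Ver k p)) ⟶ ⟨S, ⟨J⟩⟩) ≫ t =
        homMk (𝟙 S) (pr β) ≫ t') : t = t' := by
  refine hom_ext_of_blocks t t' fun i β => ?_
  by_cases hi : i = m
  · subst hi; exact H β
  · rw [eq_zero_of_right (L_hom_eq_zero hi) (homMk (𝟙 S) (pr β) ≫ t),
      eq_zero_of_right (L_hom_eq_zero hi) (homMk (𝟙 S) (pr β) ≫ t')]

/-- The prescription is consistent because `eval` depends only on the class of `β` in `Ver_p`. The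
morphism is defined on each simple summand of a decomposition of `J`, where `End(L_m) = k` makes it
a pure tensor, and the pieces are added. -/
theorem Equivar.exists_psi (f : Equivar J S g) (m : Fin (p - 1)) :
    ∃ t : (⟨S, ⟨J⟩⟩ : LinProd k C (Ver k p)) ⟶ ⟨layer (𝟙 V - g) m, L k p m⟩,
      ∀ β : (L k p m).as ⟶ J,
        (homMk (𝟙 S) (pr β) : (⟨S, L k p m⟩ : LinProd k C (Ver k p)) ⟶ ⟨S, ⟨J⟩⟩) ≫ t =
          homMk (f.eval m β) (𝟙 _) := by
  obtain ⟨N, n, γ, β, hs⟩ := exists_id_eq_sum (⟨J⟩ : Ver k p)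
  have h1 : ∀ (i : Fin (p - 1)) (β : (L k p i).as ⟶ J),
      ∃ t : (⟨S, L k p i⟩ : LinProd k C (Ver k p)) ⟶ ⟨layer (𝟙 V - g) m, L k p m⟩,
        ∀ b : (L k p m).as ⟶ (L k p i).as,
        (homMk (𝟙 S) (pr b) : (⟨S, L k p m⟩ : LinProd k C (Ver k p)) ⟶ ⟨S, L k p i⟩) ≫ t =
          homMk (f.eval m (b ≫ β)) (𝟙 _) := by
    intro i β
    by_cases hi : m = i
    · subst hi
      refine ⟨homMk (f.eval m β) (𝟙 _), fun b => ?_⟩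
      obtain ⟨c, hc⟩ := L_end_scalar m (pr b)
      have h2 : f.eval m (b ≫ β) = c • f.eval m β := by
        rw [← f.eval_smul]
        refine f.eval_congr m ?_
        rw [pr_comp, hc, pr_smul]
        exact (Linear.smul_comp _ _ _ _ _ _).trans (by rw [Category.id_comp])
      rw [h2, hc, homMk_comp, Category.id_comp, Category.comp_id, homMk_smul]
    · refine ⟨0, fun b => ?_⟩
      have h2 : pr b = 0 := L_hom_eq_zero hi (pr b)
      have h3 : f.eval m (b ≫ β) = 0 := by
        refine f.eval_of_negligible m _ ?_
        rw [← pr_eq_zero_iff, pr_comp, h2, zero_comp]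
      rw [h3, homMk_zero_left, comp_zero]
  choose t ht using h1
  refine ⟨∑ a, homMk (𝟙 S) (pr (γ a)) ≫ t (n a) (β a), fun b => ?_⟩
  rw [Preadditive.comp_sum]
  have h2 : f.eval m b = ∑ a, f.eval m ((b ≫ γ a) ≫ β a) := by
    rw [← f.eval_sum]
    refine f.eval_congr m ?_
    rw [pr_sum]
    calc pr b = pr b ≫ 𝟙 _ := (Category.comp_id _).symm
      _ = _ := by rw [← hs, Preadditive.comp_sum]; rfl
  rw [h2, homMk_sum_left]
  refine Finset.sum_congr rfl fun a _ => ?_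
  rw [← Category.assoc, homMk_comp, Category.comp_id, ← pr_comp]
  exact ht (n a) (β a) (b ≫ γ a)

/-- The morphism `S ⊠ J ⟶ B_{m+1} ⊠ L_{m+1}` induced by an equivariant map `S ⊗ J ⟶ V`. -/
def Equivar.psi (f : Equivar J S g) (m : Fin (p - 1)) :
    (⟨S, ⟨J⟩⟩ : LinProd k C (Ver k p)) ⟶ ⟨layer (𝟙 V - g) m, L k p m⟩ :=
  (f.exists_psi m).choose

theorem Equivar.homMk_psi (f : Equivar J S g) (m : Fin (p - 1)) (β : (L k p m).as ⟶ J) :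
    (homMk (𝟙 S) (pr β) : (⟨S, L k p m⟩ : LinProd k C (Ver k p)) ⟶ ⟨S, ⟨J⟩⟩) ≫ f.psi m =
      homMk (f.eval m β) (𝟙 _) :=
  (f.exists_psi m).choose_spec β

theorem Equivar.psi_pre (f : Equivar J S g) (s : S' ⟶ S) (j : J' ⟶ J) (m : Fin (p - 1)) :
    (f.pre s j).psi m = (homMk s (pr j) : (⟨S', ⟨J'⟩⟩ : LinProd k C (Ver k p)) ⟶ ⟨S, ⟨J⟩⟩) ≫
      f.psi m := by
  refine hom_ext_of_block _ _ fun β => ?_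
  rw [homMk_psi, eval_pre, ← Category.assoc, homMk_comp, Category.id_comp]
  have h1 : (homMk s (pr β ≫ pr j) : (⟨S', L k p m⟩ : LinProd k C (Ver k p)) ⟶ ⟨S, ⟨J⟩⟩) =
      (homMk s (𝟙 _) : (⟨S', L k p m⟩ : LinProd k C (Ver k p)) ⟶ ⟨S, L k p m⟩) ≫
        homMk (𝟙 S) (pr (β ≫ j)) := by
    rw [homMk_comp, Category.comp_id, Category.id_comp, pr_comp]
  rw [h1, Category.assoc, homMk_psi, homMk_comp, Category.comp_id]

theorem Equivar.psi_post (f : Equivar J S g) (φ : V ⟶ W) (hφ : g ≫ φ = φ ≫ h)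
    (hφ' : (𝟙 V - g) ≫ φ = φ ≫ (𝟙 W - h)) (m : Fin (p - 1)) :
    (f.post φ hφ).psi m = f.psi m ≫ homMk (layerMap φ hφ' m) (𝟙 _) := by
  refine hom_ext_of_block _ _ fun β => ?_
  rw [homMk_psi, f.eval_post φ hφ hφ', ← Category.assoc, homMk_psi, homMk_comp, Category.comp_id]

theorem Equivar.psi_add (f f' : Equivar J S g) (m : Fin (p - 1)) :
    (f + f').psi m = f.psi m + f'.psi m := by
  refine hom_ext_of_block _ _ fun β => ?_
  rw [homMk_psi, add_eval, Preadditive.comp_add, homMk_psi, homMk_psi, homMk_add_left]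

theorem Equivar.psi_zero (m : Fin (p - 1)) : (0 : Equivar J S g).psi m = 0 := by
  refine hom_ext_of_block _ _ fun β => ?_
  rw [homMk_psi, zero_eval, homMk_zero_left, comp_zero]

/-- This is the mechanism by which relations die: what factors through a negligible morphism
contributes nothing. -/
theorem Equivar.psi_pre_eq_zero (f : Equivar J S g) (s : S' ⟶ S) (j : J' ⟶ J) (hj : pr j = 0)
    (m : Fin (p - 1)) : (f.pre s j).psi m = 0 := by
  rw [psi_pre, hj, homMk_zero_right, zero_comp]

/-- The canonical equivariant map `Ker D^{m+1} ⊗ L_{m+1} ⟶ V`. -/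
def Equivar.can (g : V ⟶ V) (m : Fin (p - 1)) :
    Equivar (L k p m).as (powKer (𝟙 V - g) m) g :=
  ofElem (m + 1) (by omega) (kernel.ι _) (kernel.condition _)

theorem Equivar.can_genL (g : V ⟶ V) (m : Fin (p - 1)) :
    (can (k := k) g m).toFun (genL m) = kernel.ι _ := ofElem_one _ _ _ _

theorem Equivar.psi_can_self (g : V ⟶ V) (m : Fin (p - 1)) :
    (can (k := k) g m).psi m = homMk (powKerπ (𝟙 V - g) m) (𝟙 _) := by
  have h1 := (can (k := k) g m).homMk_psi m (𝟙 _)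
  rw [pr_id] at h1
  refine (Category.id_comp _).symm.trans (h1.trans ?_)
  congr 1
  exact cls_congr _ (can_genL g m)

theorem Equivar.psi_of_ne {i m : Fin (p - 1)} (hi : i ≠ m) (f : Equivar (L k p i).as S g) :
    f.psi m = 0 := eq_zero_of_right (L_hom_eq_zero hi) _

/-- The canonical map is universal, since `f` is determined by the image of the generator, an
element of `Ker D^{i+1}`. -/
theorem Equivar.eq_pre_can {i : Fin (p - 1)} (f : Equivar (L k p i).as S g) :
    ∃ s : S ⟶ powKer (𝟙 V - g) i, f = (can g i).pre s (𝟙 _) := by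
  refine ⟨kernel.lift _ _ f.genL_comp_endPow, L_ext ?_⟩
  rw [pre_apply]
  exact ((kernel.lift_ι _ _ f.genL_comp_endPow).symm.trans
    (congrArg (fun t => kernel.lift _ _ f.genL_comp_endPow ≫ t) (can_genL (k := k) g i).symm))

end Psi

section Lax

variable {k : Type w} [Field k] {p : ℕ} [Fact p.Prime] [CharP k p]
variable {C : Type u} [Category.{v} C] [Abelian C] [Linear k C]
variable [MonoidalCategory C] [MonoidalPreadditive C] [MonoidalLinear k C]
variable {J J' J'' : FDRep k (Multiplicative (ZMod p))} {S S' S'' T T' V W V' W' : C} {g : V ⟶ V}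
  {h : W ⟶ W} {g' : V' ⟶ V'} {h' : W' ⟶ W'}

theorem Equivar.tensor_pre (f : Equivar J S g) (f' : Equivar J' S' h)
    {I I' : FDRep k (Multiplicative (ZMod p))} (s : T ⟶ S) (s' : T' ⟶ S')
    (j : I ⟶ J) (j' : I' ⟶ J') :
    (f.pre s j).tensor (f'.pre s' j') = (f.tensor f').pre (s ⊗ₘ s') (j ⊗ₘ j') := by
  refine tensor_ext fun a b => ?_
  rw [tensor_tmul, pre_apply, pre_apply, pre_apply]
  exact (tensorHom_comp_tensorHom _ _ _ _).symm

theorem Equivar.tensor_add_left (f₁ f₂ : Equivar J S g) (f' : Equivar J' S' h) :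
    (f₁ + f₂).tensor f' = f₁.tensor f' + f₂.tensor f' := by
  refine tensor_ext fun a b => ?_
  rw [tensor_tmul, add_apply, MonoidalPreadditive.add_tensor]; rfl

theorem Equivar.tensor_add_right (f : Equivar J S g) (f₁ f₂ : Equivar J' S' h) :
    f.tensor (f₁ + f₂) = f.tensor f₁ + f.tensor f₂ := by
  refine tensor_ext fun a b => ?_
  rw [tensor_tmul, add_apply, MonoidalPreadditive.tensor_add]; rfl

/-- Negligible morphisms form a tensor ideal, so a relation in one factor stays a relation after
tensoring with any equivariant map. -/
theorem Equivar.psi_tensor_eq_zero_left (f : Equivar J S g) (f' : Equivar J' S' h)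
    {I : FDRep k (Multiplicative (ZMod p))} (s : T ⟶ S) (j : I ⟶ J) (hj : pr j = 0)
    (m : Fin (p - 1)) : ((f.pre s j).tensor f').psi m = 0 := by
  have h1 : f' = f'.pre (𝟙 _) (𝟙 _) := Equivar.ext (LinearMap.ext fun x => (Category.id_comp _).symm)
  rw [h1, tensor_pre]
  refine psi_pre_eq_zero _ _ _ ?_ _
  rw [← pr_tensorHom, hj]
  exact MonoidalPreadditive.zero_tensor _

theorem Equivar.psi_tensor_eq_zero_right (f : Equivar J S g) (f' : Equivar J' S' h)
    {I : FDRep k (Multiplicative (ZMod p))} (s : T ⟶ S') (j : I ⟶ J') (hj : pr j = 0)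
    (m : Fin (p - 1)) : (f.tensor (f'.pre s j)).psi m = 0 := by
  have h1 : f = f.pre (𝟙 _) (𝟙 _) := Equivar.ext (LinearMap.ext fun x => (Category.id_comp _).symm)
  rw [h1, tensor_pre]
  refine psi_pre_eq_zero _ _ _ ?_ _
  rw [← pr_tensorHom, hj]
  exact MonoidalPreadditive.tensor_zero _

/-- The relations among generalized elements of `Ker D^{m+1}` factor through smaller or larger
Jordan blocks. -/
theorem Equivar.exists_can_rel (g : V ⟶ V) (i : Fin (p - 1)) :
    ∃ (I₁ I₂ : FDRep k (Multiplicative (ZMod p)))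
      (f₁ : Equivar I₁ (kernel (endPow (𝟙 V - g) i) ⊞ kernel (endPow (𝟙 V - g) (i + 2))) g)
      (f₂ : Equivar I₂ (kernel (endPow (𝟙 V - g) i) ⊞ kernel (endPow (𝟙 V - g) (i + 2))) g)
      (j₁ : (L k p i).as ⟶ I₁) (j₂ : (L k p i).as ⟶ I₂),
      (pr j₁ : L k p i ⟶ ⟨I₁⟩) = 0 ∧ (pr j₂ : L k p i ⟶ ⟨I₂⟩) = 0 ∧
      (can g i).pre (powKerRel (𝟙 V - g) i) (𝟙 _) = f₁.pre (𝟙 _) j₁ + f₂.pre (𝟙 _) j₂ := by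
  -- A relation in `Ker D^i` extends over the quotient block of size `i`, possibly zero. A relation
  -- `D y` with `y` in `Ker D^{i+2}` extends over the block of size `i + 2`, which contains the
  -- given one as the multiples of `D`. The index bound just allows size `p`. Both maps of blocks
  -- are negligible because the sizes differ.
  have hi : i.val + 2 ≤ p := by omega
  let j₁ : blk k p (i + 1) (by omega) ⟶ blk k p i (by omega) :=
    ofVec (i + 1) (by omega) (1 : Block k i) (by
      refine (dop_blk_pow (k := k) i.val (by omega) (i + 1) 1).trans ?_
      rw [pow_succ, root_pow_eq_zero, zero_mul, zero_mul])
  let j₂ : blk k p (i + 1) (by omega) ⟶ blk k p (i + 2) hi :=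
    ofVec (i + 1) (by omega) (AdjoinRoot.root _ : Block k (i + 2)) (by
      refine (dop_blk_pow (k := k) (i.val + 2) hi (i + 1) _).trans ?_
      rw [← pow_succ, root_pow_eq_zero])
  refine ⟨blk k p i (by omega), blk k p (i + 2) hi,
    ofElem i (by omega) (biprod.fst ≫ kernel.ι _) (by simp),
    ofElem (i + 2) hi (biprod.snd ≫ kernel.ι _) (by rw [Category.assoc, kernel.condition, comp_zero]),
    j₁, j₂, ?_, ?_, ?_⟩
  · exact (pr_eq_zero_iff (X := L k p i) (Y := ⟨blk k p i (by omega)⟩) j₁).2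
      (isNegligible_of_ne (by omega) j₁)
  · exact (pr_eq_zero_iff (X := L k p i) (Y := ⟨blk k p (i + 2) hi⟩) j₂).2
      (isNegligible_of_ne (by omega) j₂)
  · refine L_ext ?_
    have e1 : toLin j₁ (1 : Block k (i + 1)) = (1 : Block k i) := ofVec_one _ _ _ _
    have e2 : toLin j₂ (1 : Block k (i + 1)) = (AdjoinRoot.root _ * 1 : Block k (i + 2)) :=
      (ofVec_one _ _ _ _).trans (mul_one _).symm
    refine (congrArg (fun t => powKerRel (𝟙 V - g) i ≫ t) (can_genL (k := k) g i)).trans ?_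
    refine Eq.trans ?_ (congrArg₂ (· + ·)
      ((congrArg (ofElem (k := k) (p := p) i.val (by omega) (biprod.fst ≫ kernel.ι (endPow (𝟙 V - g) i))
        (by simp)).toFun e1.symm).trans (Category.id_comp _).symm)
      ((congrArg (ofElem (k := k) (p := p) (i.val + 2) hi (biprod.snd ≫ kernel.ι (endPow (𝟙 V - g) (i + 2)))
        (by rw [Category.assoc, kernel.condition, comp_zero])).toFun e2.symm).trans
          (Category.id_comp _).symm))
    rw [root_mul, ofElem_one, ofElem_one, powKerRel]
    ext <;> simp

variable [HasDuals C]

/-- The morphism attached to the product of the canonical maps kills the relations in either factor,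
so it descends to the layers one factor at a time. -/
theorem Equivar.exists_mu (g : V ⟶ V) (h : W ⟶ W) (i j m : Fin (p - 1)) :
    ∃ t : ((⟨layer (𝟙 V - g) i, L k p i⟩ : LinProd k C (Ver k p)) ⊗ ⟨layer (𝟙 W - h) j, L k p j⟩) ⟶
        ⟨layer (𝟙 (V ⊗ W) - (g ⊗ₘ h)) m, L k p m⟩,
      ((homMk (powKerπ (𝟙 V - g) i) (𝟙 _) : (⟨_, L k p i⟩ : LinProd k C (Ver k p)) ⟶ ⟨_, L k p i⟩) ⊗ₘ
        (homMk (powKerπ (𝟙 W - h) j) (𝟙 _) : (⟨_, L k p j⟩ : LinProd k C (Ver k p)) ⟶ ⟨_, L k p j⟩)) ≫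
          t = ((can g i).tensor (can h j)).psi m := by
  obtain ⟨I₁, I₂, f₁, f₂, j₁, j₂, hj₁, hj₂, hr⟩ := exists_can_rel (k := k) (p := p) g i
  obtain ⟨I₁', I₂', f₁', f₂', j₁', j₂', hj₁', hj₂', hr'⟩ := exists_can_rel (k := k) (p := p) h j
  have key : (homMk (powKerRel (𝟙 V - g) i ▷ powKer (𝟙 W - h) j) (𝟙 (L k p i ⊗ L k p j)) :
      (⟨_, L k p i ⊗ L k p j⟩ : LinProd k C (Ver k p)) ⟶ ⟨_, _⟩) ≫
        ((can g i).tensor (can h j)).psi m = 0 := by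
    have h1 := psi_pre ((can (k := k) g i).tensor (can h j))
      (powKerRel (𝟙 V - g) i ⊗ₘ 𝟙 (powKer (𝟙 W - h) j)) (𝟙 _ ⊗ₘ 𝟙 _) m
    rw [← tensor_pre, hr, tensor_add_left, psi_add, psi_tensor_eq_zero_left _ _ _ _ hj₁,
      psi_tensor_eq_zero_left _ _ _ _ hj₂, add_zero, tensorHom_id, id_tensorHom_id, pr_id] at h1
    exact h1.symm
  have key' : (homMk (powKer (𝟙 V - g) i ◁ powKerRel (𝟙 W - h) j) (𝟙 (L k p i ⊗ L k p j)) :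
      (⟨_, L k p i ⊗ L k p j⟩ : LinProd k C (Ver k p)) ⟶ ⟨_, _⟩) ≫
        ((can g i).tensor (can h j)).psi m = 0 := by
    have h1 := psi_pre ((can (k := k) g i).tensor (can h j))
      (𝟙 (powKer (𝟙 V - g) i) ⊗ₘ powKerRel (𝟙 W - h) j) (𝟙 _ ⊗ₘ 𝟙 _) m
    rw [← tensor_pre, hr', tensor_add_right, psi_add, psi_tensor_eq_zero_right _ _ _ _ hj₁',
      psi_tensor_eq_zero_right _ _ _ _ hj₂', add_zero, id_tensorHom, id_tensorHom_id, pr_id] at h1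
    exact h1.symm
  have ex1 : ∀ (X Y : C) (x : powKer (𝟙 V - g) i ⊗ X ⟶ Y), powKerRel (𝟙 V - g) i ▷ X ≫ x = 0 →
      ∃ y, powKerπ (𝟙 V - g) i ▷ X ≫ y = x := fun X Y x hx => by
    have h0 : powKerRel (𝟙 V - g) i ▷ X ≫ powKerπ (𝟙 V - g) i ▷ X = 0 := by
      rw [← comp_whiskerRight, powKerRel_π, MonoidalPreadditive.zero_whiskerRight]
    have hex := HasDuals.exact_whiskerRight (powKer_exact (𝟙 V - g) i) X h0
    have : Epi (ShortComplex.mk _ _ h0).g := by dsimp; infer_instance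
    exact ⟨hex.desc x hx, hex.g_desc x hx⟩
  have ex2 : ∀ (X Y : C) (x : X ⊗ powKer (𝟙 W - h) j ⟶ Y), X ◁ powKerRel (𝟙 W - h) j ≫ x = 0 →
      ∃ y, X ◁ powKerπ (𝟙 W - h) j ≫ y = x := fun X Y x hx => by
    have h0 : X ◁ powKerRel (𝟙 W - h) j ≫ X ◁ powKerπ (𝟙 W - h) j = 0 := by
      rw [← whiskerLeft_comp, powKerRel_π, MonoidalPreadditive.whiskerLeft_zero]
    have hex := HasDuals.exact_whiskerLeft (powKer_exact (𝟙 W - h) j) X h0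
    have : Epi (ShortComplex.mk _ _ h0).g := by dsimp; infer_instance
    exact ⟨hex.desc x hx, hex.g_desc x hx⟩
  obtain ⟨t₁, ht₁⟩ := exists_factor (powKerRel (𝟙 V - g) i ▷ powKer (𝟙 W - h) j)
    (powKerπ (𝟙 V - g) i ▷ powKer (𝟙 W - h) j) (ex1 _ _)
    (by rw [← comp_whiskerRight, powKerRel_π, MonoidalPreadditive.zero_whiskerRight]) _ key
  -- The relations in the second factor persist after descent in the first, as is seen by
  -- precomposing with the epimorphism already divided out.
  have key2 : (homMk (layer (𝟙 V - g) i ◁ powKerRel (𝟙 W - h) j) (𝟙 (L k p i ⊗ L k p j)) :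
      (⟨_, L k p i ⊗ L k p j⟩ : LinProd k C (Ver k p)) ⟶ ⟨_, _⟩) ≫ t₁ = 0 := by
    rw [← cancel_epi (homMk (powKerπ (𝟙 V - g) i ▷ _) (𝟙 (L k p i ⊗ L k p j)) :
      (⟨_, L k p i ⊗ L k p j⟩ : LinProd k C (Ver k p)) ⟶ ⟨_, _⟩), comp_zero, ← Category.assoc,
      homMk_comp, ← whisker_exchange, ← homMk_comp, Category.assoc, ht₁, key']
  obtain ⟨t₂, ht₂⟩ := exists_factor (layer (𝟙 V - g) i ◁ powKerRel (𝟙 W - h) j)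
    (layer (𝟙 V - g) i ◁ powKerπ (𝟙 W - h) j) (ex2 _ _)
    (by rw [← whiskerLeft_comp, powKerRel_π, MonoidalPreadditive.whiskerLeft_zero]) _ key2
  refine ⟨t₂, ?_⟩
  have h1 : (homMk (powKerπ (𝟙 V - g) i) (𝟙 _) : (⟨_, L k p i⟩ : LinProd k C (Ver k p)) ⟶ ⟨_, L k p i⟩) ⊗ₘ
      (homMk (powKerπ (𝟙 W - h) j) (𝟙 _) : (⟨_, L k p j⟩ : LinProd k C (Ver k p)) ⟶ ⟨_, L k p j⟩) =
      (homMk (powKerπ (𝟙 V - g) i ▷ powKer (𝟙 W - h) j) (𝟙 (L k p i ⊗ L k p j)) :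
        (⟨_, L k p i ⊗ L k p j⟩ : LinProd k C (Ver k p)) ⟶ ⟨_, _⟩) ≫
      homMk (layer (𝟙 V - g) i ◁ powKerπ (𝟙 W - h) j) (𝟙 (L k p i ⊗ L k p j)) := by
    rw [homMk_tensorHom, MonoidalCategory.tensorHom_def, id_tensorHom_id, homMk_comp,
      Category.comp_id]
  rw [h1, Category.assoc, ht₂, ht₁]

/-- The entries of the tensor structure of the functor `B`. -/
def muEntry (g : V ⟶ V) (h : W ⟶ W) (i j m : Fin (p - 1)) :
    ((⟨layer (𝟙 V - g) i, L k p i⟩ : LinProd k C (Ver k p)) ⊗ ⟨layer (𝟙 W - h) j, L k p j⟩) ⟶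
        ⟨layer (𝟙 (V ⊗ W) - (g ⊗ₘ h)) m, L k p m⟩ :=
  (Equivar.exists_mu g h i j m).choose

theorem muEntry_spec (g : V ⟶ V) (h : W ⟶ W) (i j m : Fin (p - 1)) :
      ((homMk (powKerπ (𝟙 V - g) i) (𝟙 _) : (⟨_, L k p i⟩ : LinProd k C (Ver k p)) ⟶ ⟨_, L k p i⟩) ⊗ₘ
        (homMk (powKerπ (𝟙 W - h) j) (𝟙 _) : (⟨_, L k p j⟩ : LinProd k C (Ver k p)) ⟶ ⟨_, L k p j⟩)) ≫
          muEntry g h i j m = ((Equivar.can g i).tensor (Equivar.can h j)).psi m :=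
  (Equivar.exists_mu g h i j m).choose_spec

theorem hom_ext_of_tensor_blocks {X : LinProd k C (Ver k p)}
    (t t' : (⟨S ⊗ S', ⟨J ⊗ J'⟩⟩ : LinProd k C (Ver k p)) ⟶ X)
    (H : ∀ (i j : Fin (p - 1)) (β : (L k p i).as ⟶ J) (β' : (L k p j).as ⟶ J'),
      (homMk (𝟙 S ⊗ₘ 𝟙 S') (pr (β ⊗ₘ β')) :
        (⟨S ⊗ S', L k p i ⊗ L k p j⟩ : LinProd k C (Ver k p)) ⟶ ⟨S ⊗ S', ⟨J ⊗ J'⟩⟩) ≫ t =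
        homMk (𝟙 S ⊗ₘ 𝟙 S') (pr (β ⊗ₘ β')) ≫ t') : t = t' := by
  obtain ⟨N, n, γ, β, hs⟩ := exists_id_eq_sum (⟨J⟩ : Ver k p)
  obtain ⟨N', n', γ', β', hs'⟩ := exists_id_eq_sum (⟨J'⟩ : Ver k p)
  have h1 : 𝟙 (⟨S ⊗ S', ⟨J ⊗ J'⟩⟩ : LinProd k C (Ver k p)) = ∑ a, ∑ b,
      (homMk (𝟙 S ⊗ₘ 𝟙 S') (pr (γ a ⊗ₘ γ' b)) :
        (⟨S ⊗ S', ⟨J ⊗ J'⟩⟩ : LinProd k C (Ver k p)) ⟶ ⟨S ⊗ S', L k p (n a) ⊗ L k p (n' b)⟩) ≫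
      homMk (𝟙 S ⊗ₘ 𝟙 S') (pr (β a ⊗ₘ β' b)) := by
    have h2 : 𝟙 (⟨S ⊗ S', ⟨J ⊗ J'⟩⟩ : LinProd k C (Ver k p)) =
        𝟙 (⟨S, ⟨J⟩⟩ : LinProd k C (Ver k p)) ⊗ₘ 𝟙 (⟨S', ⟨J'⟩⟩ : LinProd k C (Ver k p)) :=
      (id_tensorHom_id (⟨S, ⟨J⟩⟩ : LinProd k C (Ver k p)) ⟨S', ⟨J'⟩⟩).symm
    rw [h2, id_eq_sum S hs, id_eq_sum S' hs', sum_tensor]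
    refine Finset.sum_congr rfl fun a _ => ?_
    rw [tensor_sum]
    refine Finset.sum_congr rfl fun b _ => ?_
    rw [← tensorHom_comp_tensorHom]; rfl
  rw [← Category.id_comp t, ← Category.id_comp t', h1, Preadditive.sum_comp,
    Preadditive.sum_comp]
  refine Finset.sum_congr rfl fun a _ => ?_
  rw [Preadditive.sum_comp, Preadditive.sum_comp]
  refine Finset.sum_congr rfl fun b _ => ?_
  rw [Category.assoc, Category.assoc, H]

/-- This is the characterising property of the product. It suffices to take Jordan blocks, where
both maps are pulled back from the canonical ones and the construction of `muEntry` applies. -/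
theorem sum_psi_tensor_muEntry (f : Equivar J S g) (f' : Equivar J' S' h) (m : Fin (p - 1)) :
    ∑ q : Fin (p - 1) × Fin (p - 1), (f.psi q.1 ⊗ₘ f'.psi q.2) ≫ muEntry g h q.1 q.2 m =
      (f.tensor f').psi m := by
  have hb : ∀ (i j : Fin (p - 1)) (f : Equivar (L k p i).as S g) (f' : Equivar (L k p j).as S' h),
      ∑ q : Fin (p - 1) × Fin (p - 1), (f.psi q.1 ⊗ₘ f'.psi q.2) ≫ muEntry g h q.1 q.2 m =
      (f.tensor f').psi m := by
    intro i j f f'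
    -- A map out of `L_i` has a component only in the layer with the same index.
    rw [Finset.sum_eq_single (i, j)]
    · obtain ⟨s, rfl⟩ := f.eq_pre_can
      obtain ⟨s', rfl⟩ := f'.eq_pre_can
      rw [Equivar.tensor_pre, Equivar.psi_pre, Equivar.psi_pre, Equivar.psi_pre,
        ← tensorHom_comp_tensorHom, Category.assoc, Equivar.psi_can_self, Equivar.psi_can_self,
        muEntry_spec]
      rfl
    · rintro ⟨i', j'⟩ - hq
      by_cases hi : i = i'
      · have hj : j ≠ j' := fun hj => hq (by rw [hi, hj])
        rw [f'.psi_of_ne hj, tensorHom_zero, zero_comp]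
      · rw [f.psi_of_ne hi, zero_tensorHom, zero_comp]
    · simp
  refine hom_ext_of_tensor_blocks _ _ fun i j β β' => ?_
  have h1 := hb i j (f.pre (𝟙 _) β) (f'.pre (𝟙 _) β')
  rw [Equivar.tensor_pre, Equivar.psi_pre] at h1
  refine Eq.trans ?_ h1
  rw [Preadditive.comp_sum]
  refine Finset.sum_congr rfl fun q _ => ?_
  rw [Equivar.psi_pre, Equivar.psi_pre, ← tensorHom_comp_tensorHom, Category.assoc]
  rfl

end Lax

end FrobeniusFunctor

end

noncomputable section

/-! ### The object `⊕ B_i ⊠ L_i` and epimorphic test families. -/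

namespace FrobeniusFunctor

open Verlinde LinProd Mat_Monoidal

section FamilyEpi

variable {k : Type w} [Field k]
variable {C : Type u₁} [Category.{v₁} C] [Preadditive C] [Linear k C]
variable {D : Type u₂} [Category.{v₂} D] [Preadditive D] [Linear k D]

theorem epi_homMk {X Y : C} {V W : D} (e : X ⟶ Y) [Epi e] (f : V ⟶ W) [IsIso f] :
    Epi (homMk e f : (⟨X, V⟩ : LinProd k C D) ⟶ ⟨Y, W⟩) := by
  have h1 : (homMk e f : (⟨X, V⟩ : LinProd k C D) ⟶ ⟨Y, W⟩) =
      (homMk e (𝟙 V) : (⟨X, V⟩ : LinProd k C D) ⟶ ⟨Y, V⟩) ≫ (LinProd.isoMk (Iso.refl Y) (asIso f)).hom := by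
    simp only [LinProd.isoMk, homMk_comp, Iso.refl_hom, Category.comp_id, Category.id_comp, asIso_hom]
  rw [h1]; exact epi_comp _ _

/-- Morphisms of families which are, up to a bijective relabelling, external products of
epimorphisms and isomorphisms. -/
def IsFamilyEpi {M N : Mat_ (LinProd k C D)} (f : M ⟶ N) : Prop :=
  ∃ (e : M.ι → N.ι) (φ : ∀ i, (M.X i).left ⟶ (N.X (e i)).left)
    (ψ : ∀ i, (M.X i).right ⟶ (N.X (e i)).right), Function.Bijective e ∧ (∀ i, Epi (φ i)) ∧
    (∀ i, IsIso (ψ i)) ∧ f = relabel e fun i => homMk (φ i) (ψ i)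

theorem eq_relabel {C : Type u} [Category.{v} C] [Preadditive C] {M N : Mat_ C} (f : M ⟶ N)
    (e : M.ι → N.ι) (φ : ∀ i, M.X i ⟶ N.X (e i)) (h : ∀ i, f i (e i) = φ i)
    (h' : ∀ i j, e i ≠ j → f i j = 0) : f = relabel e φ := by
  ext i j
  by_cases hij : e i = j
  · subst hij
    rw [h i, relabel, ofEntries_apply, entry, Mat_.id_apply_self, Category.comp_id]
  · rw [h' i j hij, relabel, ofEntries_apply, entry, Mat_.id_apply_of_ne _ _ _ hij, comp_zero]

theorem epi_relabel {C : Type u} [Category.{v} C] [Preadditive C] {M N : Mat_ C} (e : M.ι → N.ι)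
    (he : Function.Surjective e) (φ : ∀ i, M.X i ⟶ N.X (e i)) [∀ i, Epi (φ i)] :
    Epi (relabel e φ) where
  left_cancellation {P} t t' h := by
    ext i j
    obtain ⟨i, rfl⟩ := he i
    have := congrFun (congrFun h i) j
    rw [relabel_comp, relabel_comp] at this
    exact (cancel_epi _).1 this

theorem IsFamilyEpi.epi {M N : Mat_ (LinProd k C D)} {f : M ⟶ N} (hf : IsFamilyEpi f) : Epi f := by
  obtain ⟨e, φ, ψ, he, hφ, hψ, rfl⟩ := hf
  have : ∀ i, Epi (homMk (k := k) (φ i) (ψ i)) := fun i => epi_homMk (φ i) (ψ i)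
  exact epi_relabel e he.2 _

theorem IsFamilyEpi.id (M : Mat_ (LinProd k C D)) : IsFamilyEpi (𝟙 M) :=
  ⟨fun i => i, fun _ => 𝟙 _, fun _ => 𝟙 _, Function.bijective_id, fun _ => inferInstance,
    fun _ => inferInstance, (relabel_id M).symm⟩

/-- The explicit shape is what makes this class of epimorphisms stable under tensor products: duals
preserve the epimorphisms in the first factor, and isomorphisms tensor to isomorphisms in the
second. -/
theorem IsFamilyEpi.tensor [MonoidalCategory C] [MonoidalPreadditive C] [MonoidalLinear k C]
    [MonoidalCategory D] [MonoidalPreadditive D] [MonoidalLinear k D] [HasDuals C]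
    {M N M' N' : Mat_ (LinProd k C D)} {f : M ⟶ N} {f' : M' ⟶ N'} (hf : IsFamilyEpi f)
    (hf' : IsFamilyEpi f') : IsFamilyEpi (f ⊗ₘ f') := by
  obtain ⟨e, φ, ψ, he, hφ, hψ, rfl⟩ := hf
  obtain ⟨e', φ', ψ', he', hφ', hψ', rfl⟩ := hf'
  exact ⟨fun q => (e q.1, e' q.2), fun q => φ q.1 ⊗ₘ φ' q.2, fun q => ψ q.1 ⊗ₘ ψ' q.2,
    he.prodMap he', fun _ => inferInstance, fun _ => inferInstance, relabel_tensor _ _ _ _⟩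

end FamilyEpi

section Bl

variable {k : Type w} [Field k] {p : ℕ} [Fact p.Prime] [CharP k p]
variable {C : Type u} [Category.{v} C] [Abelian C] [Linear k C]
variable {V W V' W' : C} {g : V ⟶ V} {h : W ⟶ W} {g' : V' ⟶ V'} {h' : W' ⟶ W'}

variable (k p) in
/-- The object `⊕ B_i ⊠ L_i` attached to an endomorphism. -/
def Bl (g : V ⟶ V) : Mat_ (LinProd k C (Ver k p)) :=
  ⟨Fin (p - 1), fun i => ⟨layer (𝟙 V - g) i, L k p i⟩⟩

theorem one_sub_comm {φ : V ⟶ W} (hφ : g ≫ φ = φ ≫ h) : (𝟙 V - g) ≫ φ = φ ≫ (𝟙 W - h) := by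
  rw [Preadditive.sub_comp, Preadditive.comp_sub, hφ, Category.id_comp, Category.comp_id]

variable (k p) in
/-- The morphism induced by an equivariant morphism. -/
def Blmap (φ : V ⟶ W) (hφ : g ≫ φ = φ ≫ h) : Bl k p g ⟶ Bl k p h :=
  relabel (M := Bl k p g) (N := Bl k p h) (fun i => i)
    (fun i : Fin (p - 1) => homMk (layerMap φ (one_sub_comm hφ) i) (𝟙 _))

theorem Blmap_id : Blmap k p (𝟙 V) ((Category.comp_id g).trans (Category.id_comp g).symm) = 𝟙 _ := by
  refine Eq.trans ?_ (relabel_id (Bl k p g))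
  refine congrArg (relabel (M := Bl k p g) (N := Bl k p g) _) (funext fun i => ?_)
  rw [layerMap_id]; rfl

theorem Blmap_comp (φ : V ⟶ W) (hφ : g ≫ φ = φ ≫ h) (ψ : W ⟶ V') (hψ : h ≫ ψ = ψ ≫ g')
    (hh : g ≫ φ ≫ ψ = (φ ≫ ψ) ≫ g') :
    Blmap k p (φ ≫ ψ) hh = Blmap k p φ hφ ≫ Blmap k p ψ hψ := by
  refine Eq.trans ?_ (relabel_relabel (M := Bl k p g) (N := Bl k p h) (P := Bl k p g') _ _ _ _).symm
  refine congrArg (relabel (M := Bl k p g) (N := Bl k p g') _) (funext fun i => ?_)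
  rw [layerMap_comp φ ψ (one_sub_comm hφ) (one_sub_comm hψ)]
  exact congrArg (homMk _) (Category.comp_id _).symm

/-- Families of equivariant maps indexed by the summands of an object of `C ⊠ Ver_p`. -/
abbrev Fam (M : Mat_ (LinProd k C (Ver k p))) (g : V ⟶ V) :=
  ∀ i : M.ι, Equivar (M.X i).right.as (M.X i).left g

variable {M N : Mat_ (LinProd k C (Ver k p))}

/-- The morphism induced by a family of equivariant maps. -/
def Psi (T : Fam M g) : M ⟶ Bl k p g :=
  ofEntries (N := Bl k p g) fun i m => (T i).psi m

theorem Psi_comp_Blmap (T : Fam M g) (φ : V ⟶ W) (hφ : g ≫ φ = φ ≫ h) :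
    Psi T ≫ Blmap k p φ hφ = Psi fun i => (T i).post φ hφ := by
  ext i m
  refine (comp_relabel (Psi T) (N := Bl k p g) (P := Bl k p h) (fun i => i)
    Function.injective_id _ i m).trans ?_
  exact (Equivar.psi_post (T i) φ hφ (one_sub_comm hφ) m).symm

theorem relabel_comp_Psi (T : Fam N g) (e : M.ι → N.ι) (s : ∀ i, (M.X i).left ⟶ (N.X (e i)).left)
    (j : ∀ i, (M.X i).right.as ⟶ (N.X (e i)).right.as) :
    relabel e (fun i => homMk (s i) (pr (j i))) ≫ Psi T = Psi fun i => (T (e i)).pre (s i) (j i) := by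
  ext i m
  rw [relabel_comp]
  exact (Equivar.psi_pre (T (e i)) (s i) (j i) m).symm

theorem Psi_zero : Psi (fun _ => 0 : Fam M g) = 0 := by
  ext i m; exact Equivar.psi_zero m

variable (k p) in
/-- The source of the canonical family. -/
def canObj (g : V ⟶ V) : Mat_ (LinProd k C (Ver k p)) :=
  ⟨Fin (p - 1), fun i => ⟨powKer (𝟙 V - g) i, L k p i⟩⟩

variable (k p) in
/-- The canonical family of equivariant maps. -/
def canFam (g : V ⟶ V) : Fam (canObj k p g) g := fun i => Equivar.can g i

theorem Psi_canFam (g : V ⟶ V) : Psi (canFam k p g) =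
    relabel (M := canObj k p g) (N := Bl k p g) (fun i => i)
      (fun i : Fin (p - 1) => homMk (powKerπ (𝟙 V - g) i) (𝟙 _)) := by
  refine eq_relabel _ _ _ (fun i : Fin (p - 1) => Equivar.psi_can_self g i)
    (fun (i j : Fin (p - 1)) hij => Equivar.psi_of_ne hij _)

theorem isFamilyEpi_canFam (g : V ⟶ V) : IsFamilyEpi (Psi (canFam k p g)) :=
  ⟨fun i => i, fun i : Fin (p - 1) => powKerπ (𝟙 V - g) i, fun i : Fin (p - 1) => 𝟙 (L k p i),
    Function.bijective_id, fun i : Fin (p - 1) => inferInstanceAs (Epi (powKerπ (𝟙 V - g) i)),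
    fun i : Fin (p - 1) => inferInstanceAs (IsIso (𝟙 (L k p i))), Psi_canFam g⟩

section Monoidal

variable [MonoidalCategory C] [MonoidalPreadditive C] [MonoidalLinear k C]

/-- The tensor product of families. -/
def Fam.tensor (T : Fam M g) (T' : Fam N h) : Fam (M ⊗ N) (g ⊗ₘ h) :=
  fun q => (T q.1).tensor (T' q.2)

variable (k p C) in
/-- The equivariant map `𝟙 ⊗ 𝟙 ⟶ 𝟙`. -/
def unitEquivar : Equivar (𝟙_ (FDRep k (Multiplicative (ZMod p)))) (𝟙_ C) (𝟙 (𝟙_ C)) where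
  toFun := LinearMap.toSpanSingleton k (𝟙_ C ⟶ 𝟙_ C) (𝟙 _)
  comm _ := (Category.comp_id _).symm

variable [HasDuals C]

variable (k p) in
/-- The tensor structure of `B`. -/
def mu (g : V ⟶ V) (h : W ⟶ W) : Bl k p g ⊗ Bl k p h ⟶ Bl k p (g ⊗ₘ h) :=
  ofEntries (M := Bl k p g ⊗ Bl k p h) (N := Bl k p (g ⊗ₘ h)) fun q m => muEntry g h q.1 q.2 m

theorem Psi_tensor_mu (T : Fam M g) (T' : Fam N h) :
    (Psi T ⊗ₘ Psi T') ≫ mu k p g h = Psi (Fam.tensor T T') := by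
  refine Mat_.hom_ext _ _ fun q m => ?_
  refine (Mat_.comp_apply _ _ q m).trans ?_
  refine Eq.trans ?_ (sum_psi_tensor_muEntry (T q.1) (T' q.2) m)
  refine Finset.sum_congr rfl fun r _ => ?_
  exact congrArg (fun t => t ≫ muEntry g h r.1 r.2 m) (tensorHom_apply (Psi T) (Psi T') q r)

end Monoidal

end Bl

end FrobeniusFunctor

end

noncomputable section

/-! ### Coherence of the product, tested on canonical families. -/

namespace FrobeniusFunctor

open Verlinde LinProd Mat_Monoidal Functor.LaxMonoidal

section TensorExt

variable {k : Type w} [Field k] {p : ℕ} [Fact p.Prime]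
variable {C : Type u} [Category.{v} C] [Abelian C] [Linear k C]
variable {J J' J'' : FDRep k (Multiplicative (ZMod p))} {S V : C} {g : V ⟶ V}

theorem Equivar.tensor_ext₃ {f f' : Equivar ((J ⊗ J') ⊗ J'') S g}
    (hf : ∀ (a : J) (b : J') (c : J''),
      f.toFun ((a ⊗ₜ[k] b) ⊗ₜ[k] c : ((J : Type w) ⊗[k] (J' : Type w)) ⊗[k] (J'' : Type w)) =
      f'.toFun ((a ⊗ₜ[k] b) ⊗ₜ[k] c : ((J : Type w) ⊗[k] (J' : Type w)) ⊗[k] (J'' : Type w))) :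
    f = f' :=
  Equivar.ext (TensorProduct.ext_threefold (R := k) (M := J) (N := J') (P := J'') hf)

theorem Equivar.unit_tensor_ext {f f' : Equivar (𝟙_ (FDRep k (Multiplicative (ZMod p))) ⊗ J) S g}
    (hf : ∀ (a : J), f.toFun ((1 : k) ⊗ₜ[k] a : k ⊗[k] (J : Type w)) =
      f'.toFun ((1 : k) ⊗ₜ[k] a : k ⊗[k] (J : Type w))) : f = f' := by
  refine Equivar.ext (TensorProduct.ext (R := k) (M := k) (N := J) (LinearMap.ext_ring ?_))
  exact LinearMap.ext hf

theorem Equivar.tensor_unit_ext {f f' : Equivar (J ⊗ 𝟙_ (FDRep k (Multiplicative (ZMod p)))) S g}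
    (hf : ∀ (a : J), f.toFun (a ⊗ₜ[k] (1 : k) : (J : Type w) ⊗[k] k) =
      f'.toFun (a ⊗ₜ[k] (1 : k) : (J : Type w) ⊗[k] k)) : f = f' := by
  refine Equivar.ext (TensorProduct.ext (R := k) (M := J) (N := k) ?_)
  exact LinearMap.ext fun a => LinearMap.ext_ring (hf a)

end TensorExt

section Lax

variable {k : Type w} [Field k] {p : ℕ} [Fact p.Prime] [CharP k p]
variable {C : Type u} [Category.{v} C] [Abelian C] [Linear k C] [MonoidalCategory C]
  [MonoidalPreadditive C] [MonoidalLinear k C]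
variable {C₀ : Type u₁} [Category.{v₁} C₀] [MonoidalCategory C₀]
variable (P : C₀ ⥤ C) (g : P ⟶ P)

variable (k p) in
/-- The functor `X ↦ ⊕ B_i(P(X)) ⊠ L_i` for a functor `P` with an endomorphism `g`. -/
def blFunctor : C₀ ⥤ Mat_ (LinProd k C (Ver k p)) where
  obj X := Bl k p (g.app X)
  map f := Blmap k p (P.map f) (g.naturality f).symm
  map_id X := by
    have : ∀ (t : P.obj X ⟶ P.obj X) (h : g.app X ≫ t = t ≫ g.app X),
        t = 𝟙 _ → Blmap k p t h = 𝟙 _ := by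
      rintro t h rfl; exact Blmap_id
    exact this _ _ (P.map_id X)
  map_comp {X Y Z} f f' := by
    have : ∀ (t : P.obj X ⟶ P.obj Z) (h : g.app X ≫ t = t ≫ g.app Z),
        t = P.map f ≫ P.map f' → Blmap k p t h =
          Blmap k p _ (g.naturality f).symm ≫ Blmap k p _ (g.naturality f').symm := by
      rintro t h rfl; exact Blmap_comp _ _ _ _ _
    exact this _ _ (P.map_comp f f')

variable [P.LaxMonoidal] [NatTrans.IsMonoidal g]
variable {M N Q : Mat_ (LinProd k C (Ver k p))} {X Y Z : C₀}

theorem μ_equivariant (X Y : C₀) :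
    (g.app X ⊗ₘ g.app Y) ≫ μ P X Y = μ P X Y ≫ g.app (X ⊗ Y) :=
  (NatTrans.IsMonoidal.tensor X Y).symm

theorem ε_equivariant : 𝟙 (𝟙_ C) ≫ ε P = ε P ≫ g.app (𝟙_ C₀) := by
  rw [Category.id_comp, NatTrans.IsMonoidal.unit]

variable {g} in
/-- The product of families for a lax monoidal functor. -/
def Fam.mul (T : Fam M (g.app X)) (T' : Fam N (g.app Y)) : Fam (M ⊗ N) (g.app (X ⊗ Y)) :=
  fun q => (Fam.tensor T T' q).post (μ P X Y) (μ_equivariant P g X Y)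

variable (k p) in
/-- The action of the functor on morphisms. -/
abbrev blMap {X Y : C₀} (f : X ⟶ Y) : Bl k p (g.app X) ⟶ Bl k p (g.app Y) :=
  Blmap k p (P.map f) (g.naturality f).symm

variable {P g}

variable (k p P g) in
/-- The unit family for a lax monoidal functor. -/
def unitTest : Fam (𝟙_ (Mat_ (LinProd k C (Ver k p)))) (g.app (𝟙_ C₀)) :=
  fun _ => (unitEquivar k p C).post (ε P) (ε_equivariant P g)

variable [HasDuals C]

variable (k p P g) in
/-- The tensor structure of the functor. -/
def blMu (X Y : C₀) : Bl k p (g.app X) ⊗ Bl k p (g.app Y) ⟶ Bl k p (g.app (X ⊗ Y)) :=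
  mu k p (g.app X) (g.app Y) ≫ Blmap k p (μ P X Y) (μ_equivariant P g X Y)

theorem Psi_tensor_blMu (T : Fam M (g.app X)) (T' : Fam N (g.app Y)) :
    (Psi T ⊗ₘ Psi T') ≫ blMu k p P g X Y = Psi (Fam.mul P T T') := by
  rw [blMu, ← Category.assoc, Psi_tensor_mu, Psi_comp_Blmap]; rfl

theorem associator_comp_Psi {V : C} {h : V ⟶ V} (T : Fam (M ⊗ (N ⊗ Q)) h) :
    (α_ M N Q).hom ≫ Psi T = Psi (M := (M ⊗ N) ⊗ Q) fun q =>
      (T (q.1.1, (q.1.2, q.2))).pre (α_ (M.X q.1.1).left (N.X q.1.2).left (Q.X q.2).left).hom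
        (α_ (M.X q.1.1).right.as (N.X q.1.2).right.as (Q.X q.2).right.as).hom :=
  relabel_comp_Psi (M := (M ⊗ N) ⊗ Q) (N := M ⊗ (N ⊗ Q)) T (fun q => (q.1.1, (q.1.2, q.2)))
    (fun q => (α_ (M.X q.1.1).left (N.X q.1.2).left (Q.X q.2).left).hom)
    (fun q => (α_ (M.X q.1.1).right.as (N.X q.1.2).right.as (Q.X q.2).right.as).hom)

theorem leftUnitor_comp_Psi {V : C} {h : V ⟶ V} (T : Fam M h) :
    (λ_ M).hom ≫ Psi T = Psi (M := 𝟙_ _ ⊗ M) fun q =>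
      (T q.2).pre (λ_ (M.X q.2).left).hom (λ_ (M.X q.2).right.as).hom :=
  relabel_comp_Psi (M := 𝟙_ _ ⊗ M) T (fun q => q.2)
    (fun q => (λ_ (M.X q.2).left).hom) (fun q => (λ_ (M.X q.2).right.as).hom)

theorem rightUnitor_comp_Psi {V : C} {h : V ⟶ V} (T : Fam M h) :
    (ρ_ M).hom ≫ Psi T = Psi (M := M ⊗ 𝟙_ _) fun q =>
      (T q.1).pre (ρ_ (M.X q.1).left).hom (ρ_ (M.X q.1).right.as).hom :=
  relabel_comp_Psi (M := M ⊗ 𝟙_ _) T (fun q => q.1)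
    (fun q => (ρ_ (M.X q.1).left).hom) (fun q => (ρ_ (M.X q.1).right.as).hom)

/-- After precomposition with the epimorphic canonical families both sides are `Psi` of families of
equivariant maps. These are compared on pure tensors, where the claim is the naturality of `μ P`.
The other coherence statements are proved in the same way. -/
theorem blMu_natural {X' Y' : C₀} (f : X ⟶ Y) (f' : X' ⟶ Y') :
    (blMap k p P g f ⊗ₘ blMap k p P g f') ≫ blMu k p P g Y Y' =
      blMu k p P g X X' ≫ blMap k p P g (f ⊗ₘ f') := by
  have := ((isFamilyEpi_canFam (k := k) (p := p) (g.app X)).tensor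
    (isFamilyEpi_canFam (k := k) (p := p) (g.app X'))).epi
  rw [← cancel_epi (Psi (canFam k p (g.app X)) ⊗ₘ Psi (canFam k p (g.app X')))]
  rw [← Category.assoc, tensorHom_comp_tensorHom, Psi_comp_Blmap, Psi_comp_Blmap, Psi_tensor_blMu,
    ← Category.assoc, Psi_tensor_blMu, Psi_comp_Blmap]
  refine congrArg Psi (funext fun q => Equivar.tensor_ext fun a b => ?_)
  refine (?_ : ((_ ≫ P.map f) ⊗ₘ (_ ≫ P.map f')) ≫ μ P Y Y' =
    ((_ ⊗ₘ _) ≫ μ P X X') ≫ P.map (f ⊗ₘ f'))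
  rw [← tensorHom_comp_tensorHom, Category.assoc, Category.assoc, μ_natural]

theorem Fam.mul_assoc (T : Fam M (g.app X)) (T' : Fam N (g.app Y)) (T'' : Fam Q (g.app Z)) :
    (fun q => (Fam.mul P (Fam.mul P T T') T'' q).post (P.map (α_ X Y Z).hom)
      (g.naturality (α_ X Y Z).hom).symm) = fun q : ((M ⊗ N) ⊗ Q).ι =>
      (Fam.mul P T (Fam.mul P T' T'') (q.1.1, (q.1.2, q.2))).pre
        (α_ (M.X q.1.1).left (N.X q.1.2).left (Q.X q.2).left).hom
        (α_ (M.X q.1.1).right.as (N.X q.1.2).right.as (Q.X q.2).right.as).hom := by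
  funext ⟨⟨i, j⟩, l⟩
  refine Equivar.tensor_ext₃ fun a b c => ?_
  have h1 : ∀ {A B D : C} (x : A ⟶ P.obj X) (y : B ⟶ P.obj Y) (z : D ⟶ P.obj Z),
      (((((x ⊗ₘ y) ≫ μ P X Y) ⊗ₘ z) ≫ μ P (X ⊗ Y) Z) ≫ P.map (α_ X Y Z).hom = (α_ _ _ _).hom ≫
      (x ⊗ₘ ((y ⊗ₘ z) ≫ μ P Y Z)) ≫ μ P X (Y ⊗ Z)) := by
    intro A B D x y z
    rw [← Category.comp_id z, ← tensorHom_comp_tensorHom,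
      Category.assoc, Category.assoc, tensorHom_id, associativity,
      ← Category.comp_id x, ← tensorHom_comp_tensorHom,
      Category.assoc, Category.comp_id, Category.comp_id, id_tensorHom,
      associator_naturality_assoc]
  exact h1 ((T i).toFun a) ((T' j).toFun b) ((T'' l).toFun c)

theorem blMu_assoc (X Y Z : C₀) :
    (blMu k p P g X Y ⊗ₘ 𝟙 _) ≫ blMu k p P g (X ⊗ Y) Z ≫ blMap k p P g (α_ X Y Z).hom =
      (α_ (Bl k p (g.app X)) (Bl k p (g.app Y)) (Bl k p (g.app Z))).hom ≫
        (𝟙 _ ⊗ₘ blMu k p P g Y Z) ≫ blMu k p P g X (Y ⊗ Z) := by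
  have := (((isFamilyEpi_canFam (k := k) (p := p) (g.app X)).tensor
    (isFamilyEpi_canFam (k := k) (p := p) (g.app Y))).tensor
      (isFamilyEpi_canFam (k := k) (p := p) (g.app Z))).epi
  rw [← cancel_epi ((Psi (canFam k p (g.app X)) ⊗ₘ Psi (canFam k p (g.app Y))) ⊗ₘ
    Psi (canFam k p (g.app Z)))]
  rw [← Category.assoc, tensorHom_comp_tensorHom, Psi_tensor_blMu, Category.comp_id,
    ← Category.assoc, Psi_tensor_blMu, Psi_comp_Blmap, associator_naturality_assoc,
    ← Category.assoc (_ ⊗ₘ (_ ⊗ₘ _)), tensorHom_comp_tensorHom, Psi_tensor_blMu, Category.comp_id,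
    Psi_tensor_blMu, associator_comp_Psi]
  exact congrArg Psi (Fam.mul_assoc _ _ _)

variable (k p P g) in
/-- The unit structure of the functor. -/
def blEps : 𝟙_ (Mat_ (LinProd k C (Ver k p))) ⟶ Bl k p (g.app (𝟙_ C₀)) := Psi (unitTest k p P g)

theorem blMu_left_unit (X : C₀) : (λ_ (Bl k p (g.app X))).hom =
    (blEps k p P g ⊗ₘ 𝟙 _) ≫ blMu k p P g (𝟙_ C₀) X ≫ blMap k p P g (λ_ X).hom := by
  have := ((IsFamilyEpi.id (𝟙_ (Mat_ (LinProd k C (Ver k p))))).tensor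
    (isFamilyEpi_canFam (k := k) (p := p) (g.app X))).epi
  rw [← cancel_epi (𝟙 (𝟙_ _) ⊗ₘ Psi (canFam k p (g.app X)))]
  rw [id_tensorHom, leftUnitor_naturality, ← id_tensorHom, ← Category.assoc (_ ⊗ₘ _),
    tensorHom_comp_tensorHom, Category.id_comp, Category.comp_id, blEps,
    ← Category.assoc, Psi_tensor_blMu, Psi_comp_Blmap, leftUnitor_comp_Psi]
  refine congrArg Psi (funext fun q => Equivar.unit_tensor_ext fun a => ?_)
  have h1 : toLin (λ_ ((canObj k p (g.app X)).X q.2).right.as).hom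
      ((1 : k) ⊗ₜ[k] a : k ⊗[k] (((canObj k p (g.app X)).X q.2).right.as : Type w)) = a :=
    one_smul k a
  refine (congrArg (fun t => (λ_ _).hom ≫ (canFam k p (g.app X) q.2).toFun t) h1).trans ?_
  refine (?_ : _ = (((((1 : k) • 𝟙 (𝟙_ C)) ≫ ε P) ⊗ₘ _) ≫ μ P _ _) ≫ P.map _)
  rw [one_smul, Category.id_comp, Category.assoc, MonoidalCategory.tensorHom_def', Category.assoc,
    ← left_unitality, leftUnitor_naturality]

theorem blMu_right_unit (X : C₀) : (ρ_ (Bl k p (g.app X))).hom =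
    (𝟙 _ ⊗ₘ blEps k p P g) ≫ blMu k p P g X (𝟙_ C₀) ≫ blMap k p P g (ρ_ X).hom := by
  have := ((isFamilyEpi_canFam (k := k) (p := p) (g.app X)).tensor
    (IsFamilyEpi.id (𝟙_ (Mat_ (LinProd k C (Ver k p)))))).epi
  rw [← cancel_epi (Psi (canFam k p (g.app X)) ⊗ₘ 𝟙 (𝟙_ _))]
  rw [tensorHom_id, rightUnitor_naturality, ← tensorHom_id, ← Category.assoc (_ ⊗ₘ _),
    tensorHom_comp_tensorHom, Category.id_comp, Category.comp_id, blEps,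
    ← Category.assoc, Psi_tensor_blMu, Psi_comp_Blmap, rightUnitor_comp_Psi]
  refine congrArg Psi (funext fun q => Equivar.tensor_unit_ext fun a => ?_)
  have h1 : toLin (ρ_ ((canObj k p (g.app X)).X q.1).right.as).hom
      (a ⊗ₜ[k] (1 : k) : (((canObj k p (g.app X)).X q.1).right.as : Type w) ⊗[k] k) = a :=
    one_smul k a
  refine (congrArg (fun t => (ρ_ _).hom ≫ (canFam k p (g.app X) q.1).toFun t) h1).trans ?_
  refine (?_ : _ = ((_ ⊗ₘ (((1 : k) • 𝟙 (𝟙_ C)) ≫ ε P)) ≫ μ P _ _) ≫ P.map _)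
  rw [one_smul, Category.id_comp, Category.assoc, MonoidalCategory.tensorHom_def, Category.assoc,
    ← right_unitality, rightUnitor_naturality]

end Lax

end FrobeniusFunctor

end

noncomputable section

/-! ### The lax monoidal functor `blFunctor`. -/

namespace FrobeniusFunctor

open Verlinde LinProd Mat_Monoidal Functor.LaxMonoidal

section Lax

variable {k : Type w} [Field k] {p : ℕ} [Fact p.Prime] [CharP k p]
variable {C : Type u} [Category.{v} C] [Abelian C] [Linear k C] [MonoidalCategory C]
  [MonoidalPreadditive C] [MonoidalLinear k C]
variable {C₀ : Type u₁} [Category.{v₁} C₀] [MonoidalCategory C₀]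
variable (P : C₀ ⥤ C) (g : P ⟶ P)

variable {P g} in
/-- The morphism to a value of the functor induced by a family of equivariant maps. -/
def tst {M : Mat_ (LinProd k C (Ver k p))} {X : C₀} (T : Fam M (g.app X)) :
    M ⟶ (blFunctor k p P g).obj X := Psi T

variable [P.LaxMonoidal] [NatTrans.IsMonoidal g] [HasDuals C]

variable (k p) in
/-- The tensor structure of the functor. -/
def blTensor (X Y : C₀) : (blFunctor k p P g).obj X ⊗ (blFunctor k p P g).obj Y ⟶
    (blFunctor k p P g).obj (X ⊗ Y) := blMu k p P g X Y

variable (k p) in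
/-- The unit structure of the functor. -/
def blUnit : 𝟙_ (Mat_ (LinProd k C (Ver k p))) ⟶ (blFunctor k p P g).obj (𝟙_ C₀) := blEps k p P g

theorem blTensor_natural {X Y X' Y' : C₀} (f : X ⟶ Y) (f' : X' ⟶ Y') :
    ((blFunctor k p P g).map f ⊗ₘ (blFunctor k p P g).map f') ≫ blTensor k p P g Y Y' =
      blTensor k p P g X X' ≫ (blFunctor k p P g).map (f ⊗ₘ f') :=
  blMu_natural f f'

theorem blTensor_assoc (X Y Z : C₀) :
    (blTensor k p P g X Y ⊗ₘ 𝟙 ((blFunctor k p P g).obj Z)) ≫ blTensor k p P g (X ⊗ Y) Z ≫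
        (blFunctor k p P g).map (α_ X Y Z).hom =
      (α_ ((blFunctor k p P g).obj X) ((blFunctor k p P g).obj Y) ((blFunctor k p P g).obj Z)).hom ≫
        (𝟙 ((blFunctor k p P g).obj X) ⊗ₘ blTensor k p P g Y Z) ≫ blTensor k p P g X (Y ⊗ Z) :=
  blMu_assoc X Y Z

theorem blTensor_left_unit (X : C₀) : (λ_ ((blFunctor k p P g).obj X)).hom =
    (blUnit k p P g ⊗ₘ 𝟙 ((blFunctor k p P g).obj X)) ≫ blTensor k p P g (𝟙_ C₀) X ≫
      (blFunctor k p P g).map (λ_ X).hom :=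
  blMu_left_unit X

theorem blTensor_right_unit (X : C₀) : (ρ_ ((blFunctor k p P g).obj X)).hom =
    (𝟙 ((blFunctor k p P g).obj X) ⊗ₘ blUnit k p P g) ≫ blTensor k p P g X (𝟙_ C₀) ≫
      (blFunctor k p P g).map (ρ_ X).hom :=
  blMu_right_unit X

variable (k p) in
/-- The lax monoidal structure of the functor. -/
@[reducible]
def blLax : (blFunctor k p P g).LaxMonoidal :=
  Functor.LaxMonoidal.ofTensorHom (F := blFunctor k p P g) (blUnit k p P g) (blTensor k p P g)
    (blTensor_natural P g) (blTensor_assoc P g) (blTensor_left_unit P g) (blTensor_right_unit P g)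

instance : (blFunctor k p P g).LaxMonoidal := blLax k p P g

variable {P g} {M N Q : Mat_ (LinProd k C (Ver k p))} {X Y : C₀}

/-- With `tst_map`, `tst_unitTest` and the epimorphism given by `canFam`, this rule suffices for
computations with the lax structure, without recourse to the construction of the product. -/
theorem tst_μ (T : Fam M (g.app X)) (T' : Fam N (g.app Y)) :
    (tst T ⊗ₘ tst T') ≫ μ (blFunctor k p P g) X Y = tst (Fam.mul P T T') :=
  Psi_tensor_blMu T T'

theorem tst_map (T : Fam M (g.app X)) (f : X ⟶ Y) :
    tst T ≫ (blFunctor k p P g).map f = tst fun i => (T i).post (P.map f) (g.naturality f).symm :=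
  Psi_comp_Blmap T _ _

theorem tst_unitTest : tst (unitTest k p P g) = ε (blFunctor k p P g) := rfl

variable (X) in
theorem isFamilyEpi_tst : IsFamilyEpi (tst (P := P) (canFam k p (g.app X))) :=
  isFamilyEpi_canFam (g.app X)

instance : Epi (tst (P := P) (canFam k p (g.app X))) := (isFamilyEpi_tst X).epi

end Lax
end FrobeniusFunctor
end

noncomputable section

/-! ### A criterion for a lax monoidal functor to be strong on a dual pair. -/

section LaxDuality

open Functor.LaxMonoidal ExactPairing

variable {C₀ : Type u₁} [Category.{v₁} C₀] [MonoidalCategory C₀]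
variable {T : Type u₂} [Category.{v₂} T] [MonoidalCategory T]
variable (F : C₀ ⥤ T) [F.LaxMonoidal] (X Y : C₀) [ExactPairing X Y]

/-- Contraction of `Y` and `X`. -/
def contract (U : C₀) : Y ⊗ (X ⊗ U) ⟶ U := (α_ Y X U).inv ≫ ε_ X Y ▷ U ≫ (λ_ U).hom

/-- The action of `X ⊗ Y` on `X ⊗ U`. -/
def pairAct (U : C₀) : (X ⊗ Y) ⊗ (X ⊗ U) ⟶ X ⊗ U := (α_ X Y (X ⊗ U)).hom ≫ X ◁ contract X Y U

/-- The action of `X ⊗ Y` on `X`. -/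
def pairAct₀ : (X ⊗ Y) ⊗ X ⟶ X := (α_ X Y X).hom ≫ X ◁ ε_ X Y ≫ (ρ_ X).hom

theorem pairAct_unit : (X ⊗ Y) ◁ (ρ_ X).hom ≫ pairAct₀ X Y = pairAct X Y (𝟙_ C₀) ≫ (ρ_ X).hom := by
  rw [pairAct₀, pairAct, contract]
  monoidal

/-- The factor `U` is a bystander; nilpotency of the action on the first factor will pass to the
tensor product for this reason. -/
theorem pairAct_eq (U : C₀) : pairAct X Y U = (α_ (X ⊗ Y) X U).inv ≫ pairAct₀ X Y ▷ U := by
  rw [pairAct₀, pairAct, contract]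
  monoidal

theorem coevaluation_pairAct (U : C₀) :
    η_ X Y ▷ (X ⊗ U) ≫ pairAct X Y U = (λ_ (X ⊗ U)).hom := by
  have h1 : η_ X Y ▷ X ≫ pairAct₀ X Y = (λ_ X).hom := by
    rw [pairAct₀, evaluation_coevaluation_assoc]; simp
  have h2 := congrArg (· ▷ U) h1
  simp only [comp_whiskerRight] at h2
  rw [pairAct_eq, whiskerRight_tensor, Category.assoc, Category.assoc, Iso.hom_inv_id_assoc, h2]
  simp


/-- The action on `F (X ⊗ U)` of a morphism to `F (X ⊗ Y)`. -/
def laxAct (U : C₀) (m : 𝟙_ T ⟶ F.obj (X ⊗ Y)) : F.obj (X ⊗ U) ⟶ F.obj (X ⊗ U) :=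
  (λ_ _).inv ≫ m ▷ _ ≫ μ F _ _ ≫ F.map (pairAct X Y U)

/-- The action on `F X` of a morphism to `F (X ⊗ Y)`. -/
def laxAct₀ (m : 𝟙_ T ⟶ F.obj (X ⊗ Y)) : F.obj X ⟶ F.obj X :=
  (λ_ _).inv ≫ m ▷ _ ≫ μ F _ _ ≫ F.map (pairAct₀ X Y)

theorem laxAct_unit (m : 𝟙_ T ⟶ F.obj (X ⊗ Y)) :
    F.map (ρ_ X).hom ≫ laxAct₀ F X Y m = laxAct F X Y (𝟙_ C₀) m ≫ F.map (ρ_ X).hom := by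
  have h := pairAct_unit X Y
  rw [laxAct₀, laxAct, Category.assoc, Category.assoc, Category.assoc, ← F.map_comp, ← h,
    F.map_comp, ← μ_natural_right_assoc, leftUnitor_inv_naturality_assoc, whisker_exchange_assoc]

/-- The coevaluation corresponds to the identity operator on `X`, by the triangle identity. -/
theorem laxAct_coevaluation (U : C₀) : laxAct F X Y U (ε F ≫ F.map (η_ X Y)) = 𝟙 _ := by
  rw [laxAct, comp_whiskerRight, Category.assoc, μ_natural_left_assoc, ← F.map_comp,
    coevaluation_pairAct, ← left_unitality, Iso.inv_hom_id]

variable {F X Y}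
variable {e : F.obj Y ⊗ F.obj X ⟶ 𝟙_ T} {c : 𝟙_ T ⟶ F.obj X ⊗ F.obj Y}

theorem μ_contract (he : e ≫ ε F = μ F Y X ≫ F.map (ε_ X Y)) (U : C₀) :
    F.obj Y ◁ μ F X U ≫ μ F Y (X ⊗ U) ≫ F.map (contract X Y U) =
      (α_ _ _ _).inv ≫ e ▷ F.obj U ≫ (λ_ _).hom := by
  rw [contract, F.map_comp, F.map_comp, associativity_inv_assoc, ← μ_natural_left_assoc,
    ← comp_whiskerRight_assoc, ← he, comp_whiskerRight, Category.assoc, left_unitality]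

variable (F X Y c) in
/-- The candidate inverse of the tensor structure. -/
def laxInv (U : C₀) : F.obj (X ⊗ U) ⟶ F.obj X ⊗ F.obj U :=
  (λ_ _).inv ≫ c ▷ _ ≫ (α_ _ _ _).hom ≫ F.obj X ◁ (μ F Y (X ⊗ U) ≫ F.map (contract X Y U))

/-- Only one triangle identity between `c` and `e` is needed here, because contraction after `μ` is
`e` itself. The composite in the other order is not yet known to be the identity. -/
theorem μ_laxInv (he : e ≫ ε F = μ F Y X ≫ F.map (ε_ X Y))
    (hc : c ▷ F.obj X ≫ (α_ _ _ _).hom ≫ F.obj X ◁ e = (λ_ _).hom ≫ (ρ_ _).inv) (U : C₀) :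
    μ F X U ≫ laxInv F X Y c U = 𝟙 _ := by
  rw [laxInv, leftUnitor_inv_naturality_assoc, whisker_exchange_assoc,
    associator_naturality_right_assoc, ← whiskerLeft_comp, μ_contract he]
  have h1 := congrArg (fun t => (λ_ (F.obj X ⊗ F.obj U)).inv ≫ (α_ _ _ _).inv ≫
    t ▷ F.obj U ≫ (ρ_ _).hom ▷ F.obj U) hc
  simp only [comp_whiskerRight, Category.assoc] at h1
  refine Eq.trans ?_ (h1.trans ?_)
  · monoidal
  · monoidal

theorem laxInv_μ (U : C₀) : laxInv F X Y c U ≫ μ F X U = laxAct F X Y U (c ≫ μ F X Y) := by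
  rw [laxInv, laxAct, pairAct, F.map_comp, comp_whiskerRight]
  simp only [whiskerLeft_comp, Category.assoc, μ_natural_right, associativity_assoc]

variable [Preadditive T] [MonoidalPreadditive T]

theorem laxAct_sub (U : C₀) (m m' : 𝟙_ T ⟶ F.obj (X ⊗ Y)) :
    laxAct F X Y U (m - m') = laxAct F X Y U m - laxAct F X Y U m' := by
  have h : (m - m') ▷ F.obj (X ⊗ U) = m ▷ F.obj (X ⊗ U) - m' ▷ F.obj (X ⊗ U) :=
    (tensorRight (F.obj (X ⊗ U))).map_sub
  rw [laxAct, h, Preadditive.sub_comp, Preadditive.comp_sub]; rfl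

/-- Multiplication by `μ(c)` is the composite of the candidate inverse with `μ`, so the defect of
the coevaluation measures the failure of that inverse. -/
theorem laxAct_defect (U : C₀) :
    laxAct F X Y U (ε F ≫ F.map (η_ X Y) - c ≫ μ F X Y) = 𝟙 _ - laxInv F X Y c U ≫ μ F X U := by
  rw [laxAct_sub, laxAct_coevaluation, laxInv_μ]

/-- The right unitor of `F X` factors through `μ F X (𝟙_ C₀)`, on whose image the defect vanishes
because `laxInv` is inverse to `μ` on that side. -/
theorem laxAct₀_defect (he : e ≫ ε F = μ F Y X ≫ F.map (ε_ X Y))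
    (hc : c ▷ F.obj X ≫ (α_ _ _ _).hom ≫ F.obj X ◁ e = (λ_ _).hom ≫ (ρ_ _).inv) :
    laxAct₀ F X Y (ε F ≫ F.map (η_ X Y) - c ≫ μ F X Y) = 0 := by
  rw [← cancel_epi (ρ_ (F.obj X)).hom, right_unitality, Category.assoc, Category.assoc,
    laxAct_unit, laxAct_defect, comp_zero,
    Preadditive.sub_comp, Category.id_comp,
    Preadditive.comp_sub, Category.assoc, reassoc_of% (μ_laxInv he hc (𝟙_ C₀)), sub_self, comp_zero]

/-- The action of the defect is idempotent, being the identity minus `laxInv ≫ μ`. If it is also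
nilpotent it vanishes, and `laxInv` is a two-sided inverse. -/
theorem isIso_μ_of_pow_eq_zero (he : e ≫ ε F = μ F Y X ≫ F.map (ε_ X Y))
    (hc : c ▷ F.obj X ≫ (α_ _ _ _).hom ≫ F.obj X ◁ e = (λ_ _).hom ≫ (ρ_ _).inv) (U : C₀) (n : ℕ)
    (hn : End.of (laxAct F X Y U (ε F ≫ F.map (η_ X Y) - c ≫ μ F X Y)) ^ n = 0) :
    IsIso (μ F X U) := by
  have h1 := μ_laxInv he hc U
  have h2 : IsIdempotentElem (End.of (laxAct F X Y U (ε F ≫ F.map (η_ X Y) - c ≫ μ F X Y))) := by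
    rw [laxAct_defect]
    change (𝟙 _ - _) ≫ (𝟙 _ - _) = _
    simp only [Preadditive.sub_comp, Preadditive.comp_sub, Category.id_comp, Category.comp_id,
      Category.assoc, reassoc_of% h1, sub_self, sub_zero]
  have h3 : laxAct F X Y U (ε F ≫ F.map (η_ X Y) - c ≫ μ F X Y) = 0 := by
    have := h2.pow_succ_eq n
    rw [pow_succ, hn, zero_mul] at this
    exact this.symm
  rw [laxAct_defect, sub_eq_zero] at h3
  exact ⟨laxInv F X Y c U, h1, h3.symm⟩

end LaxDuality

end

noncomputable section

/-! ### Nilpotent actions, and modification of an invariant by a norm. -/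

namespace FrobeniusFunctor

section Iterate

variable {C : Type u} [Category.{v} C] [MonoidalCategory C] {S V V' : C}

/-- The property `Q` holds after letting `a : S ⊗ V ⟶ V` act `r` times on a generalized element. -/
def After (a : S ⊗ V ⟶ V) (Q : ∀ R : C, (R ⟶ V) → Prop) : ℕ → ∀ R : C, (R ⟶ V) → Prop
  | 0, R, v => Q R v
  | r + 1, R, v => After a Q r (S ⊗ R) (S ◁ v ≫ a)

theorem After.mono {a : S ⊗ V ⟶ V} {Q Q' : ∀ R : C, (R ⟶ V) → Prop}
    (h : ∀ R v, Q R v → Q' R v) {r : ℕ} {R : C} {v : R ⟶ V} (hv : After a Q r R v) :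
    After a Q' r R v := by
  induction r generalizing R v with
  | zero => exact h _ _ hv
  | succ r ih => exact ih hv

theorem After.add {a : S ⊗ V ⟶ V} {Q : ∀ R : C, (R ⟶ V) → Prop} {s r : ℕ} {R : C} {v : R ⟶ V}
    (hv : After a (After a Q s) r R v) : After a Q (r + s) R v := by
  induction r generalizing R v with
  | zero => rw [Nat.zero_add]; exact hv
  | succ r ih => rw [Nat.succ_add]; exact ih hv

/-- Iterated actions are compatible with morphisms of modules, so vanishing in `V'` means landing in
the kernel of `φ`. -/
theorem After.of_comp {a : S ⊗ V ⟶ V} {a' : S ⊗ V' ⟶ V'} (φ : V ⟶ V')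
    (hφ : S ◁ φ ≫ a' = a ≫ φ) {Q : ∀ R : C, (R ⟶ V') → Prop} {r : ℕ} {R : C} {v : R ⟶ V}
    (hv : After a' Q r R (v ≫ φ)) : After a (fun R v => Q R (v ≫ φ)) r R v := by
  induction r generalizing R v with
  | zero => exact hv
  | succ r ih =>
    refine ih ?_
    have : (S ◁ v ≫ a) ≫ φ = S ◁ (v ≫ φ) ≫ a' := by
      rw [Category.assoc, ← hφ, whiskerLeft_comp, Category.assoc]
    rw [this]
    exact hv

/-- Here `Z` is a filtration whose index is raised by one at each action. -/
theorem After.of_chain {a : S ⊗ V ⟶ V} {Q : ∀ R : C, (R ⟶ V) → Prop}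
    (Z : ℕ → ∀ R : C, (R ⟶ V) → Prop) {n : ℕ}
    (hZ : ∀ i < n, ∀ R v, Z i R v → Z (i + 1) (S ⊗ R) (S ◁ v ≫ a))
    (hn : ∀ R v, Z n R v → Q R v) {r i : ℕ} (hr : i + r = n) {R : C} {v : R ⟶ V}
    (hv : Z i R v) : After a Q r R v := by
  induction r generalizing i R v with
  | zero => obtain rfl : i = n := by omega
            exact hn _ _ hv
  | succ r ih => exact ih (i := i + 1) (by omega) (hZ i (by omega) _ _ hv)

end Iterate

section Nilpotent

variable {C : Type u} [Category.{v} C] [Abelian C] [MonoidalCategory C] [MonoidalPreadditive C]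
  [HasDuals C] {S V : C}

/-- An action on `V` which commutes with a nilpotent operator and vanishes on its layers is
nilpotent. -/
theorem after_eq_zero {a : S ⊗ V ⟶ V} {D : V ⟶ V} (n : ℕ) (hD : endPow D (n + 1) = 0)
    (ha : S ◁ D ≫ a = a ≫ D)
    (hl : ∀ i < n, ∀ (R : C) (v : R ⟶ V), v ≫ endPow D (i + 1) = 0 →
      ∃ (R' : C) (σ : R' ⟶ S ⊗ R) (_ : Epi σ) (y : R' ⟶ V),
        σ ≫ (S ◁ v ≫ a) ≫ endPow D i = y ≫ endPow D (i + 1))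
    (ht : S ◁ endPow D n ≫ a = 0) {R : C} (v : R ⟶ V) :
    After a (fun _ v => v = 0) ((n + 1) * (n + 1)) R v := by
  have hpow : ∀ j, S ◁ endPow D j ≫ a = a ≫ endPow D j := by
    intro j
    induction j with
    | zero => simp [endPow]
    | succ j ih => rw [endPow, whiskerLeft_comp, Category.assoc, ih, reassoc_of% ha]
  have hcomp : ∀ {R : C} (v : R ⟶ V) (j : ℕ),
      (S ◁ v ≫ a) ≫ endPow D j = S ◁ (v ≫ endPow D j) ≫ a := by
    intro R v j
    rw [Category.assoc, ← hpow, whiskerLeft_comp, Category.assoc]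
  -- The filtration of `Ker D` by `Ker D ∩ Im D^i`, in terms of generalized elements.
  let Z : ℕ → ∀ R : C, (R ⟶ V) → Prop := fun i R v => v ≫ D = 0 ∧
    ∃ (R' : C) (σ : R' ⟶ R) (_ : Epi σ) (u : R' ⟶ V), σ ≫ v = u ≫ endPow D i
  have hker : ∀ (R : C) (v : R ⟶ V), v ≫ D = 0 → After a (fun _ v => v = 0) (n + 1) R v := by
    intro R v hv
    refine After.of_chain Z (n := n + 1) (i := 0) ?_ ?_ (by omega)
      ⟨hv, R, 𝟙 R, inferInstance, v, by simp [endPow]⟩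
    · rintro i hi R v ⟨hv, R', σ, hσ, u, hu⟩
      refine ⟨by rw [Category.assoc, ← ha, ← whiskerLeft_comp_assoc, hv,
        MonoidalPreadditive.whiskerLeft_zero, zero_comp], ?_⟩
      -- For `i < n` the step up is the vanishing on the layer. For `i = n` the element lies locally
      -- in `Im D^n`, which the action kills by `ht`. So `n + 1` actions annihilate `Ker D`.
      rcases Nat.lt_succ_iff_lt_or_eq.1 hi with hi | rfl
      · have h1 : u ≫ endPow D (i + 1) = 0 := by
          rw [endPow_succ', ← Category.assoc, ← hu, Category.assoc, hv, comp_zero]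
        obtain ⟨R'', τ, hτ, y, hy⟩ := hl i hi R' u h1
        refine ⟨R'', τ ≫ S ◁ σ, epi_comp _ _, y, ?_⟩
        rw [← hy, hcomp, ← hu, whiskerLeft_comp, Category.assoc, Category.assoc]
      · refine ⟨S ⊗ R', S ◁ σ, inferInstance, 0, ?_⟩
        rw [← whiskerLeft_comp_assoc, hu, whiskerLeft_comp, Category.assoc, ht, comp_zero,
          zero_comp]
    · rintro R v ⟨-, R', σ, hσ, u, hu⟩
      rw [hD, comp_zero] at hu
      rw [← cancel_epi σ, hu, comp_zero]
  -- Applying `D^j` moves `Ker D^{j+1}` into `Ker D`, so another `n + 1` actions lower the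
  -- nilpotency order by one; there are `n + 1` levels.
  have hall : ∀ (j : ℕ) (R : C) (v : R ⟶ V), v ≫ endPow D j = 0 →
      After a (fun _ v => v = 0) ((n + 1) * j) R v := by
    intro j
    induction j with
    | zero => intro R v hv; rw [endPow, Category.comp_id] at hv; exact hv
    | succ j ih =>
      intro R v hv
      have h1 : After a (fun R v => v ≫ endPow D j = 0) (n + 1) R v :=
        After.of_comp (Q := fun _ v => v = 0) (endPow D j) (hpow j)
          (hker _ _ (by rw [Category.assoc, ← endPow_succ', hv]))
      rw [Nat.mul_succ, Nat.add_comm]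
      exact (h1.mono fun R v => ih R v).add
  exact hall (n + 1) R v (by rw [hD, comp_zero])

end Nilpotent

section Pairing

open ExactPairing

variable {C : Type u} [Category.{v} C] [Abelian C] [MonoidalCategory C] [MonoidalPreadditive C]
variable {V W : C} [ExactPairing V W] {g : V ⟶ V} {h : W ⟶ W} [IsIso g] [IsIso h]

theorem whiskerLeft_sub' (X : C) {Y Z : C} (f f' : Y ⟶ Z) : X ◁ (f - f') = X ◁ f - X ◁ f' :=
  (tensorLeft X).map_sub

theorem sub_whiskerRight' (X : C) {Y Z : C} (f f' : Y ⟶ Z) : (f - f') ▷ X = f ▷ X - f' ▷ X :=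
  (tensorRight X).map_sub

theorem sub_tensorHom' {X Y X' Y' : C} (f f' : X ⟶ Y) (t : X' ⟶ Y') :
    (f - f') ⊗ₘ t = f ⊗ₘ t - f' ⊗ₘ t := by
  simp only [MonoidalCategory.tensorHom_def, sub_whiskerRight', Preadditive.sub_comp]

theorem one_sub_comp_inv (g : V ⟶ V) [IsIso g] : (𝟙 V - g) ≫ inv g = inv g ≫ (𝟙 V - g) := by
  simp [Preadditive.sub_comp, Preadditive.comp_sub]

/-- The adjoint of a power of `1 - g` with respect to an invariant pairing. -/
theorem exists_adjoint (hev : (h ⊗ₘ g) ≫ ε_ V W = ε_ V W) (j : ℕ) :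
    ∃ u : W ⟶ W, IsIso u ∧ u ≫ (𝟙 W - h) = (𝟙 W - h) ≫ u ∧
      W ◁ endPow (𝟙 V - g) j ≫ ε_ V W = (endPow (𝟙 W - h) j ≫ u) ▷ V ≫ ε_ V W := by
  -- By invariance the adjoint of `g` is `h⁻¹`, and `1 - h⁻¹` equals `1 - h` up to the automorphism
  -- `-h⁻¹`.
  have h1 : W ◁ (𝟙 V - g) ≫ ε_ V W = ((𝟙 W - h) ≫ (-inv h)) ▷ V ≫ ε_ V W := by
    have h2 : W ◁ g ≫ ε_ V W = inv h ▷ V ≫ ε_ V W := by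
      conv_rhs => rw [← hev, MonoidalCategory.tensorHom_def, Category.assoc,
        ← comp_whiskerRight_assoc, IsIso.inv_hom_id, id_whiskerRight, Category.id_comp]
    have h3 : (𝟙 W - h) ≫ (-inv h) = 𝟙 W - inv h := by
      rw [Preadditive.comp_neg, Preadditive.sub_comp, Category.id_comp, IsIso.hom_inv_id, neg_sub]
    rw [h3, whiskerLeft_sub', sub_whiskerRight', Preadditive.sub_comp, Preadditive.sub_comp, h2,
      whiskerLeft_id, id_whiskerRight]
  induction j with
  | zero => exact ⟨𝟙 W, inferInstance, by simp, by simp [endPow]⟩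
  | succ j ih =>
    obtain ⟨u, hu, hc, he⟩ := ih
    have hneg : IsIso (-inv h) := ⟨-h, by simp, by simp⟩
    refine ⟨(-inv h) ≫ u, inferInstance, ?_, ?_⟩
    · rw [Category.assoc, hc, Preadditive.neg_comp, Preadditive.neg_comp, Preadditive.comp_neg,
        ← Category.assoc, ← Category.assoc, one_sub_comp_inv]
    · rw [endPow_succ', whiskerLeft_comp, Category.assoc, h1, whisker_exchange_assoc, he,
        ← comp_whiskerRight_assoc]
      congr 2
      have h6 := pow_natural (D := 𝟙 W - h) (D' := 𝟙 W - h) (-inv h) (by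
        rw [Preadditive.neg_comp, Preadditive.comp_neg, one_sub_comp_inv]) j
      rw [endPow]
      simp only [Category.assoc]
      rw [reassoc_of% h6]

variable {S : C}

/-- On an invariant, `h` on the second factor equals `g⁻¹` on the first. Hence `1 - h` can be moved
to the first factor as `1 - g` up to an automorphism, which again sends invariants to invariants. -/
theorem whiskerLeft_endPow_eq (j : ℕ) (x : S ⟶ V ⊗ W) (hx : x ≫ (g ⊗ₘ h) = x) :
    ∃ y : S ⟶ V ⊗ W, x ≫ V ◁ endPow (𝟙 W - h) j = y ≫ endPow (𝟙 V - g) j ▷ W := by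
  induction j generalizing x with
  | zero => exact ⟨x, by simp [endPow]⟩
  | succ j ih =>
    have h6 : x ≫ inv g ▷ W = x ≫ V ◁ h := by
      conv_lhs => rw [← hx, MonoidalCategory.tensorHom_def', Category.assoc, Category.assoc,
        ← comp_whiskerRight, IsIso.hom_inv_id, id_whiskerRight, Category.comp_id]
    obtain ⟨y, hy⟩ := ih (-(x ≫ inv g ▷ W)) (by
      have h8 : inv g ▷ W ≫ (g ⊗ₘ h) = (g ⊗ₘ h) ≫ inv g ▷ W := by
        rw [← tensorHom_id, tensorHom_comp_tensorHom, tensorHom_comp_tensorHom]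
        simp
      rw [Preadditive.neg_comp, Category.assoc, h8, ← Category.assoc, hx])
    refine ⟨y, ?_⟩
    have h7 : x ≫ V ◁ (𝟙 W - h) = (-(x ≫ inv g ▷ W)) ≫ (𝟙 V - g) ▷ W := by
      rw [whiskerLeft_sub', sub_whiskerRight', Preadditive.comp_sub, Preadditive.comp_sub,
        Preadditive.neg_comp, Preadditive.neg_comp, Category.assoc x _ (g ▷ W),
        ← comp_whiskerRight, IsIso.inv_hom_id, id_whiskerRight, whiskerLeft_id,
        Category.comp_id, Category.comp_id, h6]
      abel
    rw [endPow, whiskerLeft_comp, ← Category.assoc, h7, Category.assoc, ← whisker_exchange,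
      ← Category.assoc, hy, Category.assoc, ← comp_whiskerRight, ← endPow_succ']

variable [HasDuals C]

/-- The intersection of `A ⊗ W` and `V ⊗ B` is `A ⊗ B`: tensoring `j` and its cokernel with `A` is
exact, and `A ⊗ -` embeds into `V ⊗ -`. -/
theorem factors_tensor {A B V W : C} (i : A ⟶ V) (j : B ⟶ W) [Mono i] [Mono j] (x : S ⟶ V ⊗ W)
    (y : S ⟶ A ⊗ W) (hy : y ≫ i ▷ W = x) (hx : x ≫ V ◁ cokernel.π j = 0) :
    ∃ z : S ⟶ A ⊗ B, x = z ≫ (i ⊗ₘ j) := by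
  have := HasDuals.isRightAdjoint_tensorLeft A
  have := HasDuals.isLeftAdjoint_tensorLeft A
  have h1 : y ≫ A ◁ cokernel.π j = 0 := by
    rw [← cancel_mono (i ▷ _), Category.assoc, whisker_exchange, ← Category.assoc, hy, hx,
      zero_comp]
  have hex : (ShortComplex.mk j (cokernel.π j) (by simp)).Exact :=
    ShortComplex.exact_of_g_is_cokernel _ (cokernelIsCokernel j)
  have h0 : A ◁ j ≫ A ◁ cokernel.π j = 0 := by
    rw [← whiskerLeft_comp, cokernel.condition, MonoidalPreadditive.whiskerLeft_zero]
  have hex' := HasDuals.exact_whiskerLeft hex A h0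
  have : Mono (ShortComplex.mk _ _ h0).f := by dsimp; infer_instance
  refine ⟨hex'.lift y h1, ?_⟩
  have h2 := hex'.lift_f y h1
  dsimp at h2
  rw [MonoidalCategory.tensorHom_def', ← Category.assoc, h2, hy]

/-- Since `(1 - h)^{n+1} = 0`, the image of `(1 - h)^n` is fixed by `h`. On it the diagonal operator
`1 - g ⊗ h` reduces to `1 - g` on the first factor. -/
theorem norm_comp (n : ℕ) (hD : endPow (𝟙 W - h) (n + 1) = 0) (j : ℕ) :
    endPow (𝟙 (V ⊗ W) - (g ⊗ₘ h)) j ≫ V ◁ endPow (𝟙 W - h) n =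
      endPow (𝟙 V - g) j ⊗ₘ endPow (𝟙 W - h) n := by
  have h1 : h ≫ endPow (𝟙 W - h) n = endPow (𝟙 W - h) n := by
    rw [endPow, Preadditive.sub_comp, Category.id_comp, sub_eq_zero] at hD
    exact hD.symm
  induction j with
  | zero => simp [endPow]
  | succ j ih =>
    rw [endPow, Category.assoc, ih, Preadditive.sub_comp, Category.id_comp,
      tensorHom_comp_tensorHom, h1, ← sub_tensorHom', endPow, Preadditive.sub_comp,
      Category.id_comp]

/-- An invariant element can be changed by a norm, after passing to a cover, so that it acts by
zero on the image of the norm. -/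
theorem exists_modification (n : ℕ) (hn : 0 < n) (hD' : endPow (𝟙 W - h) (n + 1) = 0)
    (hD'' : endPow (𝟙 (V ⊗ W) - (g ⊗ₘ h)) (n + 1) = 0) (hev : (h ⊗ₘ g) ≫ ε_ V W = ε_ V W)
    (x : S ⟶ V ⊗ W) (hx : x ≫ (g ⊗ₘ h) = x) :
    ∃ (S' : C) (σ : S' ⟶ S) (_ : Epi σ) (x' : S' ⟶ V ⊗ W), x' ≫ (g ⊗ₘ h) = x' ∧
      (∃ z, x' = σ ≫ x + z ≫ (𝟙 (V ⊗ W) - (g ⊗ₘ h))) ∧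
      S' ◁ endPow (𝟙 V - g) n ≫ x' ▷ V ≫ pairAct₀ V W = 0 := by
  -- Invariance places `(1 ⊗ D^n) x` in `Im D^n ⊗ W` as well as in `V ⊗ Im D^n`, hence in `Im D^n ⊗
  -- Im D^n`, and after a cover it lifts to some `z`.
  obtain ⟨y, hy⟩ := whiskerLeft_endPow_eq n x hx
  obtain ⟨z₀, hz₀⟩ := factors_tensor (image.ι (endPow (𝟙 V - g) n)) (image.ι (endPow (𝟙 W - h) n))
    (x ≫ V ◁ endPow (𝟙 W - h) n) (y ≫ factorThruImage _ ▷ W)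
    (by rw [Category.assoc, ← comp_whiskerRight, image.fac, hy])
    (by
      have h1 : endPow (𝟙 W - h) n ≫ cokernel.π (image.ι (endPow (𝟙 W - h) n)) = 0 := by
        have := (image.fac_assoc (endPow (𝟙 W - h) n) (cokernel.π (image.ι (endPow (𝟙 W - h) n)))).symm
        rw [this, cokernel.condition, comp_zero]
      rw [Category.assoc, ← whiskerLeft_comp, h1, MonoidalPreadditive.whiskerLeft_zero, comp_zero])
  obtain ⟨S', σ, hσ, z, hz⟩ := surjective_up_to_refinements_of_epi
    (factorThruImage (endPow (𝟙 V - g) n) ⊗ₘ factorThruImage (endPow (𝟙 W - h) n)) z₀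
  have h2 : (σ ≫ x) ≫ V ◁ endPow (𝟙 W - h) n =
      z ≫ (endPow (𝟙 V - g) n ⊗ₘ endPow (𝟙 W - h) n) := by
    rw [Category.assoc, hz₀, ← Category.assoc, hz, Category.assoc, tensorHom_comp_tensorHom,
      image.fac, image.fac]
  -- By `norm_comp` the norm of `z` has the same image as `x` under `1 ⊗ D^n`, so subtracting it
  -- leaves zero.
  have h3 : (σ ≫ x - z ≫ endPow (𝟙 (V ⊗ W) - (g ⊗ₘ h)) n) ≫ V ◁ endPow (𝟙 W - h) n = 0 := by
    rw [Preadditive.sub_comp, h2, Category.assoc, norm_comp n hD', sub_self]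
  have h4 : endPow (𝟙 (V ⊗ W) - (g ⊗ₘ h)) n ≫ (g ⊗ₘ h) = endPow (𝟙 (V ⊗ W) - (g ⊗ₘ h)) n := by
    rw [endPow_succ', Preadditive.comp_sub, Category.comp_id, sub_eq_zero] at hD''
    exact hD''.symm
  refine ⟨S', σ, hσ, σ ≫ x - z ≫ endPow (𝟙 (V ⊗ W) - (g ⊗ₘ h)) n, ?_, ?_, ?_⟩
  · rw [Preadditive.sub_comp, Category.assoc, hx, Category.assoc, h4]
  -- Positivity of `n` makes the norm a multiple of `1 - g ⊗ h`, so the class in `B_1` does not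
  -- change.
  · obtain ⟨n, rfl⟩ := Nat.exists_eq_succ_of_ne_zero hn.ne'
    refine ⟨-(z ≫ endPow (𝟙 (V ⊗ W) - (g ⊗ₘ h)) n), ?_⟩
    rw [Nat.succ_eq_add_one, endPow_succ', Preadditive.neg_comp, sub_eq_add_neg, Category.assoc]
  -- Acting on `D^n v` is, by adjunction, acting on `v` after applying `1 ⊗ D^n` to the element, and
  -- that vanishes by `h3`.
  · obtain ⟨u, -, -, hu⟩ := exists_adjoint hev n
    rw [whisker_exchange_assoc, pairAct₀, tensor_whiskerLeft_assoc, Iso.inv_hom_id_assoc,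
      ← whiskerLeft_comp_assoc, hu]
    rw [comp_whiskerRight, Category.assoc, whiskerLeft_comp_assoc, ← associator_naturality_middle_assoc,
      ← comp_whiskerRight_assoc, h3, MonoidalPreadditive.zero_whiskerRight, zero_comp]

end Pairing

end FrobeniusFunctor

end

noncomputable section

/-! ### Perfect pairings and annihilators in a rigid abelian category. -/

namespace FrobeniusFunctor

open ExactPairing

section Mates

variable {C : Type u} [Category.{v} C] [MonoidalCategory C] {V W : C} [ExactPairing V W] {S : C}

/-- The triangle identity recovers a morphism into `V` from its pairing with `W`. This and the next
statements form the bijection between such morphisms and pairings, on either side. -/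
theorem eq_coevaluation_comp (f : S ⟶ V) :
    f = (λ_ S).inv ≫ η_ V W ▷ S ≫ (α_ V W S).hom ≫ V ◁ (W ◁ f ≫ ε_ V W) ≫ (ρ_ V).hom := by
  have h := evaluation_coevaluation V W
  have h2 : f = (λ_ S).inv ≫ (η_ V W ▷ S ≫ (V ⊗ W) ◁ f) ≫ (α_ V W V).hom ≫ V ◁ ε_ V W ≫
      (ρ_ V).hom := by
    rw [← whisker_exchange, Category.assoc, reassoc_of% h]
    simp
  conv_lhs => rw [h2]
  simp

theorem eq_coevaluation_comp' (u : S ⟶ W) :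
    u = (ρ_ S).inv ≫ S ◁ η_ V W ≫ (α_ S V W).inv ≫ (u ▷ V ≫ ε_ V W) ▷ W ≫ (λ_ W).hom := by
  have h := coevaluation_evaluation V W
  have h2 : u = (ρ_ S).inv ≫ (S ◁ η_ V W ≫ u ▷ (V ⊗ W)) ≫ (α_ W V W).inv ≫ ε_ V W ▷ W ≫
      (λ_ W).hom := by
    rw [whisker_exchange, Category.assoc, reassoc_of% h]
    simp
  conv_lhs => rw [h2]
  simp

theorem whiskerLeft_comp_ev_injective {f f' : S ⟶ V} (h : W ◁ f ≫ ε_ V W = W ◁ f' ≫ ε_ V W) :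
    f = f' := by
  rw [eq_coevaluation_comp (W := W) f, h, ← eq_coevaluation_comp]

theorem whiskerRight_comp_ev_injective {u u' : S ⟶ W} (h : u ▷ V ≫ ε_ V W = u' ▷ V ≫ ε_ V W) :
    u = u' := by
  rw [eq_coevaluation_comp' (V := V) u, h, ← eq_coevaluation_comp']

theorem exists_whiskerLeft_comp_ev (t : W ⊗ S ⟶ 𝟙_ C) : ∃ f : S ⟶ V, W ◁ f ≫ ε_ V W = t := by
  refine ⟨(λ_ S).inv ≫ η_ V W ▷ S ≫ (α_ V W S).hom ≫ V ◁ t ≫ (ρ_ V).hom, ?_⟩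
  have h := congrArg (· ▷ S) (coevaluation_evaluation V W)
  simp only [comp_whiskerRight] at h
  have h2 : W ◁ ((λ_ S).inv ≫ η_ V W ▷ S ≫ (α_ V W S).hom ≫ V ◁ t ≫ (ρ_ V).hom) ≫ ε_ V W =
      W ◁ (λ_ S).inv ≫ (α_ _ _ _).inv ≫ ((W ◁ η_ V W) ▷ S ≫ (α_ W V W).inv ▷ S ≫
        ε_ V W ▷ W ▷ S) ≫ (α_ _ _ _).hom ≫ 𝟙_ C ◁ t ≫ (λ_ _).hom := by
    have h3 : (W ⊗ V) ◁ t ≫ ε_ V W ▷ 𝟙_ C = ε_ V W ▷ (W ⊗ S) ≫ 𝟙_ C ◁ t := whisker_exchange _ _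
    have h4 : ε_ V W = (ρ_ _).inv ≫ ε_ V W ▷ 𝟙_ C ≫ (λ_ _).hom := by simp [unitors_equal]
    rw [h4]
    simp only [whiskerLeft_comp, Category.assoc]
    have h5 : W ◁ V ◁ t ≫ W ◁ (ρ_ V).hom ≫ (ρ_ (W ⊗ V)).inv = (α_ _ _ _).inv ≫ (W ⊗ V) ◁ t := by
      simp
    rw [reassoc_of% h5, reassoc_of% h3]
    simp [unitors_equal]
  rw [h2, h]
  simp

theorem exists_whiskerRight_comp_ev (t : S ⊗ V ⟶ 𝟙_ C) : ∃ u : S ⟶ W, u ▷ V ≫ ε_ V W = t := by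
  refine ⟨(ρ_ S).inv ≫ S ◁ η_ V W ≫ (α_ S V W).inv ≫ t ▷ W ≫ (λ_ W).hom, ?_⟩
  have h := congrArg (S ◁ ·) (evaluation_coevaluation V W)
  simp only [whiskerLeft_comp] at h
  have h2 : ((ρ_ S).inv ≫ S ◁ η_ V W ≫ (α_ S V W).inv ≫ t ▷ W ≫ (λ_ W).hom) ▷ V ≫ ε_ V W =
      (ρ_ S).inv ▷ V ≫ (α_ _ _ _).hom ≫ (S ◁ η_ V W ▷ V ≫ S ◁ (α_ V W V).hom ≫
        S ◁ V ◁ ε_ V W) ≫ (α_ _ _ _).inv ≫ t ▷ 𝟙_ C ≫ (ρ_ _).hom := by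
    have h3 : t ▷ (W ⊗ V) ≫ 𝟙_ C ◁ ε_ V W = (S ⊗ V) ◁ ε_ V W ≫ t ▷ 𝟙_ C := (whisker_exchange _ _).symm
    have h4 : ε_ V W = (λ_ _).inv ≫ 𝟙_ C ◁ ε_ V W ≫ (ρ_ _).hom := by
      rw [← unitors_equal]; simp
    rw [h4]
    simp only [comp_whiskerRight, Category.assoc]
    have h5 : t ▷ W ▷ V ≫ (λ_ W).hom ▷ V ≫ (λ_ (W ⊗ V)).inv = (α_ _ _ _).hom ≫ t ▷ (W ⊗ V) := by
      simp
    rw [reassoc_of% h5, reassoc_of% h3]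
    simp
  rw [h2, h]
  simp

end Mates

section Perfect

variable {C : Type u} [Category.{v} C] [Abelian C] [MonoidalCategory C] [MonoidalPreadditive C]
  [HasDuals C]

/-- A pairing which is nondegenerate on both sides is perfect. -/
theorem exists_copairing {A B : C} (b : A ⊗ B ⟶ 𝟙_ C)
    (hl : ∀ (S : C) (x : S ⟶ A), x ▷ B ≫ b = 0 → x = 0)
    (hr : ∀ (S : C) (y : S ⟶ B), A ◁ y ≫ b = 0 → y = 0) :
    ∃ c : 𝟙_ C ⟶ B ⊗ A, c ▷ B ≫ (α_ B A B).hom ≫ B ◁ b = (λ_ B).hom ≫ (ρ_ B).inv := by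
  obtain ⟨⟨B'⟩⟩ := HasDuals.right_dual B
  obtain ⟨f, hf⟩ := exists_whiskerRight_comp_ev (V := B) (W := B') b
  have : Mono f := by
    refine Preadditive.mono_of_cancel_zero _ fun x hx => hl _ x ?_
    rw [← hf, ← comp_whiskerRight_assoc, hx, MonoidalPreadditive.zero_whiskerRight, zero_comp]
  -- A morphism `z` out of the dual that vanishes on the image of `f` corresponds, through a dual
  -- `Z'` of its target, to a morphism from `Z'` to `B` orthogonal to `A`; nondegeneracy on the
  -- right makes it zero.
  have : Epi f := by
    refine Preadditive.epi_of_cancel_zero _ fun {Z} z hz => ?_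
    obtain ⟨⟨Z'⟩⟩ := HasDuals.left_dual Z
    obtain ⟨z', hz'⟩ := exists_whiskerLeft_comp_ev (V := B) (W := B') (z ▷ Z' ≫ ε_ Z' Z)
    have h0 : z' = 0 := by
      refine hr _ z' ?_
      rw [← hf, whisker_exchange_assoc, hz', ← comp_whiskerRight_assoc, hz,
        MonoidalPreadditive.zero_whiskerRight, zero_comp]
    refine whiskerRight_comp_ev_injective (V := Z') (W := Z) ?_
    rw [← hz', h0, MonoidalPreadditive.whiskerLeft_zero, zero_comp,
      MonoidalPreadditive.zero_whiskerRight, zero_comp]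
  have : IsIso f := isIso_of_mono_of_epi f
  refine ⟨η_ B B' ≫ B ◁ inv f, ?_⟩
  have h := evaluation_coevaluation B B'
  rw [← h, ← hf, comp_whiskerRight, Category.assoc, associator_naturality_middle_assoc,
    ← whiskerLeft_comp, ← comp_whiskerRight_assoc, IsIso.inv_hom_id, id_whiskerRight,
    Category.id_comp]

/-- Descent of a morphism out of a tensor product to quotients of both factors. -/
theorem exists_desc_tensor {R K L R' K' L' Z : C} {r : R ⟶ K} {q : K ⟶ L} {w : r ≫ q = 0}
    (hS : (ShortComplex.mk r q w).Exact) [Epi q] {r' : R' ⟶ K'} {q' : K' ⟶ L'} {w' : r' ≫ q' = 0}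
    (hS' : (ShortComplex.mk r' q' w').Exact) [Epi q'] (t : K ⊗ K' ⟶ Z) (ht : r ▷ K' ≫ t = 0)
    (ht' : K ◁ r' ≫ t = 0) : ∃ s : L ⊗ L' ⟶ Z, (q ⊗ₘ q') ≫ s = t := by
  have h0 : r ▷ K' ≫ q ▷ K' = 0 := by
    rw [← comp_whiskerRight, w, MonoidalPreadditive.zero_whiskerRight]
  have hex := HasDuals.exact_whiskerRight hS K' h0
  have : Epi (ShortComplex.mk _ _ h0).g := by dsimp; infer_instance
  have h0' : L ◁ r' ≫ L ◁ q' = 0 := by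
    rw [← whiskerLeft_comp, w', MonoidalPreadditive.whiskerLeft_zero]
  have hex' := HasDuals.exact_whiskerLeft hS' L h0'
  have : Epi (ShortComplex.mk _ _ h0').g := by dsimp; infer_instance
  have h1 : q ▷ K' ≫ hex.desc t ht = t := hex.g_desc t ht
  have h2 : L ◁ r' ≫ hex.desc t ht = 0 := by
    rw [← cancel_epi (q ▷ R'), comp_zero, ← whisker_exchange_assoc, h1, ht']
  have h3 : L ◁ q' ≫ hex'.desc _ h2 = hex.desc t ht := hex'.g_desc _ h2
  exact ⟨hex'.desc _ h2, by rw [MonoidalCategory.tensorHom_def, Category.assoc, h3, h1]⟩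

variable {V W : C} [ExactPairing V W]

/-- The annihilator of `Ker d` is the image of the adjoint of `d`. Indeed the dual of `Coker T` maps
to `V` with image in `Ker d`, so an element orthogonal to `Ker d` vanishes in `Coker T`. -/
theorem annihilator_ker {d : V ⟶ V} {T : W ⟶ W} (hT : T ▷ V ≫ ε_ V W = W ◁ d ≫ ε_ V W) {S : C}
    (u : S ⟶ W) (hu : (u ⊗ₘ kernel.ι d) ≫ ε_ V W = 0) :
    ∃ (S' : C) (σ : S' ⟶ S) (_ : Epi σ) (y : S' ⟶ W), σ ≫ u = y ≫ T := by
  obtain ⟨⟨Q'⟩⟩ := HasDuals.left_dual (cokernel T)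
  obtain ⟨t, ht⟩ := exists_whiskerLeft_comp_ev (V := V) (W := W)
    (cokernel.π T ▷ Q' ≫ ε_ Q' (cokernel T))
  have h1 : t ≫ d = 0 := by
    refine whiskerLeft_comp_ev_injective (W := W) ?_
    rw [whiskerLeft_comp, Category.assoc, ← hT, whisker_exchange_assoc, ht,
      ← comp_whiskerRight_assoc, cokernel.condition, MonoidalPreadditive.zero_whiskerRight,
      zero_comp, MonoidalPreadditive.whiskerLeft_zero, zero_comp]
  have h2 : u ≫ cokernel.π T = 0 := by
    refine whiskerRight_comp_ev_injective (V := Q') (W := cokernel T) ?_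
    have h3 := hu
    rw [MonoidalCategory.tensorHom_def', Category.assoc] at h3
    rw [comp_whiskerRight, Category.assoc, ← ht, ← whisker_exchange_assoc,
      ← kernel.lift_ι d t h1, whiskerLeft_comp, Category.assoc, h3, comp_zero,
      MonoidalPreadditive.zero_whiskerRight, zero_comp]
  have hex : (ShortComplex.mk T (cokernel.π T) (by simp)).Exact :=
    ShortComplex.exact_of_g_is_cokernel _ (cokernelIsCokernel T)
  obtain ⟨S', σ, hσ, y, hy⟩ := hex.exact_up_to_refinements u h2
  exact ⟨S', σ, hσ, y, hy⟩

theorem annihilator_ker' {d : W ⟶ W} {T : V ⟶ V} (hT : d ▷ V ≫ ε_ V W = W ◁ T ≫ ε_ V W) {S : C}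
    (u : S ⟶ V) (hu : (kernel.ι d ⊗ₘ u) ≫ ε_ V W = 0) :
    ∃ (S' : C) (σ : S' ⟶ S) (_ : Epi σ) (y : S' ⟶ V), σ ≫ u = y ≫ T := by
  obtain ⟨⟨Q'⟩⟩ := HasDuals.right_dual (cokernel T)
  obtain ⟨t, ht⟩ := exists_whiskerRight_comp_ev (V := V) (W := W)
    (Q' ◁ cokernel.π T ≫ ε_ (cokernel T) Q')
  have h1 : t ≫ d = 0 := by
    refine whiskerRight_comp_ev_injective (V := V) ?_
    rw [comp_whiskerRight, Category.assoc, hT, ← whisker_exchange_assoc, ht,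
      ← whiskerLeft_comp_assoc, cokernel.condition, MonoidalPreadditive.whiskerLeft_zero,
      zero_comp, MonoidalPreadditive.zero_whiskerRight, zero_comp]
  have h2 : u ≫ cokernel.π T = 0 := by
    refine whiskerLeft_comp_ev_injective (V := cokernel T) (W := Q') ?_
    have h3 := hu
    rw [MonoidalCategory.tensorHom_def, Category.assoc] at h3
    rw [whiskerLeft_comp, Category.assoc, ← ht, whisker_exchange_assoc,
      ← kernel.lift_ι d t h1, comp_whiskerRight, Category.assoc, h3, comp_zero,
      MonoidalPreadditive.whiskerLeft_zero, zero_comp]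
  have hex : (ShortComplex.mk T (cokernel.π T) (by simp)).Exact :=
    ShortComplex.exact_of_g_is_cokernel _ (cokernelIsCokernel T)
  obtain ⟨S', σ, hσ, y, hy⟩ := hex.exact_up_to_refinements u h2
  exact ⟨S', σ, hσ, y, hy⟩

end Perfect

end FrobeniusFunctor

end

noncomputable section

/-! ### Duality between the layers of dual objects. -/

namespace FrobeniusFunctor

open ExactPairing

section LayerPairing

variable {C : Type u} [Category.{v} C] [Abelian C] [MonoidalCategory C] [MonoidalPreadditive C]

/-- A pairing which is nondegenerate on both sides is part of a duality. -/
theorem exists_exactPairing [HasDuals C] {A B : C} (b : A ⊗ B ⟶ 𝟙_ C)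
    (hl : ∀ (S : C) (x : S ⟶ A), x ▷ B ≫ b = 0 → x = 0)
    (hr : ∀ (S : C) (y : S ⟶ B), A ◁ y ≫ b = 0 → y = 0) :
    ∃ c : 𝟙_ C ⟶ B ⊗ A, c ▷ B ≫ (α_ B A B).hom ≫ B ◁ b = (λ_ B).hom ≫ (ρ_ B).inv ∧
      A ◁ c ≫ (α_ A B A).inv ≫ b ▷ A = (ρ_ A).hom ≫ (λ_ A).inv := by
  obtain ⟨c, hc⟩ := exists_copairing b hl hr
  refine ⟨c, hc, ?_⟩
  -- The second triangle identity holds after pairing with `B`, as a consequence of the first, and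
  -- left nondegeneracy removes the pairing.
  rw [← cancel_epi (ρ_ A).inv, ← cancel_mono (λ_ A).hom, ← sub_eq_zero]
  refine hl _ _ ?_
  have h1 : ((ρ_ A).inv ≫ A ◁ c ≫ (α_ A B A).inv ≫ b ▷ A ≫ (λ_ A).hom) ▷ B ≫ b = b := by
    have h2 := congrArg (fun t => (ρ_ A).inv ▷ B ≫ (α_ _ _ _).hom ≫ A ◁ t ≫ (α_ _ _ _).inv ≫
      b ▷ 𝟙_ C ≫ (ρ_ _).hom) hc
    have h3 : b ▷ A ▷ B ≫ (λ_ A).hom ▷ B ≫ b =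
        (α_ _ _ _).hom ≫ (A ⊗ B) ◁ b ≫ b ▷ 𝟙_ C ≫ (ρ_ _).hom := by
      rw [whisker_exchange_assoc, ← unitors_equal, leftUnitor_naturality]
      monoidal
    refine Eq.trans ?_ (h2.trans ?_)
    · simp only [comp_whiskerRight, Category.assoc, h3]
      monoidal
    · monoidal
  simp only [Category.assoc, Iso.inv_hom_id, Iso.inv_hom_id_assoc] at h1 ⊢
  rw [sub_whiskerRight', Preadditive.sub_comp, h1, id_whiskerRight, Category.id_comp, sub_self]

variable {V W : C} [ExactPairing V W] {g : V ⟶ V} {h : W ⟶ W} [IsIso g] [IsIso h]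

theorem exists_adjoint_right (hev : (h ⊗ₘ g) ≫ ε_ V W = ε_ V W) (j : ℕ) :
    ∃ u : V ⟶ V, IsIso u ∧ u ≫ (𝟙 V - g) = (𝟙 V - g) ≫ u ∧
      endPow (𝟙 W - h) j ▷ V ≫ ε_ V W = W ◁ (endPow (𝟙 V - g) j ≫ u) ≫ ε_ V W := by
  have h1 : (𝟙 W - h) ▷ V ≫ ε_ V W = W ◁ ((𝟙 V - g) ≫ (-inv g)) ≫ ε_ V W := by
    have h2 : h ▷ V ≫ ε_ V W = W ◁ inv g ≫ ε_ V W := by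
      conv_rhs => rw [← hev, MonoidalCategory.tensorHom_def', Category.assoc,
        ← whiskerLeft_comp_assoc, IsIso.inv_hom_id, whiskerLeft_id, Category.id_comp]
    have h3 : (𝟙 V - g) ≫ (-inv g) = 𝟙 V - inv g := by
      rw [Preadditive.comp_neg, Preadditive.sub_comp, Category.id_comp, IsIso.hom_inv_id, neg_sub]
    rw [h3, whiskerLeft_sub', sub_whiskerRight', Preadditive.sub_comp, Preadditive.sub_comp, h2,
      whiskerLeft_id, id_whiskerRight]
  induction j with
  | zero => exact ⟨𝟙 V, inferInstance, by simp, by simp [endPow]⟩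
  | succ j ih =>
    obtain ⟨u, hu, hc, he⟩ := ih
    have hneg : IsIso (-inv g) := ⟨-g, by simp, by simp⟩
    refine ⟨(-inv g) ≫ u, inferInstance, ?_, ?_⟩
    · rw [Category.assoc, hc, Preadditive.neg_comp, Preadditive.neg_comp, Preadditive.comp_neg,
        ← Category.assoc, ← Category.assoc, one_sub_comp_inv]
    · rw [endPow_succ', comp_whiskerRight, Category.assoc, h1, ← whisker_exchange_assoc, he,
        ← whiskerLeft_comp_assoc]
      congr 2
      have h6 := pow_natural (D := 𝟙 V - g) (D' := 𝟙 V - g) (-inv g) (by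
        rw [Preadditive.neg_comp, Preadditive.comp_neg, one_sub_comp_inv]) j
      rw [endPow]
      simp only [Category.assoc]
      rw [reassoc_of% h6]

variable [HasDuals C]

/-- The perfect pairing between the layers of two operators which are adjoint up to units. -/
theorem exists_layer_pairing (hev : (h ⊗ₘ g) ≫ ε_ V W = ε_ V W) (i : ℕ) :
    ∃ (b : layer (𝟙 W - h) i ⊗ layer (𝟙 V - g) i ⟶ 𝟙_ C)
      (c : 𝟙_ C ⟶ layer (𝟙 V - g) i ⊗ layer (𝟙 W - h) i),
      (powKerπ (𝟙 W - h) i ⊗ₘ powKerπ (𝟙 V - g) i) ≫ b =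
        ((kernel.ι (endPow (𝟙 W - h) (i + 1)) ≫ endPow (𝟙 W - h) i) ⊗ₘ
          kernel.ι (endPow (𝟙 V - g) (i + 1))) ≫ ε_ V W ∧
      c ▷ _ ≫ (α_ _ _ _).hom ≫ _ ◁ b = (λ_ _).hom ≫ (ρ_ _).inv := by
  obtain ⟨u₀, hu₀, hc₀, he₀⟩ := exists_adjoint_right hev i
  obtain ⟨u₁, hu₁, hc₁, he₁⟩ := exists_adjoint_right hev (i + 1)
  obtain ⟨w₁, hw₁, hd₁, hf₁⟩ := exists_adjoint hev (i + 1)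
  -- From here on only the adjointness of the powers of the two operators up to commuting
  -- automorphisms is used.
  generalize 𝟙 W - h = d₁ at *
  generalize 𝟙 V - g = d₂ at *
  have hpair : ∀ {S T : C} (x : S ⟶ W) (y : T ⟶ V),
      ((x ≫ endPow d₁ i) ⊗ₘ y) ≫ ε_ V W = (x ⊗ₘ (y ≫ endPow d₂ i ≫ u₀)) ≫ ε_ V W := by
    intro S T x y
    rw [← Category.comp_id y, ← tensorHom_comp_tensorHom, Category.assoc, tensorHom_id, he₀,
      Category.comp_id, ← Category.comp_id x, ← tensorHom_comp_tensorHom, Category.assoc,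
      id_tensorHom, Category.comp_id]
  have hpair₁ : ∀ {S T : C} (x : S ⟶ W) (y : T ⟶ V),
      ((x ≫ endPow d₁ (i + 1)) ⊗ₘ y) ≫ ε_ V W = (x ⊗ₘ (y ≫ endPow d₂ (i + 1) ≫ u₁)) ≫ ε_ V W := by
    intro S T x y
    rw [← Category.comp_id y, ← tensorHom_comp_tensorHom, Category.assoc, tensorHom_id, he₁,
      Category.comp_id, ← Category.comp_id x, ← tensorHom_comp_tensorHom, Category.assoc,
      id_tensorHom, Category.comp_id]
  have hpair₂ : ∀ {S T : C} (x : S ⟶ W) (y : T ⟶ V),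
      (x ⊗ₘ (y ≫ endPow d₂ (i + 1))) ≫ ε_ V W = ((x ≫ endPow d₁ (i + 1) ≫ w₁) ⊗ₘ y) ≫ ε_ V W := by
    intro S T x y
    rw [← Category.comp_id x, ← tensorHom_comp_tensorHom, Category.assoc, id_tensorHom, hf₁,
      Category.comp_id, ← Category.comp_id y, ← tensorHom_comp_tensorHom, Category.assoc,
      tensorHom_id, Category.comp_id]
  have hz₁ : ∀ {X Y X' Y' : C} (x : X ⟶ Y), x ⊗ₘ (0 : X' ⟶ Y') = 0 := by
    intro X Y X' Y' x; rw [MonoidalCategory.tensorHom_def, MonoidalPreadditive.whiskerLeft_zero, comp_zero]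
  have hz₂ : ∀ {X Y X' Y' : C} (x : X ⟶ Y), (0 : X' ⟶ Y') ⊗ₘ x = 0 := by
    intro X Y X' Y' x
    rw [MonoidalCategory.tensorHom_def, MonoidalPreadditive.zero_whiskerRight, zero_comp]
  -- The pairing `(x, y) ↦ ev (d₁^i x, y)` respects the relations in both factors: `d₁^i` kills one
  -- kind and turns the other into an element of `Im d₁^{i+1}`, orthogonal to `Ker d₂^{i+1}`. The
  -- second factor is symmetric after moving `d₁^i` across.
  obtain ⟨b, hb⟩ := exists_desc_tensor (powKer_exact d₁ i) (powKer_exact d₂ i)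
    (((kernel.ι (endPow d₁ (i + 1)) ≫ endPow d₁ i) ⊗ₘ kernel.ι (endPow d₂ (i + 1))) ≫ ε_ V W)
    (by
      have h1 : powKerRel d₁ i ≫ kernel.ι (endPow d₁ (i + 1)) ≫ endPow d₁ i =
          (biprod.snd ≫ kernel.ι (endPow d₁ (i + 2))) ≫ endPow d₁ (i + 1) := by
        rw [powKerRel]
        ext
        · rw [biprod.inl_desc_assoc, kernel.lift_ι_assoc, kernel.condition]
          simp
        · rw [biprod.inr_desc_assoc, kernel.lift_ι_assoc]
          simp only [Category.assoc, biprod.inr_snd_assoc]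
          rfl
      rw [← tensorHom_id, ← Category.assoc, tensorHom_comp_tensorHom, Category.id_comp, h1, hpair₁,
        kernel.condition_assoc, zero_comp, hz₁, zero_comp])
    (by
      have h1 : powKerRel d₂ i ≫ kernel.ι (endPow d₂ (i + 1)) ≫ endPow d₂ i ≫ u₀ =
          (biprod.snd ≫ kernel.ι (endPow d₂ (i + 2)) ≫ u₀) ≫ endPow d₂ (i + 1) := by
        have h2 := pow_natural u₀ hc₀.symm (i + 1)
        rw [Category.assoc, Category.assoc, ← h2, powKerRel]
        ext
        · rw [biprod.inl_desc_assoc, kernel.lift_ι_assoc, kernel.condition_assoc]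
          simp
        · rw [biprod.inr_desc_assoc, kernel.lift_ι_assoc]
          simp only [Category.assoc, biprod.inr_snd_assoc]
          rw [← Category.assoc d₂]; rfl
      rw [← id_tensorHom, ← Category.assoc, tensorHom_comp_tensorHom, Category.id_comp, hpair,
        Category.assoc, h1, hpair₂, kernel.condition_assoc, zero_comp, hz₂, zero_comp])
  have hbl : ∀ {S T : C} (x : S ⟶ W) (hx : x ≫ endPow d₁ (i + 1) = 0) (y : T ⟶ V)
      (hy : y ≫ endPow d₂ (i + 1) = 0),
      (cls d₁ i x hx ⊗ₘ cls d₂ i y hy) ≫ b = ((x ≫ endPow d₁ i) ⊗ₘ y) ≫ ε_ V W := by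
    intro S T x hx y hy
    rw [← lift_powKerπ, ← lift_powKerπ, ← tensorHom_comp_tensorHom, Category.assoc, hb,
      ← Category.assoc, tensorHom_comp_tensorHom, ← Category.assoc, kernel.lift_ι, kernel.lift_ι]
  -- If the class of `x` is orthogonal to the other layer, then `d₁^i x` annihilates `Ker d₂^{i+1}`,
  -- hence lies locally in `Im d₁^{i+1}`, which says that the class is zero.
  obtain ⟨c, hc⟩ := exists_copairing b (fun S x hx => by
    obtain ⟨S', σ, hσ, x', hx', h1⟩ := exists_cls_eq x
    have h2 : ((x' ≫ endPow d₁ i) ⊗ₘ kernel.ι (endPow d₂ (i + 1))) ≫ ε_ V W = 0 := by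
      rw [← hbl x' hx' _ (kernel.condition _), ← h1, MonoidalCategory.tensorHom_def', comp_whiskerRight,
        Category.assoc, Category.assoc, hx, comp_zero, comp_zero]
    rw [← cancel_epi σ, h1, comp_zero, cls_eq_zero_iff]
    obtain ⟨S'', τ, hτ, y, hy⟩ := annihilator_ker hf₁.symm _ h2
    refine ⟨S'', τ, hτ, y ≫ w₁, ?_⟩
    rw [hy, Category.assoc, pow_natural w₁ hd₁.symm]) (fun S y hy => by
    obtain ⟨S', σ, hσ, y', hy', h1⟩ := exists_cls_eq y
    have h2 : (kernel.ι (endPow d₁ (i + 1)) ⊗ₘ (y' ≫ endPow d₂ i ≫ u₀)) ≫ ε_ V W = 0 := by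
      rw [← hpair, ← hbl _ (kernel.condition _) y' hy', ← h1,
        MonoidalCategory.tensorHom_def, whiskerLeft_comp,
        Category.assoc, Category.assoc, hy, comp_zero, comp_zero]
    rw [← cancel_epi σ, h1, comp_zero, cls_eq_zero_iff]
    obtain ⟨S'', τ, hτ, z, hz⟩ := annihilator_ker' he₁ _ h2
    refine ⟨S'', τ, hτ, z ≫ u₁ ≫ inv u₀, ?_⟩
    have h3 : d₂ ≫ u₁ ≫ inv u₀ = (u₁ ≫ inv u₀) ≫ d₂ := by
      rw [← cancel_mono u₀]
      rw [Category.assoc, Category.assoc, Category.assoc, Category.assoc, ← hc₀]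
      simp [hc₁]
    rw [Category.assoc, ← pow_natural _ h3, ← cancel_mono u₀]
    simpa using hz)
  exact ⟨b, c, hb, hc⟩

end LayerPairing

end FrobeniusFunctor

end

noncomputable section

/-! ### Self-duality of the simple objects of `Ver_p`. -/

namespace Verlinde

open ExactPairing

section BlockForm

variable {k : Type w} [Field k]

theorem blockLin_ext {m : ℕ} {M : Type*} [AddCommGroup M] [Module k M] {f g : Block k m →ₗ[k] M}
    (h : ∀ a : ℕ, f (AdjoinRoot.root _ ^ a) = g (AdjoinRoot.root _ ^ a)) : f = g := by
  refine LinearMap.ext fun y => ?_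
  induction y using AdjoinRoot.induction_on with
  | ih q =>
    induction q using Polynomial.induction_on' with
    | add a b ha hb => rw [map_add, map_add, map_add, ha, hb]
    | monomial n c =>
      have h1 : AdjoinRoot.mk (Polynomial.X ^ m) (Polynomial.monomial n c) =
          c • (AdjoinRoot.root (Polynomial.X ^ m : Polynomial k) ^ n) := by
        rw [← Polynomial.C_mul_X_pow_eq_monomial, map_mul, map_pow, AdjoinRoot.mk_X,
          Algebra.smul_def]; rfl
      rw [h1, map_smul, map_smul, h]

theorem root_pow_eq_zero_of_le {m a : ℕ} (h : m ≤ a) :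
    (AdjoinRoot.root (Polynomial.X ^ m : Polynomial k)) ^ a = 0 :=
  pow_eq_zero_of_le h (root_pow_eq_zero m)

/-- The socle functional on a Jordan block. -/
theorem exists_top (m : ℕ) : ∃ t : Block k (m + 1) →ₗ[k] k,
    ∀ a : ℕ, t (AdjoinRoot.root _ ^ a) = if a = m then 1 else 0 := by
  have hm := Polynomial.monic_X_pow (R := k) (m + 1)
  refine ⟨Polynomial.lcoeff k m ∘ₗ AdjoinRoot.modByMonicHom hm, fun a => ?_⟩
  by_cases ha : m + 1 ≤ a
  · rw [root_pow_eq_zero_of_le ha, map_zero, if_neg (by omega)]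
  · have h1 : (Polynomial.X ^ a : Polynomial k) %ₘ Polynomial.X ^ (m + 1) = Polynomial.X ^ a :=
      (Polynomial.modByMonic_eq_self_iff hm).2 (by
        rw [Polynomial.degree_X_pow, Polynomial.degree_X_pow]; exact_mod_cast not_le.1 ha)
    rw [← AdjoinRoot.mk_X, ← map_pow, LinearMap.comp_apply, AdjoinRoot.modByMonicHom_mk, h1,
      Polynomial.lcoeff_apply, Polynomial.coeff_X_pow]
    simp only [eq_comm]

/-- The involution of a Jordan block which inverts the generator `1 - D`. -/
theorem exists_conj (m : ℕ) : ∃ σ : Block k m →ₐ[k] Block k m,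
    (1 - AdjoinRoot.root _) * σ (1 - AdjoinRoot.root _) = 1 ∧ ∀ y, σ (σ y) = y := by
  obtain ⟨r, hr⟩ : ∃ r : Block k m, r = AdjoinRoot.root _ := ⟨_, rfl⟩
  have hrm : r ^ m = 0 := by rw [hr]; exact root_pow_eq_zero m
  obtain ⟨u, hu⟩ : ∃ u : Block k m, (1 - r) * u = 1 :=
    ⟨∑ j ∈ Finset.range m, r ^ j, by rw [mul_neg_geom_sum, hrm, sub_zero]⟩
  have h1 : 1 - u = -(r * u) := by linear_combination -hu
  let σ : Block k m →ₐ[k] Block k m := AdjoinRoot.liftAlgHom _ (Algebra.ofId k _) (1 - u) (by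
    rw [Polynomial.eval₂_X_pow, h1, neg_pow, mul_pow, hrm, zero_mul, mul_zero])
  have hσ : σ r = 1 - u := by rw [hr]; exact AdjoinRoot.liftAlgHom_root _ _ _ _
  have h2 : σ (1 - r) = u := by rw [map_sub, map_one, hσ]; ring
  refine ⟨σ, by rw [← hr, h2, hu], fun y => ?_⟩
  have h3 : σ u = 1 - r := by
    have h4 : u * σ u = 1 := by rw [← h2, ← map_mul, h2, hu, map_one]
    linear_combination (1 - r) * h4 - σ u * hu
  have h5 : σ.comp σ = AlgHom.id k _ := by
    refine AdjoinRoot.algHom_ext ?_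
    rw [← hr, AlgHom.comp_apply, hσ, map_sub, map_one, h3, sub_sub_cancel]; rfl
  exact AlgHom.congr_fun h5 y

/-- The invariant perfect form on a Jordan block. -/
theorem exists_form (m : ℕ) : ∃ θ : Block k (m + 1) →ₗ[k] Block k (m + 1) →ₗ[k] k,
    (∀ x y, θ ((1 - AdjoinRoot.root _) * x) ((1 - AdjoinRoot.root _) * y) = θ x y) ∧
    (∀ a : ℕ, θ (AdjoinRoot.root _ ^ a) 1 = if a = m then 1 else 0) ∧
    (∀ x, (∀ y, θ x y = 0) → x = 0) ∧ ∀ y, (∀ x, θ x y = 0) → y = 0 := by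
  obtain ⟨t, ht⟩ := exists_top (k := k) m
  obtain ⟨σ, hσ, hσσ⟩ := exists_conj (k := k) (m + 1)
  -- The powers `root^a` and `root^(m - a)` are dual bases for `(x, z) ↦ t (x z)`.
  have hnd : ∀ x : Block k (m + 1), (∀ z, t (x * z) = 0) → x = 0 := by
    intro x hx
    have h : ∑ a ∈ Finset.range (m + 1), LinearMap.toSpanSingleton k _ (AdjoinRoot.root _ ^ a) ∘ₗ t ∘ₗ
        LinearMap.mulRight k (AdjoinRoot.root _ ^ (m - a)) = LinearMap.id := by
      refine blockLin_ext fun b => ?_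
      rw [LinearMap.sum_apply]
      simp only [LinearMap.comp_apply, LinearMap.mulRight_apply, LinearMap.toSpanSingleton_apply,
        ← pow_add, ht, LinearMap.id_apply]
      by_cases hb : b < m + 1
      · rw [Finset.sum_eq_single b]
        · rw [if_pos (by omega), one_smul]
        · intro a ha hab
          have := Finset.mem_range.1 ha
          rw [if_neg (by omega), zero_smul]
        · intro hb'; exact absurd (Finset.mem_range.2 hb) hb'
      · rw [root_pow_eq_zero_of_le (not_lt.1 hb)]
        refine Finset.sum_eq_zero fun a ha => ?_
        have := Finset.mem_range.1 ha
        rw [if_neg (by omega), zero_smul]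
    have h1 := LinearMap.congr_fun h x
    rw [LinearMap.sum_apply] at h1
    rw [← LinearMap.id_apply (R := k) x, ← h1]
    refine Finset.sum_eq_zero fun a _ => ?_
    simp [hx]
  -- The form is `t (x * σ y)`; it is invariant because `σ` inverts `1 - D`.
  refine ⟨((LinearMap.mul k (Block k (m + 1))).compl₂ σ.toLinearMap).compr₂ t, fun x y => ?_,
    fun a => ?_, fun x hx => hnd x fun z => ?_, fun y hy => ?_⟩
  · change t (((1 - AdjoinRoot.root _) * x) * σ ((1 - AdjoinRoot.root _) * y)) = t (x * σ y)
    refine congrArg t ?_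
    rw [map_mul σ]
    linear_combination x * σ y * hσ
  · refine (congrArg t ?_).trans (ht a)
    change AdjoinRoot.root _ ^ a * σ 1 = _
    rw [map_one, mul_one]
  · rw [← hσσ z]
    exact hx (σ z)
  · have : σ y = 0 := hnd _ fun z => by rw [mul_comm]; exact hy z
    rw [← hσσ y, this, map_zero]

end BlockForm

section Duality

variable {k : Type w} [Field k] {p : ℕ} [Fact p.Prime] [CharP k p]

instance : HasDuals (FDRep k (Multiplicative (ZMod p))) where
  left_dual _ := ⟨BraidedCategory.hasLeftDualOfHasRightDual⟩
  right_dual _ := ⟨inferInstance⟩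

/-- The simple objects of the Verlinde category are self-dual. -/
theorem exists_theta (i : Fin (p - 1)) : ∃ (θ : (L k p i).as ⊗ (L k p i).as ⟶ 𝟙_ _)
    (κ : 𝟙_ _ ⟶ (L k p i).as ⊗ (L k p i).as),
    (∀ a : ℕ, toLin θ ((AdjoinRoot.root _ ^ a : Block k (i + 1)) ⊗ₜ[k] (1 : Block k (i + 1)) :
      Block k (i + 1) ⊗[k] Block k (i + 1)) = (if a = i then (1 : k) else 0)) ∧
    κ ▷ _ ≫ (α_ _ _ _).hom ≫ _ ◁ θ = (λ_ _).hom ≫ (ρ_ _).inv ∧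
    _ ◁ κ ≫ (α_ _ _ _).inv ≫ θ ▷ _ = (ρ_ _).hom ≫ (λ_ _).inv := by
  obtain ⟨θ, h1, h2, h3, h4⟩ := exists_form (k := k) (i : ℕ)
  let Θ : (L k p i).as ⊗ (L k p i).as ⟶ 𝟙_ _ :=
    homOfComm (J := (L k p i).as ⊗ (L k p i).as) (J' := 𝟙_ _) (TensorProduct.lift θ) fun x => by
      have h5 : TensorProduct.lift θ ∘ₗ TensorProduct.map (act (L k p i).as) (act (L k p i).as) =
          TensorProduct.lift θ := by
        refine TensorProduct.ext' fun x y => ?_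
        change θ (act (L k p i).as x) (act (L k p i).as y) = θ x y
        rw [← h1 x y]
        exact congrArg₂ (fun a b => θ a b) (act_blk _ _ x) (act_blk _ _ y)
      exact LinearMap.congr_fun h5 x
  have hΘ : ∀ x y : Block k (i + 1), toLin Θ (x ⊗ₜ[k] y : Block k (i + 1) ⊗[k] Block k (i + 1)) =
      θ x y := fun x y => rfl
  -- The criterion for perfect pairings is applied in the abelian category of representations; its
  -- triangle identities then pass to the quotient `Ver_p`.
  obtain ⟨κ, hκ, hκ'⟩ := FrobeniusFunctor.exists_exactPairing Θ
    (fun S x hx => by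
      refine toLin_injective (LinearMap.ext fun s => h3 _ fun y => ?_)
      exact LinearMap.congr_fun (congrArg toLin hx)
        (s ⊗ₜ[k] y : (S : Type w) ⊗[k] Block k (i + 1)))
    (fun S y hy => by
      refine toLin_injective (LinearMap.ext fun s => h4 _ fun x => ?_)
      exact LinearMap.congr_fun (congrArg toLin hy)
        (x ⊗ₜ[k] s : Block k (i + 1) ⊗[k] (S : Type w)))
  exact ⟨Θ, κ, fun a => h2 a, hκ, hκ'⟩

variable (k p) in
/-- The invariant form on a simple object. -/
def theta (i : Fin (p - 1)) : (L k p i).as ⊗ (L k p i).as ⟶ 𝟙_ _ := (exists_theta i).choose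

variable (k p) in
/-- The copairing of a simple object with itself. -/
def kappa (i : Fin (p - 1)) : 𝟙_ _ ⟶ (L k p i).as ⊗ (L k p i).as :=
  (exists_theta i).choose_spec.choose

theorem theta_apply (i : Fin (p - 1)) (a : ℕ) :
    toLin (theta k p i) ((AdjoinRoot.root _ ^ a : Block k (i + 1)) ⊗ₜ[k] (1 : Block k (i + 1)) :
      Block k (i + 1) ⊗[k] Block k (i + 1)) = (if a = i then (1 : k) else 0) :=
  (exists_theta i).choose_spec.choose_spec.1 a

variable (k p) in
/-- The form on a simple object of the Verlinde category. -/
def formL (i : Fin (p - 1)) : L k p i ⊗ L k p i ⟶ 𝟙_ (Ver k p) := pr (theta k p i)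

instance exactPairingL (i : Fin (p - 1)) : ExactPairing (L k p i) (L k p i) where
  evaluation' := formL k p i
  coevaluation' := pr (kappa k p i)
  evaluation_coevaluation' :=
    congrArg (pr (X := 𝟙_ (Ver k p) ⊗ L k p i) (Y := L k p i ⊗ 𝟙_ _))
      (exists_theta i).choose_spec.choose_spec.2.1
  coevaluation_evaluation' :=
    congrArg (pr (X := L k p i ⊗ 𝟙_ (Ver k p)) (Y := 𝟙_ _ ⊗ L k p i))
      (exists_theta i).choose_spec.choose_spec.2.2

/-- By self-duality such a form is a morphism from `L_j` to `L_i`. -/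
theorem hom_tensor_eq_zero {i j : Fin (p - 1)} (hij : i ≠ j) (f : L k p i ⊗ L k p j ⟶ 𝟙_ _) :
    f = 0 := by
  obtain ⟨t, rfl⟩ := FrobeniusFunctor.exists_whiskerLeft_comp_ev (V := L k p i) (W := L k p i) f
  rw [L_hom_eq_zero hij.symm t, MonoidalPreadditive.whiskerLeft_zero, zero_comp]

end Duality

end Verlinde

end

/-! ### Invariants, morphisms from the unit, and invertibility of the unit structure. -/

noncomputable section

namespace Verlinde

variable {k : Type w} [Field k] {p : ℕ} [Fact p.Prime] [CharP k p]

variable (p) in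
/-- The index of the unit object. -/
def zeroL : Fin (p - 1) := ⟨0, by have := (Fact.out : p.Prime).two_le; omega⟩

theorem exists_unit_iso : ∃ (β : (L k p (zeroL p)).as ⟶ 𝟙_ _) (γ : 𝟙_ _ ⟶ (L k p (zeroL p)).as),
    β ≫ γ = 𝟙 _ ∧ γ ≫ β = 𝟙 _ ∧ toLin β (1 : Block k 1) = (1 : k) := by
  have hp := (Fact.out : p.Prime).one_lt.le
  have hd : ∀ c, dop (𝟙_ (FDRep k (Multiplicative (ZMod p)))) c = 0 := fun c => sub_self _
  have hγ : ∀ c : k, (LinearMap.toSpanSingleton k (Block k 1) 1) c =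
      act (blk k p 1 hp) (LinearMap.toSpanSingleton k (Block k 1) 1 c) := by
    intro c
    have h1 : AdjoinRoot.root (Polynomial.X ^ 1 : Polynomial k) = 0 := by
      have := root_pow_eq_zero (k := k) 1; exact (pow_one _).symm.trans this
    refine Eq.trans ?_ (act_blk 1 hp _).symm
    rw [h1, sub_zero, one_mul]
  have hx : (dop (𝟙_ (FDRep k (Multiplicative (ZMod p)))) ^ 1) (1 : k) = 0 := by
    rw [pow_one]; exact hd _
  refine ⟨ofVec 1 hp (J := 𝟙_ _) (1 : k) hx,
    homOfComm (J := 𝟙_ _) (J' := blk k p 1 hp) (LinearMap.toSpanSingleton k (Block k 1) 1) hγ,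
    ?_, ?_, ?_⟩
  · refine blkHom_ext (m := 1) (hm := hp) _ _ ?_
    refine (congrArg (LinearMap.toSpanSingleton k (Block k 1) 1)
      (ofVec_one (J := 𝟙_ _) 1 hp (1 : k) hx)).trans ?_
    exact one_smul k (1 : Block k 1)
  · refine toLin_injective (LinearMap.ext_ring (R := k) ?_)
    refine (congrArg (toLin (ofVec 1 hp (J := 𝟙_ _) (1 : k) hx))
      (one_smul k (1 : Block k 1))).trans ?_
    exact ofVec_one (J := 𝟙_ _) 1 hp (1 : k) hx
  · exact ofVec_one (J := 𝟙_ _) 1 hp (1 : k) hx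

variable (k p) in
/-- The isomorphism from the trivial simple object to the unit. -/
def toUnit : (L k p (zeroL p)).as ⟶ 𝟙_ _ := exists_unit_iso.choose

variable (k p) in
/-- The isomorphism from the unit to the trivial simple object. -/
def ofUnit : 𝟙_ _ ⟶ (L k p (zeroL p)).as := exists_unit_iso.choose_spec.choose

variable (k p) in
/-- The unit of the Verlinde category is the simple object `L_1`. -/
def unitIso : 𝟙_ (Ver k p) ≅ L k p (zeroL p) where
  hom := pr (ofUnit k p)
  inv := pr (toUnit k p)
  hom_inv_id := congrArg (pr (X := 𝟙_ (Ver k p)) (Y := 𝟙_ _))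
    exists_unit_iso.choose_spec.choose_spec.2.1
  inv_hom_id := congrArg (pr (X := L k p (zeroL p)) (Y := L k p (zeroL p)))
    exists_unit_iso.choose_spec.choose_spec.1

theorem toLin_toUnit_one : toLin (toUnit k p) (1 : Block k 1) = (1 : k) :=
  exists_unit_iso.choose_spec.choose_spec.2.2

theorem unit_hom_eq_zero {i : Fin (p - 1)} (hi : i ≠ zeroL p) (f : 𝟙_ (Ver k p) ⟶ L k p i) :
    f = 0 := by
  rw [← cancel_epi (unitIso k p).inv, comp_zero]
  exact L_hom_eq_zero hi.symm _

theorem unit_hom_scalar (f : 𝟙_ (Ver k p) ⟶ L k p (zeroL p)) :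
    ∃ c : k, f = c • (unitIso k p).hom := by
  obtain ⟨c, hc⟩ := L_end_scalar (zeroL p) ((unitIso k p).inv ≫ f)
  refine ⟨c, ?_⟩
  rw [← cancel_epi (unitIso k p).inv, hc, Linear.comp_smul, Iso.inv_hom_id]

end Verlinde

namespace FrobeniusFunctor

open Verlinde LinProd Mat_Monoidal Functor.LaxMonoidal

section Unit

variable {k : Type w} [Field k] {p : ℕ} [Fact p.Prime] [CharP k p]
variable {C : Type u} [Category.{v} C] [Abelian C] [Linear k C]
variable {S V : C} {g : V ⟶ V}

variable (k p) in
/-- The equivariant map from the trivial representation given by an invariant. -/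
def invElem (x : S ⟶ V) (hx : x ≫ g = x) :
    Equivar (𝟙_ (FDRep k (Multiplicative (ZMod p)))) S g where
  toFun := LinearMap.toSpanSingleton k (S ⟶ V) x
  comm c := by
    refine (?_ : c • x = (c • x) ≫ g)
    rw [Linear.smul_comp, hx]

theorem comp_endPow_of_invariant {x : S ⟶ V} (hx : x ≫ g = x) (j : ℕ) :
    x ≫ endPow (𝟙 V - g) (j + 1) = 0 := by
  rw [endPow, Preadditive.sub_comp, Category.id_comp, Preadditive.comp_sub, ← Category.assoc, hx,
    sub_self]

theorem psi_invElem_zero (x : S ⟶ V) (hx : x ≫ g = x) :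
    (invElem k p x hx).psi (zeroL p) =
      homMk (cls (𝟙 V - g) (zeroL p) x (comp_endPow_of_invariant hx _)) (unitIso k p).hom := by
  have h1 := (invElem k p x hx).homMk_psi (zeroL p) (toUnit k p)
  have h2 : (invElem k p x hx).eval (zeroL p) (toUnit k p) =
      cls (𝟙 V - g) (zeroL p) x (comp_endPow_of_invariant hx _) := by
    refine cls_congr _ ?_
    refine (congrArg (invElem k p x hx).toFun toLin_toUnit_one).trans (one_smul k x)
  have h3 : (homMk (𝟙 S) (unitIso k p).hom : (⟨S, 𝟙_ _⟩ : LinProd k C (Ver k p)) ⟶ ⟨S, _⟩) ≫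
      homMk (𝟙 S) (unitIso k p).inv = 𝟙 _ := by
    rw [homMk_comp, Iso.hom_inv_id, Category.comp_id, homMk_id]
  refine (Category.id_comp _).symm.trans ?_
  refine (congrArg (fun t => t ≫ (invElem k p x hx).psi (zeroL p)) h3.symm).trans ?_
  refine (Category.assoc _ _ _).trans ?_
  refine (congrArg (fun t => _ ≫ t) (h1.trans (congrArg (fun t => homMk t _) h2))).trans ?_
  refine (homMk_comp _ _ _ _).trans ?_
  rw [Category.id_comp, Category.comp_id]

theorem psi_invElem_of_ne (x : S ⟶ V) (hx : x ≫ g = x) {m : Fin (p - 1)} (hm : m ≠ zeroL p) :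
    (invElem k p x hx).psi m = 0 :=
  eq_zero_of_right (unit_hom_eq_zero hm) _

/-- The object of the additive envelope given by a single external product. -/
abbrev single (X : LinProd k C (Ver k p)) : Mat_ (LinProd k C (Ver k p)) := ⟨PUnit, fun _ => X⟩

/-- The morphism of one-element families given by a morphism. -/
def singleMap {X Y : LinProd k C (Ver k p)} (f : X ⟶ Y) : single X ⟶ single Y :=
  relabel (M := single X) (N := single Y) (fun i => i) (fun _ => f)

variable (k p) in
/-- The one-element family given by an invariant. -/
def invFam (x : S ⟶ V) (hx : x ≫ g = x) :
    Fam (single (⟨S, 𝟙_ _⟩ : LinProd k C (Ver k p))) g :=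
  fun _ => invElem k p x hx

/-- The space of morphisms from the unit to `L_1` is a line, so scalars can be moved to the first
factor and every tensor becomes pure. -/
theorem exists_homMk_unitIso {X Y : C}
    (f : (⟨X, 𝟙_ _⟩ : LinProd k C (Ver k p)) ⟶ ⟨Y, L k p (zeroL p)⟩) :
    ∃ a : X ⟶ Y, f = homMk a (unitIso k p).hom := by
  induction f using LinProd.hom_induction with
  | h0 => exact ⟨0, (homMk_zero_left _).symm⟩
  | hm a b =>
    obtain ⟨c, rfl⟩ := unit_hom_scalar b
    exact ⟨c • a, (homMk_smul _ _ _)⟩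
  | ha a b ha hb =>
    obtain ⟨a, rfl⟩ := ha
    obtain ⟨b, rfl⟩ := hb
    exact ⟨a + b, (homMk_add_left _ _ _).symm⟩

theorem isFamilyEpi_singleMap {X Y : C} (σ : X ⟶ Y) [Epi σ] (J : Ver k p) :
    IsFamilyEpi (singleMap (homMk σ (𝟙 J) : (⟨X, J⟩ : LinProd k C (Ver k p)) ⟶ ⟨Y, J⟩)) :=
  ⟨fun i => i, fun _ => σ, fun _ => 𝟙 J, Function.bijective_id, fun _ => inferInstance,
    fun _ => inferInstance, rfl⟩

/-- Every morphism from the unit is locally given by an invariant. -/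
theorem exists_invariant [MonoidalCategory C] [MonoidalPreadditive C] [MonoidalLinear k C]
    (n : 𝟙_ (Mat_ (LinProd k C (Ver k p))) ⟶ Bl k p g) :
    ∃ (S : C) (σ : S ⟶ 𝟙_ C) (_ : Epi σ) (x : S ⟶ V) (hx : x ≫ g = x),
      singleMap (homMk σ (𝟙 (𝟙_ (Ver k p)))) ≫ n = Psi (invFam k p x hx) := by
  obtain ⟨a, ha⟩ := exists_homMk_unitIso (Y := layer (𝟙 V - g) (zeroL p))
    (n PUnit.unit (zeroL p))
  obtain ⟨S, σ, hσ, x, hx, h1⟩ := exists_cls_eq a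
  have hx' : x ≫ g = x := by
    replace hx : x ≫ endPow (𝟙 V - g) (0 + 1) = 0 := hx
    rw [endPow, endPow, Category.comp_id, Preadditive.comp_sub, Category.comp_id, sub_eq_zero] at hx
    exact hx.symm
  refine ⟨S, σ, hσ, x, hx', ?_⟩
  refine Mat_.hom_ext _ _ fun i m => ?_
  refine (relabel_comp (M := single ⟨S, 𝟙_ _⟩) (N := single ⟨𝟙_ C, 𝟙_ _⟩) (P := Bl k p g)
    _ _ n i m).trans ?_
  by_cases hm : m = zeroL p
  · subst hm
    refine (congrArg (fun t => homMk σ (𝟙 (𝟙_ (Ver k p))) ≫ t) ha).trans ?_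
    refine (homMk_comp _ _ _ _).trans ?_
    rw [Category.id_comp, h1]
    exact (psi_invElem_zero x hx').symm
  · refine Eq.trans ?_ (psi_invElem_of_ne (k := k) x hx' hm).symm
    exact eq_zero_of_right (unit_hom_eq_zero hm) _

theorem isZero_layer_zero (V : C) {j : ℕ} (hj : 0 < j) : IsZero (layer (0 : V ⟶ V) j) := by
  obtain ⟨j, rfl⟩ := Nat.exists_eq_succ_of_ne_zero hj.ne'
  have h1 : powKerπ (0 : V ⟶ V) (j + 1) = 0 :=
    cls_eq_zero_of_pow _ _ (by
      have : endPow (0 : V ⟶ V) (j + 1) = 0 := by rw [endPow, zero_comp]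
      exact (congrArg (fun t => _ ≫ t) this).trans comp_zero)
  rw [IsZero.iff_id_eq_zero, ← cancel_epi (powKerπ (0 : V ⟶ V) (j + 1)), h1]
  simp

theorem isIso_cls_zero {T : C} (x : T ⟶ V) [IsIso x] {d : V ⟶ V} (hd : d = 0) {j : ℕ} (hj : j = 0)
    (hx : x ≫ endPow d (j + 1) = 0) : IsIso (cls d j x hx) := by
  subst hd hj
  have h0 : ∀ {S : C} (y : S ⟶ V), y ≫ endPow (0 : V ⟶ V) (0 + 1) = 0 := by
    intro S y; rw [endPow, zero_comp, comp_zero]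
  have : Mono (cls (0 : V ⟶ V) 0 x hx) := by
    refine Preadditive.mono_of_cancel_zero _ fun s hs => ?_
    rw [comp_cls _ _ _ (h0 _), cls_eq_zero_iff] at hs
    obtain ⟨S', σ, hσ, y, hy⟩ := hs
    rw [h0, endPow, Category.comp_id] at hy
    rw [← cancel_epi σ, ← cancel_mono x, Category.assoc, hy, comp_zero, zero_comp]
  have : Epi (cls (0 : V ⟶ V) 0 x hx) := by
    obtain ⟨S', σ, hσ, y, hy, h1⟩ := exists_cls_eq (𝟙 (layer (0 : V ⟶ V) 0))
    refine Preadditive.epi_of_cancel_zero _ fun t ht => ?_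
    have h2 : σ = (y ≫ inv x) ≫ cls (0 : V ⟶ V) 0 x hx := by
      rw [comp_cls _ _ _ (h0 _), ← Category.comp_id σ, h1]
      exact cls_congr _ (by simp)
    rw [← cancel_epi σ, h2, Category.assoc, ht, comp_zero, comp_zero]
  exact isIso_of_mono_of_epi _

variable [MonoidalCategory C] [MonoidalPreadditive C] [MonoidalLinear k C]

/-- Here `g` acts trivially, so `D = 0`: the first layer is all of `V`, and the others vanish. -/
theorem isIso_Psi_invElem (x : 𝟙_ C ⟶ V) [IsIso x] (hx : x ≫ g = x) :
    IsIso (Psi (M := 𝟙_ (Mat_ (LinProd k C (Ver k p)))) fun _ => invElem k p x hx) := by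
  have hg : 𝟙 V - g = 0 := by rw [← cancel_epi x, Preadditive.comp_sub, hx]; simp
  obtain ⟨X, hXd⟩ : ∃ X, X = cls (𝟙 V - g) (zeroL p) x (comp_endPow_of_invariant hx _) := ⟨_, rfl⟩
  have hX : IsIso X := hXd ▸ isIso_cls_zero x hg rfl _
  have hpsi : (invElem k p x hx).psi (zeroL p) = homMk X (unitIso k p).hom :=
    hXd ▸ psi_invElem_zero x hx
  have hz : ∀ m : Fin (p - 1), m ≠ zeroL p → IsZero (layer (𝟙 V - g) m) := by
    intro m hm
    rw [hg]
    exact isZero_layer_zero V (Nat.pos_of_ne_zero fun h => hm (Fin.ext h))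
  -- The inverse is given on `L_1`; the value `0` elsewhere is harmless because those layers are
  -- zero objects.
  obtain ⟨r₀, hr₀⟩ : ∃ r₀ : ∀ i : Fin (p - 1),
      (⟨layer (𝟙 V - g) i, L k p i⟩ : LinProd k C (Ver k p)) ⟶ 𝟙_ _,
      r₀ (zeroL p) = homMk (inv X) (unitIso k p).inv :=
    ⟨Function.update (fun _ => 0) (zeroL p) (homMk (inv X) (unitIso k p).inv),
      Function.update_self _ _ _⟩
  let r : Bl k p g ⟶ 𝟙_ (Mat_ (LinProd k C (Ver k p))) := ofEntries (M := Bl k p g) fun i _ => r₀ i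
  have hr : ∀ j, r (zeroL p) j = homMk (inv X) (unitIso k p).inv := fun j => hr₀
  refine ⟨r, ?_, ?_⟩
  · refine Mat_.hom_ext _ _ fun i j => ?_
    refine (Mat_.comp_apply _ _ i j).trans ?_
    refine (Finset.sum_eq_single (zeroL p) (fun m _ hm => ?_)
      (fun h => absurd (Finset.mem_univ _) h)).trans ?_
    · exact (congrArg (fun s => s ≫ r m j) (psi_invElem_of_ne x hx hm)).trans zero_comp
    · refine (congrArg₂ (fun s t => s ≫ t) hpsi (hr j)).trans ?_
      refine (homMk_comp _ _ _ _).trans ?_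
      rw [IsIso.hom_inv_id, Iso.hom_inv_id]
      exact (Mat_.id_apply_self (𝟙_ (Mat_ (LinProd k C (Ver k p)))) PUnit.unit).symm
  · refine Mat_.hom_ext _ _ fun (i : Fin (p - 1)) (j : Fin (p - 1)) => ?_
    by_cases hi : i = zeroL p
    · subst hi
      by_cases hj : j = zeroL p
      · subst hj
        refine (Mat_.comp_apply _ _ _ _).trans ?_
        refine (Finset.sum_eq_single PUnit.unit (fun b _ hb => absurd (Subsingleton.elim _ _) hb)
          (fun h => absurd (Finset.mem_univ _) h)).trans ?_
        refine (congrArg₂ (fun s t => s ≫ t) (hr _) hpsi).trans ?_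
        refine (homMk_comp _ _ _ _).trans ?_
        rw [IsIso.inv_hom_id, Iso.inv_hom_id]
        exact (Mat_.id_apply_self (Bl k p g) (zeroL p)).symm
      · exact (eq_zero_of_left (fun f => (hz j hj).eq_of_tgt _ _) _).trans
          (eq_zero_of_left (fun f => (hz j hj).eq_of_tgt _ _) _).symm
    · exact (eq_zero_of_left (fun f => (hz i hi).eq_of_src _ _) _).trans
          (eq_zero_of_left (fun f => (hz i hi).eq_of_src _ _) _).symm

end Unit

section UnitIso

variable {k : Type w} [Field k] {p : ℕ} [Fact p.Prime] [CharP k p]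
variable {C : Type u} [Category.{v} C] [Abelian C] [Linear k C] [MonoidalCategory C]
  [MonoidalPreadditive C] [MonoidalLinear k C] [HasDuals C]
variable {C₀ : Type u₁} [Category.{v₁} C₀] [MonoidalCategory C₀]
variable (P : C₀ ⥤ C) (g : P ⟶ P) [P.Monoidal] [NatTrans.IsMonoidal g]

theorem isIso_ε : IsIso (ε (blFunctor k p P g)) := by
  have hx : ε P ≫ g.app (𝟙_ C₀) = ε P := by rw [← ε_equivariant P g, Category.id_comp]
  have h1 : unitTest k p P g = fun _ => invElem k p (ε P) hx := by
    refine funext fun i => Equivar.ext (LinearMap.ext fun c => ?_)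
    refine (?_ : (c • 𝟙 (𝟙_ C)) ≫ ε P = c • ε P)
    rw [Linear.smul_comp, Category.id_comp]
  have h2 : ε (blFunctor k p P g) = Psi (fun _ => invElem k p (ε P) hx) :=
    congrArg Psi h1
  rw [h2]
  exact isIso_Psi_invElem _ hx

end UnitIso

end FrobeniusFunctor

end

/-! ### Coevaluations for families, and invariant forms on a Jordan block. -/

noncomputable section

namespace Mat_Monoidal

variable {C : Type u} [Category.{v} C] [Preadditive C] [MonoidalCategory C] [MonoidalPreadditive C]

instance : MonoidalPreadditive (Mat_ C) where
  whiskerLeft_zero {X Y Z} := by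
    ext p q
    exact MonoidalPreadditive.tensor_zero (entry (𝟙 X) p.1 q.1)
  zero_whiskerRight {X Y Z} := by
    ext p q
    exact MonoidalPreadditive.zero_tensor (entry (𝟙 X) p.2 q.2)
  whiskerLeft_add {X Y Z} f g := by
    ext p q
    exact MonoidalPreadditive.tensor_add (entry (𝟙 X) p.1 q.1) (entry f p.2 q.2) (entry g p.2 q.2)
  add_whiskerRight {X Y Z} f g := by
    ext p q
    exact MonoidalPreadditive.add_tensor (entry f p.1 q.1) (entry g p.1 q.1) (entry (𝟙 X) p.2 q.2)

/-- A diagonal evaluation of families with coevaluations on the diagonal has a coevaluation. -/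
theorem exists_coevaluation {ι : Type} [Fintype ι] (a b : ι → C)
    (e : (⟨ι, b⟩ : Mat_ C) ⊗ (⟨ι, a⟩ : Mat_ C) ⟶ 𝟙_ (Mat_ C))
    (he : ∀ i j, i ≠ j → e (i, j) PUnit.unit = 0) (c : ∀ i, 𝟙_ C ⟶ a i ⊗ b i)
    (d : ∀ i, b i ⊗ a i ⟶ 𝟙_ C) (hd : ∀ i, e (i, i) PUnit.unit = d i)
    (hc : ∀ i, c i ▷ a i ≫ (α_ _ _ _).hom ≫ a i ◁ d i = (λ_ _).hom ≫ (ρ_ _).inv) :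
    ∃ c : 𝟙_ (Mat_ C) ⟶ (⟨ι, a⟩ : Mat_ C) ⊗ (⟨ι, b⟩ : Mat_ C),
      c ▷ _ ≫ (α_ _ _ _).hom ≫ _ ◁ e = (λ_ _).hom ≫ (ρ_ _).inv := by
  classical

  -- The coevaluation is the sum of the `c i`, each placed at the diagonal position `(i, i)`; in the
  -- triangle identity only the term with index `j` survives.
  let γ : ι → (𝟙_ (Mat_ C) ⟶ (⟨ι, a⟩ : Mat_ C) ⊗ (⟨ι, b⟩ : Mat_ C)) := fun i =>
    relabel (M := 𝟙_ (Mat_ C)) (N := (⟨ι, a⟩ : Mat_ C) ⊗ (⟨ι, b⟩ : Mat_ C)) (fun _ => (i, i))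
      (fun _ => c i)
  have key : ∀ (i : ι) (u : PUnit) (j i' : ι),
      (γ i ▷ (⟨ι, a⟩ : Mat_ C) ≫ (α_ _ _ _).hom ≫ (⟨ι, a⟩ : Mat_ C) ◁ e ≫ (ρ_ _).hom) (u, j) i' =
        (c i ⊗ₘ 𝟙 (a j)) ≫ (α_ (a i) (b i) (a j)).hom ≫
          (entry (𝟙 (⟨ι, a⟩ : Mat_ C)) i i' ⊗ₘ e (i, j) PUnit.unit) ≫ (ρ_ (a i')).hom := by
    intro i u j i'
    rw [← tensorHom_id, relabel_tensor_id]
    refine (relabel_comp _ _ _ _ _).trans ?_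
    refine congrArg (fun t => (c i ⊗ₘ 𝟙 (a j)) ≫ t) ?_
    rw [associator_hom]
    refine (relabel_comp (M := ((⟨ι, a⟩ : Mat_ C) ⊗ (⟨ι, b⟩ : Mat_ C)) ⊗ (⟨ι, a⟩ : Mat_ C))
      (N := (⟨ι, a⟩ : Mat_ C) ⊗ ((⟨ι, b⟩ : Mat_ C) ⊗ (⟨ι, a⟩ : Mat_ C)))
      (P := (⟨ι, a⟩ : Mat_ C)) _ _ _ _ _).trans ?_
    refine congrArg (fun t => (α_ (a i) (b i) (a j)).hom ≫ t) ?_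
    rw [rightUnitor_hom]
    exact comp_relabel (M := (⟨ι, a⟩ : Mat_ C) ⊗ ((⟨ι, b⟩ : Mat_ C) ⊗ (⟨ι, a⟩ : Mat_ C)))
      (N := (⟨ι, a⟩ : Mat_ C) ⊗ 𝟙_ (Mat_ C)) (P := (⟨ι, a⟩ : Mat_ C)) ((⟨ι, a⟩ : Mat_ C) ◁ e)
      (fun q => q.1) (fun q q' h => Prod.ext h (Subsingleton.elim (α := PUnit) _ _))
      (fun q => (ρ_ (a q.1)).hom) (i, (i, j)) (i', PUnit.unit)
  refine ⟨∑ i, γ i, ?_⟩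
  rw [← cancel_mono (ρ_ _).hom]
  simp only [Category.assoc, Iso.inv_hom_id, Category.comp_id]
  have hs : (∑ i, γ i) ▷ (⟨ι, a⟩ : Mat_ C) = ∑ i, γ i ▷ (⟨ι, a⟩ : Mat_ C) :=
    (tensorRight (⟨ι, a⟩ : Mat_ C)).map_sum _ _
  rw [hs, Preadditive.sum_comp]
  refine Mat_.hom_ext _ _ fun q (i' : ι) => ?_
  obtain ⟨u, j⟩ := q
  have happ : ∀ (t : ι → (𝟙_ (Mat_ C) ⊗ (⟨ι, a⟩ : Mat_ C) ⟶ (⟨ι, a⟩ : Mat_ C))),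
      (∑ i, t i) (u, j) i' = ∑ i, t i (u, j) i' := by
    intro t
    exact map_sum (AddMonoidHom.mk' (fun s : (𝟙_ (Mat_ C) ⊗ (⟨ι, a⟩ : Mat_ C) ⟶
      (⟨ι, a⟩ : Mat_ C)) => s (u, j) i') (fun _ _ => rfl)) t Finset.univ
  refine (happ _).trans ?_
  refine (Finset.sum_congr rfl fun i _ => key i u j i').trans ?_
  refine (Finset.sum_eq_single j (fun i _ hij => ?_) (fun h => absurd (Finset.mem_univ _) h)).trans ?_
  · rw [he i j hij, MonoidalPreadditive.tensor_zero, zero_comp, comp_zero, comp_zero]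
  · have h1 := congrArg (fun t => t ≫ (ρ_ _).hom ≫ entry (𝟙 (⟨ι, a⟩ : Mat_ C)) j i') (hc j)
    simp only [Category.assoc, Iso.inv_hom_id_assoc] at h1
    rw [leftUnitor_hom]
    refine Eq.trans ?_ h1
    rw [hd, tensorHom_id, MonoidalCategory.tensorHom_def', Category.assoc]
    exact congrArg (fun t => _ ≫ _ ≫ _ ≫ t) (rightUnitor_naturality _)

end Mat_Monoidal

namespace FrobeniusFunctor

open Verlinde LinProd Mat_Monoidal

section Form

variable {k : Type w} [Field k] {p : ℕ} [Fact p.Prime] [CharP k p]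
variable {C : Type u} [Category.{v} C] [Abelian C] [Linear k C]
variable {S V : C} {g : V ⟶ V}

/-- Invariance moves `1 - D` from the second argument to the first as its inverse. The second
argument can thus be reduced to `1`. -/
theorem Equivar.form_ext {i : Fin (p - 1)}
    {f f' : Equivar ((L k p i).as ⊗ (L k p i).as) S (𝟙 V)}
    (h : ∀ a : ℕ, f.toFun ((AdjoinRoot.root _ ^ a : Block k (i + 1)) ⊗ₜ[k] (1 : Block k (i + 1)) :
      Block k (i + 1) ⊗[k] Block k (i + 1)) = f'.toFun
        ((AdjoinRoot.root _ ^ a : Block k (i + 1)) ⊗ₜ[k] (1 : Block k (i + 1)) :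
      Block k (i + 1) ⊗[k] Block k (i + 1))) : f = f' := by
  let B := Block k (i + 1)
  let φ : Equivar ((L k p i).as ⊗ (L k p i).as) S (𝟙 V) → (B →ₗ[k] B →ₗ[k] (S ⟶ V)) := fun f =>
    (TensorProduct.mk k B B).compr₂ f.toFun
  have hφ : ∀ f (x y : B), φ f ((1 - AdjoinRoot.root _) * x) ((1 - AdjoinRoot.root _) * y) =
      φ f x y := by
    intro f x y
    have h1 := f.comm (x ⊗ₜ[k] y : B ⊗[k] B)
    rw [Category.comp_id] at h1
    refine Eq.trans (congrArg f.toFun ?_) h1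
    exact congrArg₂ (fun a b : B => (a ⊗ₜ[k] b : B ⊗[k] B))
      (act_blk (k := k) (p := p) (i + 1) (by omega) x).symm
      (act_blk (k := k) (p := p) (i + 1) (by omega) y).symm
  obtain ⟨σ, hσ, -⟩ := exists_conj (k := k) (i + 1)
  have hstep : ∀ (f) (x y : B), φ f x ((1 - AdjoinRoot.root _) * y) =
      φ f (σ (1 - AdjoinRoot.root _) * x) y := by
    intro f x y
    rw [← hφ f (σ (1 - AdjoinRoot.root _) * x) y, ← mul_assoc, hσ, one_mul]
  have h1 : ∀ x : B, φ f x 1 = φ f' x 1 := by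
    intro x
    exact LinearMap.congr_fun (f := (φ f).flip 1) (g := (φ f').flip 1) (blockLin_ext h) x
  have h2 : ∀ (a : ℕ) (x : B), φ f x (AdjoinRoot.root _ ^ a) = φ f' x (AdjoinRoot.root _ ^ a) := by
    intro a
    induction a with
    | zero => intro x; rw [pow_zero]; exact h1 x
    | succ a ih =>
      intro x
      have h3 : (AdjoinRoot.root _ ^ (a + 1) : B) =
          AdjoinRoot.root _ ^ a - (1 - AdjoinRoot.root _) * AdjoinRoot.root _ ^ a := by ring
      rw [h3, map_sub, map_sub, hstep, hstep, ih, ih]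
  refine Equivar.ext (TensorProduct.ext' (R := k) (M := B) (N := B) fun x y => ?_)
  exact LinearMap.congr_fun (blockLin_ext (f := φ f x) (g := φ f' x) fun a => h2 a x) y

variable [MonoidalCategory C] [MonoidalPreadditive C] [MonoidalLinear k C]

/-- Twisting the standard form by powers of `D` produces the basis of invariant forms dual to the
vectors `root^s ⊗ 1`. -/
theorem toLin_mulHom_theta (i : Fin (p - 1)) (s a : ℕ) (hs : s ≤ i) :
    toLin (mulHom (k := k) (p := p) (i + 1) (by omega) (AdjoinRoot.root _ ^ ((i : ℕ) - s)) ▷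
      (L k p i).as ≫ theta k p i) ((AdjoinRoot.root _ ^ a : Block k (i + 1)) ⊗ₜ[k]
        (1 : Block k (i + 1)) : Block k (i + 1) ⊗[k] Block k (i + 1)) =
      (if a = s then (1 : k) else 0) := by
  have h1 : (AdjoinRoot.root _ ^ ((i : ℕ) - s) * AdjoinRoot.root _ ^ a : Block k (i + 1)) =
      AdjoinRoot.root _ ^ ((i : ℕ) - s + a) := (pow_add _ _ _).symm
  refine (congrArg (fun t : Block k (i + 1) => toLin (theta k p i)
    (t ⊗ₜ[k] (1 : Block k (i + 1)) : Block k (i + 1) ⊗[k] Block k (i + 1))) h1).trans ?_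
  refine (theta_apply i _).trans ?_
  congr 1
  exact propext (by omega)

/-- An invariant form on a Jordan block factors, modulo negligible morphisms, through the
standard one. -/
theorem Equivar.psi_form {i : Fin (p - 1)} (f : Equivar ((L k p i).as ⊗ (L k p i).as) S (𝟙 (𝟙_ C)))
    (m : Fin (p - 1)) : f.psi m =
      (homMk (f.toFun ((AdjoinRoot.root _ ^ (i : ℕ) : Block k (i + 1)) ⊗ₜ[k] (1 : Block k (i + 1)) :
        Block k (i + 1) ⊗[k] Block k (i + 1))) (formL k p i) :
        (⟨S, L k p i ⊗ L k p i⟩ : LinProd k C (Ver k p)) ⟶ ⟨𝟙_ C, 𝟙_ _⟩) ≫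
          (unitEquivar k p C).psi m := by
  let x : ℕ → (S ⟶ 𝟙_ C) := fun a => f.toFun
    ((AdjoinRoot.root _ ^ a : Block k (i + 1)) ⊗ₜ[k] (1 : Block k (i + 1)) :
        Block k (i + 1) ⊗[k] Block k (i + 1))
  let τ : ℕ → ((L k p i).as ⊗ (L k p i).as ⟶ 𝟙_ _) := fun s =>
    mulHom (k := k) (p := p) (i + 1) (by omega) (AdjoinRoot.root _ ^ ((i : ℕ) - s)) ▷
      (L k p i).as ≫ theta k p i
  -- Expansion of an invariant form in the basis `τ s` of twisted standard forms.
  have h1 : f = ∑ s ∈ Finset.range (i + 1), (unitEquivar k p C).pre (x s) (τ s) := by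
    refine form_ext fun a => ?_
    have h2 : ∀ s ∈ Finset.range ((i : ℕ) + 1), ((unitEquivar k p C).pre (x s) (τ s)).toFun
        ((AdjoinRoot.root _ ^ a : Block k (i + 1)) ⊗ₜ[k] (1 : Block k (i + 1)) :
        Block k (i + 1) ⊗[k] Block k (i + 1)) = if a = s then x s else 0 := by
      intro s hs
      have hs' := Finset.mem_range.1 hs
      refine (pre_apply _ _ _ _).trans ?_
      refine (congrArg (fun t => x s ≫ (unitEquivar k p C).toFun t)
        (toLin_mulHom_theta i s a (by omega))).trans ?_
      refine (?_ : x s ≫ ((if a = s then (1 : k) else 0) • 𝟙 (𝟙_ C)) = _)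
      split_ifs
      · rw [one_smul, Category.comp_id]
      · rw [zero_smul, comp_zero]
    refine Eq.trans ?_ ((sum_apply _ _ _).trans (Finset.sum_congr rfl h2)).symm
    rw [Finset.sum_ite_eq]
    split_ifs with ha
    · rfl
    · rw [Finset.mem_range, not_lt] at ha
      have h3 : (AdjoinRoot.root _ ^ a : Block k (i + 1)) = 0 := root_pow_eq_zero_of_le ha
      refine (congrArg (fun t : Block k (i + 1) => f.toFun (t ⊗ₜ[k] (1 : Block k (i + 1)) :
        Block k (i + 1) ⊗[k] Block k (i + 1))) h3).trans ?_
      refine (congrArg f.toFun (TensorProduct.zero_tmul _ _)).trans (map_zero _)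
  -- For `s < i` the form `τ s` contains a positive power of `D`, which is negligible. Only the
  -- coefficient of the standard form, the value at `root^i ⊗ 1`, remains.
  have h4 : ∀ s ∈ Finset.range ((i : ℕ) + 1), s ≠ i →
      ((unitEquivar k p C).pre (x s) (τ s)).psi m = 0 := by
    intro s hs hsi
    have hs' := Finset.mem_range.1 hs
    refine psi_pre_eq_zero _ _ _ ?_ m
    have h5 : (pr (mulHom (k := k) (p := p) (i + 1) (by omega)
        (AdjoinRoot.root _ ^ ((i : ℕ) - s))) : L k p i ⟶ L k p i) = 0 := by
      refine (pr_eq_zero_iff (X := L k p i) (Y := L k p i) _).2 ?_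
      have := isNegligible_mulHom (k := k) (p := p) (m := i + 1) (hm := by omega)
        (Polynomial.X ^ ((i : ℕ) - s)) (by rw [Polynomial.coeff_X_pow, if_neg (by omega)])
      rwa [map_pow, AdjoinRoot.mk_X] at this
    change (pr (mulHom (k := k) (p := p) (i + 1) (by omega)
        (AdjoinRoot.root _ ^ ((i : ℕ) - s))) : L k p i ⟶ L k p i) ▷ L k p i ≫ formL k p i = 0
    rw [h5, MonoidalPreadditive.zero_whiskerRight, zero_comp]
  have h6 : f.psi m = ∑ s ∈ Finset.range ((i : ℕ) + 1),
      ((unitEquivar k p C).pre (x s) (τ s)).psi m := by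
    conv_lhs => rw [h1]
    exact map_sum (AddMonoidHom.mk' (fun f : Equivar ((L k p i).as ⊗ (L k p i).as) S (𝟙 (𝟙_ C)) =>
      f.psi m) (fun _ _ => psi_add _ _ m)) _ _
  rw [h6, Finset.sum_eq_single (i : ℕ) (fun s hs hsi => h4 s hs hsi)
    (fun h => absurd (Finset.mem_range.2 (Nat.lt_succ_self _)) h), psi_pre]
  have h7 : τ i = theta k p i := by
    change mulHom (k := k) (p := p) (i + 1) _ _ ▷ _ ≫ _ = _
    have h8 : mulHom (k := k) (p := p) (i + 1) (by omega) (AdjoinRoot.root _ ^ ((i : ℕ) - i)) =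
        𝟙 (L k p i).as := by
      rw [Nat.sub_self, pow_zero]; exact mulHom_id _ _
    refine (congrArg (fun t => t ▷ _ ≫ _) h8).trans ?_
    exact (congrArg (fun t => t ≫ _) (id_whiskerRight _ _)).trans (Category.id_comp _)
  rw [h7]; rfl

end Form

end FrobeniusFunctor

end

/-! ### The evaluation on the values of the functor at a dual pair. -/

noncomputable section

section MapPairing

open Functor.LaxMonoidal Functor.OplaxMonoidal ExactPairing

variable {C₀ : Type u₁} [Category.{v₁} C₀] [MonoidalCategory C₀]
variable {C : Type u} [Category.{v} C] [MonoidalCategory C]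
variable (P : C₀ ⥤ C) [P.Monoidal] (X Y : C₀) [ExactPairing X Y]

/-- Monoidal functors preserve dualities. -/
@[reducible]
def mapPairing : ExactPairing (P.obj X) (P.obj Y) where
  coevaluation' := ε P ≫ P.map (η_ X Y) ≫ δ P X Y
  evaluation' := μ P Y X ≫ P.map (ε_ X Y) ≫ η P
  coevaluation_evaluation' := by
    have h := congrArg P.map (coevaluation_evaluation X Y)
    simp only [Functor.map_comp, Functor.Monoidal.map_whiskerLeft, Functor.Monoidal.map_whiskerRight,
      Functor.Monoidal.map_associator_inv, Functor.Monoidal.map_rightUnitor,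
      Functor.Monoidal.map_leftUnitor_inv, Category.assoc, Functor.Monoidal.μ_δ_assoc] at h
    have h' := congrArg (fun t => P.obj Y ◁ ε P ≫ μ P _ _ ≫ t ≫ δ P _ _ ≫ η P ▷ P.obj Y) h
    simp only [Category.assoc, Functor.Monoidal.μ_δ_assoc] at h'
    simpa [← comp_whiskerRight, ← whiskerLeft_comp, ← comp_whiskerRight_assoc,
      ← whiskerLeft_comp_assoc] using h'
  evaluation_coevaluation' := by
    have h := congrArg P.map (evaluation_coevaluation X Y)
    simp only [Functor.map_comp, Functor.Monoidal.map_whiskerLeft, Functor.Monoidal.map_whiskerRight,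
      Functor.Monoidal.map_associator, Functor.Monoidal.map_rightUnitor_inv,
      Functor.Monoidal.map_leftUnitor, Category.assoc, Functor.Monoidal.μ_δ_assoc] at h
    have h' := congrArg (fun t => ε P ▷ P.obj X ≫ μ P _ _ ≫ t ≫ δ P _ _ ≫ P.obj X ◁ η P) h
    simp only [Category.assoc, Functor.Monoidal.μ_δ_assoc] at h'
    simpa [← comp_whiskerRight, ← whiskerLeft_comp, ← comp_whiskerRight_assoc,
      ← whiskerLeft_comp_assoc] using h'

end MapPairing

namespace FrobeniusFunctor

open Verlinde LinProd Mat_Monoidal Functor.LaxMonoidal Functor.OplaxMonoidal ExactPairing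

section FormPairing

variable {k : Type w} [Field k] {p : ℕ} [Fact p.Prime] [CharP k p]
variable {C : Type u} [Category.{v} C] [Abelian C] [Linear k C]

theorem Equivar.can_root_pow {V : C} (g : V ⟶ V) (i : Fin (p - 1)) (a : ℕ) :
    (can (k := k) g i).toFun (AdjoinRoot.root _ ^ a : Block k (i + 1)) =
      kernel.ι (endPow (𝟙 V - g) (i + 1)) ≫ endPow (𝟙 V - g) a := by
  have h1 := (can (k := k) g i).dop_pow_comm a (1 : Block k (i + 1))
  refine Eq.trans (congrArg _ ?_) (h1.trans (congrArg (fun t => t ≫ _) (can_genL g i)))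
  exact ((dop_blk_pow (k := k) (i + 1) (by omega) a (1 : Block k (i + 1))).trans (mul_one _)).symm

variable [MonoidalCategory C] [MonoidalPreadditive C] [MonoidalLinear k C] [HasDuals C]
variable {C₀ : Type u₁} [Category.{v₁} C₀] [MonoidalCategory C₀]
variable (P : C₀ ⥤ C) [P.Monoidal] (g : P ⟶ P) [NatTrans.IsMonoidal g]
variable (X Y : C₀) [ExactPairing X Y]

attribute [local instance] mapPairing

theorem evaluation_map : ε_ (P.obj X) (P.obj Y) = μ P Y X ≫ P.map (ε_ X Y) ≫ η P := rfl

theorem evaluation_map_ε :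
    ε_ (P.obj X) (P.obj Y) ≫ ε P = μ P Y X ≫ P.map (ε_ X Y) := by
  rw [evaluation_map, Category.assoc, Category.assoc, Functor.Monoidal.η_ε, Category.comp_id]

/-- The evaluation is built from structure maps of `P` and the image of a morphism, all compatible
with the monoidal transformation `g`, and `g` is trivial on the unit. -/
theorem evaluation_map_equivariant :
    (g.app Y ⊗ₘ g.app X) ≫ ε_ (P.obj X) (P.obj Y) = ε_ (P.obj X) (P.obj Y) := by
  have : Mono (ε P) := inferInstance
  rw [← cancel_mono (ε P), Category.assoc, evaluation_map_ε, ← Category.assoc,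
    μ_equivariant P g Y X, Category.assoc, ← g.naturality, ← Category.assoc, ← evaluation_map_ε,
    Category.assoc, ← ε_equivariant P g]
  exact congrArg (fun t => _ ≫ t) (Category.id_comp _)

/-- The evaluation of the values of the functor on a dual pair. -/
def formMap [IsIso (ε (blFunctor k p P g))] : (blFunctor k p P g).obj Y ⊗ (blFunctor k p P g).obj X ⟶ 𝟙_ _ :=
  μ (blFunctor k p P g) Y X ≫ (blFunctor k p P g).map (ε_ X Y) ≫ inv (ε (blFunctor k p P g))

theorem formMap_ε [IsIso (ε (blFunctor k p P g))] :
    formMap (k := k) (p := p) P g X Y ≫ ε (blFunctor k p P g) =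
    μ (blFunctor k p P g) Y X ≫ (blFunctor k p P g).map (ε_ X Y) := by
  rw [formMap, Category.assoc, Category.assoc, IsIso.inv_hom_id, Category.comp_id]

variable {X} in
theorem tst_can (i : Fin (p - 1)) :
    tst (k := k) (p := p) (P := P) (g := g) (M := single ⟨powKer (𝟙 _ - g.app X) i, L k p i⟩)
      (fun _ => Equivar.can (g.app X) i) =
    relabel (M := single ⟨powKer (𝟙 _ - g.app X) i, L k p i⟩) (N := Bl k p (g.app X)) (fun _ => i)
      (fun _ => homMk (powKerπ (𝟙 _ - g.app X) i) (𝟙 (L k p i))) :=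
  eq_relabel _ _ _ (fun _ => Equivar.psi_can_self (g.app X) i)
    (fun _ (_ : Fin (p - 1)) hij => Equivar.psi_of_ne hij _)

theorem formMap_ne [IsIso (ε (blFunctor k p P g))] (i j : Fin (p - 1)) (hij : i ≠ j) :
    formMap (k := k) (p := p) P g X Y (i, j) PUnit.unit = 0 :=
  eq_zero_of_right (fun t => hom_tensor_eq_zero hij t) _

/-- On canonical elements the evaluation is an invariant form on a Jordan block. By `psi_form` it is
the standard form times its value at `root^i ⊗ 1`, that is `ev (D^i x, y)`: exactly the pairing of
layers, whose exponent `i` is explained in this way. -/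
theorem formMap_self [IsIso (ε (blFunctor k p P g))] (i : Fin (p - 1))
    (b : layer (𝟙 _ - g.app Y) i ⊗ layer (𝟙 _ - g.app X) i ⟶ 𝟙_ C)
    (hb : (powKerπ (𝟙 _ - g.app Y) i ⊗ₘ powKerπ (𝟙 _ - g.app X) i) ≫ b =
      ((kernel.ι (endPow (𝟙 _ - g.app Y) (i + 1)) ≫ endPow (𝟙 _ - g.app Y) i) ⊗ₘ
        kernel.ι (endPow (𝟙 _ - g.app X) (i + 1))) ≫ ε_ (P.obj X) (P.obj Y)) :
    formMap (k := k) (p := p) P g X Y (i, i) PUnit.unit = homMk b (formL k p i) := by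
  let M : Mat_ (LinProd k C (Ver k p)) := single ⟨powKer (𝟙 _ - g.app Y) i, L k p i⟩
  let N : Mat_ (LinProd k C (Ver k p)) := single ⟨powKer (𝟙 _ - g.app X) i, L k p i⟩
  let T : Fam M (g.app Y) := fun _ => Equivar.can (g.app Y) i
  let T' : Fam N (g.app X) := fun _ => Equivar.can (g.app X) i
  let f : Equivar ((L k p i).as ⊗ (L k p i).as)
      (powKer (𝟙 _ - g.app Y) i ⊗ powKer (𝟙 _ - g.app X) i) (𝟙 (𝟙_ C)) :=
    ((Equivar.can (g.app Y) i).tensor (Equivar.can (g.app X) i)).post (ε_ (P.obj X) (P.obj Y))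
      ((evaluation_map_equivariant P g X Y).trans (Category.comp_id _).symm)
  have hf : f.toFun ((AdjoinRoot.root _ ^ (i : ℕ) : Block k (i + 1)) ⊗ₜ[k] (1 : Block k (i + 1)) :
        Block k (i + 1) ⊗[k] Block k (i + 1)) =
      (powKerπ (𝟙 _ - g.app Y) i ⊗ₘ powKerπ (𝟙 _ - g.app X) i) ≫ b := by
    rw [hb]
    refine congrArg (fun t => t ≫ _) ?_
    exact congrArg₂ (fun s t => s ⊗ₘ t) (Equivar.can_root_pow (g.app Y) i i)
      (Equivar.can_genL (g.app X) i)
  have h1 : (tst T ⊗ₘ tst T') ≫ formMap (k := k) (p := p) P g X Y =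
      relabel (M := M ⊗ N) (N := 𝟙_ (Mat_ (LinProd k C (Ver k p)))) (fun _ => PUnit.unit)
        (fun _ => homMk ((powKerπ (𝟙 _ - g.app Y) i ⊗ₘ powKerπ (𝟙 _ - g.app X) i) ≫ b)
          (formL k p i)) := by
    rw [← cancel_mono (ε (blFunctor k p P g)), Category.assoc, formMap_ε, ← Category.assoc, tst_μ,
      tst_map]
    refine Mat_.hom_ext _ _ fun q (m : Fin (p - 1)) => ?_
    refine Eq.trans ?_ (relabel_comp (M := M ⊗ N) (N := 𝟙_ (Mat_ (LinProd k C (Ver k p))))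
      (P := Bl k p (g.app (𝟙_ C₀))) _ _ _ q m).symm
    have h2 : ((Fam.mul P T T' q).post (P.map (ε_ X Y)) (g.naturality (ε_ X Y)).symm) =
        f.post (ε P) (ε_equivariant P g) := by
      refine Equivar.tensor_ext fun a b => ?_
      exact (Category.assoc _ _ _).trans ((congrArg (fun t => _ ≫ t)
        (evaluation_map_ε P X Y).symm).trans (Category.assoc _ _ _).symm)
    refine (congrArg (fun t => Equivar.psi t m) h2).trans ?_
    refine (Equivar.psi_post f (ε P) (ε_equivariant P g) (one_sub_comm (ε_equivariant P g)) m).trans ?_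
    rw [Equivar.psi_form, hf, Category.assoc]
    refine congrArg (fun t => _ ≫ t) ?_
    exact (Equivar.psi_post _ (ε P) (ε_equivariant P g) (one_sub_comm (ε_equivariant P g)) m).symm
  have h3 := congrFun (congrFun h1 (PUnit.unit, PUnit.unit)) PUnit.unit
  have hY := tst_can (k := k) (p := p) P g (X := Y) i
  have hX := tst_can (k := k) (p := p) P g (X := X) i
  have h4 : (tst T ⊗ₘ tst T') ≫ formMap (k := k) (p := p) P g X Y =
    relabel (M := M ⊗ N) (N := Bl k p (g.app Y) ⊗ Bl k p (g.app X)) (fun _ => (i, i))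
      (fun _ => homMk (powKerπ (𝟙 _ - g.app Y) i) (𝟙 (L k p i)) ⊗ₘ
        homMk (powKerπ (𝟙 _ - g.app X) i) (𝟙 (L k p i))) ≫ formMap (k := k) (p := p) P g X Y := by
    refine congrArg (fun t => t ≫ _) ?_
    refine (congrArg₂ (fun s t => s ⊗ₘ t) hY hX).trans ?_
    exact relabel_tensor (M := M) (N := Bl k p (g.app Y)) (M' := N) (N' := Bl k p (g.app X)) _ _ _ _
  rw [h4] at h3
  have h5 := (relabel_comp (M := M ⊗ N) (N := Bl k p (g.app Y) ⊗ Bl k p (g.app X))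
    (P := 𝟙_ (Mat_ (LinProd k C (Ver k p)))) _ _ (formMap (k := k) (p := p) P g X Y)
      (PUnit.unit, PUnit.unit) PUnit.unit).symm.trans h3
  -- The identity is known after pulling back to the kernels of `D^{i+1}`, and descends because the
  -- projections to the layers tensor to an epimorphism.
  have : Epi (homMk (k := k) (powKerπ (𝟙 _ - g.app Y) i ⊗ₘ powKerπ (𝟙 _ - g.app X) i)
    (𝟙 (L k p i) ⊗ₘ 𝟙 (L k p i))) := epi_homMk _ _
  refine (cancel_epi (homMk (k := k) (powKerπ (𝟙 _ - g.app Y) i ⊗ₘ powKerπ (𝟙 _ - g.app X) i)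
    (𝟙 (L k p i) ⊗ₘ 𝟙 (L k p i)))).1 ?_
  refine h5.trans ?_
  have h6 : (𝟙 (𝟙_ (Mat_ (LinProd k C (Ver k p))))) PUnit.unit PUnit.unit =
      𝟙 (𝟙_ (LinProd k C (Ver k p))) := Mat_.id_apply_self _ _
  refine (congrArg (fun t => homMk ((powKerπ (𝟙 _ - g.app Y) i ⊗ₘ powKerπ (𝟙 _ - g.app X) i) ≫ b)
    (formL k p i) ≫ t) h6).trans ((Category.comp_id _).trans ?_)
  rw [homMk_comp]
  congr 1
  exact ((congrArg (fun t => t ≫ _) (id_tensorHom_id _ _)).trans (Category.id_comp _)).symm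

/-- The evaluation is diagonal, and its diagonal entries are external products of the perfect
pairing of layers with the perfect form on `L_i`; the coevaluations multiply accordingly. -/
theorem exists_coevaluation_formMap [∀ X, IsIso (g.app X)] [IsIso (ε (blFunctor k p P g))] :
    ∃ c : 𝟙_ _ ⟶ (blFunctor k p P g).obj X ⊗ (blFunctor k p P g).obj Y,
      c ▷ _ ≫ (α_ _ _ _).hom ≫ _ ◁ formMap (k := k) (p := p) P g X Y = (λ_ _).hom ≫ (ρ_ _).inv := by
  choose b c hb hc using fun i : ℕ => exists_layer_pairing (V := P.obj X) (W := P.obj Y)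
    (g := g.app X) (h := g.app Y) (evaluation_map_equivariant P g X Y) i
  refine Mat_Monoidal.exists_coevaluation (ι := Fin (p - 1))
    (fun i => (⟨layer (𝟙 _ - g.app X) i, L k p i⟩ : LinProd k C (Ver k p)))
    (fun i => ⟨layer (𝟙 _ - g.app Y) i, L k p i⟩) (formMap (k := k) (p := p) P g X Y)
    (formMap_ne P g X Y) (fun i => homMk (c i) (η_ (L k p i) (L k p i)))
    (fun i => homMk (b i) (formL k p i))
    (fun i => formMap_self P g X Y i (b i) (hb i)) (fun i => ?_)
  change homMk ((c i ⊗ₘ 𝟙 _) ≫ (α_ _ _ _).hom ≫ (𝟙 _ ⊗ₘ b i))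
    ((η_ (L k p i) (L k p i) ⊗ₘ 𝟙 (L k p i)) ≫ (α_ _ _ _).hom ≫ (𝟙 (L k p i) ⊗ₘ formL k p i)) =
    homMk ((λ_ _).hom ≫ (ρ_ _).inv) ((λ_ (L k p i)).hom ≫ (ρ_ (L k p i)).inv)
  congr 1
  · rw [tensorHom_id, id_tensorHom]; exact hc i
  · rw [tensorHom_id, id_tensorHom]; exact evaluation_coevaluation (L k p i) (L k p i)

end FormPairing

end FrobeniusFunctor

end

/-! ### Nilpotency of the defect, and invertibility of the tensor structure. -/

noncomputable section

section MapAction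

open Functor.LaxMonoidal Functor.OplaxMonoidal ExactPairing

variable {C₀ : Type u₁} [Category.{v₁} C₀] [MonoidalCategory C₀]
variable {C : Type u} [Category.{v} C] [MonoidalCategory C]
variable (P : C₀ ⥤ C) [P.Monoidal] (X Y : C₀) [ExactPairing X Y]

attribute [local instance] mapPairing

theorem map_pairAct₀ : μ P X Y ▷ P.obj X ≫ μ P (X ⊗ Y) X ≫ P.map (pairAct₀ X Y) =
    pairAct₀ (P.obj X) (P.obj Y) := by
  have h : ε_ (P.obj X) (P.obj Y) = μ P Y X ≫ P.map (ε_ X Y) ≫ η P := rfl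
  rw [pairAct₀, pairAct₀, h]
  simp

/-- Since `P` is strong, an element of `P X ⊗ P Y` acts on `P (X ⊗ U)` through its action on the
first factor alone. -/
theorem map_pairAct (U : C₀) {S : C} (x : S ⟶ P.obj X ⊗ P.obj Y) :
    S ◁ μ P X U ≫ (x ≫ μ P X Y) ▷ P.obj (X ⊗ U) ≫ μ P (X ⊗ Y) (X ⊗ U) ≫ P.map (pairAct X Y U) =
      ((α_ _ _ _).inv ≫ (x ▷ P.obj X ≫ pairAct₀ (P.obj X) (P.obj Y)) ▷ P.obj U) ≫ μ P X U := by
  rw [pairAct_eq, P.map_comp, whisker_exchange_assoc,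
    Functor.LaxMonoidal.associativity_inv_assoc, ← μ_natural_left, ← map_pairAct₀]
  simp

end MapAction

namespace FrobeniusFunctor

open Verlinde LinProd Mat_Monoidal Functor.LaxMonoidal Functor.OplaxMonoidal ExactPairing

theorem After.whiskerRight {C : Type u} [Category.{v} C] [Preadditive C] [MonoidalCategory C]
    [MonoidalPreadditive C] {S V : C} {a : S ⊗ V ⟶ V} {r : ℕ} {R : C} {v : R ⟶ V}
    (hv : After a (fun _ v => v = 0) r R v) {Z T : C} (s : T ⟶ R ⊗ Z) :
    After ((α_ S V Z).inv ≫ a ▷ Z) (fun _ v => v = 0) r T (s ≫ v ▷ Z) := by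
  induction r generalizing R T with
  | zero =>
    have : v = 0 := hv
    change s ≫ v ▷ Z = 0
    rw [this, MonoidalPreadditive.zero_whiskerRight, comp_zero]
  | succ r ih =>
    have h1 : S ◁ (s ≫ v ▷ Z) ≫ (α_ S V Z).inv ≫ a ▷ Z =
        (S ◁ s ≫ (α_ S R Z).inv) ≫ (S ◁ v ≫ a) ▷ Z := by
      rw [whiskerLeft_comp, Category.assoc, associator_inv_naturality_middle_assoc, Category.assoc,
        comp_whiskerRight]
    change After _ _ r _ (S ◁ (s ≫ v ▷ Z) ≫ (α_ S V Z).inv ≫ a ▷ Z)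
    rw [h1]
    exact ih hv _

theorem pairAct₀_equivariant {C : Type u} [Category.{v} C] [MonoidalCategory C] {V W : C}
    [ExactPairing V W] {g : V ⟶ V} {h : W ⟶ W} (hev : (h ⊗ₘ g) ≫ ε_ V W = ε_ V W) :
    ((g ⊗ₘ h) ⊗ₘ g) ≫ pairAct₀ V W = pairAct₀ V W ≫ g := by
  have h1 : (g ⊗ₘ (h ⊗ₘ g)) ≫ V ◁ ε_ V W = V ◁ ε_ V W ≫ g ▷ _ := by
    rw [← id_tensorHom, tensorHom_comp_tensorHom, hev, Category.comp_id, ← tensorHom_id,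
      tensorHom_comp_tensorHom, Category.id_comp, Category.comp_id]
  rw [pairAct₀, associator_naturality_assoc, reassoc_of% h1, rightUnitor_naturality]
  simp

section Nilpotent

variable {k : Type w} [Field k] {p : ℕ} [Fact p.Prime] [CharP k p]
variable {C : Type u} [Category.{v} C] [Abelian C] [Linear k C]
variable [MonoidalCategory C] [MonoidalPreadditive C] [MonoidalLinear k C] [HasDuals C]
variable {C₀ : Type u₁} [Category.{v₁} C₀] [MonoidalCategory C₀]
variable {P : C₀ ⥤ C} [P.Monoidal] {g : P ⟶ P} [NatTrans.IsMonoidal g]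

/-- Multiplication with an element which is locally given by an invariant. -/
theorem tst_mul_map {Q Z Z' : C₀} {n : 𝟙_ _ ⟶ (blFunctor k p P g).obj Q} {S : C} {σ : S ⟶ 𝟙_ C}
    {y : S ⟶ P.obj Q} {hy : y ≫ g.app Q = y}
    (hn : singleMap (homMk σ (𝟙 (𝟙_ (Ver k p)))) ≫ n = tst (invFam k p y hy))
    {M : Mat_ (LinProd k C (Ver k p))} (T : Fam M (g.app Z)) (f : Q ⊗ Z ⟶ Z') :
    (singleMap (homMk σ (𝟙 (𝟙_ (Ver k p)))) ⊗ₘ tst T) ≫ n ▷ (blFunctor k p P g).obj Z ≫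
        μ (blFunctor k p P g) Q Z ≫ (blFunctor k p P g).map f =
      tst fun q => (Fam.mul P (invFam k p y hy) T q).post (P.map f) (g.naturality f).symm := by
  rw [← tensorHom_id, ← Category.assoc, tensorHom_comp_tensorHom, Category.comp_id, hn,
    ← Category.assoc, tst_μ, tst_map]

theorem mul_invFam_apply {Q Z : C₀} {S : C} {y : S ⟶ P.obj Q} {hy : y ≫ g.app Q = y}
    {M : Mat_ (LinProd k C (Ver k p))} (T : Fam M (g.app Z)) (i : M.ι) (a : (M.X i).right.as) :
    (Fam.mul P (invFam k p y hy) T (PUnit.unit, i)).toFun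
      ((1 : k) ⊗ₜ[k] a : k ⊗[k] ((M.X i).right.as : Type w)) =
      S ◁ (T i).toFun a ≫ y ▷ P.obj Z ≫ μ P Q Z := by
  refine (?_ : (((1 : k) • y) ⊗ₘ (T i).toFun a) ≫ μ P Q Z = _)
  rw [one_smul, MonoidalCategory.tensorHom_def', Category.assoc]

/-- On a class given by a family `T`, the lax action of `n` is, after covering the unit by `S`, the
class of the family acted on by `y`. Vanishing of iterated actions on elements therefore gives
vanishing of the power of the operator. -/
theorem tst_laxAct_pow (X Y U : C₀) [ExactPairing X Y]
    {n : 𝟙_ _ ⟶ (blFunctor k p P g).obj (X ⊗ Y)} {S : C} {σ : S ⟶ 𝟙_ C} [Epi σ]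
    {y : S ⟶ P.obj (X ⊗ Y)} {hy : y ≫ g.app (X ⊗ Y) = y}
    (hn : singleMap (homMk σ (𝟙 (𝟙_ (Ver k p)))) ≫ n = tst (invFam k p y hy)) (r : ℕ)
    {M : Mat_ (LinProd k C (Ver k p))} (T : Fam M (g.app (X ⊗ U)))
    (hT : ∀ i a, After (y ▷ P.obj (X ⊗ U) ≫ μ P (X ⊗ Y) (X ⊗ U) ≫ P.map (pairAct X Y U))
      (fun _ v => v = 0) r _ ((T i).toFun a)) :
    tst T ≫ (End.of (laxAct (blFunctor k p P g) X Y U n) ^ r).asHom = 0 := by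
  induction r generalizing M with
  | zero =>
    have : T = fun _ => 0 := by
      refine funext fun i => Equivar.ext (LinearMap.ext fun a => hT i a)
    rw [this]
    exact (congrArg (fun t => t ≫ _) Psi_zero).trans zero_comp
  | succ r ih =>
    let M' : Mat_ (LinProd k C (Ver k p)) := single ⟨S, 𝟙_ _⟩ ⊗ M
    let T' : Fam M' (g.app (X ⊗ U)) := fun q =>
      (Fam.mul P (invFam k p y hy) T q).post (P.map (pairAct X Y U)) (g.naturality _).symm
    have h1 : tst T' ≫ (End.of (laxAct (blFunctor k p P g) X Y U n) ^ r).asHom = 0 := by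
      refine ih T' ?_
      rintro ⟨u, i⟩ (a : k ⊗[k] ((M.X i).right.as : Type w))
      obtain ⟨b, rfl⟩ : ∃ b : (M.X i).right.as, (1 : k) ⊗ₜ[k] b = a :=
        ⟨TensorProduct.lid k _ a, (TensorProduct.lid k ((M.X i).right.as : Type w)).symm_apply_apply a⟩
      have h2 : (T' (u, i)).toFun ((1 : k) ⊗ₜ[k] b : k ⊗[k] ((M.X i).right.as : Type w)) =
          S ◁ (T i).toFun b ≫ y ▷ P.obj (X ⊗ U) ≫ μ P (X ⊗ Y) (X ⊗ U) ≫ P.map (pairAct X Y U) := by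
        refine (congrArg (fun t => t ≫ P.map (pairAct X Y U)) (mul_invFam_apply T i b)).trans ?_
        simp only [Category.assoc]
      have h3 := hT i b
      exact h2 ▸ h3
    have h4 := tst_mul_map hn T (pairAct X Y U)
    have h5 : tst T' = (singleMap (homMk σ (𝟙 (𝟙_ (Ver k p)))) ⊗ₘ 𝟙 M) ≫ (λ_ M).hom ≫ tst T ≫
        laxAct (blFunctor k p P g) X Y U n := by
      refine h4.symm.trans ?_
      rw [laxAct, leftUnitor_inv_naturality_assoc, Iso.hom_inv_id_assoc, ← id_tensorHom]
      refine Eq.trans ?_ (tensorHom_comp_tensorHom_assoc _ _ _ _ _).symm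
      exact congrArg₂ (fun s t => (s ⊗ₘ t) ≫ _) (Category.comp_id _).symm (Category.id_comp _).symm
    rw [h5] at h1
    have h6 : Epi (singleMap (homMk σ (𝟙 (𝟙_ (Ver k p))) :
        (⟨S, 𝟙_ _⟩ : LinProd k C (Ver k p)) ⟶ ⟨𝟙_ _, 𝟙_ _⟩) ⊗ₘ 𝟙 M) :=
      ((isFamilyEpi_singleMap (k := k) (p := p) σ (𝟙_ _)).tensor (IsFamilyEpi.id M)).epi
    rw [Category.assoc, Category.assoc, Category.assoc] at h1
    have h7 := (cancel_epi (singleMap (homMk σ (𝟙 (𝟙_ (Ver k p))) :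
        (⟨S, 𝟙_ _⟩ : LinProd k C (Ver k p)) ⟶ ⟨𝟙_ _, 𝟙_ _⟩) ⊗ₘ 𝟙 M)).1 (h1.trans comp_zero.symm)
    rw [pow_succ]
    exact (cancel_epi (λ_ M).hom).1 (h7.trans comp_zero.symm)

/-- An invariant annihilating all layers of the first factor annihilates them locally. -/
theorem cls_pairAct₀_eq_zero (X Y : C₀) [ExactPairing X Y]
    {n : 𝟙_ _ ⟶ (blFunctor k p P g).obj (X ⊗ Y)} {S : C} {σ : S ⟶ 𝟙_ C}
    {y : S ⟶ P.obj (X ⊗ Y)} {hy : y ≫ g.app (X ⊗ Y) = y}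
    (hn : singleMap (homMk σ (𝟙 (𝟙_ (Ver k p)))) ≫ n = tst (invFam k p y hy))
    (h0 : laxAct₀ (blFunctor k p P g) X Y n = 0) (i : Fin (p - 1)) {R : C} (v : R ⟶ P.obj X)
    (hv : v ≫ endPow (𝟙 _ - g.app X) (i + 1) = 0) :
    ∃ (R' : C) (τ : R' ⟶ S ⊗ R) (_ : Epi τ) (z : R' ⟶ P.obj X),
      τ ≫ (S ◁ v ≫ y ▷ P.obj X ≫ μ P (X ⊗ Y) X ≫ P.map (pairAct₀ X Y)) ≫
        endPow (𝟙 _ - g.app X) i = z ≫ endPow (𝟙 _ - g.app X) (i + 1) := by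
  let M : Mat_ (LinProd k C (Ver k p)) := single ⟨R, L k p i⟩
  let T : Fam M (g.app X) := fun _ => Equivar.ofElem (i + 1) (by omega) v hv
  let T' : Fam (single ⟨S, 𝟙_ _⟩ ⊗ M) (g.app X) := fun q =>
      (Fam.mul P (invFam k p y hy) T q).post (P.map (pairAct₀ X Y)) (g.naturality _).symm
  have h1 : tst T' = 0 := by
    refine (tst_mul_map hn T (pairAct₀ X Y)).symm.trans ?_
    have h2 : n ▷ (blFunctor k p P g).obj X ≫ μ (blFunctor k p P g) (X ⊗ Y) X ≫
        (blFunctor k p P g).map (pairAct₀ X Y) = 0 := by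
      rw [laxAct₀] at h0
      exact (cancel_epi (λ_ _).inv).1 (h0.trans comp_zero.symm)
    rw [h2, comp_zero]
  have h2 : (T' (PUnit.unit, PUnit.unit)).psi i = 0 :=
    congrFun (congrFun h1 (PUnit.unit, PUnit.unit)) i
  -- The inverse unitor is the map from a Jordan block at which the vanishing morphism is evaluated,
  -- so as to obtain a vanishing class in the layer.
  have h3 := (T' (PUnit.unit, PUnit.unit)).homMk_psi i (λ_ (L k p i).as).inv
  rw [h2, comp_zero, ← homMk_zero_left (𝟙 (L k p i))] at h3
  have h4 := homMk_left_injective (𝟙 (L k p i)) (L_id_ne_zero i) h3.symm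
  have h5 : (T' (PUnit.unit, PUnit.unit)).toFun (genImage i (λ_ (L k p i).as).inv) =
      S ◁ v ≫ y ▷ P.obj X ≫ μ P (X ⊗ Y) X ≫ P.map (pairAct₀ X Y) := by
    refine (congrArg (fun t => t ≫ P.map (pairAct₀ X Y))
      (mul_invFam_apply T PUnit.unit (1 : Block k (i + 1)))).trans ?_
    have h6 : (T PUnit.unit).toFun (1 : Block k (i + 1)) = v := Equivar.ofElem_one _ _ _ _
    refine (congrArg (fun t => (S ◁ t ≫ y ▷ P.obj X ≫ μ P (X ⊗ Y) X) ≫ P.map (pairAct₀ X Y)) h6).trans ?_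
    simp only [Category.assoc]
  have h7 := (T' (PUnit.unit, PUnit.unit)).genImage_comp_endPow i (λ_ (L k p i).as).inv
  obtain ⟨R', τ, hτ, z, hz⟩ := (cls_eq_zero_iff _ h7).1 h4
  refine ⟨R', τ, hτ, z, ?_⟩
  rw [← h5]
  exact hz

theorem singleMap_comp_invFam {V : C} {f : V ⟶ V} {S S' : C} (s : S' ⟶ S) (x : S ⟶ V)
    (hx : x ≫ f = x) (hx' : (s ≫ x) ≫ f = s ≫ x) :
    singleMap (homMk s (𝟙 (𝟙_ (Ver k p)))) ≫ Psi (invFam k p x hx) = Psi (invFam k p (s ≫ x) hx') := by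
  refine (relabel_comp_Psi (M := single ⟨S', 𝟙_ _⟩) (N := single ⟨S, 𝟙_ _⟩) (invFam k p x hx)
    (fun i => i) (fun _ => s) (fun _ => 𝟙 _)).trans ?_
  refine congrArg Psi (funext fun _ => Equivar.ext (LinearMap.ext fun (c : k) => ?_))
  exact Linear.comp_smul _ _ _ s c x

/-- An invariant is seen only through its class in `B_1`, where multiples of `D` vanish. -/
theorem Psi_invFam_congr {V : C} {f : V ⟶ V} {S : C} {x x' : S ⟶ V} (hx : x ≫ f = x)
    (hx' : x' ≫ f = x') (z : S ⟶ V) (h : x' = x + z ≫ (𝟙 V - f)) :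
    Psi (invFam k p x hx) = Psi (invFam k p x' hx') := by
  refine Mat_.hom_ext _ _ fun u (m : Fin (p - 1)) => ?_
  refine (?_ : (invElem k p x hx).psi m = (invElem k p x' hx').psi m)
  by_cases hm : m = zeroL p
  · subst hm
    rw [psi_invElem_zero, psi_invElem_zero]
    congr 1
    have hz : (z ≫ (𝟙 V - f)) ≫ endPow (𝟙 V - f) ((zeroL p : ℕ) + 1) = 0 := by
      have h1 := comp_endPow_of_invariant hx' (zeroL p : ℕ)
      rw [h, Preadditive.add_comp, comp_endPow_of_invariant hx (zeroL p : ℕ), zero_add] at h1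
      exact h1
    have h1 : (x + z ≫ (𝟙 V - f)) ≫ endPow (𝟙 V - f) ((zeroL p : ℕ) + 1) = 0 := by
      rw [← h]; exact comp_endPow_of_invariant hx' _
    rw [cls_congr (comp_endPow_of_invariant hx' _) h, cls_add _ _ (comp_endPow_of_invariant hx _) hz h1,
      cls_comp_eq_zero, add_zero]
  · rw [psi_invElem_of_ne _ _ hm, psi_invElem_of_ne _ _ hm]

attribute [local instance] mapPairing

theorem δ_equivariant (P : C₀ ⥤ C) [P.Monoidal] (g : P ⟶ P) [NatTrans.IsMonoidal g] (X Y : C₀) :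
    g.app (X ⊗ Y) ≫ δ P X Y = δ P X Y ≫ (g.app X ⊗ₘ g.app Y) := by
  rw [← cancel_epi (μ P X Y), ← Category.assoc, ← μ_equivariant P g X Y, Category.assoc,
    Functor.Monoidal.μ_δ, Functor.Monoidal.μ_δ_assoc, Category.comp_id]

/-- The morphism `n` is locally an invariant element of `P X ⊗ P Y`, so an operator on `P X`. Zero
on the layers by hypothesis and zero on `Im D^{p-1}` after modification, it is nilpotent there,
hence on `P X ⊗ P U`. -/
theorem exists_laxAct_pow_eq_zero [∀ X, IsIso (g.app X)]
    (hp : ∀ X, endPow (𝟙 _ - g.app X) p = 0) (X Y U : C₀) [ExactPairing X Y]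
    (n : 𝟙_ _ ⟶ (blFunctor k p P g).obj (X ⊗ Y)) (h0 : laxAct₀ (blFunctor k p P g) X Y n = 0) :
    ∃ N, End.of (laxAct (blFunctor k p P g) X Y U n) ^ N = 0 := by
  have hp1 : p - 1 + 1 = p := Nat.succ_pred_prime Fact.out
  have hp0 : 0 < p - 1 := by have := (Fact.out : p.Prime).two_le; omega
  obtain ⟨S₀, σ₀, hσ₀, x₀, hx₀, hn₀⟩ := exists_invariant (k := k) (p := p) (g := g.app (X ⊗ Y)) n
  have hx₀' : (x₀ ≫ δ P X Y) ≫ (g.app X ⊗ₘ g.app Y) = x₀ ≫ δ P X Y := by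
    rw [Category.assoc, ← δ_equivariant, ← Category.assoc, hx₀]
  have hev := evaluation_map_equivariant P g X Y
  have hD : endPow (𝟙 _ - (g.app X ⊗ₘ g.app Y)) (p - 1 + 1) = 0 := by
    rw [hp1, ← cancel_epi (δ P X Y), comp_zero,
      ← pow_natural (D := 𝟙 _ - g.app (X ⊗ Y)) (δ P X Y) (one_sub_comm (δ_equivariant P g X Y)), hp,
      zero_comp]
  -- The hypothesis on `n` concerns only the layers `B_1, …, B_{p-1}`. The missing top layer, the
  -- image of the norm, is cleared by changing the representative without changing the class.
  obtain ⟨S, σ, hσ, x, hx, ⟨z, hz⟩, ht⟩ := exists_modification (p - 1) hp0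
    (by rw [hp1]; exact hp Y) hD hev _ hx₀'
  have hy : (x ≫ μ P X Y) ≫ g.app (X ⊗ Y) = x ≫ μ P X Y := by
    rw [Category.assoc, ← μ_equivariant P g X Y, ← Category.assoc, hx]
  have hy₀ : (σ ≫ x₀) ≫ g.app (X ⊗ Y) = σ ≫ x₀ := by rw [Category.assoc, hx₀]
  have hn : singleMap (homMk (σ ≫ σ₀) (𝟙 (𝟙_ (Ver k p)))) ≫ n =
      tst (P := P) (g := g) (invFam k p (x ≫ μ P X Y) hy) := by
    have h1 : singleMap (homMk (σ ≫ σ₀) (𝟙 (𝟙_ (Ver k p)))) =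
        singleMap (homMk (k := k) σ (𝟙 (𝟙_ (Ver k p)))) ≫ singleMap (homMk σ₀ (𝟙 (𝟙_ (Ver k p)))) := by
      refine Eq.trans ?_ (relabel_relabel (M := single ⟨S, 𝟙_ _⟩) (N := single ⟨S₀, 𝟙_ _⟩)
        (P := single ⟨𝟙_ C, 𝟙_ _⟩) _ _ _ _).symm
      refine congrArg (relabel (M := single ⟨S, 𝟙_ _⟩) (N := single ⟨𝟙_ C, 𝟙_ _⟩) _) (funext fun _ => ?_)
      exact congrArg (homMk _) (Category.comp_id _).symm
    rw [h1, Category.assoc]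
    refine (congrArg (fun t => _ ≫ t) hn₀).trans ?_
    rw [singleMap_comp_invFam _ _ _ hy₀]
    refine Psi_invFam_congr hy₀ hy (z ≫ μ P X Y) ?_
    rw [hz, Preadditive.add_comp, Category.assoc, Category.assoc, Functor.Monoidal.δ_μ,
      Category.comp_id, Category.assoc, Category.assoc,
      one_sub_comm (μ_equivariant P g X Y)]
  have : Epi (σ ≫ σ₀) := epi_comp _ _
  obtain ⟨a, had⟩ : ∃ a, a = x ▷ P.obj X ≫ pairAct₀ (P.obj X) (P.obj Y) := ⟨_, rfl⟩
  have ha : S ◁ g.app X ≫ a = a ≫ g.app X := by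
    have h1 := pairAct₀_equivariant hev
    rw [had, Category.assoc, ← h1, MonoidalCategory.tensorHom_def (g.app X ⊗ₘ g.app Y), Category.assoc,
      ← comp_whiskerRight_assoc, hx, whisker_exchange_assoc]
  rw [← had] at ht
  -- Taking the identity as the generalized element makes the nilpotency uniform.
  have hnil : After a (fun _ v => v = 0) ((p - 1 + 1) * (p - 1 + 1)) _ (𝟙 (P.obj X)) := by
    refine after_eq_zero (D := 𝟙 _ - g.app X) (p - 1) (by rw [hp1]; exact hp X) ?_ ?_ ht (𝟙 _)
    · rw [whiskerLeft_sub', Preadditive.sub_comp, ha, Preadditive.comp_sub]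
      simp
    · intro i hi R v hv
      obtain ⟨R', τ, hτ, w, hw⟩ := cls_pairAct₀_eq_zero X Y hn h0 ⟨i, hi⟩ v hv
      refine ⟨R', τ, hτ, w, ?_⟩
      rw [← hw]
      have h1 : a = (x ≫ μ P X Y) ▷ P.obj X ≫ μ P (X ⊗ Y) X ≫ P.map (pairAct₀ X Y) := by
        rw [had, comp_whiskerRight, Category.assoc, map_pairAct₀]
      rw [h1]
  refine ⟨(p - 1 + 1) * (p - 1 + 1), ?_⟩
  refine (cancel_epi (tst (k := k) (p := p) (P := P) (canFam k p (g.app (X ⊗ U))))).1 ?_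
  refine Eq.trans ?_ comp_zero.symm
  refine tst_laxAct_pow X Y U hn _ _ fun i b => ?_
  -- The isomorphism `δ` identifies the action on `P (X ⊗ U)` with the action on the first factor of
  -- `P X ⊗ P U`.
  have hφ : S ◁ δ P X U ≫ (α_ _ _ _).inv ≫ a ▷ P.obj U = ((x ≫ μ P X Y) ▷ P.obj (X ⊗ U) ≫
      μ P (X ⊗ Y) (X ⊗ U) ≫ P.map (pairAct X Y U)) ≫ δ P X U := by
    rw [← cancel_epi (S ◁ μ P X U), Functor.Monoidal.whiskerLeft_μ_δ_assoc, ← Category.assoc (S ◁ μ P X U),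
      map_pairAct, ← had, Category.assoc, Category.assoc, Functor.Monoidal.μ_δ, Category.comp_id]
  generalize ((canFam k p (g.app (X ⊗ U)) i).toFun b) = w
  refine (After.of_comp (Q := fun _ v => v = 0) (δ P X U) hφ ?_).mono fun R v hv => ?_
  · have := hnil.whiskerRight (w ≫ δ P X U)
    rwa [id_whiskerRight, Category.comp_id] at this
  · exact (cancel_mono (δ P X U)).1 (hv.trans zero_comp.symm)

end Nilpotent

section Strong

variable {k : Type w} [Field k] {p : ℕ} [Fact p.Prime] [CharP k p]
variable {C : Type u} [Category.{v} C] [Abelian C] [Linear k C]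
variable [MonoidalCategory C] [MonoidalPreadditive C] [MonoidalLinear k C] [HasDuals C]
variable {C₀ : Type u₁} [Category.{v₁} C₀] [MonoidalCategory C₀]

/-- The tensor structure is strong on rigid objects. -/
theorem isIso_μ (P : C₀ ⥤ C) [P.Monoidal] (g : P ⟶ P) [NatTrans.IsMonoidal g]
    [∀ X, IsIso (g.app X)] (hp : ∀ X, endPow (𝟙 _ - g.app X) p = 0) (X Y U : C₀)
    [ExactPairing X Y] : IsIso (μ (blFunctor k p P g) X U) := by
  have := isIso_ε (k := k) (p := p) P g
  obtain ⟨c, hc⟩ := exists_coevaluation_formMap (k := k) (p := p) P g X Y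
  have he := formMap_ε (k := k) (p := p) P g X Y
  obtain ⟨N, hN⟩ := exists_laxAct_pow_eq_zero (k := k) (p := p) (P := P) (g := g) hp X Y U _
    (laxAct₀_defect he hc)
  exact isIso_μ_of_pow_eq_zero he hc U N hN

end Strong

end FrobeniusFunctor

end

/-! ### Tensor powers as monoidal functors, and the cyclic permutation as a monoidal transformation.
-/

noncomputable section

namespace FrobeniusFunctor

open Functor.LaxMonoidal

section PowerMonoidal

variable {C : Type u} [Category.{v} C] [MonoidalCategory C]

theorem shift_succ (X : C) (n : ℕ) :
    (shift X (n + 1)).hom = (α_ X ((power n).obj X) X).inv ≫ (shift X n).hom ▷ X := rfl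

theorem shift_zero (X : C) : (shift X 0).hom = (ρ_ X).hom ≫ (λ_ X).inv := rfl

variable [BraidedCategory C]

theorem cyclic_succ (X : C) (n : ℕ) :
    cyclic X (n + 1) = (β_ ((power n).obj X) X).hom ≫ (shift X n).hom := rfl

variable (C) in
/-- The constant functor at the unit is monoidal. -/
@[reducible]
def constMonoidal : ((Functor.const C).obj (𝟙_ C)).Monoidal :=
  Functor.CoreMonoidal.toMonoidal
    { εIso := Iso.refl _
      μIso := fun _ _ => λ_ (𝟙_ C)
      μIso_hom_natural_left := fun _ _ => by simp
      μIso_hom_natural_right := fun _ _ => by simp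
      associativity := fun _ _ _ => by simp [unitors_equal]
      left_unitality := fun _ => by simp
      right_unitality := fun _ => by simp [unitors_equal] }

/-- In a braided category the tensor product is itself a monoidal functor; the next power is its
composite with the pair formed by the previous power and the identity. -/
instance powerMonoidal : (n : ℕ) → (power n : C ⥤ C).Monoidal
  | 0 => constMonoidal C
  | n + 1 =>
    letI := powerMonoidal n
    inferInstanceAs ((Functor.prod' (power n) (𝟭 C)) ⋙ tensor C).Monoidal

theorem power_zero_ε : ε (power 0 : C ⥤ C) = 𝟙 _ := rfl

theorem power_zero_μ (X Y : C) : μ (power 0) X Y = (λ_ (𝟙_ C)).hom := rfl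

theorem power_succ_ε (n : ℕ) : ε (power (n + 1) : C ⥤ C) =
    (λ_ (𝟙_ C)).inv ≫ (ε (power n) ⊗ₘ 𝟙 _) := by
  change ε (Functor.prod' (power n) (𝟭 C) ⋙ tensor C) = _
  rw [Functor.LaxMonoidal.comp_ε]
  simp

theorem power_succ_μ (n : ℕ) (X Y : C) : μ (power (n + 1)) X Y =
    tensorμ ((power n).obj X) X ((power n).obj Y) Y ≫ (μ (power n) X Y ⊗ₘ 𝟙 _) := by
  change μ (Functor.prod' (power n) (𝟭 C) ⋙ tensor C) X Y = _
  rw [Functor.LaxMonoidal.comp_μ]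
  simp

theorem unit_shift_step {A : C} (e : 𝟙_ C ⟶ A) (s : 𝟙_ C ⊗ A ⟶ A ⊗ 𝟙_ C)
    (h : (𝟙 (𝟙_ C) ⊗ₘ e) ≫ s = (e ⊗ₘ 𝟙 (𝟙_ C))) :
    (𝟙 (𝟙_ C) ⊗ₘ (λ_ (𝟙_ C)).inv ≫ (e ⊗ₘ 𝟙 (𝟙_ C))) ≫ (α_ _ _ _).inv ≫ s ▷ 𝟙_ C =
      ((λ_ (𝟙_ C)).inv ≫ (e ⊗ₘ 𝟙 (𝟙_ C)) ⊗ₘ 𝟙 (𝟙_ C)) := by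
  have h1 : (𝟙 (𝟙_ C) ⊗ₘ (λ_ (𝟙_ C)).inv ≫ (e ⊗ₘ 𝟙 (𝟙_ C))) ≫ (α_ _ _ _).inv =
      𝟙_ C ◁ (λ_ (𝟙_ C)).inv ≫ (α_ _ _ _).inv ≫ (𝟙 (𝟙_ C) ⊗ₘ e) ▷ 𝟙_ C := by
    monoidal
  rw [reassoc_of% h1, ← comp_whiskerRight, h]
  monoidal

theorem ε_shift (n : ℕ) : (𝟙 (𝟙_ C) ⊗ₘ ε (power n)) ≫ (shift (𝟙_ C) n).hom =
    (ε (power n) ⊗ₘ 𝟙 (𝟙_ C)) := by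
  induction n with
  | zero =>
    rw [power_zero_ε, shift_zero]
    change (𝟙 _ ⊗ₘ 𝟙 (𝟙_ C)) ≫ _ = (𝟙 (𝟙_ C) ⊗ₘ 𝟙 _)
    rw [← unitors_equal]
    simp
  | succ n ih =>
    rw [shift_succ, power_succ_ε]
    exact unit_shift_step _ _ ih

theorem tensorμ_shift_step {X Y A B Z : C} (m : A ⊗ B ⟶ Z) (s : X ⊗ A ⟶ A ⊗ X)
    (s' : Y ⊗ B ⟶ B ⊗ Y) (s'' : (X ⊗ Y) ⊗ Z ⟶ Z ⊗ (X ⊗ Y))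
    (h : tensorμ X A Y B ≫ (𝟙 _ ⊗ₘ m) ≫ s'' = (s ⊗ₘ s') ≫ tensorμ A X B Y ≫ (m ⊗ₘ 𝟙 _)) :
    tensorμ X (A ⊗ X) Y (B ⊗ Y) ≫ (𝟙 _ ⊗ₘ tensorμ A X B Y ≫ (m ⊗ₘ 𝟙 _)) ≫ (α_ _ _ _).inv ≫
      s'' ▷ (X ⊗ Y) = ((α_ _ _ _).inv ≫ s ▷ X ⊗ₘ (α_ _ _ _).inv ≫ s' ▷ Y) ≫
        tensorμ (A ⊗ X) X (B ⊗ Y) Y ≫ (tensorμ A X B Y ≫ (m ⊗ₘ 𝟙 _) ⊗ₘ 𝟙 _) := by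
  have h2 : tensorμ X (A ⊗ X) Y (B ⊗ Y) ≫ (X ⊗ Y) ◁ tensorμ A X B Y =
      ((α_ X A X).inv ⊗ₘ (α_ Y B Y).inv) ≫ tensorμ (X ⊗ A) X (Y ⊗ B) Y ≫
      (tensorμ X A Y B ▷ (X ⊗ Y)) ≫ (α_ (X ⊗ Y) (A ⊗ B) (X ⊗ Y)).hom := by
    rw [associator_monoidal, ← Category.assoc, tensorHom_comp_tensorHom, Iso.inv_hom_id,
      Iso.inv_hom_id, id_tensorHom_id, Category.id_comp]
  have h4 : (s ▷ X ⊗ₘ s' ▷ Y) ≫ tensorμ (A ⊗ X) X (B ⊗ Y) Y =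
      tensorμ (X ⊗ A) X (Y ⊗ B) Y ≫ (s ⊗ₘ s') ▷ (X ⊗ Y) := by
    have := tensorμ_natural s (𝟙 X) s' (𝟙 Y)
    rwa [tensorHom_id, tensorHom_id, id_tensorHom_id, tensorHom_id] at this
  rw [← tensorHom_comp_tensorHom, Category.assoc, reassoc_of% h4, id_tensorHom,
    whiskerLeft_comp, Category.assoc, reassoc_of% h2]
  refine congrArg (fun t => _ ≫ _ ≫ t) ?_
  rw [tensorHom_id (tensorμ A X B Y ≫ (m ⊗ₘ 𝟙 _)), ← comp_whiskerRight, ← h]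
  monoidal

theorem tensorμ_shift_zero (X Y : C) :
    tensorμ X (𝟙_ C) Y (𝟙_ C) ≫ (𝟙 _ ⊗ₘ (λ_ (𝟙_ C)).hom) ≫ (ρ_ _).hom ≫ (λ_ _).inv =
      ((ρ_ X).hom ≫ (λ_ X).inv ⊗ₘ (ρ_ Y).hom ≫ (λ_ Y).inv) ≫ tensorμ (𝟙_ C) X (𝟙_ C) Y ≫
        ((λ_ (𝟙_ C)).hom ⊗ₘ 𝟙 _) := by
  have h1 := rightUnitor_monoidal X Y
  have h2 := leftUnitor_monoidal X Y
  rw [id_tensorHom, tensorHom_id, ← cancel_mono (λ_ _).hom, Category.assoc, Category.assoc,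
    Category.assoc, Category.assoc, Category.assoc, Iso.inv_hom_id, Category.comp_id, ← h2, ← h1,
    tensorHom_comp_tensorHom]
  simp

/-- Regrouping the factors of `X ⊗ Y` commutes with moving a first factor to the end without
permutation; by induction this is coherence of `tensorμ` with the associator. -/
theorem μ_shift (X Y : C) (n : ℕ) :
    tensorμ X ((power n).obj X) Y ((power n).obj Y) ≫ (𝟙 _ ⊗ₘ μ (power n) X Y) ≫
      (shift (X ⊗ Y) n).hom = ((shift X n).hom ⊗ₘ (shift Y n).hom) ≫
        tensorμ ((power n).obj X) X ((power n).obj Y) Y ≫ (μ (power n) X Y ⊗ₘ 𝟙 _) := by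
  induction n with
  | zero =>
    rw [power_zero_μ, shift_zero, shift_zero, shift_zero]
    exact tensorμ_shift_zero X Y
  | succ n ih =>
    rw [power_succ_μ, shift_succ, shift_succ, shift_succ]
    exact tensorμ_shift_step _ _ _ _ ih

/-- The braiding of `X` with `B` is used once in each direction; the two uses cancel because the
category is symmetric. -/
theorem tensorμ_braiding {C : Type u} [Category.{v} C] [MonoidalCategory C] [SymmetricCategory C]
    (A X B Y : C) :
    tensorμ A X B Y ≫ (β_ (A ⊗ B) (X ⊗ Y)).hom =
      ((β_ A X).hom ⊗ₘ (β_ B Y).hom) ≫ tensorμ X A Y B := by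
  dsimp only [tensorμ]
  simp only [BraidedCategory.braiding_tensor_left_hom, BraidedCategory.braiding_tensor_right_hom]
  calc
    _ = 𝟙 _ ⊗≫ A ◁ ((β_ X B).hom ≫ (β_ B X).hom) ▷ Y ⊗≫ (β_ A X).hom ▷ (B ⊗ Y) ⊗≫
        (X ⊗ A) ◁ (β_ B Y).hom ⊗≫ X ◁ (β_ A Y).hom ▷ B ⊗≫ 𝟙 _ := by monoidal
    _ = _ := by
      rw [SymmetricCategory.symmetry, MonoidalCategory.tensorHom_def]
      monoidal

theorem cyclic_monoidal_aux {C : Type u} [Category.{v} C] [MonoidalCategory C] [SymmetricCategory C]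
    {X Y A B Z : C} (m : A ⊗ B ⟶ Z) (s : X ⊗ A ⟶ A ⊗ X)
    (s' : Y ⊗ B ⟶ B ⊗ Y) (s'' : (X ⊗ Y) ⊗ Z ⟶ Z ⊗ (X ⊗ Y))
    (h : tensorμ X A Y B ≫ (𝟙 _ ⊗ₘ m) ≫ s'' = (s ⊗ₘ s') ≫ tensorμ A X B Y ≫ (m ⊗ₘ 𝟙 _)) :
    (tensorμ A X B Y ≫ (m ⊗ₘ 𝟙 _)) ≫ (β_ Z (X ⊗ Y)).hom ≫ s'' =
      ((β_ A X).hom ≫ s ⊗ₘ (β_ B Y).hom ≫ s') ≫ tensorμ A X B Y ≫ (m ⊗ₘ 𝟙 _) := by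
  rw [Category.assoc, BraidedCategory.braiding_naturality_assoc, ← Category.assoc,
    tensorμ_braiding, Category.assoc, h, ← Category.assoc, tensorHom_comp_tensorHom]

theorem cyclic_unit_aux {A : C} (e : 𝟙_ C ⟶ A) (s : 𝟙_ C ⊗ A ⟶ A ⊗ 𝟙_ C)
    (h : (𝟙 (𝟙_ C) ⊗ₘ e) ≫ s = (e ⊗ₘ 𝟙 (𝟙_ C))) :
    ((λ_ (𝟙_ C)).inv ≫ (e ⊗ₘ 𝟙 (𝟙_ C))) ≫ (β_ A (𝟙_ C)).hom ≫ s =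
      (λ_ (𝟙_ C)).inv ≫ (e ⊗ₘ 𝟙 (𝟙_ C)) := by
  have h1 : (β_ (𝟙_ C) (𝟙_ C)).hom = 𝟙 _ := by
    rw [braiding_tensorUnit_left, unitors_equal, Iso.hom_inv_id]
  rw [Category.assoc, BraidedCategory.braiding_naturality_assoc, h1, Category.id_comp, h]

end PowerMonoidal

section Cyclic

variable {C : Type u} [Category.{v} C] [MonoidalCategory C] [SymmetricCategory C]

variable (C) in
/-- The cyclic permutation as a natural transformation. -/
def cyclicNat (n : ℕ) : (power n : C ⥤ C) ⟶ power n where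
  app X := cyclic X n
  naturality _ _ f := (cyclic_natural f n).symm

instance (n : ℕ) : NatTrans.IsMonoidal (cyclicNat C n) where
  unit := by
    cases n with
    | zero => exact Category.comp_id _
    | succ n =>
      change ε (power (n + 1)) ≫ cyclic (𝟙_ C) (n + 1) = _
      rw [power_succ_ε, cyclic_succ]
      exact cyclic_unit_aux _ _ (ε_shift n)
  tensor X Y := by
    cases n with
    | zero =>
      change μ (power 0) X Y ≫ 𝟙 _ = (𝟙 _ ⊗ₘ 𝟙 _) ≫ μ (power 0) X Y
      rw [id_tensorHom_id, Category.comp_id, Category.id_comp]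
    | succ n =>
      change μ (power (n + 1)) X Y ≫ cyclic (X ⊗ Y) (n + 1) =
        (cyclic X (n + 1) ⊗ₘ cyclic Y (n + 1)) ≫ μ (power (n + 1)) X Y
      rw [power_succ_μ, cyclic_succ, cyclic_succ, cyclic_succ]
      exact cyclic_monoidal_aux _ _ _ _ (μ_shift X Y n)

end Cyclic

/-! ### The cyclic permutation has order dividing `n`. -/

section Rotation

variable {C : Type u} [Category.{v} C] [MonoidalCategory C]

/-- The canonical isomorphism `X^{⊗ i} ⊗ X^{⊗ j} ≅ X^{⊗ n}` for `i + j = n`. -/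
def merge (X : C) (i : ℕ) : (j n : ℕ) → i + j = n →
    ((power i).obj X ⊗ (power j).obj X ⟶ (power n).obj X)
  | 0, n, h => (ρ_ _).hom ≫ eqToHom (by rw [← h, Nat.add_zero])
  | j + 1, n + 1, h => (α_ _ _ _).inv ≫ merge X i j n (by omega) ▷ X
  | j + 1, 0, h => absurd h (by omega)

theorem merge_zero (X : C) (n : ℕ) : merge X n 0 n rfl = (ρ_ _).hom := Category.comp_id _

theorem merge_succ (X : C) (i j n : ℕ) (h : i + (j + 1) = n + 1) (h' : i + j = n) :
    merge X i (j + 1) (n + 1) h = (α_ _ _ _).inv ≫ merge X i j n h' ▷ X := rfl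

theorem zero_merge (X : C) (n : ℕ) (h : 0 + n = n) : merge X 0 n n h = (λ_ _).hom := by
  induction n with
  | zero => rw [merge_zero]; exact unitors_equal.symm
  | succ n ih =>
    rw [merge_succ X 0 n n h (by omega), ih]
    exact (leftUnitor_tensor_hom _ _).symm

/-- This and the next lemma say that concatenation of blocks is compatible with reassociating one
copy of `X`; together they let a factor change blocks in the induction on rotations. -/
theorem whiskerLeft_merge_shift (X : C) (i j n : ℕ) (h : i + j = n) (h' : i + 1 + j = n + 1) :
    X ◁ merge X i j n h ≫ (shift X n).hom =
      (α_ _ _ _).inv ≫ (shift X i).hom ▷ _ ≫ merge X (i + 1) j (n + 1) h' := by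
  induction j generalizing n with
  | zero =>
    obtain rfl : i = n := h
    rw [merge_zero, merge_zero]
    generalize (shift X i).hom = s
    change X ◁ (ρ_ ((power i).obj X)).hom ≫ s = (α_ X ((power i).obj X) (𝟙_ C)).inv ≫
      s ▷ 𝟙_ C ≫ (ρ_ _).hom
    monoidal
  | succ j ih =>
    obtain ⟨n, rfl⟩ : ∃ m, n = m + 1 := ⟨n - 1, by omega⟩
    have := ih n (by omega) (by omega)
    rw [merge_succ X i j n h (by omega), merge_succ X (i + 1) j (n + 1) h' (by omega), shift_succ]
    generalize merge X (i + 1) j (n + 1) _ = m₁ at *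
    generalize merge X i j n _ = m₂ at *
    generalize (shift X n).hom = s₁ at *
    generalize (shift X i).hom = s₂ at *
    change X ◁ ((α_ ((power i).obj X) ((power j).obj X) X).inv ≫ m₂ ▷ X) ≫ (α_ X _ X).inv ≫ s₁ ▷ X =
      (α_ _ _ ((power j).obj X ⊗ X)).inv ≫ s₂ ▷ ((power j).obj X ⊗ X) ≫ (α_ _ _ _).inv ≫ m₁ ▷ X
    have h2 : X ◁ ((α_ ((power i).obj X) ((power j).obj X) X).inv ≫ m₂ ▷ X) ≫ (α_ X _ X).inv ≫
        s₁ ▷ X = X ◁ (α_ _ _ _).inv ≫ (α_ _ _ _).inv ≫ (X ◁ m₂ ≫ s₁) ▷ X := by monoidal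
    rw [h2, this]
    monoidal

theorem whiskerLeft_shift_merge (X : C) (j i n : ℕ) (h : j + (i + 1) = n) (h' : j + 1 + i = n) :
    (power j).obj X ◁ (shift X i).hom ≫ merge X j (i + 1) n h =
      (α_ _ _ _).inv ≫ merge X (j + 1) i n h' := by
  induction i generalizing n with
  | zero =>
    obtain rfl : j + 1 = n := h
    rw [merge_succ X j 0 j _ rfl, merge_zero, merge_zero, shift_zero]
    change (power j).obj X ◁ ((ρ_ X).hom ≫ (λ_ X).inv) ≫ (α_ _ (𝟙_ C) X).inv ≫ (ρ_ _).hom ▷ X =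
      (α_ _ X (𝟙_ C)).inv ≫ (ρ_ ((power j).obj X ⊗ X)).hom
    monoidal
  | succ i ih =>
    obtain ⟨n, rfl⟩ : ∃ m, n = m + 1 := ⟨n - 1, by omega⟩
    have := ih n (by omega) (by omega)
    rw [merge_succ X j (i + 1) n h (by omega), merge_succ X (j + 1) i n h' (by omega), shift_succ]
    generalize merge X (j + 1) i n _ = m₁ at *
    generalize merge X j (i + 1) n _ = m₂ at *
    generalize (shift X i).hom = s at *
    change (power j).obj X ◁ ((α_ X ((power i).obj X) X).inv ≫ s ▷ X) ≫ (α_ _ _ X).inv ≫ m₂ ▷ X =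
      (α_ _ X ((power i).obj X ⊗ X)).inv ≫ (α_ _ _ X).inv ≫ m₁ ▷ X
    have h2 : (power j).obj X ◁ ((α_ X ((power i).obj X) X).inv ≫ s ▷ X) ≫ (α_ _ _ X).inv ≫ m₂ ▷ X =
      (power j).obj X ◁ (α_ _ _ _).inv ≫ (α_ _ _ _).inv ≫ ((power j).obj X ◁ s ≫ m₂) ▷ X := by
      monoidal
    refine h2.trans ((congrArg (fun t => _ ≫ _ ≫ t ▷ X) this).trans ?_)
    monoidal

variable [SymmetricCategory C]

/-- Bringing `X` to the front and then `B` to the front has the effect of moving `A` past both. The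
braiding of `B` with `X` occurs in both directions and cancels by symmetry. -/
theorem braiding_rotate (A B X : C) :
    (α_ A B X).inv ≫ (β_ (A ⊗ B) X).hom ≫ (α_ X A B).inv ≫ (β_ (X ⊗ A) B).hom =
      (β_ A (B ⊗ X)).hom ≫ (α_ B X A).hom := by
  have h : A ◁ (β_ B X).hom ≫ (β_ A (X ⊗ B)).hom ≫ (β_ X B).hom ▷ A ≫ (α_ B X A).hom =
      (β_ A (B ⊗ X)).hom ≫ (α_ B X A).hom := by
    rw [BraidedCategory.braiding_naturality_right_assoc, ← comp_whiskerRight_assoc,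
      SymmetricCategory.symmetry, id_whiskerRight, Category.id_comp]
  rw [← h, BraidedCategory.braiding_tensor_left_hom, BraidedCategory.braiding_tensor_left_hom,
    BraidedCategory.braiding_tensor_right_hom]
  monoidal

theorem rotate_step {X A B Z N : C} (m : A ⊗ B ⟶ Z) (s : X ⊗ Z ⟶ N) (s' : X ⊗ A ⟶ A ⊗ X)
    (m' : (A ⊗ X) ⊗ B ⟶ N) (t : N ⟶ N) (m'' : B ⊗ (A ⊗ X) ⟶ N) (m₃ : (B ⊗ X) ⊗ A ⟶ N)
    (h₁ : X ◁ m ≫ s = (α_ _ _ _).inv ≫ s' ▷ _ ≫ m') (h₂ : m' ≫ t = (β_ (A ⊗ X) B).hom ≫ m'')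
    (h₃ : B ◁ s' ≫ m'' = (α_ _ _ _).inv ≫ m₃) :
    ((α_ A B X).inv ≫ m ▷ X) ≫ ((β_ Z X).hom ≫ s) ≫ t = (β_ A (B ⊗ X)).hom ≫ m₃ := by
  have h := braiding_rotate A B X
  rw [Category.assoc, Category.assoc, BraidedCategory.braiding_naturality_left_assoc,
    reassoc_of% h₁, h₂, BraidedCategory.braiding_naturality_left_assoc, h₃, reassoc_of% h,
    Iso.hom_inv_id_assoc]

/-- Iterates of the cyclic permutation are block transpositions. -/
theorem merge_comp_cyclic (X : C) (j i n : ℕ) (h : i + j = n) (h' : j + i = n) (t : ℕ → (((power n).obj X) ⟶ (power n).obj X))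
    (h0 : t 0 = 𝟙 _) (ht : ∀ r, t (r + 1) = cyclic X n ≫ t r) :
    merge X i j n h ≫ t j = (β_ ((power i).obj X) ((power j).obj X)).hom ≫ merge X j i n h' := by
  induction j generalizing i with
  | zero =>
    obtain rfl : i = n := h
    rw [merge_zero, h0, zero_merge]
    exact (Category.comp_id _).trans (braiding_leftUnitor _).symm
  | succ j ih =>
    obtain ⟨n, rfl⟩ : ∃ m, n = m + 1 := ⟨n - 1, by omega⟩
    rw [ht, merge_succ X i j n h (by omega), cyclic_succ]
    exact rotate_step _ _ _ _ _ _ _ (whiskerLeft_merge_shift X i j n (by omega) (by omega))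
      (ih (i + 1) (by omega) (by omega)) (whiskerLeft_shift_merge X j i (n + 1) (by omega) (by omega))

/-- The `n`-th iterate is the transposition of all `n` factors with an empty block, which is
trivial. -/
theorem cyclic_iterate (X : C) (n : ℕ) (t : ℕ → (((power n).obj X) ⟶ (power n).obj X))
    (h0 : t 0 = 𝟙 _) (ht : ∀ r, t (r + 1) = cyclic X n ≫ t r) : t n = 𝟙 _ := by
  have h1 := merge_comp_cyclic X n 0 n (Nat.zero_add n) (Nat.add_zero n) t h0 ht
  rw [zero_merge, merge_zero] at h1
  exact (cancel_epi (λ_ _).hom).1 ((h1.trans (braiding_rightUnitor _)).trans (Category.comp_id _).symm)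

end Rotation

end FrobeniusFunctor

end

/-! ### The Frobenius functor as a monoidal functor. -/

noncomputable section

namespace FrobeniusFunctor

theorem endPow_eq_pow {C : Type u} [Category.{v} C] [Abelian C] {V : C} (d : V ⟶ V) (n : ℕ) :
    End.of (endPow d n) = End.of d ^ n := by
  induction n with
  | zero => rfl
  | succ n ih => rw [pow_succ, ← ih]; rfl

/-- Evaluate the polynomial identity `(1 - X)^p = 1 - X^p` at `c` in its endomorphism algebra. -/
theorem endPow_one_sub (k : Type w) [Field k] (p : ℕ) [Fact p.Prime] [CharP k p] {C : Type u}
    [Category.{v} C] [Abelian C] [Linear k C] {V : C} (c : V ⟶ V) (hc : endPow c p = 𝟙 _) :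
    endPow (𝟙 V - c) p = 0 := by
  have h1 : (1 - Polynomial.X : Polynomial k) ^ p = 1 - Polynomial.X ^ p := by
    rw [sub_pow_char, one_pow]
  have h2 := congrArg (Polynomial.aeval (End.of c)) h1
  simp only [map_pow, map_sub, map_one, Polynomial.aeval_X] at h2
  have h3 := (endPow_eq_pow (𝟙 V - c) p).trans (h2.trans
    (congrArg (fun t => 1 - t) (endPow_eq_pow c p).symm))
  rw [hc] at h3
  exact h3.trans (sub_self _)

theorem endPow_diff (k : Type w) [Field k] (p : ℕ) [Fact p.Prime] [CharP k p] {C : Type u}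
    [Category.{v} C] [Abelian C] [Linear k C] [MonoidalCategory C] [SymmetricCategory C] (X : C) :
    endPow (diff p X) p = 0 :=
  endPow_one_sub k p _ (cyclic_iterate X p (endPow (cyclic X p)) rfl fun _ => rfl)

section Twist

variable (k : Type w) [Field k] (p : ℕ) [Fact p.Prime] [CharP k p]
variable (C : Type u) [Category.{v} C] [Abelian C] [Linear k C] [MonoidalCategory C]
  [MonoidalPreadditive C] [MonoidalLinear k C] [SymmetricCategory C]

instance : Abelian (FrobeniusTwist p C) := inferInstanceAs (Abelian C)

instance [HasDuals C] : HasDuals (FrobeniusTwist p C) := inferInstanceAs (HasDuals C)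

/-- The tensor power functor with values in the twist. -/
def twistPower : C ⥤ FrobeniusTwist p C := power p

instance : (twistPower p C).Monoidal := inferInstanceAs (power p : C ⥤ C).Monoidal

/-- The cyclic permutation as an endomorphism of the tensor power functor. -/
def twistCyclic : twistPower p C ⟶ twistPower p C := cyclicNat C p

instance : NatTrans.IsMonoidal (twistCyclic p C) :=
  inferInstanceAs (NatTrans.IsMonoidal (cyclicNat C p))

section

variable {C}

instance (n : ℕ) (X : C) : IsIso (cyclic X n) := by
  cases n with
  | zero => exact inferInstanceAs (IsIso (𝟙 _))
  | succ n => exact inferInstanceAs (IsIso ((β_ ((power n).obj X) X).hom ≫ (shift X n).hom))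

instance (X : C) : IsIso ((twistCyclic p C).app X) := inferInstanceAs (IsIso (cyclic X p))

end

theorem hasDuals_of_isTensorCategory [IsTensorCategory k C] : HasDuals C where
  left_dual := IsTensorCategory.left_dual k
  right_dual := IsTensorCategory.right_dual k

/-- The lax monoidal structure of the Frobenius functor. -/
@[reducible]
def frobLax [HasDuals C] : (frob C k p).LaxMonoidal :=
  -- By definition `frob` is `blFunctor` for the tensor power with its cyclic permutation, `diff`
  -- being `𝟙 - c` and the layers being formed in the twist, the same category.
  blLax k p (twistPower p C) (twistCyclic p C)

/-- The monoidal structure of the Frobenius functor. -/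
@[reducible]
def frobMonoidal [HasDuals C] : (frob C k p).Monoidal :=
  letI := frobLax k p C
  have : IsIso (Functor.LaxMonoidal.ε (frob C k p)) :=
    isIso_ε (k := k) (p := p) (twistPower p C) (twistCyclic p C)
  have (X Y : C) : IsIso (Functor.LaxMonoidal.μ (frob C k p) X Y) := by
    -- Only a dual of the first tensor factor enters the criterion.
    obtain ⟨h⟩ := HasDuals.right_dual X
    exact isIso_μ (k := k) (p := p) (twistPower p C) (twistCyclic p C)
      (fun X => endPow_diff k p X) X Xᘁ Y
  Functor.Monoidal.ofLaxMonoidal (frob C k p)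

end Twist

end FrobeniusFunctor

end

/-! ### Layers and tensor powers under exact monoidal functors. -/

noncomputable section

namespace FrobeniusFunctor

section LayerComparison

variable {C : Type u} [Category.{v} C] [Abelian C] {D : Type u₁} [Category.{v₁} D] [Abelian D]
variable (E : C ⥤ D) [E.Additive] [PreservesFiniteLimits E] [PreservesFiniteColimits E]
variable {V : C} {V' : D} {d : V ⟶ V} {d' : V' ⟶ V'} (φ : E.obj V ⟶ V')

theorem map_endPow_comp (h : E.map d ≫ φ = φ ≫ d') (j : ℕ) :
    E.map (endPow d j) ≫ φ = φ ≫ endPow d' j := by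
  induction j with
  | zero =>
    refine (?_ : E.map (𝟙 V) ≫ φ = φ ≫ 𝟙 V')
    rw [E.map_id, Category.id_comp, Category.comp_id]
  | succ j ih => rw [endPow, endPow, E.map_comp, Category.assoc, ih, ← Category.assoc, h, Category.assoc]

theorem map_comp_endPow {S : C} {x : S ⟶ V} {j : ℕ} (h : E.map d ≫ φ = φ ≫ d')
    (hx : x ≫ endPow d j = 0) : (E.map x ≫ φ) ≫ endPow d' j = 0 := by
  rw [Category.assoc, ← map_endPow_comp E φ h, ← Category.assoc, ← E.map_comp, hx, E.map_zero,
    zero_comp]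

theorem factors_map_kerIm (h : E.map d ≫ φ = φ ≫ d') (j : ℕ) :
    (kerIm d' j).Factors (E.map (kerIm d j).arrow ≫ φ) := by
  obtain ⟨h0, S, σ, hσ, y, hy⟩ := (factors_kerIm_iff (D := d) (j := j) (kerIm d j).arrow).1
    (by simpa using Subobject.factors_comp_arrow (P := kerIm d j) (𝟙 _))
  refine (factors_kerIm_iff _).2 ⟨?_, E.obj S, E.map σ, inferInstance, E.map y ≫ φ, ?_⟩
  · rw [Category.assoc, ← h, ← Category.assoc, ← E.map_comp, h0, E.map_zero, zero_comp]
  · rw [Category.assoc, ← map_endPow_comp E φ h, ← Category.assoc, ← E.map_comp, hy, E.map_comp,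
      Category.assoc]

/-- The comparison of `Ker D ∩ Im D^j` along an exact functor. -/
def kerImComparison (h : E.map d ≫ φ = φ ≫ d') (j : ℕ) :
    E.obj (kerIm d j : C) ⟶ (kerIm d' j : D) :=
  (kerIm d' j).factorThru _ (factors_map_kerIm E φ h j)

theorem kerImComparison_arrow (h : E.map d ≫ φ = φ ≫ d') (j : ℕ) :
    kerImComparison E φ h j ≫ (kerIm d' j).arrow = E.map (kerIm d j).arrow ≫ φ :=
  Subobject.factorThru_arrow _ _ _

/-- The comparison of layers along an exact functor. -/
def layerComparison (h : E.map d ≫ φ = φ ≫ d') (j : ℕ) : E.obj (layer d j) ⟶ layer d' j :=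
  (PreservesCokernel.iso E (Subobject.ofLE _ _ (kerIm_le d j))).hom ≫
    cokernel.desc _ (kerImComparison E φ h j ≫ layerπ d' j) (by
      have h1 : E.map (Subobject.ofLE _ _ (kerIm_le d j)) ≫ kerImComparison E φ h j =
          kerImComparison E φ h (j + 1) ≫ Subobject.ofLE _ _ (kerIm_le d' j) := by
        rw [← cancel_mono (kerIm d' j).arrow, Category.assoc, kerImComparison_arrow,
          Category.assoc, Subobject.ofLE_arrow, kerImComparison_arrow, ← Category.assoc,
          ← E.map_comp, Subobject.ofLE_arrow]
      rw [← Category.assoc, h1, Category.assoc]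
      exact (congrArg (fun t => _ ≫ t) (cokernel.condition _)).trans comp_zero)

theorem map_layerπ_comparison (h : E.map d ≫ φ = φ ≫ d') (j : ℕ) :
    E.map (layerπ d j) ≫ layerComparison E φ h j = kerImComparison E φ h j ≫ layerπ d' j := by
  refine (Category.assoc _ _ _).symm.trans
    (Eq.trans (congrArg (fun t => t ≫ _) ?_) (cokernel.π_desc _ _ _))
  exact PreservesCokernel.π_iso_hom E (Subobject.ofLE _ _ (kerIm_le d j))

theorem map_cls_comparison (h : E.map d ≫ φ = φ ≫ d') {j : ℕ} {S : C} (x : S ⟶ V)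
    (hx : x ≫ endPow d (j + 1) = 0) :
    E.map (cls d j x hx) ≫ layerComparison E φ h j =
      cls d' j (E.map x ≫ φ) (map_comp_endPow E φ h hx) := by
  rw [cls, cls, E.map_comp, Category.assoc, map_layerπ_comparison, ← Category.assoc]
  refine congrArg (fun t => t ≫ _) ?_
  rw [← cancel_mono (kerIm d' j).arrow, Category.assoc, kerImComparison_arrow, ← Category.assoc,
    ← E.map_comp, Subobject.factorThru_arrow, Subobject.factorThru_arrow, E.map_comp,
    Category.assoc, Category.assoc, map_endPow_comp E φ h]

variable [IsIso φ]

theorem exists_lift_map_kernel (h : E.map d ≫ φ = φ ≫ d') (j : ℕ) {S : D} (x : S ⟶ V')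
    (hx : x ≫ endPow d' j = 0) : ∃ y : S ⟶ E.obj (kernel (endPow d j)),
      y ≫ E.map (kernel.ι (endPow d j)) ≫ φ = x := by
  have h1 : (x ≫ inv φ) ≫ E.map (endPow d j) = 0 := by
    rw [← cancel_mono φ, Category.assoc, map_endPow_comp E φ h, Category.assoc, zero_comp]
    simpa using hx
  refine ⟨kernel.lift _ _ h1 ≫ (PreservesKernel.iso E (endPow d j)).inv, ?_⟩
  have h2 : (PreservesKernel.iso E (endPow d j)).inv ≫ E.map (kernel.ι (endPow d j)) =
      kernel.ι (E.map (endPow d j)) := PreservesKernel.iso_inv_ι E _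
  rw [Category.assoc, reassoc_of% h2, kernel.lift_ι_assoc, Category.assoc, IsIso.inv_hom_id,
    Category.comp_id]

/-- The functor preserves the kernels of all powers of the operator. It hence carries the
presentation of the layer by generators in `Ker d^{j+1}` and its relations to that of the target. -/
theorem isIso_layerComparison (h : E.map d ≫ φ = φ ≫ d') (j : ℕ) :
    IsIso (layerComparison E φ h j) := by
  have hepi : Epi (layerComparison E φ h j) := by
    obtain ⟨y, hy⟩ := exists_lift_map_kernel E φ h (j + 1) (kernel.ι (endPow d' (j + 1)))
      (kernel.condition _)
    have h1 : (y ≫ E.map (powKerπ d j)) ≫ layerComparison E φ h j = powKerπ d' j := by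
      rw [powKerπ, Category.assoc, map_cls_comparison,
        comp_cls _ _ _ (by rw [hy]; exact kernel.condition _)]
      exact cls_congr _ hy
    have : Epi ((y ≫ E.map (powKerπ d j)) ≫ layerComparison E φ h j) := h1 ▸ inferInstance
    exact epi_of_epi (y ≫ E.map (powKerπ d j)) (layerComparison E φ h j)
  have hmono : Mono (layerComparison E φ h j) := by
    refine Preadditive.mono_of_cancel_zero _ fun {T} y hy => ?_
    obtain ⟨T', σ, hσ, x, hx⟩ := surjective_up_to_refinements_of_epi (E.map (powKerπ d j)) y
    have hx' : (x ≫ E.map (kernel.ι (endPow d (j + 1))) ≫ φ) ≫ endPow d' (j + 1) = 0 := by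
      rw [Category.assoc, map_comp_endPow E φ h (kernel.condition _), comp_zero]
    have h1 : cls d' j (x ≫ E.map (kernel.ι (endPow d (j + 1))) ≫ φ) hx' = 0 := by
      rw [← comp_cls x _ (map_comp_endPow E φ h (kernel.condition _)), ← map_cls_comparison E φ h]
      change x ≫ E.map (powKerπ d j) ≫ _ = 0
      rw [← Category.assoc, ← hx, Category.assoc, hy, comp_zero]
    -- A vanishing class in the target is locally a sum of the two kinds of relations, each of which
    -- lifts to the image under the functor of a relation in the source.
    obtain ⟨T'', τ, hτ, a, b, hab, ha, hb⟩ := exists_of_cls_eq_zero _ hx' h1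
    obtain ⟨a', ha'⟩ := exists_lift_map_kernel E φ h j a ha
    obtain ⟨b', hb'⟩ := exists_lift_map_kernel E φ h (j + 2) b hb
    have ha₀ : kernel.ι (endPow d j) ≫ endPow d (j + 1) = 0 :=
      comp_endPow_eq_zero (Nat.le_succ j) (kernel.condition _)
    have hb₀ : (kernel.ι (endPow d (j + 2)) ≫ d) ≫ endPow d (j + 1) = 0 := by
      rw [Category.assoc]; exact kernel.condition (endPow d (j + 2))
    have h2 : τ ≫ x = a' ≫ E.map (kernel.lift _ _ ha₀) + b' ≫ E.map (kernel.lift _ _ hb₀) := by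
      rw [← cancel_mono (E.map (kernel.ι (endPow d (j + 1)))), ← cancel_mono φ, Category.assoc,
        Category.assoc, hab, Preadditive.add_comp, Preadditive.add_comp, Category.assoc,
        Category.assoc, Category.assoc, Category.assoc, ← Category.assoc (E.map _) (E.map _),
        ← E.map_comp, kernel.lift_ι, ha', ← Category.assoc (E.map _) (E.map _), ← E.map_comp,
        kernel.lift_ι, E.map_comp, Category.assoc, h, ← hb']
      simp only [Category.assoc]
    rw [← cancel_epi σ, ← cancel_epi τ, hx, ← Category.assoc, h2, Preadditive.add_comp,
      Category.assoc, Category.assoc, ← E.map_comp, ← E.map_comp, lift_powKerπ, lift_powKerπ,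
      cls_eq_zero_of_pow _ _ (kernel.condition _), cls_comp_eq_zero]
    simp
  exact isIso_of_mono_of_epi _

end LayerComparison

section PowerComparison

open Functor.LaxMonoidal Functor.Monoidal

variable {C : Type u} [Category.{v} C] [MonoidalCategory C]
variable {D : Type u₁} [Category.{v₁} D] [MonoidalCategory D]

theorem powerComparison_succ (E : C ⥤ D) [E.Monoidal] (X : C) (n : ℕ) :
    (powerComparison E X (n + 1)).hom =
      (powerComparison E X n).hom ▷ E.obj X ≫ μ E ((power n).obj X) X := rfl

theorem powerComparison_natural (E : C ⥤ D) [E.Monoidal] {X Y : C} (f : X ⟶ Y) (n : ℕ) :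
    (power n).map (E.map f) ≫ (powerComparison E Y n).hom =
      (powerComparison E X n).hom ≫ E.map ((power n).map f) := by
  induction n with
  | zero =>
    change 𝟙 _ ≫ ε E = ε E ≫ E.map (𝟙 _)
    rw [E.map_id, Category.id_comp, Category.comp_id]
  | succ n ih =>
    rw [powerComparison_succ, powerComparison_succ]
    change ((power n).map (E.map f) ⊗ₘ E.map f) ≫ (powerComparison E Y n).hom ▷ E.obj Y ≫ μ E _ _ =
      ((powerComparison E X n).hom ▷ E.obj X ≫ μ E _ _) ≫ E.map ((power n).map f ⊗ₘ f)
    rw [← tensorHom_id, ← Category.assoc, tensorHom_comp_tensorHom, ih, Category.assoc, ← μ_natural,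
      ← tensorHom_id, ← Category.assoc, tensorHom_comp_tensorHom, Category.comp_id, Category.id_comp]

theorem shift_comparison_step (E : C ⥤ D) [E.Monoidal] {X A : C} {A' : D} (c : A' ⟶ E.obj A)
    (s : X ⊗ A ⟶ A ⊗ X) (s' : E.obj X ⊗ A' ⟶ A' ⊗ E.obj X)
    (h : s' ≫ c ▷ E.obj X ≫ μ E A X = E.obj X ◁ c ≫ μ E X A ≫ E.map s) :
    ((α_ _ _ _).inv ≫ s' ▷ E.obj X) ≫ (c ▷ E.obj X ≫ μ E A X) ▷ E.obj X ≫ μ E (A ⊗ X) X =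
      E.obj X ◁ (c ▷ E.obj X ≫ μ E A X) ≫ μ E X (A ⊗ X) ≫ E.map ((α_ _ _ _).inv ≫ s ▷ X) := by
  rw [Category.assoc, ← comp_whiskerRight_assoc, h, E.map_comp, whiskerLeft_comp, Category.assoc,
    Functor.LaxMonoidal.associativity_inv_assoc, ← μ_natural_left]
  simp

theorem shift_comparison_zero (E : C ⥤ D) [E.Monoidal] (X : C) :
    ((ρ_ (E.obj X)).hom ≫ (λ_ _).inv) ≫ ε E ▷ E.obj X ≫ μ E (𝟙_ C) X =
      E.obj X ◁ ε E ≫ μ E X (𝟙_ C) ≫ E.map ((ρ_ X).hom ≫ (λ_ X).inv) := by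
  rw [E.map_comp, ← right_unitality_assoc, Category.assoc, left_unitality_inv]

theorem shift_comparison (E : C ⥤ D) [E.Monoidal] (X : C) (n : ℕ) :
    (shift (E.obj X) n).hom ≫ (powerComparison E X n).hom ▷ E.obj X ≫ μ E ((power n).obj X) X =
      E.obj X ◁ (powerComparison E X n).hom ≫ μ E X ((power n).obj X) ≫ E.map (shift X n).hom := by
  induction n with
  | zero => exact shift_comparison_zero E X
  | succ n ih => exact shift_comparison_step E _ _ _ ih

/-- The cyclic permutation is a braiding followed by a regrouping; braidedness of `E` handles the
first and `shift_comparison` the second. -/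
theorem cyclic_comparison [BraidedCategory C] [BraidedCategory D] (E : C ⥤ D) [E.Braided] (X : C)
    (n : ℕ) : cyclic (E.obj X) n ≫ (powerComparison E X n).hom =
      (powerComparison E X n).hom ≫ E.map (cyclic X n) := by
  cases n with
  | zero =>
    change 𝟙 _ ≫ ε E = ε E ≫ E.map (𝟙 _)
    rw [E.map_id, Category.id_comp, Category.comp_id]
  | succ n =>
    have h := shift_comparison E X n
    rw [powerComparison_succ, cyclic_succ, cyclic_succ]
    generalize (powerComparison E X n).hom = c at *
    have h1 : ((β_ _ (E.obj X)).hom ≫ (shift (E.obj X) n).hom) ≫ c ▷ E.obj X ≫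
        μ E ((power n).obj X) X = (c ▷ E.obj X ≫ μ E ((power n).obj X) X) ≫
          E.map ((β_ ((power n).obj X) X).hom ≫ (shift X n).hom) := by
      rw [Category.assoc, h, E.map_comp, Category.assoc,
        ← BraidedCategory.braiding_naturality_left_assoc, ← reassoc_of%
        (Functor.LaxBraided.braided (F := E) ((power n).obj X) X)]
    exact h1

variable [BraidedCategory C] [BraidedCategory D]

theorem unit_comparison_step (E : C ⥤ D) [E.Monoidal] {A : C} {A' A'' : D} (e : 𝟙_ C ⟶ A)
    (e' : 𝟙_ D ⟶ A') (m : A' ⟶ A'') (c : A'' ⟶ E.obj A) (h : e' ≫ m ≫ c = ε E ≫ E.map e) :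
    ((λ_ (𝟙_ D)).inv ≫ (e' ⊗ₘ 𝟙 _)) ≫ (m ⊗ₘ ε E) ≫ c ▷ _ ≫ μ E A (𝟙_ C) =
      ε E ≫ E.map ((λ_ (𝟙_ C)).inv ≫ (e ⊗ₘ 𝟙 _)) := by
  have h1 : (e' ⊗ₘ 𝟙 _) ≫ (m ⊗ₘ ε E) ≫ c ▷ _ = ((ε E ≫ E.map e) ⊗ₘ ε E) := by
    rw [← h, ← tensorHom_id, tensorHom_comp_tensorHom, tensorHom_comp_tensorHom, Category.id_comp,
      Category.comp_id]
  have h2 : (ε E ≫ E.map e) ⊗ₘ ε E = (ε E ⊗ₘ ε E) ≫ (E.map e ⊗ₘ E.map (𝟙 (𝟙_ C))) := by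
    rw [tensorHom_comp_tensorHom, E.map_id, Category.comp_id]
  rw [Category.assoc, reassoc_of% h1, E.map_comp, h2, Category.assoc, μ_natural,
    MonoidalCategory.tensorHom_def', Category.assoc, ← leftUnitor_inv_naturality_assoc,
    left_unitality_inv_assoc]

theorem ε_comparison (E : C ⥤ D) [E.Monoidal] (n : ℕ) :
    ε (power n : D ⥤ D) ≫ (power n).map (ε E) ≫ (powerComparison E (𝟙_ C) n).hom =
      ε E ≫ E.map (ε (power n)) := by
  induction n with
  | zero =>
    change 𝟙 _ ≫ 𝟙 _ ≫ ε E = ε E ≫ E.map (𝟙 _)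
    rw [E.map_id, Category.id_comp, Category.id_comp, Category.comp_id]
  | succ n ih =>
    rw [power_succ_ε, power_succ_ε, powerComparison_succ]
    exact unit_comparison_step E _ _ _ _ ih

theorem tensor_comparison_step (E : C ⥤ D) [E.Braided] {X Y A B Z : C} {A' B' Z' Z'' : D}
    (m : A ⊗ B ⟶ Z) (m' : A' ⊗ B' ⟶ Z') (f : Z' ⟶ Z'') (c : Z'' ⟶ E.obj Z) (a : A' ⟶ E.obj A)
    (b : B' ⟶ E.obj B) (h : m' ≫ f ≫ c = (a ⊗ₘ b) ≫ μ E A B ≫ E.map m) :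
    (tensorμ A' (E.obj X) B' (E.obj Y) ≫ (m' ⊗ₘ 𝟙 _)) ≫ (f ⊗ₘ μ E X Y) ≫ c ▷ _ ≫
      μ E Z (X ⊗ Y) = (a ▷ E.obj X ≫ μ E A X ⊗ₘ b ▷ E.obj Y ≫ μ E B Y) ≫ μ E (A ⊗ X) (B ⊗ Y) ≫
        E.map (tensorμ A X B Y ≫ (m ⊗ₘ 𝟙 _)) := by
  have h1 : (m' ⊗ₘ 𝟙 _) ≫ (f ⊗ₘ μ E X Y) ≫ c ▷ _ =
      ((a ⊗ₘ b) ⊗ₘ (𝟙 _ ⊗ₘ 𝟙 _)) ≫ (μ E A B ⊗ₘ μ E X Y) ≫ (E.map m ⊗ₘ E.map (𝟙 _)) := by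
    rw [← tensorHom_id, tensorHom_comp_tensorHom, tensorHom_comp_tensorHom, h,
      tensorHom_comp_tensorHom, tensorHom_comp_tensorHom]
    simp
  rw [Category.assoc, reassoc_of% h1, ← tensorμ_natural_assoc, μ_natural, E.map_comp,
    reassoc_of% (tensorμ_comp_μ_tensorHom_μ_comp_μ E A X B Y), ← Category.assoc ((_ ⊗ₘ _) ⊗ₘ _),
    tensorHom_comp_tensorHom, tensorHom_id, tensorHom_id]

/-- With `ε_comparison` this makes the comparison of tensor powers a monoidal transformation; the
braiding enters through the interchange `tensorμ`. -/
theorem μ_comparison (E : C ⥤ D) [E.Braided] (X Y : C) (n : ℕ) :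
    μ (power n) (E.obj X) (E.obj Y) ≫ (power n).map (μ E X Y) ≫ (powerComparison E (X ⊗ Y) n).hom =
      ((powerComparison E X n).hom ⊗ₘ (powerComparison E Y n).hom) ≫
        μ E ((power n).obj X) ((power n).obj Y) ≫ E.map (μ (power n) X Y) := by
  induction n with
  | zero =>
    rw [power_zero_μ, power_zero_μ]
    change (λ_ (𝟙_ D)).hom ≫ 𝟙 _ ≫ ε E = (ε E ⊗ₘ ε E) ≫ μ E (𝟙_ C) (𝟙_ C) ≫ E.map (λ_ (𝟙_ C)).hom
    rw [MonoidalCategory.tensorHom_def', Category.assoc, ← left_unitality, Category.id_comp]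
    simp
  | succ n ih =>
    rw [power_succ_μ, power_succ_μ, powerComparison_succ, powerComparison_succ, powerComparison_succ]
    exact tensor_comparison_step E _ _ _ _ _ _ ih

end PowerComparison

end FrobeniusFunctor

end

/-! ### Compatibility of the functor `B` with exact functors. -/

noncomputable section

namespace FrobeniusFunctor

open Verlinde LinProd Mat_Monoidal

section Comparison

variable {k : Type w} [Field k] {p : ℕ} [Fact p.Prime]
variable {C : Type u} [Category.{v} C] [Abelian C] [Linear k C]
variable {D : Type u₁} [Category.{v} D] [Abelian D] [Linear k D]
variable (G : C ⥤ D) [G.Additive] [G.Linear k]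
variable {V W : C} {V' W' : D} {g : V ⟶ V} {h : W ⟶ W} {g' : V' ⟶ V'} {h' : W' ⟶ W'}

variable {G} in
theorem map_one_sub {φ : G.obj V ⟶ V'} (hφ : G.map g ≫ φ = φ ≫ g') :
    G.map (𝟙 V - g) ≫ φ = φ ≫ (𝟙 V' - g') := by
  rw [G.map_sub, G.map_id, Preadditive.sub_comp, Preadditive.comp_sub, hφ, Category.id_comp,
    Category.comp_id]

section Push

variable {J : FDRep k (Multiplicative (ZMod p))} {S : C}

/-- The image of an equivariant map under a linear functor. -/
def Equivar.push (f : Equivar J S g) (φ : G.obj V ⟶ V') (hφ : G.map g ≫ φ = φ ≫ g') :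
    Equivar J (G.obj S) g' where
  toFun := Linear.rightComp k _ φ ∘ₗ G.mapLinearMap k ∘ₗ f.toFun
  comm x := by
    refine (?_ : G.map (f.toFun (act J x)) ≫ φ = (G.map (f.toFun x) ≫ φ) ≫ g')
    rw [f.comm, G.map_comp, Category.assoc, hφ, Category.assoc]

variable [CharP k p] [PreservesFiniteLimits G] [PreservesFiniteColimits G]

/-- Both sides are determined by their values on Jordan blocks, where the comparison of layers sends
the class of an element to the class of its image. -/
theorem Equivar.map_psi (f : Equivar J S g) (φ : G.obj V ⟶ V')
    (hφ : G.map g ≫ φ = φ ≫ g') (m : Fin (p - 1)) :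
    (mapLeft (Ver k p) G).map (f.psi m) ≫
        (homMk (layerComparison G φ (map_one_sub hφ) m) (𝟙 (L k p m)) :
          (⟨G.obj (layer (𝟙 V - g) m), L k p m⟩ : LinProd k D (Ver k p)) ⟶ ⟨_, L k p m⟩) =
      (f.push G φ hφ).psi m := by
  refine hom_ext_of_block _ _ fun β => ?_
  have h1 : (homMk (𝟙 (G.obj S)) (pr β) : (⟨G.obj S, L k p m⟩ : LinProd k D (Ver k p)) ⟶
      ⟨G.obj S, ⟨J⟩⟩) = (mapLeft (Ver k p) G).map (homMk (𝟙 S) (pr β)) := by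
    rw [mapLeft_map_homMk, G.map_id]
  have h2 := congrArg (fun t => (mapLeft (Ver k p) G).map t) (f.homMk_psi m β)
  rw [homMk_psi]
  refine (congrArg (fun t => t ≫ _) h1).trans ((Category.assoc _ _ _).symm.trans ?_)
  refine (congrArg (fun t => t ≫ _) (((mapLeft (Ver k p) G).map_comp _ _).symm.trans h2)).trans ?_
  refine (homMk_comp (G.map (f.eval m β)) (𝟙 (L k p m)) _ _).trans ?_
  rw [Category.comp_id]
  exact congrArg (fun t => homMk t _) (map_cls_comparison G φ (map_one_sub hφ) _ _)

end Push

variable [CharP k p] [PreservesFiniteLimits G] [PreservesFiniteColimits G]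

variable (k p) in
/-- The comparison of the objects `⊕ B_i ⊠ L_i` along an exact functor. -/
def blComparison (φ : G.obj V ⟶ V') (hφ : G.map g ≫ φ = φ ≫ g') :
    (mapLeft (Ver k p) G).mapMat_.obj (Bl k p g) ⟶ Bl k p g' :=
  relabel (M := (mapLeft (Ver k p) G).mapMat_.obj (Bl k p g)) (N := Bl k p g') (fun i => i)
    (fun i : Fin (p - 1) => homMk (layerComparison G φ (map_one_sub hφ) i) (𝟙 (L k p i)))

variable {M : Mat_ (LinProd k C (Ver k p))}

/-- The image of a family of equivariant maps under a linear functor. -/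
def Fam.push (T : Fam M g) (φ : G.obj V ⟶ V') (hφ : G.map g ≫ φ = φ ≫ g') :
    Fam ((mapLeft (Ver k p) G).mapMat_.obj M) g' :=
  fun i => (T i).push G φ hφ

theorem map_Psi_comparison (T : Fam M g) (φ : G.obj V ⟶ V') (hφ : G.map g ≫ φ = φ ≫ g') :
    (mapLeft (Ver k p) G).mapMat_.map (Psi T) ≫ blComparison k p G φ hφ =
      Psi (Fam.push G T φ hφ) := by
  refine Mat_.hom_ext _ _ fun i (m : Fin (p - 1)) => ?_
  refine (comp_relabel ((mapLeft (Ver k p) G).mapMat_.map (Psi T))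
    (N := (mapLeft (Ver k p) G).mapMat_.obj (Bl k p g)) (P := Bl k p g') (fun i => i)
    Function.injective_id _ i m).trans ?_
  exact (T i).map_psi G φ hφ m

theorem isIso_blComparison (φ : G.obj V ⟶ V') [IsIso φ] (hφ : G.map g ≫ φ = φ ≫ g') :
    IsIso (blComparison k p G φ hφ) := by
  have hi (i : Fin (p - 1)) : IsIso (layerComparison G φ (map_one_sub hφ) i) :=
    isIso_layerComparison G φ (map_one_sub hφ) i
  exact inferInstanceAs (IsIso (relabelIso (M := (mapLeft (Ver k p) G).mapMat_.obj (Bl k p g))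
    (N := Bl k p g') (fun i => i) (fun i => i) (fun _ => rfl) (fun _ => rfl)
    (fun i : Fin (p - 1) => LinProd.isoMk
      (@asIso _ _ _ _ (layerComparison G φ (map_one_sub hφ) i) (hi i)) (Iso.refl (L k p i)))).hom)

theorem isFamilyEpi_map {N : Mat_ (LinProd k C (Ver k p))} {f : M ⟶ N} (hf : IsFamilyEpi f) :
    IsFamilyEpi ((mapLeft (Ver k p) G).mapMat_.map f) := by
  obtain ⟨e, φ, ψ, he, hφ, hψ, rfl⟩ := hf
  exact ⟨mapIdx _ e, fun i => G.map (φ i), ψ, he, fun i => have := hφ i; inferInstanceAs (Epi (G.map (φ i))), hψ,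
    mapMat_relabel _ _ _⟩

theorem blComparison_natural (φ : G.obj V ⟶ V') (hφ : G.map g ≫ φ = φ ≫ g')
    (φ₁ : G.obj W ⟶ W') (hφ₁ : G.map h ≫ φ₁ = φ₁ ≫ h') (ψ : V ⟶ W) (hψ : g ≫ ψ = ψ ≫ h)
    (ψ' : V' ⟶ W') (hψ' : g' ≫ ψ' = ψ' ≫ h') (hc : G.map ψ ≫ φ₁ = φ ≫ ψ') :
    (mapLeft (Ver k p) G).mapMat_.map (Blmap k p ψ hψ) ≫ blComparison k p G φ₁ hφ₁ =
      blComparison k p G φ hφ ≫ Blmap k p ψ' hψ' := by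
  have := (isFamilyEpi_map G (isFamilyEpi_canFam (k := k) (p := p) g)).epi
  rw [← cancel_epi ((mapLeft (Ver k p) G).mapMat_.map (Psi (canFam k p g))), ← Category.assoc,
    ← (mapLeft (Ver k p) G).mapMat_.map_comp, Psi_comp_Blmap, map_Psi_comparison, ← Category.assoc,
    map_Psi_comparison, Psi_comp_Blmap]
  refine congrArg Psi (funext fun i => Equivar.ext (LinearMap.ext fun a => ?_))
  refine (?_ : G.map ((canFam k p g i).toFun a ≫ ψ) ≫ φ₁ = (G.map ((canFam k p g i).toFun a) ≫ φ) ≫ ψ')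
  rw [G.map_comp, Category.assoc, Category.assoc, hc]

end Comparison

section FunctorComparison

open Functor.LaxMonoidal

variable {k : Type w} [Field k] {p : ℕ} [Fact p.Prime] [CharP k p]
variable {C : Type u} [Category.{v} C] [Abelian C] [Linear k C] [MonoidalCategory C]
  [MonoidalPreadditive C] [MonoidalLinear k C]
variable {D : Type u₁} [Category.{v} D] [Abelian D] [Linear k D] [MonoidalCategory D]
  [MonoidalPreadditive D] [MonoidalLinear k D]
variable {C₀ : Type u₂} [Category.{v₂} C₀] [MonoidalCategory C₀]
variable {D₀ : Type u₂} [Category.{v₂} D₀] [MonoidalCategory D₀]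
variable (G : C ⥤ D) [G.Additive] [G.Linear k] [PreservesFiniteLimits G]
  [PreservesFiniteColimits G]
variable (E : C₀ ⥤ D₀) {P : C₀ ⥤ C} {g : P ⟶ P} {P' : D₀ ⥤ D} {g' : P' ⟶ P'}
variable (φ : P ⋙ G ≅ E ⋙ P')
  (hφ : ∀ X, G.map (g.app X) ≫ φ.hom.app X = φ.hom.app X ≫ g'.app (E.obj X))

variable (k p) in
/-- The functors `X ↦ ⊕ B_i(P(X)) ⊠ L_i` are compatible with exact functors. -/
def blFunctorComparison : blFunctor k p P g ⋙ (mapLeft (Ver k p) G).mapMat_ ≅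
    E ⋙ blFunctor k p P' g' :=
  NatIso.ofComponents
    (fun X => @asIso _ _ ((mapLeft (Ver k p) G).mapMat_.obj (Bl k p (g.app X)))
      (Bl k p (g'.app (E.obj X))) (blComparison k p G (φ.hom.app X) (hφ X))
      (isIso_blComparison (k := k) (p := p) G (φ.hom.app X) (hφ X)))
    (fun {X Y} f => blComparison_natural G _ (hφ X) _ (hφ Y) (P.map f) (g.naturality f).symm
      (P'.map (E.map f)) (g'.naturality (E.map f)).symm (φ.hom.naturality f))

theorem map_tst_comparison {M : Mat_ (LinProd k C (Ver k p))} {X : C₀} (T : Fam M (g.app X)) :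
    (mapLeft (Ver k p) G).mapMat_.map (tst T) ≫ (blFunctorComparison k p G E φ hφ).hom.app X =
      tst (P := P') (g := g') (X := E.obj X) (Fam.push G T (φ.hom.app X) (hφ X)) :=
  map_Psi_comparison G T _ _

variable [G.Monoidal] [E.Monoidal] [P.Monoidal] [P'.Monoidal]

theorem ε_comp_tst {X : D₀} (T : Fam ((mapLeft (Ver k p) G).mapMat_.obj (𝟙_ _)) (g'.app X)) :
    ε (mapLeft (Ver k p) G).mapMat_ ≫ tst T = tst (M := 𝟙_ _) fun i => (T i).pre (ε G) (𝟙 (𝟙_ _)) :=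
  relabel_comp_Psi (M := 𝟙_ _) (N := (mapLeft (Ver k p) G).mapMat_.obj (𝟙_ _)) T
    (unitIdx (mapLeft (Ver k p) G)) (fun _ => ε G) (fun _ => 𝟙 (𝟙_ _))

theorem μ_comp_tst {X : D₀} (M N : Mat_ (LinProd k C (Ver k p)))
    (T : Fam ((mapLeft (Ver k p) G).mapMat_.obj (M ⊗ N)) (g'.app X)) :
    μ (mapLeft (Ver k p) G).mapMat_ M N ≫ tst T =
      tst (M := (mapLeft (Ver k p) G).mapMat_.obj M ⊗ (mapLeft (Ver k p) G).mapMat_.obj N) fun q =>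
        (T q).pre (μ G (M.X q.1).left (N.X q.2).left)
          (𝟙 ((M.X q.1).right.as ⊗ (N.X q.2).right.as)) :=
  relabel_comp_Psi (M := (mapLeft (Ver k p) G).mapMat_.obj M ⊗ (mapLeft (Ver k p) G).mapMat_.obj N)
    (N := (mapLeft (Ver k p) G).mapMat_.obj (M ⊗ N)) T
    (tensorIdx (mapLeft (Ver k p) G) M N) (fun q => μ G (M.X q.1).left (N.X q.2).left)
    (fun q => 𝟙 ((M.X q.1).right.as ⊗ (N.X q.2).right.as))

variable [HasDuals C] [HasDuals D] [NatTrans.IsMonoidal g] [NatTrans.IsMonoidal g']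
  [NatTrans.IsMonoidal φ.hom]

theorem blFunctorComparison_unit :
    ε (mapLeft (Ver k p) G).mapMat_ ≫ (mapLeft (Ver k p) G).mapMat_.map (ε (blFunctor k p P g)) ≫
        (blFunctorComparison k p G E φ hφ).hom.app (𝟙_ C₀) =
      ε (blFunctor k p P' g') ≫ (blFunctor k p P' g').map (ε E) := by
  have hu : (ε G ≫ G.map (ε P)) ≫ φ.hom.app (𝟙_ C₀) = ε P' ≫ P'.map (ε E) :=
    NatTrans.IsMonoidal.unit (τ := φ.hom)
  rw [← tst_unitTest, ← tst_unitTest]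
  refine (congrArg (fun t => ε (mapLeft (Ver k p) G).mapMat_ ≫ t)
    (map_tst_comparison G E φ hφ (unitTest k p P g))).trans ?_
  refine (ε_comp_tst G (Fam.push G (unitTest k p P g) _ (hφ _))).trans ?_
  refine Eq.trans ?_ (tst_map (unitTest k p P' g') (ε E)).symm
  refine congrArg Psi (funext fun i => Equivar.ext (LinearMap.ext_ring (R := k) ?_))
  refine (?_ : ε G ≫ G.map (((1 : k) • 𝟙 (𝟙_ C)) ≫ ε P) ≫ φ.hom.app (𝟙_ C₀) =
    (((1 : k) • 𝟙 (𝟙_ D)) ≫ ε P') ≫ P'.map (ε E))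
  rw [one_smul, one_smul, Category.id_comp, Category.id_comp, ← hu, Category.assoc]

/-- Tested on images of canonical families, which are still epimorphic, both sides become `tst` of
families of equivariant maps; these agree because `φ` is a monoidal transformation. -/
theorem blFunctorComparison_tensor (X Y : C₀) :
    μ (mapLeft (Ver k p) G).mapMat_ ((blFunctor k p P g).obj X) ((blFunctor k p P g).obj Y) ≫
      (mapLeft (Ver k p) G).mapMat_.map (μ (blFunctor k p P g) X Y) ≫
        (blFunctorComparison k p G E φ hφ).hom.app (X ⊗ Y) =
      ((blFunctorComparison k p G E φ hφ).hom.app X ⊗ₘ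
        (blFunctorComparison k p G E φ hφ).hom.app Y) ≫
        μ (blFunctor k p P' g') (E.obj X) (E.obj Y) ≫ (blFunctor k p P' g').map (μ E X Y) := by
  have ht : (μ G (P.obj X) (P.obj Y) ≫ G.map (μ P X Y)) ≫ φ.hom.app (X ⊗ Y) =
      (φ.hom.app X ⊗ₘ φ.hom.app Y) ≫ μ P' (E.obj X) (E.obj Y) ≫ P'.map (μ E X Y) :=
    NatTrans.IsMonoidal.tensor (τ := φ.hom) X Y
  have := ((isFamilyEpi_map G (isFamilyEpi_tst (k := k) (p := p) (P := P) (g := g) X)).tensor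
    (isFamilyEpi_map G (isFamilyEpi_tst (k := k) (p := p) (P := P) (g := g) Y))).epi
  rw [← cancel_epi ((mapLeft (Ver k p) G).mapMat_.map (tst (P := P) (canFam k p (g.app X))) ⊗ₘ
    (mapLeft (Ver k p) G).mapMat_.map (tst (P := P) (canFam k p (g.app Y))))]
  generalize canFam k p (g.app X) = T
  generalize canFam k p (g.app Y) = T'
  have h1 := map_tst_comparison G E φ hφ T
  have h2 := map_tst_comparison G E φ hφ T'
  have h3 : (mapLeft (Ver k p) G).mapMat_.map (tst T ⊗ₘ tst T') ≫
      (mapLeft (Ver k p) G).mapMat_.map (μ (blFunctor k p P g) X Y) ≫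
        (blFunctorComparison k p G E φ hφ).hom.app (X ⊗ Y) =
      tst (P := P') (g := g') (X := E.obj (X ⊗ Y))
        (Fam.push G (Fam.mul P T T') (φ.hom.app (X ⊗ Y)) (hφ (X ⊗ Y))) := by
    rw [← Category.assoc, ← Functor.map_comp, tst_μ]
    exact map_tst_comparison G E φ hφ (Fam.mul P T T')
  have h4 := μ_comp_tst G (P' := P') (g' := g') _ _
    (Fam.push G (Fam.mul P T T') (φ.hom.app (X ⊗ Y)) (hφ (X ⊗ Y)))
  rw [μ_natural_assoc]
  refine (congrArg (fun t => _ ≫ t) h3).trans (h4.trans ?_)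
  refine Eq.trans ?_ (tensorHom_comp_tensorHom_assoc _ _ _ _ _).symm
  refine Eq.trans ?_ (congrArg₂ (fun s t => (s ⊗ₘ t) ≫ μ (blFunctor k p P' g') (E.obj X) (E.obj Y) ≫
    (blFunctor k p P' g').map (μ E X Y)) h1 h2).symm
  refine Eq.trans ?_ (Category.assoc _ _ _)
  refine Eq.trans ?_ (congrArg (fun t => t ≫ (blFunctor k p P' g').map (μ E X Y)) (tst_μ _ _).symm)
  refine Eq.trans ?_ (tst_map _ (μ E X Y)).symm
  refine congrArg Psi (funext fun q => Equivar.tensor_ext fun a b => ?_)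
  refine (?_ : μ G _ _ ≫ G.map (((T q.1).toFun a ⊗ₘ (T' q.2).toFun b) ≫ μ P X Y) ≫
    φ.hom.app (X ⊗ Y) = (((G.map ((T q.1).toFun a) ≫ φ.hom.app X) ⊗ₘ
      (G.map ((T' q.2).toFun b) ≫ φ.hom.app Y)) ≫ μ P' (E.obj X) (E.obj Y)) ≫ P'.map (μ E X Y))
  rw [G.map_comp, Category.assoc, ← μ_natural_assoc, ← tensorHom_comp_tensorHom, Category.assoc,
    Category.assoc, ← ht, Category.assoc]

end FunctorComparison

end FrobeniusFunctor

end

/-! ### The comparison for the Frobenius functor. -/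

noncomputable section

namespace FrobeniusFunctor

open Verlinde LinProd Mat_Monoidal Functor.LaxMonoidal

section Twist

variable (k : Type w) [Field k] (p : ℕ) [Fact p.Prime] [CharP k p]
variable {C : Type u} [Category.{v} C] [Abelian C] [Linear k C] [MonoidalCategory C]
  [MonoidalPreadditive C] [MonoidalLinear k C] [SymmetricCategory C]
variable {D : Type u} [Category.{v} D] [Abelian D] [Linear k D] [MonoidalCategory D]
  [MonoidalPreadditive D] [MonoidalLinear k D] [SymmetricCategory D]
variable (E : C ⥤ D)

instance [PreservesFiniteLimits E] : PreservesFiniteLimits (FrobeniusTwist.map p E) :=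
  inferInstanceAs (PreservesFiniteLimits E)

instance [PreservesFiniteColimits E] : PreservesFiniteColimits (FrobeniusTwist.map p E) :=
  inferInstanceAs (PreservesFiniteColimits E)

theorem powerComparison_inv_natural [E.Monoidal] {X Y : C} (f : X ⟶ Y) (n : ℕ) :
    E.map ((power n).map f) ≫ (powerComparison E Y n).inv =
      (powerComparison E X n).inv ≫ (power n).map (E.map f) := by
  rw [Iso.eq_inv_comp, ← Category.assoc, ← powerComparison_natural, Category.assoc,
    Iso.hom_inv_id, Category.comp_id]

/-- The comparison of tensor powers along a monoidal functor, as a natural isomorphism. -/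
def powerNatIso [E.Monoidal] (n : ℕ) : power n ⋙ E ≅ E ⋙ power n :=
  NatIso.ofComponents (fun X => (powerComparison E X n).symm)
    (fun f => powerComparison_inv_natural E f n)

instance [E.Braided] (n : ℕ) : NatTrans.IsMonoidal (powerNatIso E n).hom where
  unit := by
    refine (?_ : (ε E ≫ E.map (ε (power n))) ≫ (powerComparison E (𝟙_ C) n).inv =
      ε (power n) ≫ (power n).map (ε E))
    rw [Iso.comp_inv_eq, ← ε_comparison, Category.assoc]
  tensor X Y := by
    refine (?_ : (μ E _ _ ≫ E.map (μ (power n) X Y)) ≫ (powerComparison E (X ⊗ Y) n).inv =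
      ((powerComparison E X n).inv ⊗ₘ (powerComparison E Y n).inv) ≫
        μ (power n) (E.obj X) (E.obj Y) ≫ (power n).map (μ E X Y))
    rw [Iso.comp_inv_eq, Category.assoc, Category.assoc, μ_comparison,
      tensorHom_comp_tensorHom_assoc, Iso.inv_hom_id, Iso.inv_hom_id, id_tensorHom_id,
      Category.id_comp]

/-- The comparison of tensor powers with values in the twist. -/
def twistPowerIso [E.Monoidal] :
    twistPower p C ⋙ FrobeniusTwist.map p E ≅ E ⋙ twistPower p D := powerNatIso E p

instance [E.Braided] : NatTrans.IsMonoidal (twistPowerIso p E).hom :=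
  inferInstanceAs (NatTrans.IsMonoidal (powerNatIso E p).hom)

theorem cyclic_comparison_inv [E.Braided] (X : C) (n : ℕ) :
    E.map (cyclic X n) ≫ (powerComparison E X n).inv =
      (powerComparison E X n).inv ≫ cyclic (E.obj X) n := by
  rw [Iso.eq_inv_comp, ← Category.assoc, ← cyclic_comparison, Category.assoc,
    Iso.hom_inv_id, Category.comp_id]

theorem twistCyclic_comparison [E.Braided] (X : C) :
    (FrobeniusTwist.map p E).map ((twistCyclic p C).app X) ≫ (twistPowerIso p E).hom.app X =
      (twistPowerIso p E).hom.app X ≫ (twistCyclic p D).app (E.obj X) :=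
  cyclic_comparison_inv E X p

variable [E.Additive] [E.Linear k] [E.Braided] [PreservesFiniteLimits E] [PreservesFiniteColimits E]

/-- The Frobenius functor commutes with symmetric tensor functors. -/
def frobComparison : frob C k p ⋙ targetMap k p E ≅ E ⋙ frob D k p :=
  blFunctorComparison k p (FrobeniusTwist.map p E) E (P := twistPower p C) (g := twistCyclic p C)
    (P' := twistPower p D) (g' := twistCyclic p D) (twistPowerIso p E) (twistCyclic_comparison p E)

theorem isMonoidal_frobComparison [HasDuals C] [HasDuals D] :
    letI := frobMonoidal k p C
    letI := frobMonoidal k p D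
    NatTrans.IsMonoidal (frobComparison k p E).hom :=
  letI := frobMonoidal k p C
  letI := frobMonoidal k p D
  { unit := (Category.assoc _ _ _).trans (blFunctorComparison_unit (k := k) (p := p)
      (P := twistPower p C) (g := twistCyclic p C) (P' := twistPower p D) (g' := twistCyclic p D)
      (FrobeniusTwist.map p E) E (twistPowerIso p E) (twistCyclic_comparison p E))
    tensor := fun X Y => (Category.assoc _ _ _).trans (blFunctorComparison_tensor (k := k) (p := p)
      (P := twistPower p C) (g := twistCyclic p C) (P' := twistPower p D) (g' := twistCyclic p D)
      (FrobeniusTwist.map p E) E (twistPowerIso p E) (twistCyclic_comparison p E) X Y) }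

theorem map_diff_comparison (X : C) : E.map (diff p X) ≫ (powerComparison E X p).inv =
    (powerComparison E X p).inv ≫ diff p (E.obj X) :=
  map_one_sub (cyclic_comparison_inv E X p)

theorem isCanonical_layerComparison (j : ℕ) (X : C) : IsCanonical p E j X
    (layerComparison E (powerComparison E X p).inv (map_diff_comparison p E X) j) :=
  ⟨kerImComparison E _ (map_diff_comparison p E X) j, kerImComparison_arrow E _ _ j,
    map_layerπ_comparison E _ _ j⟩

theorem frobComparison_app (X : C) : (frobComparison k p E).hom.app X =
    sumMap k p fun i => layerComparison E (powerComparison E X p).inv (map_diff_comparison p E X) i :=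
  rfl

end Twist

end FrobeniusFunctor

end

/-! ### Norms and the additivity of maps between layers. -/

noncomputable section

namespace FrobeniusFunctor

section Conjugation

variable {k : Type w} [Field k] {C : Type u} [Category.{v} C] [Abelian C] [Linear k C]
variable {V W : C} (c : V ⟶ V) (c' : W ⟶ W) [IsIso c']

variable (k) in
/-- Conjugation of morphisms by a pair of automorphisms. -/
def conjHom : Module.End k (V ⟶ W) := Linear.leftComp k W c ∘ₗ Linear.rightComp k V (inv c')

theorem conjHom_apply (h : V ⟶ W) : conjHom k c c' h = c ≫ h ≫ inv c' := by
  refine (?_ : c ≫ (h ≫ inv c') = _)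
  rfl

theorem one_sub_conjHom_apply (h : V ⟶ W) :
    (1 - conjHom k c c') h = ((𝟙 V - c) ≫ h - h ≫ (𝟙 W - c')) ≫ inv c' := by
  rw [LinearMap.sub_apply, conjHom_apply, Module.End.one_apply]
  simp [Preadditive.sub_comp, Preadditive.comp_sub]

/-- One application of `1 - Ad` replaces `h` by the difference of `D h` and `h D'`, up to an
automorphism. After `n` applications each term has `i` factors `D` before `h` and `n - i` factors
`D'` after it. Terms with `i ≥ a` vanish on `Ker D^a`, and the others lie in `Im D'^{n+1-a}`. -/
theorem comp_one_sub_conjHom_pow (h : V ⟶ W) (n a : ℕ) (ha : 0 < a) (han : a ≤ n + 1) {S : C}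
    (x : S ⟶ V) (hx : x ≫ endPow (𝟙 V - c) a = 0) :
    ∃ z : S ⟶ W, x ≫ ((1 - conjHom k c c') ^ n) h = z ≫ endPow (𝟙 W - c') (n + 1 - a) := by
  induction n generalizing a x with
  | zero =>
    obtain rfl : a = 1 := by omega
    exact ⟨x ≫ h, by simp [endPow]⟩
  | succ n ih =>
    rw [pow_succ', Module.End.mul_apply, one_sub_conjHom_apply]
    have hcomm : ∀ j, inv c' ≫ endPow (𝟙 W - c') j = endPow (𝟙 W - c') j ≫ inv c' := fun j =>
      (pow_natural _ (by simp [Preadditive.sub_comp, Preadditive.comp_sub]) j).symm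
    have h1 : ∃ z : S ⟶ W, (x ≫ (𝟙 V - c)) ≫ ((1 - conjHom k c c') ^ n) h =
        z ≫ endPow (𝟙 W - c') (n + 2 - a) := by
      obtain ⟨a, rfl⟩ := Nat.exists_eq_succ_of_ne_zero ha.ne'
      rcases Nat.eq_zero_or_pos a with rfl | h0
      · rw [endPow, endPow, Category.comp_id] at hx
        exact ⟨0, by rw [hx, zero_comp, zero_comp]⟩
      · obtain ⟨z, hz⟩ := ih a h0 (by omega) (x ≫ (𝟙 V - c)) (by rw [Category.assoc]; exact hx)
        exact ⟨z, by rw [hz]; congr 2; omega⟩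
    have h2 : ∃ z : S ⟶ W, (x ≫ ((1 - conjHom k c c') ^ n) h) ≫ (𝟙 W - c') =
        z ≫ endPow (𝟙 W - c') (n + 2 - a) := by
      rcases Nat.lt_or_ge (n + 1) a with h0 | h0
      · obtain rfl : a = n + 2 := by omega
        exact ⟨_, by rw [Nat.sub_self]; exact (Category.comp_id _).symm⟩
      · obtain ⟨z, hz⟩ := ih a ha h0 x hx
        refine ⟨z, ?_⟩
        rw [hz, Category.assoc, ← endPow_succ']
        congr 2; omega
    obtain ⟨z₁, hz₁⟩ := h1
    obtain ⟨z₂, hz₂⟩ := h2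
    refine ⟨(z₁ - z₂) ≫ inv c', ?_⟩
    rw [Category.assoc, hcomm, ← Category.assoc, ← Category.assoc, Preadditive.comp_sub,
      ← Category.assoc, ← Category.assoc, hz₁, hz₂, Preadditive.sub_comp,
      Preadditive.sub_comp, Preadditive.sub_comp]

/-- Multiplied by `1 - X`, both sides become `1 - X^p = (1 - X)^p`; the factor cancels in the
polynomial ring, and the identity is then evaluated at `t`. -/
theorem sum_pow_eq_one_sub_pow (p : ℕ) [Fact p.Prime] [CharP k p] {A : Type*} [Ring A]
    [Algebra k A] (t : A) : ∑ r ∈ Finset.range p, t ^ r = (1 - t) ^ (p - 1) := by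
  have hp := Nat.succ_pred_prime (Fact.out : p.Prime)
  have h1 : ∑ r ∈ Finset.range p, (Polynomial.X : Polynomial k) ^ r =
      (1 - Polynomial.X) ^ (p - 1) := by
    have h0 : (1 - Polynomial.X : Polynomial k) ≠ 0 := by
      intro h
      have := congrArg (Polynomial.eval 0) h
      simp at this
    refine mul_left_cancel₀ h0 ?_
    rw [mul_neg_geom_sum, ← pow_succ']
    refine Eq.trans ?_ (congrArg (fun n => (1 - Polynomial.X : Polynomial k) ^ n) hp).symm
    rw [sub_pow_char, one_pow]
  have h2 := congrArg (Polynomial.aeval t) h1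
  simpa using h2

variable {c c'} in
/-- Norms do not contribute to the layers below the top. -/
theorem cls_comp_sum_conjHom_eq_zero (p : ℕ) [Fact p.Prime] [CharP k p] (h : V ⟶ W) {j : ℕ}
    (hj : j < p - 1) {S : C} (x : S ⟶ V) (hx : x ≫ endPow (𝟙 V - c) (j + 1) = 0)
    (hx' : (x ≫ (∑ r ∈ Finset.range p, conjHom k c c' ^ r) h) ≫ endPow (𝟙 W - c') (j + 1) = 0) :
    cls (𝟙 W - c') j (x ≫ (∑ r ∈ Finset.range p, conjHom k c c' ^ r) h) hx' = 0 := by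
  -- The norm is `(1 - Ad)^{p-1}`, so it sends `Ker D^{j+1}` into `Im D'^{p-1-j}`. The exponent is
  -- positive just when `j < p - 1`, and multiples of `D'` have zero class.
  obtain ⟨z, hz⟩ := comp_one_sub_conjHom_pow (k := k) c c' h (p - 1) (j + 1) (by omega) (by omega) x hx
  rw [← sum_pow_eq_one_sub_pow (k := k) p] at hz
  obtain ⟨m, hm⟩ : ∃ m, p - 1 + 1 - (j + 1) = m + 1 := ⟨p - 1 - j - 1, by omega⟩
  rw [hm, endPow_succ', ← Category.assoc] at hz
  rw [cls_congr hx' hz]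
  exact cls_comp_eq_zero _ _

end Conjugation

section LayerMap

variable {C : Type u} [Category.{v} C] [Abelian C] {V W : C} {d : V ⟶ V} {d' : W ⟶ W} {j : ℕ}

theorem comp_comp_endPow {S : C} (x : S ⟶ V) (hx : x ≫ endPow d (j + 1) = 0) (f : V ⟶ W)
    (hf : d ≫ f = f ≫ d') : (x ≫ f) ≫ endPow d' (j + 1) = 0 := by
  rw [Category.assoc, ← pow_natural f hf, ← Category.assoc, hx, zero_comp]

theorem powKerπ_layerMap (f : V ⟶ W) (hf : d ≫ f = f ≫ d') : powKerπ d j ≫ layerMap f hf j =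
    cls d' j (kernel.ι (endPow d (j + 1)) ≫ f) (comp_comp_endPow _ (kernel.condition _) f hf) :=
  cls_layerMap f hf _ _ _

theorem layerMap_add {f₁ f₂ f N : V ⟶ W} (h₁ : d ≫ f₁ = f₁ ≫ d') (h₂ : d ≫ f₂ = f₂ ≫ d')
    (hf : d ≫ f = f ≫ d') (hN : d ≫ N = N ≫ d') (e : f = f₁ + f₂ + N)
    (h0 : ∀ (S : C) (x : S ⟶ V) (hx : x ≫ endPow d (j + 1) = 0),
      cls d' j (x ≫ N) (comp_comp_endPow x hx N hN) = 0) :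
    layerMap f hf j = layerMap f₁ h₁ j + layerMap f₂ h₂ j := by
  rw [← cancel_epi (powKerπ d j), Preadditive.comp_add, powKerπ_layerMap, powKerπ_layerMap,
    powKerπ_layerMap]
  have k₁ := comp_comp_endPow (j := j) _ (kernel.condition (endPow d (j + 1))) f₁ h₁
  have k₂ := comp_comp_endPow (j := j) _ (kernel.condition (endPow d (j + 1))) f₂ h₂
  have k₃ := comp_comp_endPow (j := j) _ (kernel.condition (endPow d (j + 1))) N hN
  have k₄ : (kernel.ι (endPow d (j + 1)) ≫ f₁ + kernel.ι (endPow d (j + 1)) ≫ f₂) ≫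
      endPow d' (j + 1) = 0 := by rw [Preadditive.add_comp, k₁, k₂, add_zero]
  have h3 : kernel.ι (endPow d (j + 1)) ≫ f = (kernel.ι (endPow d (j + 1)) ≫ f₁ +
      kernel.ι (endPow d (j + 1)) ≫ f₂) + kernel.ι (endPow d (j + 1)) ≫ N := by
    rw [e, Preadditive.comp_add, Preadditive.comp_add]
  rw [cls_congr _ h3, cls_add _ _ k₄ k₃, cls_add _ _ k₁ k₂, h0 _ _ (kernel.condition _), add_zero]

theorem layerMap_smul {k : Type w} [Field k] [Linear k C] {f f' : V ⟶ W} (hf : d ≫ f = f ≫ d')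
    (hf' : d ≫ f' = f' ≫ d') (c : k) (e : f' = c • f) :
    layerMap f' hf' j = c • layerMap f hf j := by
  subst e
  rw [← cancel_epi (powKerπ d j), Linear.comp_smul, powKerπ_layerMap, powKerπ_layerMap]
  have h1 := comp_comp_endPow (j := j) _ (kernel.condition (endPow d (j + 1))) f hf
  rw [← cls_smul c _ h1 (by rw [Linear.smul_comp, h1, smul_zero])]
  exact cls_congr _ (Linear.comp_smul _ _ _ _ _ _)

end LayerMap

section MixedPower

variable {C : Type u} [Category.{v} C] [MonoidalCategory C] {X Y : C}

/-- The tensor product of the first `n` members of a sequence of morphisms. -/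
def mixedPower (u : ℕ → (X ⟶ Y)) : (n : ℕ) → ((power n).obj X ⟶ (power n).obj Y)
  | 0 => 𝟙 _
  | n + 1 => mixedPower u n ⊗ₘ u n

theorem mixedPower_succ (u : ℕ → (X ⟶ Y)) (n : ℕ) :
    mixedPower u (n + 1) = mixedPower u n ⊗ₘ u n := rfl

theorem mixedPower_const (f : X ⟶ Y) (n : ℕ) : mixedPower (fun _ => f) n = (power n).map f := by
  induction n with
  | zero => rfl
  | succ n ih => rw [mixedPower_succ, ih]; rfl

theorem mixedPower_congr {u u' : ℕ → (X ⟶ Y)} {n : ℕ} (h : ∀ i < n, u i = u' i) :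
    mixedPower u n = mixedPower u' n := by
  induction n with
  | zero => rfl
  | succ n ih =>
    rw [mixedPower_succ, mixedPower_succ, ih fun i hi => h i (by omega), h n (by omega)]

theorem tensorHom_comp_whiskerRight {A B A' B' N N' : C} {a : A ⟶ A'} {b : B ⟶ B'}
    {s : A' ⊗ B' ⟶ N'} {t : A ⊗ B ⟶ N} {m : N ⟶ N'} (h : (a ⊗ₘ b) ≫ s = t ≫ m) (u : X ⟶ Y) :
    ((a ⊗ₘ b) ⊗ₘ u) ≫ s ▷ Y = t ▷ X ≫ (m ⊗ₘ u) := by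
  rw [← tensorHom_id, ← tensorHom_id, tensorHom_comp_tensorHom, tensorHom_comp_tensorHom, h,
    Category.comp_id, Category.id_comp]

theorem mixedPower_shift (u : ℕ → (X ⟶ Y)) (n : ℕ) :
    (u 0 ⊗ₘ mixedPower (fun i => u (i + 1)) n) ≫ (shift Y n).hom =
      (shift X n).hom ≫ mixedPower u (n + 1) := by
  induction n with
  | zero =>
    change (u 0 ⊗ₘ 𝟙 _) ≫ (ρ_ Y).hom ≫ (λ_ Y).inv = ((ρ_ X).hom ≫ (λ_ X).inv) ≫ (𝟙 _ ⊗ₘ u 0)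
    simp
  | succ n ih =>
    rw [mixedPower_succ u (n + 1), mixedPower_succ, shift_succ, shift_succ]
    change (u 0 ⊗ₘ (mixedPower (fun i => u (i + 1)) n ⊗ₘ u (n + 1))) ≫ (α_ _ _ _).inv ≫
      (shift Y n).hom ▷ Y = ((α_ _ _ _).inv ≫ (shift X n).hom ▷ X) ≫ (mixedPower u (n + 1) ⊗ₘ u (n + 1))
    rw [associator_inv_naturality_assoc, Category.assoc]
    congr 1
    exact tensorHom_comp_whiskerRight ih _

/-- Indexing the factors by `ℤ/p` turns the cyclic permutation into a translation of the index, the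
last factor `n + 1 = 0` being the one that moves to the front. -/
theorem mixedPower_cyclic [BraidedCategory C] {p : ℕ} [NeZero p] (u : ZMod p → (X ⟶ Y)) :
    cyclic X p ≫ mixedPower (fun i => u i) p = mixedPower (fun i => u (i + 1)) p ≫ cyclic Y p := by
  obtain ⟨n, rfl⟩ : ∃ n, p = n + 1 := Nat.exists_eq_succ_of_ne_zero (NeZero.ne p)
  have h1 := mixedPower_shift (fun i => u i) n
  have h0 : u ((n : ZMod (n + 1)) + 1) = u ((0 : ℕ) : ZMod (n + 1)) := by
    congr 1
    have := ZMod.natCast_self (n + 1)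
    push_cast at this ⊢
    exact this
  rw [mixedPower_succ (fun i => u (i + 1)), h0]
  change ((β_ ((power n).obj X) X).hom ≫ (shift X n).hom) ≫ _ =
    (mixedPower (fun i => u (i + 1)) n ⊗ₘ u ((0 : ℕ) : ZMod (n + 1))) ≫
      (β_ ((power n).obj Y) Y).hom ≫ (shift Y n).hom
  refine (Category.assoc _ _ _).trans ((congrArg (fun t => _ ≫ t) h1.symm).trans ?_)
  refine Eq.trans ?_ (BraidedCategory.braiding_naturality_assoc _ _ _).symm
  simp only [Nat.cast_add, Nat.cast_one]
  rfl

variable {k : Type w} [Field k] [Preadditive C] [Linear k C] [MonoidalPreadditive C] [MonoidalLinear k C]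

theorem mixedPower_update_add (u : ℕ → (X ⟶ Y)) (x y : X ⟶ Y) {i n : ℕ} (hi : i < n) :
    mixedPower (Function.update u i (x + y)) n =
      mixedPower (Function.update u i x) n + mixedPower (Function.update u i y) n := by
  induction n with
  | zero => omega
  | succ n ih =>
    rw [mixedPower_succ, mixedPower_succ, mixedPower_succ]
    rcases Nat.lt_succ_iff_lt_or_eq.1 hi with hi | rfl
    · rw [ih hi, Function.update_of_ne hi.ne', Function.update_of_ne hi.ne',
        Function.update_of_ne hi.ne', MonoidalPreadditive.add_tensor]
      rfl
    · have h1 : ∀ z, mixedPower (Function.update u i z) i = mixedPower u i := fun z =>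
        mixedPower_congr fun j hj => Function.update_of_ne hj.ne _ _
      rw [h1, h1, h1, Function.update_self, Function.update_self, Function.update_self,
        MonoidalPreadditive.tensor_add]
      rfl

theorem mixedPower_update_smul (u : ℕ → (X ⟶ Y)) (c : k) (x : X ⟶ Y) {i n : ℕ} (hi : i < n) :
    mixedPower (Function.update u i (c • x)) n = c • mixedPower (Function.update u i x) n := by
  induction n with
  | zero => omega
  | succ n ih =>
    rw [mixedPower_succ, mixedPower_succ]
    rcases Nat.lt_succ_iff_lt_or_eq.1 hi with hi | rfl
    · rw [ih hi, Function.update_of_ne hi.ne', Function.update_of_ne hi.ne']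
      simp only [MonoidalCategory.tensorHom_def, MonoidalLinear.smul_whiskerRight, Linear.smul_comp]
      rfl
    · have h1 : ∀ z, mixedPower (Function.update u i z) i = mixedPower u i := fun z =>
        mixedPower_congr fun j hj => Function.update_of_ne hj.ne _ _
      rw [h1, h1, Function.update_self, Function.update_self]
      simp only [MonoidalCategory.tensorHom_def, MonoidalLinear.whiskerLeft_smul, Linear.comp_smul]
      rfl

theorem mixedPower_update_cast {p : ℕ} [NeZero p] [DecidableEq (ZMod p)] (u : ZMod p → (X ⟶ Y))
    (i : ZMod p) (x : X ⟶ Y) : mixedPower (fun j : ℕ => Function.update u i x j) p =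
      mixedPower (Function.update (fun j : ℕ => u j) i.val x) p := by
  refine mixedPower_congr fun j hj => ?_
  by_cases h : j = i.val
  · subst h
    rw [Function.update_self, ZMod.natCast_zmod_val, Function.update_self]
  · rw [Function.update_of_ne h, Function.update_of_ne]
    rintro rfl
    exact h (ZMod.val_cast_of_lt hj).symm

variable (k) in
/-- The tensor product of morphisms as a multilinear map. -/
def mixedPowerMultilinear (p : ℕ) [NeZero p] (X Y : C) :
    MultilinearMap k (fun _ : ZMod p => (X ⟶ Y)) ((power p).obj X ⟶ (power p).obj Y) where
  toFun u := mixedPower (fun j : ℕ => u j) p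
  map_update_add' u i x y := by
    rw [mixedPower_update_cast, mixedPower_update_cast, mixedPower_update_cast,
      mixedPower_update_add _ _ _ i.val_lt]
  map_update_smul' u i c x := by
    rw [mixedPower_update_cast, mixedPower_update_cast, mixedPower_update_smul _ _ _ i.val_lt]

variable (k) in
theorem power_map_smul (p : ℕ) [NeZero p] (c : k) (f : X ⟶ Y) :
    (power p).map (c • f) = c ^ p • (power p).map f := by
  have h1 := (mixedPowerMultilinear k p X Y).map_smul_univ (fun _ => c) (fun _ => f)
  rw [Finset.prod_const, Finset.card_univ, ZMod.card] at h1
  rw [← mixedPower_const, ← mixedPower_const]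
  exact h1

end MixedPower

end FrobeniusFunctor

end

/-! ### Additivity and linearity of the Frobenius functor. -/

noncomputable section

namespace FrobeniusFunctor

section Translate

variable {p : ℕ} [Fact p.Prime]

/-- The translation of subsets of `ℤ/p`. -/
def translate (r : ZMod p) : Finset (ZMod p) ≃ Finset (ZMod p) := (Equiv.addRight (-r)).finsetCongr

theorem mem_translate (r i : ZMod p) (s : Finset (ZMod p)) : i ∈ translate r s ↔ i + r ∈ s := by
  rw [translate, Equiv.finsetCongr_apply, Finset.mem_map_equiv]
  simp

theorem card_translate_symm (r : ZMod p) (s : Finset (ZMod p)) :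
    ((translate r).symm s).card = s.card := by
  conv_rhs => rw [← (translate r).apply_symm_apply s, translate, Equiv.finsetCongr_apply,
    Finset.card_map]
  rfl

theorem zero_mem_translate_symm (r : ZMod p) (s : Finset (ZMod p)) :
    0 ∈ (translate r).symm s ↔ -r ∈ s := by
  conv_rhs => rw [← (translate r).apply_symm_apply s, mem_translate, neg_add_cancel]

theorem sum_range_natCast {M : Type*} [AddCommMonoid M] (F : ZMod p → M) :
    ∑ r ∈ Finset.range p, F (r : ZMod p) = ∑ x, F x :=
  Finset.sum_bij' (fun r _ => (r : ZMod p)) (fun x _ => x.val) (fun _ _ => Finset.mem_univ _)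
    (fun x _ => Finset.mem_range.2 x.val_lt)
    (fun _ hr => ZMod.val_cast_of_lt (Finset.mem_range.1 hr)) (fun x _ => ZMod.natCast_zmod_val x)
    (fun _ _ => rfl)

variable (k : Type w) [Field k] [CharP k p]

/-- The weight of a subset of `ℤ/p`: the inverse of its cardinality if it contains `0`. -/
def weight (s : Finset (ZMod p)) : k := if 0 ∈ s then (s.card : k)⁻¹ else 0

/-- Exactly `|s|` translations bring an element of `s` to `0`, each with weight `|s|⁻¹`. Weighting
in this way gives a preimage under the norm without a choice of representatives of the orbits of
subsets. -/
theorem sum_weight_translate (s : Finset (ZMod p)) :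
    ∑ r ∈ Finset.range p, weight k ((translate (r : ZMod p)).symm s) =
      (s.card : k) * (s.card : k)⁻¹ := by
  rw [sum_range_natCast fun x => weight k ((translate x).symm s)]
  simp only [weight, zero_mem_translate_symm, card_translate_symm]
  refine (Fintype.sum_equiv (Equiv.neg _) (fun x => if -x ∈ s then (s.card : k)⁻¹ else 0)
    (fun x => if x ∈ s then (s.card : k)⁻¹ else 0) fun _ => rfl).trans ?_
  simp

/-- The cardinality lies strictly between `0` and `p`, hence is invertible in `k`. For the two
excluded subsets it is zero in `k`, and the convention `0⁻¹ = 0` gives them the coefficient `0`. -/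
theorem card_mul_inv_card (s : Finset (ZMod p)) (h0 : s ≠ ∅) (h1 : s ≠ Finset.univ) :
    (s.card : k) * (s.card : k)⁻¹ = 1 := by
  refine mul_inv_cancel₀ fun h => ?_
  have h2 := (CharP.cast_eq_zero_iff k p _).1 h
  have h3 := Finset.card_pos.2 (Finset.nonempty_iff_ne_empty.2 h0)
  have h4 := (Finset.card_lt_iff_ne_univ s).2 h1
  rw [ZMod.card] at h4
  exact absurd (Nat.le_of_dvd h3 h2) (by omega)

end Translate

section Additive

variable (k : Type w) [Field k] (p : ℕ) [Fact p.Prime] [CharP k p]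
variable {C : Type u} [Category.{v} C] [Abelian C] [Linear k C] [MonoidalCategory C]
  [MonoidalPreadditive C] [MonoidalLinear k C] [SymmetricCategory C] {X Y : C}

/-- The tensor product of copies of two morphisms, distributed according to a subset of `ℤ/p`. -/
def subsetPower (f g : X ⟶ Y) (s : Finset (ZMod p)) : (power p).obj X ⟶ (power p).obj Y :=
  mixedPowerMultilinear k p X Y (s.piecewise (fun _ => f) fun _ => g)

theorem conjHom_subsetPower (f g : X ⟶ Y) (s : Finset (ZMod p)) :
    conjHom k (cyclic X p) (cyclic Y p) (subsetPower k p f g s) =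
      subsetPower k p f g (translate 1 s) := by
  have h1 := mixedPower_cyclic (s.piecewise (fun _ => f) fun _ => g)
  rw [conjHom_apply, ← Category.assoc, IsIso.comp_inv_eq]
  refine h1.trans (congrArg (fun t => t ≫ cyclic Y p) (mixedPower_congr fun a _ => ?_))
  generalize (a : ZMod p) = i
  by_cases h : i + 1 ∈ s
  · rw [Finset.piecewise_eq_of_mem _ _ _ h,
      Finset.piecewise_eq_of_mem _ _ _ ((mem_translate _ _ _).2 h)]
  · rw [Finset.piecewise_eq_of_notMem _ _ _ h,
      Finset.piecewise_eq_of_notMem _ _ _ fun h' => h ((mem_translate _ _ _).1 h')]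

theorem conjHom_pow_subsetPower (f g : X ⟶ Y) (s : Finset (ZMod p)) (r : ℕ) :
    (conjHom k (cyclic X p) (cyclic Y p) ^ r) (subsetPower k p f g s) =
      subsetPower k p f g (translate (r : ZMod p) s) := by
  induction r with
  | zero =>
    refine congrArg (subsetPower k p f g) (Finset.ext fun i => ?_)
    rw [mem_translate, Nat.cast_zero, add_zero]
  | succ r ih =>
    rw [pow_succ', Module.End.mul_apply, ih, conjHom_subsetPower]
    refine congrArg (subsetPower k p f g) (Finset.ext fun i => ?_)
    rw [mem_translate, mem_translate, mem_translate, Nat.cast_succ, add_assoc, add_comm (1 : ZMod p)]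

/-- The tensor power is additive up to norms. -/
theorem exists_power_map_add (f g : X ⟶ Y) : ∃ h, (power p).map (f + g) = (power p).map f +
    (power p).map g + (∑ r ∈ Finset.range p, conjHom k (cyclic X p) (cyclic Y p) ^ r) h := by
  refine ⟨∑ s, weight k s • subsetPower k p f g s, ?_⟩
  have h1 : (power p).map (f + g) = ∑ s, subsetPower k p f g s := by
    rw [← mixedPower_const]
    exact (mixedPowerMultilinear k p X Y).map_add_univ (fun _ => f) fun _ => g
  have h2 : (∑ r ∈ Finset.range p, conjHom k (cyclic X p) (cyclic Y p) ^ r)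
      (∑ s, weight k s • subsetPower k p f g s) =
      ∑ s : Finset (ZMod p), ((s.card : k) * (s.card : k)⁻¹) • subsetPower k p f g s := by
    rw [LinearMap.sum_apply]
    have h3 : ∀ r : ℕ, (conjHom k (cyclic X p) (cyclic Y p) ^ r)
        (∑ s, weight k s • subsetPower k p f g s) =
        ∑ s, weight k ((translate (r : ZMod p)).symm s) • subsetPower k p f g s := by
      intro r
      rw [map_sum]
      refine Fintype.sum_equiv (translate (r : ZMod p)) _ _ fun s => ?_
      rw [map_smul, conjHom_pow_subsetPower, Equiv.symm_apply_apply]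
    rw [Finset.sum_congr rfl fun r _ => h3 r, Finset.sum_comm]
    refine Finset.sum_congr rfl fun s _ => ?_
    rw [← Finset.sum_smul, sum_weight_translate]
  -- Every proper nonempty subset is accounted for by the norm; the full and the empty subset remain
  -- and give the powers of `f` and of `g`.
  have h4 : ∑ s : Finset (ZMod p), (subsetPower k p f g s -
      ((s.card : k) * (s.card : k)⁻¹) • subsetPower k p f g s) =
        (power p).map f + (power p).map g := by
    have hne : (Finset.univ : Finset (ZMod p)) ≠ ∅ := Finset.univ_nonempty.ne_empty
    rw [← Finset.sum_subset (Finset.subset_univ {Finset.univ, ∅}) fun s _ hs => ?_,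
      Finset.sum_pair hne]
    · have h5 : (((Finset.univ : Finset (ZMod p)).card : ℕ) : k) = 0 := by
        rw [Finset.card_univ, ZMod.card, CharP.cast_eq_zero]
      rw [h5, Finset.card_empty, Nat.cast_zero, zero_mul, zero_smul, zero_smul, sub_zero, sub_zero,
        subsetPower, subsetPower, Finset.piecewise_univ, Finset.piecewise_empty,
        ← mixedPower_const, ← mixedPower_const]
      rfl
    · have h6 : s ≠ Finset.univ ∧ s ≠ ∅ := by simpa using hs
      rw [card_mul_inv_card k s h6.2 h6.1, one_smul, sub_self]
  rw [h2, h1, ← h4, Finset.sum_sub_distrib, sub_add_cancel]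

end Additive

theorem component_map_add (k : Type w) [Field k] (p : ℕ) [Fact p.Prime] [CharP k p] {C : Type u}
    [Category.{v} C] [Abelian C] [Linear k C] [MonoidalCategory C] [MonoidalPreadditive C]
    [MonoidalLinear k C] [SymmetricCategory C] {X Y : C} (j : ℕ) (hj : j < p - 1) (f g : X ⟶ Y) :
    (component C p j).map (f + g) = (component C p j).map f + (component C p j).map g := by
  obtain ⟨h, hh⟩ := exists_power_map_add k p f g
  -- The norm is equivariant because it is the difference of equivariant maps.
  have hN : diff p X ≫ (∑ r ∈ Finset.range p, conjHom k (cyclic X p) (cyclic Y p) ^ r) h =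
      (∑ r ∈ Finset.range p, conjHom k (cyclic X p) (cyclic Y p) ^ r) h ≫ diff p Y := by
    have h1 := diff_natural p (f + g)
    rw [hh, Preadditive.comp_add, Preadditive.comp_add, Preadditive.add_comp, Preadditive.add_comp,
      diff_natural, diff_natural] at h1
    exact add_left_cancel h1
  exact layerMap_add (diff_natural p f) (diff_natural p g) (diff_natural p (f + g)) hN hh
    fun S x hx => cls_comp_sum_conjHom_eq_zero p h hj x hx _

section Linear

variable (k : Type w) [Field k] (p : ℕ) [Fact p.Prime] [CharP k p]
variable {C : Type u} [Category.{v} C] [Abelian C] [Linear k C] [MonoidalCategory C]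
  [MonoidalPreadditive C] [MonoidalLinear k C] [SymmetricCategory C] {X Y : C}

theorem component_map_smul (j : ℕ) (c : k) (f : X ⟶ Y) :
    (component C p j).map (c • f) = c ^ p • (component C p j).map f :=
  layerMap_smul (diff_natural p f) (diff_natural p (c • f)) (c ^ p) (power_map_smul k p c f)

theorem frob_map_apply (f : X ⟶ Y) (i j : Fin (p - 1)) : (frob C k p).map f i j =
    LinProd.homMk (FrobeniusTwist.ofHom p ((component C p i).map f)) (𝟙 (Verlinde.L k p i)) ≫
      Mat_Monoidal.entry (𝟙 ((frob C k p).obj Y)) i j := rfl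

instance additive_frob : (frob C k p).Additive where
  map_add {X Y f g} := by
    refine Mat_.hom_ext _ _ fun (i : Fin (p - 1)) (j : Fin (p - 1)) => ?_
    refine (frob_map_apply k p (f + g) i j).trans ?_
    rw [component_map_add k p i i.2]
    refine (congrArg (fun t => t ≫ Mat_Monoidal.entry (𝟙 ((frob C k p).obj Y)) i j)
      (LinProd.homMk_add_left (k := k) (FrobeniusTwist.ofHom p ((component C p i).map f))
        (FrobeniusTwist.ofHom p ((component C p i).map g)) (𝟙 (Verlinde.L k p i)))).trans ?_
    exact Preadditive.add_comp _ _ _ _ _ _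

instance linear_frob : (frob C k p).Linear k where
  map_smul {X Y} f c := by
    refine Mat_.hom_ext _ _ fun (i : Fin (p - 1)) (j : Fin (p - 1)) => ?_
    refine (frob_map_apply k p (c • f) i j).trans ?_
    rw [component_map_smul k p i, ← FrobeniusTwist.smul_ofHom]
    refine (congrArg (fun t => t ≫ Mat_Monoidal.entry (𝟙 ((frob C k p).obj Y)) i j)
      (LinProd.smul_homMk (k := k) c (FrobeniusTwist.ofHom p ((component C p i).map f))
        (𝟙 (Verlinde.L k p i))).symm).trans ?_
    exact Linear.smul_comp (R := k) (C := LinProd k (FrobeniusTwist p C) (Verlinde.Ver k p)) _ _ _ _ _ _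

end Linear

end FrobeniusFunctor

end

theorem proposition5p1 (k : Type w) [Field k] [IsAlgClosed k] (p : ℕ) [Fact p.Prime] [CharP k p] :
    (∀ (C : Type u) [Category.{v} C] [Abelian C] [Linear k C] [MonoidalCategory C]
      [MonoidalPreadditive C] [MonoidalLinear k C] [SymmetricCategory C] [IsTensorCategory k C],
      (FrobeniusFunctor.frob C k p).Additive ∧
        (FrobeniusFunctor.frob C k p).Linear k) ∧
    ∃ mon : ∀ (C : Type u) [Category.{v} C] [Abelian C] [Linear k C] [MonoidalCategory C]
        [MonoidalPreadditive C] [MonoidalLinear k C] [SymmetricCategory C] [IsTensorCategory k C],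
        (FrobeniusFunctor.frob C k p).Monoidal,
      ∀ (C : Type u) [Category.{v} C] [Abelian C] [Linear k C] [MonoidalCategory C]
        [MonoidalPreadditive C] [MonoidalLinear k C] [SymmetricCategory C] [IsTensorCategory k C]
        (D : Type u) [Category.{v} D] [Abelian D] [Linear k D] [MonoidalCategory D]
        [MonoidalPreadditive D] [MonoidalLinear k D] [SymmetricCategory D] [IsTensorCategory k D]
        (E : C ⥤ D) [E.Additive] [E.Linear k] [E.Braided] [PreservesFiniteLimits E]
        [PreservesFiniteColimits E],
        letI := mon C
        letI := mon D
        ∃ Θ : FrobeniusFunctor.frob C k p ⋙ FrobeniusFunctor.targetMap k p E ≅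
            E ⋙ FrobeniusFunctor.frob D k p,
          NatTrans.IsMonoidal Θ.hom ∧
          ∀ X : C, ∃ θ : ∀ i : Fin (p - 1), E.obj ((FrobeniusFunctor.component C p i.val).obj X) ⟶
              (FrobeniusFunctor.component D p i.val).obj (E.obj X),
            (∀ i : Fin (p - 1), FrobeniusFunctor.IsCanonical p E i.val X (θ i)) ∧
              Θ.hom.app X = FrobeniusFunctor.sumMap k p θ := by
  refine ⟨fun C _ _ _ _ _ _ _ _ => ⟨inferInstance, inferInstance⟩,
    fun C _ _ _ _ _ _ _ _ =>
      have := FrobeniusFunctor.hasDuals_of_isTensorCategory k C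
      FrobeniusFunctor.frobMonoidal k p C, ?_⟩
  intro C _ _ _ _ _ _ _ _ D _ _ _ _ _ _ _ _ E _ _ _ _ _
  have := FrobeniusFunctor.hasDuals_of_isTensorCategory k C
  have := FrobeniusFunctor.hasDuals_of_isTensorCategory k D
  exact ⟨FrobeniusFunctor.frobComparison k p E,
    FrobeniusFunctor.isMonoidal_frobComparison k p E, fun X =>
    ⟨fun i => FrobeniusFunctor.layerComparison E (FrobeniusFunctor.powerComparison E X p).inv
      (FrobeniusFunctor.map_diff_comparison p E X) i,
      fun i => FrobeniusFunctor.isCanonical_layerComparison p E i X,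
      FrobeniusFunctor.frobComparison_app k p E X⟩⟩
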